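/- Let $V\in C^\infty(\mathbb R^3)$ be real-valued and $\mathbb Z^3$-periodic. For $L\ge 1$ let $\Lambda_L=(-\tfrac L2,\tfrac L2)^3$ and let $H_L=-\tfrac12\Delta+V$ in $L^2(\Lambda_L)$ with Dirichlet boundary conditions, i.e. with domain $H^1_0(\Lambda_L)\cap H^2(\Lambda_L)$; let $e_1\le e_2\le\dots$ be its eigenvalues counted with multiplicity and $N_L(E)$ the number of those not greater than $E$. For $\beta,z>0$ put $$\rho_L(\beta,z)=\frac1{L^3}\sum_{j\ge1}\frac{z e^{-\beta e_j}}{1+z e^{-\beta e_j}} .$$ For $k\in\Omega^*=[-\pi,\pi]^3$ let $E_1(k)\le E_2(k)\le\dots$ be the eigenvalues, counted with multiplicity, of $h(k)=\tfrac12(-i\nabla+k)^2+V$ in $L^2(\mathbb R^3/\mathbb Z^3)$ with domain $H^2(\mathbb R^3/\mathbb Z^3)$, and let $\mathcal E_j=[\min_{\Omega^*}E_j,\max_{\Omega^*}E_j]$ be the $j$-th Bloch band ($j\ge1$). Then these minima and maxima exist, the series defining $\rho_L$ converge, and the limits $n_\infty(E)=\lim_{L\to\infty}N_L(E)/L^3$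 (the integrated density of states) and $\rho_\infty(\beta,z)=\lim_{L\to\infty}\rho_L(\beta,z)$ exist for all $E\in\mathbb R$ and $\beta,z>0$. For all $\beta>0$ and $\rho_0>0$ the equation $\rho_\infty(\beta,e^{\beta\mu})=\rho_0$ has a unique real solution $\mu=\mu_\infty(\beta,\rho_0)$, and the limit $$\mathcal E_F(\rho_0)=\lim_{\beta\to\infty}\mu_\infty(\beta,\rho_0)$$ exists and is a strictly increasing function of $\rho_0\in(0,\infty)$. For every $\rho_0>0$ at least one of the following two cases occurs: (SC) there is $N\ge1$ with $\max\mathcal E_N\le\min\mathcal E_{N+1}$ and $n_\infty(E)=\rho_0$ for all $E\in[\max\mathcal E_N,\min\mathcal E_{N+1}]$; (M) the equation $n_\infty(E)=\rho_0$ has a unique solution $E_M\in\mathbb R$, and $\min\mathcal E_N<E_M<\max\mathcal E_N$ for some $N\ge1$. In case (SC), for every such $N$, $\mathcal E_F(\rho_0)=\tfrac12(\max\mathcal E_N+\min\mathcal E_{N+1})$; in case (M), $\mathcal E_F(\rho_0)=E_M$. -/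

import Mathlib

open Filter Topology MeasureTheory
open scoped ContDiff

noncomputable section

namespace BlochElectrons

/-! ### Eigenvalue counting for an operator given by its graph -/

/-- The operator is given by its graph `G ⊆ H × H` (pairs `(u, T u)` with `u` in the domain of `T`).
`eigenCount G E` is the number of eigenvalues not greater than `E`, counted with multiplicity:
the dimension of the span of all eigenvectors whose eigenvalue is at most `E`. -/
def eigenCount {H : Type*} [AddCommGroup H] [Module ℂ H] (G : Set (H × H)) (E : ℝ) : ℕ :=
  Module.finrank ℂ (Submodule.span ℂ {u : H | ∃ l : ℝ, l ≤ E ∧ (u, (l : ℂ) • u) ∈ G})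

/-- The `j`-th eigenvalue (`j ≥ 1`), in increasing order and counted with multiplicity. -/
def nthEigenvalue {H : Type*} [AddCommGroup H] [Module ℂ H] (G : Set (H × H)) (j : ℕ) : ℝ :=
  sInf {E : ℝ | j ≤ eigenCount G E}

/-! ### The Dirichlet Hamiltonian in a box -/

/-- `ℝ³` with the Euclidean norm. -/
abbrev Space := EuclideanSpace ℝ (Fin 3)

/-- The open cube `(-L/2, L/2)³`. -/
def box (L : ℝ) : Set Space := {x | ∀ i, -(L / 2) < x i ∧ x i < L / 2}

/-- The complex Hilbert space `L²` of the box. -/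
abbrev BoxL2 (L : ℝ) := Lp ℂ 2 (volume.restrict (box L))

/-- Smooth functions with compact support inside the box. -/
def IsTest (L : ℝ) (φ : Space → ℂ) : Prop :=
  ContDiff ℝ ∞ φ ∧ HasCompactSupport φ ∧ tsupport φ ⊆ box L

/-- The classical `i`-th partial derivative. -/
def partialDeriv (i : Fin 3) (φ : Space → ℂ) (x : Space) : ℂ :=
  fderiv ℝ φ x (EuclideanSpace.single i 1)

/-- `g` is the `i`-th weak partial derivative of `u` in the box. -/
def HasWeakPartial (L : ℝ) (i : Fin 3) (u g : BoxL2 L) : Prop :=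
  ∀ φ : Space → ℂ, IsTest L φ →
    ∫ x in box L, u x * partialDeriv i φ x = -∫ x in box L, g x * φ x

/-- `u ∈ H¹₀` of the box: `u` is a limit of test functions in the `H¹` norm. -/
def MemH10 (L : ℝ) (u : BoxL2 L) : Prop :=
  ∃ (φ : ℕ → Space → ℂ) (g : Fin 3 → BoxL2 L), (∀ m, IsTest L (φ m)) ∧
    Tendsto (fun m => eLpNorm (fun x => φ m x - u x) 2 (volume.restrict (box L))) atTop (𝓝 0) ∧
    ∀ i, Tendsto (fun m => eLpNorm (fun x => partialDeriv i (φ m) x - g i x) 2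
      (volume.restrict (box L))) atTop (𝓝 0)

/-- The graph of the Dirichlet Hamiltonian `-Δ/2 + V` on the domain `H¹₀ ∩ H²` of the box:
`g` and `h` are the first and second weak derivatives of `u`, all of them in `L²`. -/
def dirichletGraph (V : Space → ℝ) (L : ℝ) : Set (BoxL2 L × BoxL2 L) :=
  {p | MemH10 L p.1 ∧ ∃ (g : Fin 3 → BoxL2 L) (h : Fin 3 → Fin 3 → BoxL2 L),
    (∀ i, HasWeakPartial L i p.1 (g i)) ∧ (∀ i j, HasWeakPartial L j (g i) (h i j)) ∧
    ∀ᵐ x ∂(volume.restrict (box L)),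
      p.2 x = -(1 / 2 : ℂ) * ∑ i, h i i x + (V x : ℂ) * p.1 x}

/-- `e_j`, the `j`-th eigenvalue (`j ≥ 1`) of the Dirichlet Hamiltonian. -/
def boxEigenvalue (V : Space → ℝ) (L : ℝ) (j : ℕ) : ℝ :=
  nthEigenvalue (dirichletGraph V L) j

/-- The `j`-th term (`j ≥ 1`) of the finite volume density series:
`z e^{-β e_j} / (1 + z e^{-β e_j})`. -/
def occupation (V : Space → ℝ) (L β z : ℝ) (j : ℕ) : ℝ :=
  z * Real.exp (-β * boxEigenvalue V L j) / (1 + z * Real.exp (-β * boxEigenvalue V L j))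

/-- The finite volume grand canonical density at inverse temperature `β` and fugacity `z`. -/
def density (V : Space → ℝ) (L β z : ℝ) : ℝ :=
  (1 / L ^ 3) * ∑' j : ℕ, occupation V L β z (j + 1)

/-- The finite volume integrated density of states `N_L(E) / |Λ_L|`. -/
def boxIDS (V : Space → ℝ) (L E : ℝ) : ℝ :=
  (eigenCount (dirichletGraph V L) E : ℝ) / L ^ 3

/-! ### The fiber Hamiltonians and the Bloch bands -/

/-- The complex Hilbert space `L²` of the torus `ℝ³ / ℤ³`, with the Haar measure of total mass `1`
(the one that Mathlib's `UnitAddTorus.mFourierCoeff` integrates against). -/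
abbrev TorusL2 :=
  Lp ℂ 2 (Measure.pi fun _ : Fin 3 => (AddCircle.haarAddCircle : Measure UnitAddCircle))

/-- A `ℤ³`-periodic function on `ℝ³` seen as a function on the torus, through the representative in
`[0, 1)³`. -/
def onTorus (V : Space → ℝ) (t : UnitAddTorus (Fin 3)) : ℝ :=
  V (WithLp.toLp 2 fun i => (AddCircle.equivIco (1 : ℝ) 0 (t i) : ℝ))

/-- The graph of the fiber Hamiltonian `(-i∇ + k)² / 2 + V` in `L²` of the torus, on the domain
`H²` of the torus. On the Fourier mode `e^{2πi n·x}` the operator `-i∇ + k` is `2πn + k`. -/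
def fiberGraph (V : Space → ℝ) (k : Space) : Set (TorusL2 × TorusL2) :=
  {p | Summable (fun n : Fin 3 → ℤ =>
      (1 + ∑ i, (n i : ℝ) ^ 2) ^ 2 * ‖UnitAddTorus.mFourierCoeff p.1 n‖ ^ 2) ∧
    ∀ n : Fin 3 → ℤ, UnitAddTorus.mFourierCoeff p.2 n =
      (((1 / 2 : ℝ) * ∑ i, (2 * Real.pi * n i + k i) ^ 2 : ℝ) : ℂ)
          * UnitAddTorus.mFourierCoeff p.1 n
        + UnitAddTorus.mFourierCoeff (fun t => (onTorus V t : ℂ) * p.1 t) n}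

/-- The Bloch energy `E_j(k)`, `j ≥ 1`. -/
def blochEnergy (V : Space → ℝ) (j : ℕ) (k : Space) : ℝ :=
  nthEigenvalue (fiberGraph V k) j

/-- The Brillouin zone `[-π, π]³`. -/
def brillouinZone : Set Space := {k | ∀ i, k i ∈ Set.Icc (-Real.pi) Real.pi}

/-- The lower edge of the `j`-th Bloch band. -/
def bandMin (V : Space → ℝ) (j : ℕ) : ℝ := sInf (blochEnergy V j '' brillouinZone)

/-- The upper edge of the `j`-th Bloch band. -/
def bandMax (V : Space → ℝ) (j : ℕ) : ℝ := sSup (blochEnergy V j '' brillouinZone)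

/-- The density `ρ₀` fills exactly the first `N` bands: the integrated density of states `n` equals
`ρ₀` on the whole (nonempty) interval between the `N`-th and the `(N+1)`-st band. -/
def IsSemiconductor (V : Space → ℝ) (n : ℝ → ℝ) (ρ₀ : ℝ) (N : ℕ) : Prop :=
  1 ≤ N ∧ bandMax V N ≤ bandMin V (N + 1) ∧
    ∀ E ∈ Set.Icc (bandMax V N) (bandMin V (N + 1)), n E = ρ₀

/-- `EM` is the only solution of `n E = ρ₀`, and it lies in the interior of some Bloch band. -/
def IsMetal (V : Space → ℝ) (n : ℝ → ℝ) (ρ₀ EM : ℝ) : Prop :=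
  (∀ E : ℝ, n E = ρ₀ ↔ E = EM) ∧ ∃ N : ℕ, 1 ≤ N ∧ bandMin V N < EM ∧ EM < bandMax V N

end BlochElectrons

end

open Filter Topology MeasureTheory
open scoped ContDiff

noncomputable section

namespace BlochElectrons

/-! ### Diagonal operators -/

section Diagonal

variable {H : Type*} [NormedAddCommGroup H] [InnerProductSpace ℂ H] [CompleteSpace H]
  {ι : Type*}

/-! Everything reduces to one explicit function, `ids W`: the average over the cell of rescaled
quasi-momenta of the number of fiber eigenvalues up to a given energy. It is the limit of the box
counting functions, it is continuous, and it grows strictly across every band.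

The limit is `tendsto_boxIDS`. Counting functions are hard to compare, since a small error in the
quadratic form may move many eigenvalues across `E`; the Riesz means, sums of `(E - μ)₊`, are stable
and obey a variational bound for every finite Bessel family
(`SpectralResolution.sum_form_le_riesz`). The box is placed in a cube of integer side `M`. Extending
Dirichlet eigenfunctions by zero and splitting them into `M³` fibers gives trial vectors in the
fibers, hence an upper bound by a sum of fiber Riesz means (`riesz_box_le`). Conversely, Bloch waves
truncated to finitely many Fourier modes and cut off near the boundary are trial functions in the
box, and give the reverse bound up to an error small compared with `M³` (`riesz_box_ge`). Fiber
Riesz means are continuous in the quasi-momentum, so these sums are Riemann sums. Difference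
quotients of Riesz means bracket the counting functions, and continuity of `ids W` closes the
bracket. For all this the given graphs are identified with diagonal operators in the sine and the
Fourier basis, perturbed by a bounded potential (`dirichletGraph_eq`, `fiberGraph_eq`); their
resolvents are compact.

Continuity of `ids W` is the absence of flat bands, by Thomas' argument (`countable_slice`). In one
momentum component the fiber operator is a quadratic polynomial. Expanding about a complex momentum
with large imaginary part, where the operator minus `E` is invertible, one finds that `E` is an
eigenvalue only where a pencil `1 + w A + w² C` with compact `A`, `C` is singular, and such `w` are
countable. Fubini then gives `ae_nth_ne`.

At positive temperature the density is the counting function convolved with minus the derivative of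
the Fermi function (`hasSum_occupation`). A cubic bound uniform in `L` allows dominated convergence,
and the limit is continuous and strictly increasing from zero to infinity in the chemical potential.

At zero temperature, let `[a, b]` be the level set of `ids W` at `ρ₀`. The kernel has tails of order
`exp (-β |x|)`, so for a chemical potential above the midpoint the excess beyond `b`, being nearer,
outweighs the deficit below `a` exponentially, and conversely below it. Hence the chemical potential
tends to `(a + b) / 2`. If `a` lies inside a band then `a = b`; otherwise `[a, b]` is the whole
interval between two consecutive bands (`isSemiconductor_or_isMetal`,
`IsSemiconductor.levelSet_eq`). -/

theorem hasSum_norm_sq_inner (b : HilbertBasis ι ℂ H) (x : H) :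
    HasSum (fun i => ‖inner ℂ (b i) x‖ ^ 2) (‖x‖ ^ 2) := by
  have h := lp.hasSum_norm (p := 2) (by norm_num) (b.repr x)
  simpa [b.repr_apply_apply] using h

theorem exists_inner_eq (b : HilbertBasis ι ℂ H) (a : ι → ℂ)
    (ha : Summable fun i => ‖a i‖ ^ 2) : ∃ x : H, ∀ i, inner ℂ (b i) x = a i := by
  have hm : Memℓp a 2 := by
    rw [memℓp_gen_iff (by norm_num)]
    simpa using ha
  refine ⟨b.repr.symm ⟨a, hm⟩, fun i => ?_⟩
  rw [← b.repr_apply_apply, b.repr.apply_symm_apply]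

theorem eq_of_inner_eq (b : HilbertBasis ι ℂ H) {x y : H}
    (h : ∀ i, inner ℂ (b i) x = inner ℂ (b i) y) : x = y :=
  b.repr.injective (lp.ext (funext fun i => by
    rw [b.repr_apply_apply, b.repr_apply_apply, h]))

theorem exists_diagonal (b : HilbertBasis ι ℂ H) (r : ι → ℂ) (C : ℝ) (hC : 0 ≤ C)
    (hr : ∀ i, ‖r i‖ ≤ C) :
    ∃ R : H →L[ℂ] H, (∀ x i, inner ℂ (b i) (R x) = r i * inner ℂ (b i) x) ∧ ‖R‖ ≤ C := by
  have hs : ∀ x : H, Summable fun i => ‖r i * inner ℂ (b i) x‖ ^ 2 := fun x => by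
    refine Summable.of_nonneg_of_le (fun i => by positivity) (fun i => ?_)
      ((hasSum_norm_sq_inner b x).summable.mul_left (C ^ 2))
    rw [norm_mul, mul_pow]
    gcongr
    exact hr i
  choose f hf using fun x => exists_inner_eq b _ (hs x)
  let F : H →ₗ[ℂ] H :=
    { toFun := f
      map_add' := fun x y => eq_of_inner_eq b fun i => by simp [hf, mul_add]
      map_smul' := fun c x => eq_of_inner_eq b fun i => by
        simp only [hf, inner_smul_right, RingHom.id_apply]; ring }
  have hF : ∀ x, ‖F x‖ ≤ C * ‖x‖ := fun x => by
    refine abs_le_of_sq_le_sq' ?_ (by positivity) |>.2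
    rw [mul_pow]
    refine hasSum_le (fun i => ?_) (hasSum_norm_sq_inner b (F x))
      ((hasSum_norm_sq_inner b x).mul_left (C ^ 2))
    change ‖inner ℂ (b i) (f x)‖ ^ 2 ≤ _
    rw [hf, norm_mul, mul_pow]
    gcongr
    exact hr i
  exact ⟨F.mkContinuous C hF, fun x i => hf x i, F.mkContinuous_norm_le hC hF⟩

theorem isCompactOperator_rankOne (x y : H) :
    IsCompactOperator ((innerSL ℂ x).smulRight y : H →L[ℂ] H) := by
  have h : IsCompactOperator (innerSL ℂ x) := by
    have h1 : IsCompactOperator (id : ℂ → ℂ) := isCompactOperator_id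
    exact h1.comp_clm (innerSL ℂ x)
  exact h.clm_comp ((1 : ℂ →L[ℂ] ℂ).smulRight y)

/-- Since the diagonal tends to zero, `R` is the norm limit of its finite-rank truncations: the
remainder is again diagonal, with small entries. -/
theorem isCompactOperator_diagonal (b : HilbertBasis ι ℂ H) {r : ι → ℂ}
    (hr : Tendsto r cofinite (𝓝 0)) {R : H →L[ℂ] H}
    (hR : ∀ x i, inner ℂ (b i) (R x) = r i * inner ℂ (b i) x) : IsCompactOperator R := by
  classical
  let F : Finset ι → H →L[ℂ] H := fun K => ∑ i ∈ K, r i • (innerSL ℂ (b i)).smulRight (b i)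
  have hF : ∀ K, IsCompactOperator (F K) := fun K => by
    have : F K ∈ compactOperator (RingHom.id ℂ) H H :=
      Submodule.sum_mem _ fun i _ => Submodule.smul_mem _ _ (isCompactOperator_rankOne _ _)
    exact this
  refine isCompactOperator_of_tendsto (l := atTop) (F := F) ?_ (Eventually.of_forall hF)
  rw [tendsto_iff_norm_sub_tendsto_zero, Metric.tendsto_atTop]
  intro ε hε
  have hfin : {i | ¬ ‖r i‖ < ε / 2}.Finite := by
    have := (Metric.tendsto_nhds.1 hr) (ε / 2) (by positivity)
    simpa [Filter.Eventually, Filter.mem_cofinite, Set.compl_def] using this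
  refine ⟨hfin.toFinset, fun K hK => ?_⟩
  obtain ⟨S, hS, hSn⟩ := exists_diagonal b (fun i => if i ∈ K then 0 else -r i) (ε / 2)
    (by positivity) (fun i => by
      split_ifs with h
      · simp; positivity
      · by_contra hc
        refine h (hK ?_)
        simp only [norm_neg, not_le] at hc
        simp only [Set.Finite.mem_toFinset, Set.mem_ofPred_eq, not_lt]
        exact hc.le)
  have : F K - R = S := by
    ext x
    refine eq_of_inner_eq b fun i => ?_
    have hb := orthonormal_iff_ite.1 b.orthonormal
    simp only [F, sub_apply, inner_sub_right, hR, hS, sum_apply, smul_apply,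
      ContinuousLinearMap.smulRight_apply, innerSL_apply_apply, inner_sum, inner_smul_right, hb]
    split_ifs with h <;> simp [h]
  rw [this, Real.dist_eq, sub_zero, abs_of_nonneg (norm_nonneg _)]
  linarith

/-- A compact operator cannot be bounded below along an orthonormal sequence. -/
theorem exists_norm_lt_of_isCompactOperator {K : H →L[ℂ] H} (hK : IsCompactOperator K)
    {e : ℕ → H} (he : Orthonormal ℂ e) {ε : ℝ} (hε : 0 < ε) : ∃ n, ‖K (e n)‖ < ε := by
  by_contra! hc
  obtain ⟨C, hC, hsub⟩ := hK.image_closedBall_subset_compact (𝕜₁ := ℂ) (f := (K : H →ₗ[ℂ] H)) 1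
  obtain ⟨y, -, φ, hφ, hy⟩ := hC.tendsto_subseq (x := fun n => K (e n))
    (fun n => hsub ⟨e n, by simp [he.1 n], rfl⟩)
  have hy1 : ε ≤ ‖y‖ := ge_of_tendsto hy.norm (Eventually.of_forall fun n => hc _)
  -- Along the subsequence `K (e n)` converges in norm to `y`, while an orthonormal sequence tends
  -- weakly to zero; moving `K` to the other side shows that `y` has norm zero.
  have h1 : Tendsto (fun n => inner ℂ (K (e (φ n))) y) atTop (𝓝 (inner ℂ y y)) :=
    hy.inner tendsto_const_nhds
  have h2 : Tendsto (fun n => inner ℂ (e n) (K.adjoint y)) atTop (𝓝 0) := by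
    have := (he.inner_products_summable (K.adjoint y)).tendsto_atTop_zero
    have h3 := this.sqrt
    simp only [Real.sqrt_sq (norm_nonneg _), Real.sqrt_zero] at h3
    exact tendsto_zero_iff_norm_tendsto_zero.2 h3
  have h3 := h2.comp hφ.tendsto_atTop
  have h4 : inner ℂ y y = (0 : ℂ) := by
    refine tendsto_nhds_unique h1 (h3.congr fun n => ?_)
    simp [ContinuousLinearMap.adjoint_inner_right]
  rw [inner_self_eq_zero] at h4
  simp [h4] at hy1
  linarith

/-- The graph of `diag(lam) + W` in the Hilbert basis `b`. -/
def diagGraph (b : HilbertBasis ι ℂ H) (lam : ι → ℝ) (W : H →L[ℂ] H) : Set (H × H) :=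
  {p | ∀ i, inner ℂ (b i) p.2 = lam i * inner ℂ (b i) p.1 + inner ℂ (b i) (W p.1)}

/-- Parseval is applied to `p.2` and to `W p.1` separately, so no summability of the weighted
coefficients has to be assumed. -/
theorem hasSum_diagGraph {b : HilbertBasis ι ℂ H} {lam : ι → ℝ} {W : H →L[ℂ] H} {p : H × H}
    (hp : p ∈ diagGraph b lam W) (u : H) :
    HasSum (fun i => lam i * (inner ℂ u (b i) * inner ℂ (b i) p.1))
      (inner ℂ u p.2 - inner ℂ u (W p.1)) := by
  have h := (b.hasSum_inner_mul_inner u p.2).sub (b.hasSum_inner_mul_inner u (W p.1))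
  refine h.congr_fun fun i => ?_
  rw [hp i]
  ring

theorem diagGraph_symmetric {b : HilbertBasis ι ℂ H} {lam : ι → ℝ} {W : H →L[ℂ] H}
    (hW : IsSelfAdjoint W) {p q : H × H} (hp : p ∈ diagGraph b lam W)
    (hq : q ∈ diagGraph b lam W) : inner ℂ p.1 q.2 = inner ℂ p.2 q.1 := by
  have h1 := hasSum_diagGraph hq p.1
  have h2 := (hasSum_diagGraph hp q.1).map (starRingEnd ℂ) Complex.continuous_conj
  have h3 := h1.unique (h2.congr_fun fun i => by
    simp only [Function.comp_apply, map_mul, Complex.conj_ofReal, inner_conj_symm]; ring)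
  have hs : inner ℂ p.1 (W q.1) = inner ℂ (W p.1) q.1 := (hW.isSymmetric p.1 q.1).symm
  simp only [map_sub, inner_conj_symm] at h3
  rw [hs] at h3
  exact sub_left_inj.1 h3

theorem hasSum_diagGraph_re {b : HilbertBasis ι ℂ H} {lam : ι → ℝ} {W : H →L[ℂ] H} {p : H × H}
    (hp : p ∈ diagGraph b lam W) :
    HasSum (fun i => lam i * ‖inner ℂ (b i) p.1‖ ^ 2)
      ((inner ℂ p.1 p.2).re - (inner ℂ p.1 (W p.1)).re) := by
  have h := Complex.hasSum_re (hasSum_diagGraph hp p.1)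
  rw [Complex.sub_re] at h
  refine h.congr_fun fun i => ?_
  rw [← inner_conj_symm p.1 (b i), mul_comm ((starRingEnd ℂ) _), Complex.mul_conj,
    Complex.normSq_eq_norm_sq]
  norm_cast

theorem abs_re_inner_apply_le (W : H →L[ℂ] H) (u : H) :
    |(inner ℂ u (W u)).re| ≤ ‖W‖ * ‖u‖ ^ 2 := by
  calc |(inner ℂ u (W u)).re| ≤ ‖inner ℂ u (W u)‖ := Complex.abs_re_le_norm _
    _ ≤ ‖u‖ * ‖W u‖ := norm_inner_le_norm _ _
    _ ≤ ‖u‖ * (‖W‖ * ‖u‖) := by gcongr; exact W.le_opNorm u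
    _ = _ := by ring

/-- The resolvent of `diag(lam) + W` at `-c` exists and is compact. -/
theorem exists_compact_resolvent (b : HilbertBasis ι ℂ H) {lam : ι → ℝ} (h0 : ∀ i, 0 ≤ lam i)
    (hlam : ∀ E, {i | lam i ≤ E}.Finite) (W : H →L[ℂ] H) :
    ∃ K : H →L[ℂ] H, IsCompactOperator K ∧
      ∀ p : H × H, p ∈ diagGraph b lam W ↔ K (p.2 + ((‖W‖ + 1 : ℝ) : ℂ) • p.1) = p.1 := by
  -- With this shift the unperturbed inverse `R` has norm at most `1 / (‖W‖ + 1)`, so `W R` has norm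
  -- below one and `1 + W R` is invertible by a Neumann series. The resolvent is `R (1 + W R)⁻¹`,
  -- compact because `R` is.
  set c : ℝ := ‖W‖ + 1 with hc
  have hcpos : 0 < c := by positivity
  have hpos : ∀ i, 0 < lam i + c := fun i => by have := h0 i; linarith
  obtain ⟨R, hR, hRn⟩ := exists_diagonal b (fun i => ((lam i + c)⁻¹ : ℝ)) c⁻¹ (by positivity)
    (fun i => by
      rw [Complex.norm_real, Real.norm_eq_abs, abs_of_pos (inv_pos.2 (hpos i))]
      exact inv_anti₀ hcpos (by have := h0 i; linarith))
  have hRc : IsCompactOperator R := by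
    refine isCompactOperator_diagonal b ?_ hR
    have h1 : Tendsto lam cofinite atTop := by
      refine tendsto_atTop.2 fun E => ?_
      have : {i | ¬ E ≤ lam i}.Finite := (hlam E).subset fun i hi => (not_le.1 hi).le
      simpa [Filter.Eventually, Filter.mem_cofinite, Set.compl_def] using this
    have h2 := (tendsto_inv_atTop_zero.comp (tendsto_atTop_add_const_right _ c h1))
    have h3 := (Complex.continuous_ofReal.tendsto 0).comp h2
    simpa [Function.comp_def] using h3
  have hRR : ∀ x z, R z = x ↔ ∀ i, inner ℂ (b i) z = (lam i + c : ℝ) * inner ℂ (b i) x := by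
    intro x z
    constructor
    · rintro rfl i
      rw [hR, ← mul_assoc, ← Complex.ofReal_mul, mul_inv_cancel₀ (hpos i).ne']
      simp
    · intro h
      refine eq_of_inner_eq b fun i => ?_
      rw [hR, h, ← mul_assoc, ← Complex.ofReal_mul, inv_mul_cancel₀ (hpos i).ne']
      simp
  have hu : IsUnit (1 + W * R) := by
    have : ‖-(W * R)‖ < 1 := by
      rw [norm_neg]
      calc ‖W * R‖ ≤ ‖W‖ * ‖R‖ := norm_mul_le _ _
        _ ≤ ‖W‖ * c⁻¹ := by gcongr
        _ < 1 := by rw [← div_eq_mul_inv, div_lt_one hcpos]; linarith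
    simpa using isUnit_one_sub_of_norm_lt_one this
  obtain ⟨U, hU⟩ := hu
  have hU1 : ∀ x, U.val (U⁻¹.val x) = x := fun x =>
    congrArg (fun A : H →L[ℂ] H => A x) U.mul_inv
  have hU2 : ∀ x, U⁻¹.val (U.val x) = x := fun x =>
    congrArg (fun A : H →L[ℂ] H => A x) U.inv_mul
  have hUx : ∀ z, U.val z = z + W (R z) := fun z => by rw [hU]; simp
  refine ⟨R ∘L U⁻¹.val, hRc.comp_clm _, fun p => ?_⟩
  have key : ∀ z, (R z = p.1 ∧ U.val z = p.2 + (c : ℂ) • p.1) ↔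
      (R z = p.1 ∧ p ∈ diagGraph b lam W) := by
    intro z
    refine and_congr_right fun hz => ?_
    have hz' := (hRR _ _).1 hz
    rw [hUx, hz]
    constructor
    · intro h i
      have := congrArg (inner ℂ (b i)) h
      simp only [inner_add_right, inner_smul_right, hz'] at this
      push_cast at this
      linear_combination -this
    · intro h
      refine eq_of_inner_eq b fun i => ?_
      simp only [inner_add_right, inner_smul_right, hz', h i]
      push_cast
      ring
  constructor
  · intro hp
    set z := p.2 + (c : ℂ) • p.1 - W p.1 with hz
    have hz1 : R z = p.1 := (hRR _ _).2 fun i => by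
      simp only [hz, inner_add_right, inner_sub_right, inner_smul_right, hp i]
      push_cast
      ring
    have := ((key z).2 ⟨hz1, hp⟩).2
    rw [← this]
    simp [hU2, hz1]
  · intro h
    exact ((key (U⁻¹.val (p.2 + (c : ℂ) • p.1))).1 ⟨h, hU1 _⟩).2

end Diagonal

/-! ### Spectral resolutions -/

/-- A Hilbert basis of eigenvectors, with eigenvalues tending to infinity, of the symmetric operator
with graph `G`. -/
structure SpectralResolution {H : Type} [NormedAddCommGroup H] [InnerProductSpace ℂ H]
    (G : Set (H × H)) where
  /-- The index set of the eigenvectors. -/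
  J : Type
  /-- The eigenvectors. -/
  v : HilbertBasis J ℂ H
  /-- The eigenvalues. -/
  μ : J → ℝ
  finite_le : ∀ E, {j | μ j ≤ E}.Finite
  mem : ∀ j, (v j, (μ j : ℂ) • v j) ∈ G
  inner_eq : ∀ p ∈ G, ∀ j, inner ℂ (v j) p.2 = μ j * inner ℂ (v j) p.1

section Existence

variable {H : Type} [NormedAddCommGroup H] [InnerProductSpace ℂ H] [CompleteSpace H]
  {ι : Type}

/-- The spectral theorem for the compact symmetric resolvent `K`: an eigenvalue `κ > 0` of `K`
becomes `κ⁻¹ - c`. Injectivity of `K` makes the eigenspaces with `κ ≠ 0` total, and compactness lets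
`κ` accumulate only at zero. -/
theorem diagGraph_nonempty_spectralResolution (b : HilbertBasis ι ℂ H) {lam : ι → ℝ}
    (h0 : ∀ i, 0 ≤ lam i) (hlam : ∀ E, {i | lam i ≤ E}.Finite) {W : H →L[ℂ] H}
    (hW : IsSelfAdjoint W) : Nonempty (SpectralResolution (diagGraph b lam W)) := by
  obtain ⟨K, hK, hG⟩ := exists_compact_resolvent b h0 hlam W
  set c : ℝ := ‖W‖ + 1 with hc
  have hmem : ∀ x, (K x, x - (c : ℂ) • K x) ∈ diagGraph b lam W := fun x => by
    rw [hG]; simp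
  have hinj : ∀ x, K x = 0 → x = 0 := fun x hx => by
    have := hmem x
    rw [hx, smul_zero, sub_zero] at this
    refine eq_of_inner_eq b fun i => ?_
    simpa using this i
  have hsym : (K : H →ₗ[ℂ] H).IsSymmetric := fun x y => by
    have h := diagGraph_symmetric hW (hmem x) (hmem y)
    simp only [inner_sub_right, inner_sub_left, inner_smul_right, inner_smul_left,
      Complex.conj_ofReal] at h
    exact (sub_left_inj.1 h)
  -- The form of the operator is bounded below by `-‖W‖`, and the shift `c` exceeds `‖W‖`.
  have hpos : ∀ x, 0 ≤ (inner ℂ (K x) x).re := fun x => by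
    have h := hasSum_diagGraph_re (hmem x)
    have h1 := h.nonneg fun i => mul_nonneg (h0 i) (by positivity)
    have h2 := (abs_le.1 (abs_re_inner_apply_le W (K x))).1
    simp only [inner_sub_right, inner_smul_right, inner_self_eq_norm_sq_to_K] at h1
    have h3 : ((inner ℂ (K x) x) - (c : ℂ) * ((‖K x‖ : ℂ)) ^ 2).re
        = (inner ℂ (K x) x).re - c * ‖K x‖ ^ 2 := by
      rw [Complex.sub_re]; norm_cast
    erw [h3] at h1
    nlinarith [sq_nonneg ‖K x‖]
  let S : {κ : ℂ // κ ≠ 0} → Submodule ℂ H := fun κ => Module.End.eigenspace (K : H →ₗ[ℂ] H) κ.1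
  have hfd : ∀ κ, FiniteDimensional ℂ (S κ) := fun κ =>
    ContinuousLinearMap.finite_dimensional_eigenspace hK κ.1 κ.2
  have hfam : OrthogonalFamily ℂ (fun κ => S κ) fun κ => (S κ).subtypeₗᵢ :=
    hsym.orthogonalFamily_eigenspaces.comp Subtype.val_injective
  let J : Type := Σ κ : {κ : ℂ // κ ≠ 0}, Fin (Module.finrank ℂ (S κ))
  let e : J → H := fun j => (stdOrthonormalBasis ℂ (S j.1) j.2 : S j.1)
  have he : Orthonormal ℂ e :=
    hfam.orthonormal_sigma_orthonormal (α := fun κ => Fin (Module.finrank ℂ (S κ)))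
      (v_family := fun κ => ⇑(stdOrthonormalBasis ℂ (S κ)))
      fun κ => (stdOrthonormalBasis ℂ (S κ)).orthonormal
  have hKe : ∀ j, K (e j) = j.1.1 • e j := fun j =>
    Module.End.mem_eigenspace_iff.1 (stdOrthonormalBasis ℂ (S j.1) j.2).2
  have hbot : (Submodule.span ℂ (Set.range e))ᗮ = ⊥ := by
    rw [eq_bot_iff, ← ContinuousLinearMap.orthogonalComplement_iSup_eigenspaces_eq_bot hK hsym]
    refine Submodule.orthogonal_le (iSup_le fun κ => ?_)
    by_cases hκ : κ = 0
    · intro x hx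
      have hx' := Module.End.mem_eigenspace_iff.1 hx
      rw [hκ, zero_smul] at hx'
      rw [hinj x hx']
      exact zero_mem _
    · intro x hx
      have := (stdOrthonormalBasis ℂ (S ⟨κ, hκ⟩)).sum_repr (⟨x, hx⟩ : S ⟨κ, hκ⟩)
      have h2 := congrArg Subtype.val this
      simp only [Submodule.coe_sum, Submodule.coe_smul] at h2
      rw [← h2]
      exact Submodule.sum_mem _ fun i _ => Submodule.smul_mem _ _
        (Submodule.subset_span ⟨⟨⟨κ, hκ⟩, i⟩, rfl⟩)
  let v : HilbertBasis J ℂ H := HilbertBasis.mkOfOrthogonalEqBot he hbot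
  have hv : ∀ j, v j = e j := fun j => by simp [v]
  have hreal : ∀ j : J, ∃ r : ℝ, 0 < r ∧ j.1.1 = r := fun j => by
    have h1 : inner ℂ (K (e j)) (e j) = (starRingEnd ℂ) j.1.1 := by
      rw [hKe, inner_smul_left, inner_self_eq_norm_sq_to_K, he.1 j]; simp
    have h2 : inner ℂ (e j) (K (e j)) = j.1.1 := by
      rw [hKe, inner_smul_right, inner_self_eq_norm_sq_to_K, he.1 j]; simp
    have h3 : (starRingEnd ℂ) j.1.1 = j.1.1 := by
      rw [← h1, ← h2]; exact hsym (e j) (e j)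
    obtain ⟨r, hr⟩ := Complex.conj_eq_iff_real.1 h3
    have h4 := hpos (e j)
    rw [h1, h3, hr, Complex.ofReal_re] at h4
    refine ⟨r, lt_of_le_of_ne h4 fun h => j.1.2 ?_, hr⟩
    rw [hr, ← h]; simp
  choose κ hκpos hκ using hreal
  refine ⟨⟨J, v, fun j => (κ j)⁻¹ - c, fun E => ?_, fun j => ?_, fun p hp j => ?_⟩⟩
  -- Infinitely many eigenvalues up to `E` would give an orthonormal sequence along which `‖K e‖ ≥
  -- (E + c)⁻¹`.
  · by_contra hinf
    have hinf : {j | (κ j)⁻¹ - c ≤ E}.Infinite := hinf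
    have hE : 0 < E + c := by
      obtain ⟨j, hj⟩ := hinf.nonempty
      have := inv_pos.2 (hκpos j)
      have h : (κ j)⁻¹ - c ≤ E := hj
      linarith
    obtain ⟨n, hn⟩ := exists_norm_lt_of_isCompactOperator hK
      (e := fun n => e (hinf.natEmbedding _ n : J))
      (he.comp _ (Subtype.val_injective.comp (hinf.natEmbedding _).injective))
      (inv_pos.2 hE)
    have h1 : (κ (hinf.natEmbedding _ n : J))⁻¹ - c ≤ E := (hinf.natEmbedding _ n).2
    have h2 := hκpos (hinf.natEmbedding _ n : J)
    rw [hKe, norm_smul, he.1, hκ, Complex.norm_real, Real.norm_of_nonneg h2.le, mul_one] at hn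
    have h3 := (inv_le_comm₀ h2 hE).1 (by linarith)
    linarith
  · rw [hG, hv, ← add_smul, map_smul, hKe, hκ, smul_smul]
    have : ((((κ j)⁻¹ - c : ℝ) : ℂ) + (c : ℂ)) * (κ j : ℂ) = 1 := by
      norm_cast
      rw [sub_add_cancel, inv_mul_cancel₀ (hκpos j).ne']
    rw [this, one_smul]
  · have h1 := (hG p).1 hp
    have h2 : inner ℂ (v j) p.1 = κ j * (inner ℂ (v j) p.2 + c * inner ℂ (v j) p.1) := by
      conv_lhs => rw [← h1]
      rw [hv]
      have h3 : inner ℂ (e j) (K (p.2 + (c : ℂ) • p.1))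
          = inner ℂ (K (e j)) (p.2 + (c : ℂ) • p.1) := (hsym _ _).symm
      rw [h3, hKe, inner_smul_left, hκ, Complex.conj_ofReal, inner_add_right, inner_smul_right]
    have h4 : (κ j : ℂ) ≠ 0 := by exact_mod_cast (hκpos j).ne'
    push_cast
    field_simp
    linear_combination -h2

/-- The unperturbed diagonal operator. -/
def diagResolution (b : HilbertBasis ι ℂ H) (lam : ι → ℝ)
    (hlam : ∀ E, {i | lam i ≤ E}.Finite) : SpectralResolution (diagGraph b lam 0) where
  J := ι
  v := b
  μ := lam
  finite_le := hlam
  mem := fun j i => by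
    classical
    have hb := orthonormal_iff_ite.1 b.orthonormal
    by_cases h : i = j
    · subst h; simp
    · simp [hb, h]
  inner_eq := fun p hp j => by simpa using hp j

end Existence

/-! ### Eigenvalue counts, Riesz means and variational principles -/

namespace SpectralResolution

variable {H : Type} [NormedAddCommGroup H] [InnerProductSpace ℂ H] [CompleteSpace H]
  {G : Set (H × H)} (D : SpectralResolution G)

/-- The indices of the eigenvalues not greater than `E`. -/
def below (E : ℝ) : Finset D.J := (D.finite_le E).toFinset

@[simp]
theorem mem_below {E : ℝ} {j : D.J} : j ∈ D.below E ↔ D.μ j ≤ E := by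
  simp [below]

theorem below_mono {E F : ℝ} (h : E ≤ F) : D.below E ⊆ D.below F := fun j hj => by
  rw [mem_below] at *; linarith

/-- An eigenvector is orthogonal to every `v j` with a different eigenvalue, so its expansion is a
finite sum over the indices below `E`. -/
theorem span_eigenvectors (E : ℝ) :
    Submodule.span ℂ {u : H | ∃ l : ℝ, l ≤ E ∧ (u, (l : ℂ) • u) ∈ G} =
      Submodule.span ℂ (Set.range fun j : D.below E => D.v j) := by
  refine le_antisymm (Submodule.span_le.2 ?_) (Submodule.span_mono ?_)
  · rintro u ⟨l, hl, hu⟩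
    have h0 : ∀ j ∉ D.below E, inner ℂ (D.v j) u • D.v j = 0 := fun j hj => by
      have h := D.inner_eq _ hu j
      simp only [inner_smul_right] at h
      rw [mem_below] at hj
      have h1 : ((l - D.μ j : ℝ) : ℂ) * inner ℂ (D.v j) u = 0 := by
        push_cast; linear_combination h
      rcases mul_eq_zero.1 h1 with h2 | h2
      · have : l - D.μ j = 0 := by exact_mod_cast h2
        exact absurd (by linarith) hj
      · rw [h2, zero_smul]
    have h1 := D.v.hasSum_repr u
    simp only [D.v.repr_apply_apply] at h1
    rw [h1.unique (hasSum_sum_of_ne_finset_zero h0)]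
    exact Submodule.sum_mem _ fun j hj => Submodule.smul_mem _ _
      (Submodule.subset_span ⟨⟨j, hj⟩, rfl⟩)
  · rintro _ ⟨j, rfl⟩
    exact ⟨D.μ j, D.mem_below.1 j.2, D.mem j⟩

theorem eigenCount_eq (E : ℝ) : eigenCount G E = (D.below E).card := by
  have hli : LinearIndependent ℂ fun j : D.below E => D.v j :=
    D.v.orthonormal.linearIndependent.comp _ Subtype.val_injective
  rw [eigenCount, D.span_eigenvectors E, finrank_span_eq_card hli, Fintype.card_coe]

theorem eigenCount_mono (D : SpectralResolution G) : Monotone (eigenCount G) := fun E F h => by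
  rw [D.eigenCount_eq, D.eigenCount_eq]
  exact Finset.card_le_card (D.below_mono h)

/-- The Riesz mean `∑ (E - μ)₊` of order one. -/
def riesz (E : ℝ) : ℝ := ∑ j ∈ D.below E, (E - D.μ j)

/-- The Riesz mean is a primitive of the counting function, which is monotone, so its difference
quotients bracket the count. Limits of Riesz means pass to limits of counts by this route. -/
theorem riesz_add_sub (E : ℝ) {δ : ℝ} (hδ : 0 ≤ δ) :
    δ * eigenCount G E ≤ D.riesz (E + δ) - D.riesz E ∧
      D.riesz (E + δ) - D.riesz E ≤ δ * eigenCount G (E + δ) := by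
  have hsub := D.below_mono (show E ≤ E + δ by linarith)
  have hcard : ∀ s : Finset D.J, δ * (s.card : ℝ) = ∑ j ∈ s, δ := fun s => by
    rw [Finset.sum_const, nsmul_eq_mul, mul_comm]
  classical
  have hsplit := Finset.sum_sdiff (f := fun j => E + δ - D.μ j) hsub
  rw [D.eigenCount_eq, D.eigenCount_eq, hcard, hcard, riesz, riesz]
  constructor
  · have h1 : 0 ≤ ∑ j ∈ D.below (E + δ) \ D.below E, (E + δ - D.μ j) :=
      Finset.sum_nonneg fun j hj => by
        have := D.mem_below.1 (Finset.mem_sdiff.1 hj).1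
        linarith
    have h2 : ∑ j ∈ D.below E, (E + δ - D.μ j) - ∑ j ∈ D.below E, (E - D.μ j)
        = ∑ j ∈ D.below E, δ := by
      rw [← Finset.sum_sub_distrib]
      exact Finset.sum_congr rfl fun j _ => by ring
    linarith
  · have h3 := Finset.sum_sdiff (f := fun _ : D.J => δ) hsub
    have h1 : ∑ j ∈ D.below (E + δ) \ D.below E, (E + δ - D.μ j) ≤
        ∑ j ∈ D.below (E + δ) \ D.below E, δ :=
      Finset.sum_le_sum fun j hj => by
        have := (Finset.mem_sdiff.1 hj).2
        rw [mem_below, not_le] at this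
        linarith
    have h2 : ∑ j ∈ D.below E, (E + δ - D.μ j) - ∑ j ∈ D.below E, (E - D.μ j)
        = ∑ j ∈ D.below E, δ := by
      rw [← Finset.sum_sub_distrib]
      exact Finset.sum_congr rfl fun j _ => by ring
    linarith

theorem hasSum_form {p : H × H} (hp : p ∈ G) :
    HasSum (fun j => D.μ j * ‖inner ℂ (D.v j) p.1‖ ^ 2) (inner ℂ p.1 p.2).re := by
  have h := Complex.hasSum_re (D.v.hasSum_inner_mul_inner p.1 p.2)
  refine h.congr_fun fun j => ?_
  rw [D.inner_eq p hp, ← inner_conj_symm p.1 (D.v j)]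
  have : (starRingEnd ℂ) (inner ℂ (D.v j) p.1) * ((D.μ j : ℂ) * inner ℂ (D.v j) p.1)
      = ((D.μ j * ‖inner ℂ (D.v j) p.1‖ ^ 2 : ℝ) : ℂ) := by
    rw [mul_left_comm, mul_comm ((starRingEnd ℂ) _), Complex.mul_conj, Complex.normSq_eq_norm_sq]
    norm_cast
  rw [this, Complex.ofReal_re]

/-- The quadratic form is at most `E` on the span of the eigenvectors with eigenvalue at most
`E`. -/
theorem exists_mem_of_mem_span (D : SpectralResolution G)
    (hG : ∃ S : Submodule ℂ (H × H), (S : Set (H × H)) = G) {E : ℝ} {u : H}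
    (hu : u ∈ Submodule.span ℂ {u : H | ∃ l : ℝ, l ≤ E ∧ (u, (l : ℂ) • u) ∈ G}) :
    ∃ w, (u, w) ∈ G ∧ (inner ℂ u w).re ≤ E * ‖u‖ ^ 2 := by
  classical
  obtain ⟨S, hS⟩ := hG
  rw [D.span_eigenvectors, Submodule.mem_span_range_iff_exists_fun] at hu
  obtain ⟨c, rfl⟩ := hu
  set u := ∑ j : D.below E, c j • D.v j with hu
  set w := ∑ j : D.below E, c j • (D.μ j : ℂ) • D.v j with hw
  have hmem : (u, w) ∈ G := by
    have : (u, w) = ∑ j : D.below E, c j • (D.v j, (D.μ j : ℂ) • D.v j) := by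
      ext <;> simp [hu, hw, Prod.fst_sum, Prod.snd_sum]
    rw [this]
    have hsum : ∑ j : D.below E, c j • (D.v j, (D.μ j : ℂ) • D.v j) ∈ S :=
      Submodule.sum_mem _ fun j _ => Submodule.smul_mem _ _ (hS.symm.subset (D.mem j))
    exact hS.subset hsum
  refine ⟨w, hmem, ?_⟩
  refine hasSum_le (fun j => ?_) (D.hasSum_form hmem)
    ((hasSum_norm_sq_inner D.v u).mul_left E)
  by_cases hj : D.μ j ≤ E
  · gcongr
  · have h0 : inner ℂ (D.v j) u = 0 := by
      rw [hu, inner_sum]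
      refine Finset.sum_eq_zero fun i _ => ?_
      rw [inner_smul_right, D.v.orthonormal.2, mul_zero]
      rintro rfl
      exact hj (D.mem_below.1 i.2)
    simp [h0]

/-- Every subspace of the domain on which the quadratic form is at most `E` has dimension at most
the number of eigenvalues not greater than `E`. -/
theorem finrank_le_eigenCount (D : SpectralResolution G) (S : Submodule ℂ H) [FiniteDimensional ℂ S] {E : ℝ}
    (hS : ∀ u ∈ S, ∃ w, (u, w) ∈ G ∧ (inner ℂ u w).re ≤ E * ‖u‖ ^ 2) :
    Module.finrank ℂ S ≤ eigenCount G E := by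
  -- The coordinates along the eigenvectors below `E`. If they all vanish, the remaining coordinates
  -- sit at eigenvalues above `E`, so the form exceeds `E‖u‖²` unless `u = 0`; hence `f` is
  -- injective.
  let f : S →ₗ[ℂ] (D.below E → ℂ) :=
    LinearMap.pi fun j => (innerSL ℂ (D.v j)).toLinearMap ∘ₗ S.subtype
  have hf : Function.Injective f := by
    rw [← LinearMap.ker_eq_bot, LinearMap.ker_eq_bot']
    intro u hu
    obtain ⟨w, hw, hle⟩ := hS u u.2
    have h0 : ∀ j, D.μ j ≤ E → inner ℂ (D.v j) (u : H) = 0 := fun j hj =>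
      congrFun hu ⟨j, D.mem_below.2 hj⟩
    have h1 := (D.hasSum_form hw).sub ((hasSum_norm_sq_inner D.v (u : H)).mul_left E)
    have hnn : ∀ j, 0 ≤ D.μ j * ‖inner ℂ (D.v j) (u : H)‖ ^ 2
        - E * ‖inner ℂ (D.v j) (u : H)‖ ^ 2 := fun j => by
      by_cases hj : D.μ j ≤ E
      · simp [h0 j hj]
      · rw [← sub_mul]
        exact mul_nonneg (by linarith) (by positivity)
    have h2 := h1.nonneg hnn
    have h3 : HasSum (fun j => D.μ j * ‖inner ℂ (D.v j) (u : H)‖ ^ 2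
        - E * ‖inner ℂ (D.v j) (u : H)‖ ^ 2) 0 := by
      have h : (inner ℂ (u : H) w).re - E * ‖(u : H)‖ ^ 2 = 0 := le_antisymm (by linarith) h2
      have h1' := h1
      simp only at h1'
      rwa [h] at h1'
    have h4 := (hasSum_zero_iff_of_nonneg hnn).1 h3
    have h5 : (u : H) = 0 := eq_of_inner_eq D.v fun j => by
      by_cases hj : D.μ j ≤ E
      · simp [h0 j hj]
      · have := congrFun h4 j
        simp only [Pi.zero_apply, ← sub_mul, mul_eq_zero, sub_eq_zero] at this
        rcases this with h | h
        · exact absurd h.le hj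
        · simpa using h
    exact Subtype.ext h5
  have := LinearMap.finrank_le_finrank_of_injective hf
  rw [D.eigenCount_eq]
  simpa using this

/-- The variational upper bound on the Riesz mean, for a finite Bessel family in the domain. -/
theorem sum_le_riesz {α : Type*} [Fintype α] (p : α → H × H) (hp : ∀ a, p a ∈ G)
    (hB : ∀ g : H, ∑ a, ‖inner ℂ (p a).1 g‖ ^ 2 ≤ ‖g‖ ^ 2) (E : ℝ) :
    ∑ a, (E * ‖(p a).1‖ ^ 2 - (inner ℂ (p a).1 (p a).2).re) ≤ D.riesz E := by
  have h1 : HasSum (fun j => ∑ a, (E - D.μ j) * ‖inner ℂ (D.v j) (p a).1‖ ^ 2)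
      (∑ a, (E * ‖(p a).1‖ ^ 2 - (inner ℂ (p a).1 (p a).2).re)) := by
    refine hasSum_sum fun a _ => ?_
    refine (((hasSum_norm_sq_inner D.v (p a).1).mul_left E).sub
      (D.hasSum_form (hp a))).congr_fun fun j => ?_
    ring
  -- The Bessel bound tested on `v j`: each eigenvector carries total weight at most one, so
  -- replacing the weight by one below `E` and by zero above it can only increase the sum.
  have hb : ∀ j, ∑ a, ‖inner ℂ (D.v j) (p a).1‖ ^ 2 ≤ 1 := fun j => by
    have := hB (D.v j)
    simp only [D.v.orthonormal.1 j, one_pow] at this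
    simpa only [norm_inner_symm] using this
  classical
  have h2 : HasSum (fun j => if j ∈ D.below E then E - D.μ j else 0) (D.riesz E) := by
    have := hasSum_sum_of_ne_finset_zero (f := fun j => if j ∈ D.below E then E - D.μ j else 0)
      (s := D.below E) (L := .unconditional _) (fun j hj => if_neg hj)
    convert this using 1
    exact Finset.sum_congr rfl fun j hj => (if_pos hj).symm
  refine hasSum_le (fun j => ?_) h1 h2
  rw [← Finset.mul_sum]
  split_ifs with h
  · have := D.mem_below.1 h
    nlinarith [hb j]
  · rw [mem_below, not_le] at h
    exact mul_nonpos_of_nonpos_of_nonneg (by linarith) (Finset.sum_nonneg fun a _ => by positivity)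

theorem exists_le_eigenCount (D : SpectralResolution G) (hJ : Infinite D.J) (m : ℕ) : ∃ E, m ≤ eigenCount G E := by
  obtain ⟨s, hs⟩ := Infinite.exists_subset_card_eq D.J m
  obtain ⟨E, hE⟩ := (s.image D.μ).bddAbove
  refine ⟨E, ?_⟩
  rw [D.eigenCount_eq, ← hs]
  exact Finset.card_le_card fun j hj =>
    D.mem_below.2 (hE (by simpa using ⟨j, hj, rfl⟩))

theorem bddBelow_setOf_le_eigenCount (D : SpectralResolution G) {m : ℕ} (hm : 1 ≤ m) :
    BddBelow {E | m ≤ eigenCount G E} := by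
  obtain ⟨E₀, hE₀⟩ := ((D.below 0).image D.μ).bddBelow
  refine ⟨min E₀ 0, fun E hE => ?_⟩
  have hE : m ≤ eigenCount G E := hE
  by_contra hlt
  rw [not_le, lt_min_iff] at hlt
  rw [D.eigenCount_eq] at hE
  obtain ⟨j, hj⟩ := Finset.card_pos.1 (lt_of_lt_of_le hm hE)
  rw [mem_below] at hj
  have : E₀ ≤ D.μ j := hE₀ (by simpa using ⟨j, by linarith, rfl⟩)
  linarith

theorem exists_eigenCount_eq_right (D : SpectralResolution G) (E : ℝ) : ∃ F > E, eigenCount G F = eigenCount G E := by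
  classical
  set s := (D.below (E + 1)).filter fun j => E < D.μ j
  have key : ∀ F, E < F → F ≤ E + 1 → (∀ j ∈ s, F < D.μ j) →
      eigenCount G F = eigenCount G E := fun F h1 h2 h3 => by
    rw [D.eigenCount_eq, D.eigenCount_eq]
    congr 1
    ext j
    simp only [mem_below]
    refine ⟨fun h => ?_, fun h => by linarith⟩
    by_contra hc
    have := h3 j (by simp [s]; exact ⟨by linarith, by linarith⟩)
    linarith
  by_cases hs : s.Nonempty
  · obtain ⟨j, hj, hmin⟩ := s.exists_min_image D.μ hs
    have hj' : E < D.μ j := (Finset.mem_filter.1 hj).2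
    refine ⟨min (E + 1) ((E + D.μ j) / 2), lt_min (by linarith) (by linarith),
      key _ (lt_min (by linarith) (by linarith)) (min_le_left _ _) fun i hi => ?_⟩
    have := hmin i hi
    exact lt_of_le_of_lt (min_le_right _ _) (by linarith)
  · exact ⟨E + 1, by linarith, key _ (by linarith) le_rfl fun i hi => (hs ⟨i, hi⟩).elim⟩

/-- The infimum behaves as a minimum because the counting function is right continuous. Infinitely
many eigenvalues and a lower bound keep the infimum from taking its default value. -/
theorem nthEigenvalue_le_iff (D : SpectralResolution G) (hJ : Infinite D.J) {m : ℕ} (hm : 1 ≤ m) (E : ℝ) :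
    nthEigenvalue G m ≤ E ↔ m ≤ eigenCount G E := by
  constructor
  · intro h
    obtain ⟨F, hF, hFE⟩ := D.exists_eigenCount_eq_right E
    obtain ⟨E', hE', hlt⟩ := exists_lt_of_csInf_lt (s := {E | m ≤ eigenCount G E})
      (D.exists_le_eigenCount hJ m) (lt_of_le_of_lt h hF)
    rw [← hFE]
    exact le_trans hE' (D.eigenCount_mono hlt.le)
  · exact fun h => csInf_le (D.bddBelow_setOf_le_eigenCount hm) h

end SpectralResolution

/-- The variational upper bound on the Riesz mean of `diag(lam) + W`, for a finite Bessel family in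
the form domain. -/
theorem SpectralResolution.sum_form_le_riesz {H : Type} [NormedAddCommGroup H]
    [InnerProductSpace ℂ H] [CompleteSpace H] {ι : Type} {b : HilbertBasis ι ℂ H} {lam : ι → ℝ}
    {W : H →L[ℂ] H} (D : SpectralResolution (diagGraph b lam W)) {α : Type*} [Fintype α]
    (f : α → H) (t : α → ℝ) (ht : ∀ a, HasSum (fun i => lam i * ‖inner ℂ (b i) (f a)‖ ^ 2) (t a))
    (hB : ∀ g : H, ∑ a, ‖inner ℂ (f a) g‖ ^ 2 ≤ ‖g‖ ^ 2) (E : ℝ) :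
    ∑ a, (E * ‖f a‖ ^ 2 - t a - (inner ℂ (f a) (W (f a))).re) ≤ D.riesz E := by
  classical
  have hb := orthonormal_iff_ite.1 b.orthonormal
  -- Vectors in the form domain need not lie in the operator domain. Their truncations to finitely
  -- many modes do; they remain a Bessel family because `P K` is a symmetric contraction, and their
  -- energies converge.
  let P : Finset ι → H → H := fun K x => ∑ i ∈ K, inner ℂ (b i) x • b i
  let Q : Finset ι → H → H := fun K x => ∑ i ∈ K, ((lam i : ℂ) * inner ℂ (b i) x) • b i
  have hP : ∀ K x i, inner ℂ (b i) (P K x) = if i ∈ K then inner ℂ (b i) x else 0 :=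
    fun K x i => by simp [P, hb]
  have hQ : ∀ K x i, inner ℂ (b i) (Q K x) = if i ∈ K then lam i * inner ℂ (b i) x else 0 :=
    fun K x i => by simp [Q, hb]
  have hlim : ∀ x, Tendsto (fun K => P K x) atTop (𝓝 x) := fun x => by
    have := b.hasSum_repr x
    simp only [b.repr_apply_apply] at this
    exact this
  have hPs : ∀ K x y, inner ℂ (P K x) y = inner ℂ x (P K y) := fun K x y => by
    simp only [P, sum_inner, inner_sum, inner_smul_left, inner_smul_right, inner_conj_symm]
    exact Finset.sum_congr rfl fun i _ => by ring
  have hPn : ∀ K x, ‖P K x‖ ^ 2 ≤ ‖x‖ ^ 2 := fun K x => by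
    refine hasSum_le (fun i => ?_) (hasSum_norm_sq_inner b (P K x)) (hasSum_norm_sq_inner b x)
    rw [hP]
    split_ifs
    · exact le_rfl
    · simp
  have hmem : ∀ K x, (P K x, Q K x + W (P K x)) ∈ diagGraph b lam W := fun K x i => by
    simp only [inner_add_right, hP, hQ]
    split_ifs <;> simp
  have hQr : ∀ K x, (inner ℂ (P K x) (Q K x)).re =
      ∑ i ∈ K, lam i * ‖inner ℂ (b i) x‖ ^ 2 := fun K x => by
    have h1 : inner ℂ (P K x) (Q K x) = ∑ i ∈ K, ((lam i * ‖inner ℂ (b i) x‖ ^ 2 : ℝ) : ℂ) := by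
      conv_lhs => rw [show P K x = ∑ i ∈ K, inner ℂ (b i) x • b i from rfl]
      rw [sum_inner]
      refine Finset.sum_congr rfl fun i hi => ?_
      rw [inner_smul_left, hQ, if_pos hi, mul_left_comm, mul_comm ((starRingEnd ℂ) _),
        Complex.mul_conj, Complex.normSq_eq_norm_sq]
      norm_cast
    rw [h1, ← Complex.ofReal_sum, Complex.ofReal_re]
  have hbound : ∀ K, ∑ a, (E * ‖P K (f a)‖ ^ 2 - (∑ i ∈ K, lam i * ‖inner ℂ (b i) (f a)‖ ^ 2)
      - (inner ℂ (P K (f a)) (W (P K (f a)))).re) ≤ D.riesz E := fun K => by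
    refine le_trans (le_of_eq ?_)
      (D.sum_le_riesz (fun a => (P K (f a), Q K (f a) + W (P K (f a)))) (fun a => hmem K (f a))
        (fun g => ?_) E)
    · refine Finset.sum_congr rfl fun a _ => ?_
      simp only [inner_add_right, Complex.add_re, hQr]
      ring
    · simp only [hPs]
      exact (hB _).trans (hPn K g)
  refine le_of_tendsto' (x := (atTop : Filter (Finset ι))) (tendsto_finsetSum _ fun a _ => ?_)
    hbound
  refine (((hlim (f a)).norm.pow 2).const_mul E).sub (ht a) |>.sub ?_
  exact (Complex.continuous_re.tendsto _).comp
    ((hlim (f a)).inner ((W.continuous.tendsto _).comp (hlim (f a))))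

theorem exists_submodule_eq_diagGraph {H : Type} [NormedAddCommGroup H] [InnerProductSpace ℂ H]
    [CompleteSpace H] {ι : Type} (b : HilbertBasis ι ℂ H) (lam : ι → ℝ) (W : H →L[ℂ] H) :
    ∃ S : Submodule ℂ (H × H), (S : Set (H × H)) = diagGraph b lam W :=
  ⟨{ carrier := diagGraph b lam W
     add_mem' := fun {p q} hp hq i => by
      have h1 := hp i
      have h2 := hq i
      simp only [Prod.fst_add, Prod.snd_add, inner_add_right, map_add, h1, h2]
      ring
     zero_mem' := fun i => by simp
     smul_mem' := fun c p hp i => by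
      have h1 := hp i
      simp only [Prod.smul_fst, Prod.smul_snd, inner_smul_right, map_smul, h1]
      ring }, rfl⟩

/-- The number of eigenvalues of a bounded perturbation is bounded by that of the unperturbed
diagonal operator. -/
theorem eigenCount_diagGraph_le {H : Type} [NormedAddCommGroup H]
    [InnerProductSpace ℂ H] [CompleteSpace H] {ι : Type} {b : HilbertBasis ι ℂ H} {lam : ι → ℝ}
    {W : H →L[ℂ] H} (D : SpectralResolution (diagGraph b lam W))
    (hlam : ∀ E, {i | lam i ≤ E}.Finite) (E : ℝ) :
    eigenCount (diagGraph b lam W) E ≤ {i | lam i ≤ E + ‖W‖}.ncard := by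
  set D₀ := diagResolution b lam hlam
  have h0 : eigenCount (diagGraph b lam 0) (E + ‖W‖) = {i | lam i ≤ E + ‖W‖}.ncard := by
    rw [D₀.eigenCount_eq, Set.ncard_eq_toFinset_card _ (hlam _)]
    rfl
  rw [← h0]
  set S := Submodule.span ℂ {u : H | ∃ l : ℝ, l ≤ E ∧ (u, (l : ℂ) • u) ∈ diagGraph b lam W} with hS
  have hfd : FiniteDimensional ℂ S := by
    rw [hS, D.span_eigenvectors E]
    exact FiniteDimensional.span_of_finite ℂ (Set.finite_range _)
  refine D₀.finrank_le_eigenCount S fun u hu => ?_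
  obtain ⟨w, hw, hle⟩ := D.exists_mem_of_mem_span (exists_submodule_eq_diagGraph b lam W) hu
  -- The span of the low eigenvectors is tested in the unperturbed operator; dropping `W` raises the
  -- form by at most `‖W‖ ‖u‖²`.
  refine ⟨w - W u, fun i => ?_, ?_⟩
  · have := hw i
    simp only at this
    simp [this]
  · have := abs_le.1 (abs_re_inner_apply_le W u)
    rw [inner_sub_right, Complex.sub_re]
    nlinarith

/-! ### Eigenvalues of compact operators and of compact quadratic pencils -/

section Pencil

variable {H : Type*} [NormedAddCommGroup H] [InnerProductSpace ℂ H] [CompleteSpace H]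

/-- `K` need not be normal, so eigenvectors for distinct eigenvalues are only independent.
Gram–Schmidt yields an orthonormal sequence in which `K` is triangular with diagonal `κ n`; then `‖K
(o n)‖ ≥ ‖κ n‖ ≥ ε` contradicts compactness. -/
theorem finite_eigenvalues_of_isCompactOperator {K : H →L[ℂ] H} (hK : IsCompactOperator K)
    {ε : ℝ} (hε : 0 < ε) :
    {κ : ℂ | ε ≤ ‖κ‖ ∧ ∃ v : H, v ≠ 0 ∧ K v = κ • v}.Finite := by
  by_contra hinf
  have hinf : {κ : ℂ | ε ≤ ‖κ‖ ∧ ∃ v : H, v ≠ 0 ∧ K v = κ • v}.Infinite := hinf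
  let κ : ℕ → ℂ := fun n => (hinf.natEmbedding _ n : ℂ)
  have hκinj : Function.Injective κ := Subtype.val_injective.comp (hinf.natEmbedding _).injective
  have hκ : ∀ n, ε ≤ ‖κ n‖ ∧ ∃ v : H, v ≠ 0 ∧ K v = κ n • v := fun n =>
    (hinf.natEmbedding _ n).2
  choose hκε x hx0 hx using hκ
  have hli : LinearIndependent ℂ x :=
    Module.End.eigenvectors_linearIndependent' (K : H →ₗ[ℂ] H) κ hκinj x fun n =>
      ⟨Module.End.mem_eigenspace_iff.2 (hx n), hx0 n⟩
  let g := InnerProductSpace.gramSchmidt ℂ x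
  have hg0 : ∀ n, g n ≠ 0 := fun n => InnerProductSpace.gramSchmidt_ne_zero n hli
  let S : ℕ → Submodule ℂ H := fun n => Submodule.span ℂ (x '' Set.Iio n)
  have hSK : ∀ n y, y ∈ S n → K y ∈ S n := fun n y hy => by
    refine Submodule.span_induction (p := fun y _ => K y ∈ S n) ?_ ?_ ?_ ?_ hy
    · rintro _ ⟨i, hi, rfl⟩
      rw [hx]
      exact Submodule.smul_mem _ _ (Submodule.subset_span ⟨i, hi, rfl⟩)
    · simp
    · intro a b _ _ ha hb
      rw [map_add]; exact add_mem ha hb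
    · intro c a _ ha
      rw [map_smul]; exact Submodule.smul_mem _ _ ha
  have hSg : ∀ n, Submodule.span ℂ (g '' Set.Iio n) = S n := fun n =>
    InnerProductSpace.span_gramSchmidt_Iio ℂ x n
  have horth : ∀ n y, y ∈ S n → inner ℂ (g n) y = 0 := fun n y hy => by
    rw [← hSg] at hy
    refine Submodule.span_induction (p := fun y _ => inner ℂ (g n) y = 0) ?_ ?_ ?_ ?_ hy
    · rintro _ ⟨i, hi, rfl⟩
      exact InnerProductSpace.gramSchmidt_orthogonal ℂ x (ne_of_gt hi)
    · simp
    · intro a b _ _ ha hb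
      rw [inner_add_right, ha, hb, add_zero]
    · intro c a _ ha
      rw [inner_smul_right, ha, mul_zero]
  have hdiff : ∀ n, x n - g n ∈ S n := fun n => by
    have := InnerProductSpace.gramSchmidt_def ℂ x n
    have h2 : x n - g n = ∑ i ∈ Finset.Iio n, (ℂ ∙ g i).starProjection (x n) := by
      simp only [g]; rw [this]; abel
    rw [h2, ← hSg]
    refine Submodule.sum_mem _ fun i hi => ?_
    have h3 : (ℂ ∙ g i).starProjection (x n) ∈ (ℂ ∙ g i) :=
      Submodule.starProjection_apply_mem _ _
    refine Submodule.span_mono ?_ h3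
    rintro _ rfl
    exact ⟨i, by simpa using hi, rfl⟩
  have hKg : ∀ n, inner ℂ (g n) (K (g n)) = κ n * ‖g n‖ ^ 2 := fun n => by
    have h1 : K (g n) = κ n • g n + (κ n • (x n - g n) - K (x n - g n)) := by
      rw [map_sub, hx]; module
    rw [h1, inner_add_right, horth n _ (sub_mem (Submodule.smul_mem _ _ (hdiff n))
      (hSK n _ (hdiff n))), inner_smul_right, inner_self_eq_norm_sq_to_K, add_zero]
    rfl
  let o : ℕ → H := InnerProductSpace.gramSchmidtNormed ℂ x
  have ho : Orthonormal ℂ o := InnerProductSpace.gramSchmidtNormed_orthonormal hli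
  obtain ⟨n, hn⟩ := exists_norm_lt_of_isCompactOperator hK ho hε
  have h1 : inner ℂ (o n) (K (o n)) = κ n := by
    have hne : (‖g n‖ : ℂ) ≠ 0 := by exact_mod_cast (norm_pos_iff.2 (hg0 n)).ne'
    have : o n = (‖g n‖ : ℂ)⁻¹ • g n := rfl
    rw [this, map_smul, inner_smul_left, inner_smul_right, hKg]
    simp only [map_inv₀, Complex.conj_ofReal]
    field_simp
  have h2 : ‖κ n‖ ≤ ‖K (o n)‖ := by
    rw [← h1]
    refine (norm_inner_le_norm _ _).trans ?_
    rw [ho.1 n, one_mul]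
  have := hκε n
  linarith

theorem countable_eigenvalues_of_isCompactOperator {K : H →L[ℂ] H} (hK : IsCompactOperator K) :
    {κ : ℂ | κ ≠ 0 ∧ ∃ v : H, v ≠ 0 ∧ K v = κ • v}.Countable := by
  refine (Set.countable_iUnion fun n : ℕ =>
    (finite_eigenvalues_of_isCompactOperator hK (ε := 1 / (n + 1)) (by positivity)).countable).mono ?_
  rintro κ ⟨h0, hv⟩
  obtain ⟨n, hn⟩ := exists_nat_one_div_lt (norm_pos_iff.2 h0)
  exact Set.mem_iUnion.2 ⟨n, hn.le, hv⟩

/-- A quadratic pencil `1 + w A + w² C` with compact `A`, `C` is singular for at most countably many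
values of `w`. -/
theorem countable_singular_pencil {A C : H →L[ℂ] H} (hA : IsCompactOperator A)
    (hC : IsCompactOperator C) :
    {w : ℂ | ∃ v : H, v ≠ 0 ∧ v + w • A v + w ^ 2 • C v = 0}.Countable := by
  -- Linearization: a singular `w` makes `(v, w v)` an eigenvector of the companion operator `(x, y)
  -- ↦ (-A x - C y, x)` with eigenvalue `w⁻¹`. The identity block is not compact, but the square `M
  -- = (X, Y)` of the companion is, with eigenvalue `(w²)⁻¹`. The type `WithLp 2` supplies the inner
  -- product on pairs.
  let e := WithLp.prodContinuousLinearEquiv 2 ℂ H H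
  let fst : H × H →L[ℂ] H := ContinuousLinearMap.fst ℂ H H
  let snd : H × H →L[ℂ] H := ContinuousLinearMap.snd ℂ H H
  let X : H × H →L[ℂ] H := (A ∘L A - C) ∘L fst + (A ∘L C) ∘L snd
  let Y : H × H →L[ℂ] H := -(A ∘L fst) - C ∘L snd
  let M : H × H →L[ℂ] H × H :=
    ContinuousLinearMap.inl ℂ H H ∘L X + ContinuousLinearMap.inr ℂ H H ∘L Y
  let e₁ : WithLp 2 (H × H) →L[ℂ] H × H := e
  let e₂ : H × H →L[ℂ] WithLp 2 (H × H) := e.symm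
  let N : WithLp 2 (H × H) →L[ℂ] WithLp 2 (H × H) := e₂ ∘L M ∘L e₁
  have hX : IsCompactOperator X := by
    have h1 : IsCompactOperator ((A ∘L A - C) ∘L fst) :=
      ((hA.clm_comp A).sub hC).comp_clm fst
    have h2 : IsCompactOperator ((A ∘L C) ∘L snd) := (hC.clm_comp A).comp_clm snd
    exact h1.add h2
  have hY : IsCompactOperator Y := by
    have h1 : IsCompactOperator (A ∘L fst) := hA.comp_clm fst
    have h2 : IsCompactOperator (C ∘L snd) := hC.comp_clm snd
    exact h1.neg.sub h2
  have hM : IsCompactOperator M := by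
    have h1 : IsCompactOperator (ContinuousLinearMap.inl ℂ H H ∘L X) :=
      hX.clm_comp (ContinuousLinearMap.inl ℂ H H)
    have h2 : IsCompactOperator (ContinuousLinearMap.inr ℂ H H ∘L Y) :=
      hY.clm_comp (ContinuousLinearMap.inr ℂ H H)
    exact h1.add h2
  have hN : IsCompactOperator N := by
    have h1 : IsCompactOperator (M ∘L e₁) := hM.comp_clm e₁
    exact h1.clm_comp e₂
  have hcount := countable_eigenvalues_of_isCompactOperator hN
  refine (hcount.biUnion (t := fun κ _ => {w : ℂ | (w ^ 2)⁻¹ = κ}) fun κ _ => ?_).mono ?_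
  · rcases Set.eq_empty_or_nonempty {w : ℂ | (w ^ 2)⁻¹ = κ} with h | ⟨w₀, hw₀⟩
    · rw [h]; exact Set.countable_empty
    · refine ((Set.finite_singleton (-w₀)).insert w₀).countable.mono fun w hw => ?_
      have hw₀ : (w₀ ^ 2)⁻¹ = κ := hw₀
      have hw : (w ^ 2)⁻¹ = κ := hw
      have : w ^ 2 = w₀ ^ 2 := inv_injective (hw.trans hw₀.symm)
      rcases sq_eq_sq_iff_eq_or_eq_neg.1 this with h | h <;> simp [h]
  · rintro w ⟨v, hv, hw⟩
    have hw0 : w ≠ 0 := by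
      rintro rfl
      simp at hw
      exact hv hw
    refine Set.mem_iUnion₂.2 ⟨(w ^ 2)⁻¹, ⟨by simp [hw0], e.symm (v, w • v), ?_, ?_⟩, rfl⟩
    · intro h
      have := congrArg e h
      simp at this
      exact hv this.1
    · have hNx : N (e.symm (v, w • v)) = e.symm (M (v, w • v)) := by
        simp [N, e₁, e₂]
      have hAv : w • A v + w ^ 2 • C v = -v := by
        rw [add_assoc] at hw
        exact eq_neg_of_add_eq_zero_right hw
      have hv1 : A v + w • C v = -(w⁻¹ • v) := by
        have : w • (A v + w • C v) = -v := by rw [← hAv]; module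
        rw [← smul_neg, ← this, smul_smul, inv_mul_cancel₀ hw0, one_smul]
      have hY1 : Y (v, w • v) = w⁻¹ • v := by
        have : Y (v, w • v) = -(A v + w • C v) := by
          simp only [Y, fst, snd]; simp; abel
        rw [this, hv1, neg_neg]
      have hX1 : X (v, w • v) = (w ^ 2)⁻¹ • v := by
        have : X (v, w • v) = A (A v + w • C v) - C v := by
          simp only [X, fst, snd]; simp; abel
        rw [this, hv1, map_neg, map_smul]
        have h2 : w⁻¹ • (A v + w • C v) = w⁻¹ • A v + C v := by
          rw [smul_add, smul_smul, inv_mul_cancel₀ hw0, one_smul]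
        rw [hv1] at h2
        have h3 : -(w⁻¹ • A v) - C v = -(w⁻¹ • A v + C v) := by abel
        rw [h3, ← h2, smul_neg, neg_neg, smul_smul, ← mul_inv, sq]
      rw [hNx, ← map_smul]
      congr 1
      have : M (v, w • v) = (X (v, w • v), Y (v, w • v)) := by simp [M]
      rw [this, hX1, hY1, Prod.smul_mk, smul_smul]
      congr 2
      field_simp

end Pencil

/-! ### Multiplication operators -/

theorem exists_mulOperator {α : Type*} [MeasurableSpace α] (μ : Measure α) {F : α → ℂ}
    (hF : AEStronglyMeasurable F μ) {C : ℝ} (hC : 0 ≤ C) (hb : ∀ x, ‖F x‖ ≤ C) :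
    ∃ W : Lp ℂ 2 μ →L[ℂ] Lp ℂ 2 μ, (∀ u : Lp ℂ 2 μ, W u =ᵐ[μ] fun x => F x * u x) ∧ ‖W‖ ≤ C := by
  have hm : ∀ u : Lp ℂ 2 μ, MemLp (fun x => F x * u x) 2 μ := fun u =>
    (Lp.memLp u).of_le_mul (hF.mul (Lp.aestronglyMeasurable u)) (c := C)
      (Eventually.of_forall fun x => by
        rw [norm_mul]; gcongr; exact hb x)
  let T : Lp ℂ 2 μ →ₗ[ℂ] Lp ℂ 2 μ :=
    { toFun := fun u => (hm u).toLp _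
      map_add' := fun u v => by
        refine Lp.ext ?_
        filter_upwards [(hm (u + v)).coeFn_toLp, (hm u).coeFn_toLp, (hm v).coeFn_toLp,
          Lp.coeFn_add u v, Lp.coeFn_add ((hm u).toLp _) ((hm v).toLp _)] with x h1 h2 h3 h4 h5
        rw [h1, h5, Pi.add_apply, h2, h3, h4, Pi.add_apply, mul_add]
      map_smul' := fun c u => by
        refine Lp.ext ?_
        filter_upwards [(hm (c • u)).coeFn_toLp, (hm u).coeFn_toLp,
          Lp.coeFn_smul c u, Lp.coeFn_smul c ((hm u).toLp _)] with x h1 h2 h3 h4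
        simp only [RingHom.id_apply]
        rw [h1, h4, Pi.smul_apply, h2, h3, Pi.smul_apply, smul_eq_mul, smul_eq_mul]
        ring }
  have hT : ∀ u, T u =ᵐ[μ] fun x => F x * u x := fun u => (hm u).coeFn_toLp
  have hTn : ∀ u, ‖T u‖ ≤ C * ‖u‖ := fun u => by
    refine Lp.norm_le_mul_norm_of_ae_le_mul ?_
    filter_upwards [hT u] with x hx
    rw [hx, norm_mul]
    gcongr
    exact hb x
  exact ⟨T.mkContinuous C hTn, hT, T.mkContinuous_norm_le hC hTn⟩

theorem isSelfAdjoint_of_coeFn_mul {α : Type*} [MeasurableSpace α] {μ : Measure α} {F : α → ℝ}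
    {W : Lp ℂ 2 μ →L[ℂ] Lp ℂ 2 μ} (hW : ∀ u : Lp ℂ 2 μ, W u =ᵐ[μ] fun x => (F x : ℂ) * u x) :
    IsSelfAdjoint W := by
  rw [ContinuousLinearMap.isSelfAdjoint_iff_isSymmetric]
  intro u v
  change inner ℂ (W u) v = inner ℂ u (W v)
  rw [L2.inner_def, L2.inner_def]
  refine integral_congr_ae ?_
  filter_upwards [hW u, hW v] with x h1 h2
  rw [h1, h2]
  simp
  ring

/-! ### The torus -/

/-- The Fourier basis of the torus. -/
def fourierBasis : HilbertBasis (Fin 3 → ℤ) ℂ TorusL2 := UnitAddTorus.mFourierBasis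

theorem inner_fourierBasis (n : Fin 3 → ℤ) (u : TorusL2) :
    inner ℂ (fourierBasis n) u = UnitAddTorus.mFourierCoeff u n := by
  rw [← UnitAddTorus.mFourierBasis_repr u n]
  exact (HilbertBasis.repr_apply_apply _ _ _).symm

/-- The projection of `ℝ³` onto the torus. -/
def toTorus (x : Fin 3 → ℝ) : UnitAddTorus (Fin 3) := fun i => (x i : UnitAddCircle)

theorem isOpenQuotientMap_toTorus : IsOpenQuotientMap toTorus :=
  IsOpenQuotientMap.piMap (fun _ => QuotientAddGroup.isOpenQuotientMap_mk)

section Potential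

variable {V : Space → ℝ} (hV : Continuous V)
  (hper : ∀ (m : Fin 3 → ℤ) (x : Space), V (x + WithLp.toLp 2 (fun i => (m i : ℝ))) = V x)
include hV hper

theorem onTorus_toTorus (x : Space) : onTorus V (toTorus x) = V x := by
  rw [onTorus]
  rw [← hper (fun i => -⌊x i⌋) x]
  congr 1
  ext i
  have h : (AddCircle.equivIco (1 : ℝ) 0 (toTorus x i) : ℝ) = Int.fract (x i) := by
    simp [toTorus, AddCircle.coe_equivIco_mk_apply]
  rw [PiLp.add_apply]
  simp only [h]
  rw [← Int.self_sub_floor]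
  push_cast
  ring

/-- Not visible from the representative in `[0, 1)³`, which jumps; continuity descends from `ℝ³`
through the quotient map. -/
theorem continuous_onTorus : Continuous (onTorus V) := by
  rw [isOpenQuotientMap_toTorus.isQuotientMap.continuous_iff]
  have : onTorus V ∘ toTorus = fun x => V (WithLp.toLp 2 x) := by
    ext x
    exact onTorus_toTorus hV hper (WithLp.toLp 2 x)
  rw [this]
  exact hV.comp (PiLp.continuous_toLp 2 _)

theorem exists_potential_bound : ∃ C : ℝ, 0 ≤ C ∧ (∀ x, |V x| ≤ C) ∧ ∀ t, |onTorus V t| ≤ C := by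
  obtain ⟨C, hC⟩ := isCompact_univ.exists_bound_of_continuousOn
    (continuous_onTorus hV hper).continuousOn
  refine ⟨C, (abs_nonneg (onTorus V 0)).trans (hC 0 trivial), fun x => ?_, fun t => hC t trivial⟩
  rw [← onTorus_toTorus hV hper x]
  exact hC _ trivial

theorem exists_torusPotential : ∃ W : TorusL2 →L[ℂ] TorusL2, IsSelfAdjoint W ∧
    (∀ u : TorusL2, W u =ᵐ[Measure.pi fun _ : Fin 3 =>
      (AddCircle.haarAddCircle : Measure UnitAddCircle)] fun t => (onTorus V t : ℂ) * u t) := by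
  obtain ⟨C, hC, -, hb⟩ := exists_potential_bound hV hper
  obtain ⟨W, hW, -⟩ := exists_mulOperator (Measure.pi fun _ : Fin 3 =>
      (AddCircle.haarAddCircle : Measure UnitAddCircle)) (F := fun t => (onTorus V t : ℂ))
    (Complex.continuous_ofReal.comp (continuous_onTorus hV hper)).aestronglyMeasurable hC
    (fun t => by simpa using hb t)
  exact ⟨W, isSelfAdjoint_of_coeFn_mul hW, hW⟩

end Potential

/-- The kinetic energy of the mode `n` at quasi-momentum `k`. -/
def kin (k : Space) (n : Fin 3 → ℤ) : ℝ := (1 / 2 : ℝ) * ∑ i, (2 * Real.pi * n i + k i) ^ 2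

theorem kin_nonneg (k : Space) (n : Fin 3 → ℤ) : 0 ≤ kin k n := by
  unfold kin; positivity

/-- Kinetic energy dominates the square of the mode number up to a constant depending on `k`. This
leaves finitely many modes below any energy and controls the `H²` weight. -/
theorem sum_sq_le_kin (k : Space) (n : Fin 3 → ℤ) :
    ∑ i, (n i : ℝ) ^ 2 ≤ kin k n + ∑ i, k i ^ 2 := by
  unfold kin
  rw [Finset.mul_sum, ← Finset.sum_add_distrib]
  refine Finset.sum_le_sum fun i _ => ?_
  have hpi := Real.pi_gt_three
  have h1 : (2 * Real.pi * n i) ^ 2 ≤ 2 * (2 * Real.pi * n i + k i) ^ 2 + 2 * k i ^ 2 := by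
    nlinarith [sq_nonneg (2 * Real.pi * n i + k i + k i)]
  have h2 : 36 * (n i : ℝ) ^ 2 ≤ (2 * Real.pi * n i) ^ 2 := by
    have : (36 : ℝ) ≤ (2 * Real.pi) ^ 2 := by nlinarith
    rw [mul_pow]
    gcongr
  nlinarith [sq_nonneg (2 * Real.pi * n i + k i), sq_nonneg (k i)]

theorem finite_setOf_sum_sq_le (B : ℝ) : {n : Fin 3 → ℤ | ∑ i, (n i : ℝ) ^ 2 ≤ B}.Finite := by
  have : {n : Fin 3 → ℤ | ∑ i, (n i : ℝ) ^ 2 ≤ B} ⊆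
      Set.univ.pi fun _ => Set.Icc (-⌈B⌉) ⌈B⌉ := by
    intro n hn i _
    have hn : ∑ i, (n i : ℝ) ^ 2 ≤ B := hn
    have h1 : (n i : ℝ) ^ 2 ≤ B :=
      (Finset.single_le_sum (f := fun i => (n i : ℝ) ^ 2) (fun i _ => sq_nonneg _)
        (Finset.mem_univ i)).trans hn
    have h2 : n i ^ 2 ≤ ⌈B⌉ := by
      have : ((n i ^ 2 : ℤ) : ℝ) ≤ ⌈B⌉ := by push_cast; exact h1.trans (Int.le_ceil B)
      exact_mod_cast this
    constructor
    · nlinarith [sq_nonneg (n i + 1), Int.le_self_sq (-n i)]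
    · nlinarith [Int.le_self_sq (n i)]
  exact (Set.Finite.pi' fun _ => Set.finite_Icc (-⌈B⌉) ⌈B⌉).subset fun n hn i => this hn i trivial

theorem finite_setOf_kin_le (k : Space) (E : ℝ) : {n | kin k n ≤ E}.Finite :=
  (finite_setOf_sum_sq_le (E + ∑ i, k i ^ 2)).subset fun n hn => by
    have hn : kin k n ≤ E := hn
    have := sum_sq_le_kin k n
    exact this.trans (by linarith)

/-- The `H²` condition is automatic: by the graph equation, `kin k n` times the coefficients of
`p.1` are the coefficients of `p.2 - W p.1`, hence square summable, and `kin` dominates the Sobolev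
weight up to a constant. -/
theorem fiberGraph_eq {V : Space → ℝ} {W : TorusL2 →L[ℂ] TorusL2}
    (hW : ∀ u : TorusL2, W u =ᵐ[Measure.pi fun _ : Fin 3 =>
      (AddCircle.haarAddCircle : Measure UnitAddCircle)] fun t => (onTorus V t : ℂ) * u t)
    (k : Space) : fiberGraph V k = diagGraph fourierBasis (kin k) W := by
  have hWc : ∀ (u : TorusL2) n, UnitAddTorus.mFourierCoeff (W u) n
      = UnitAddTorus.mFourierCoeff (fun t => (onTorus V t : ℂ) * u t) n := fun u n => by
    refine integral_congr_ae ?_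
    filter_upwards [hW u] with t ht
    rw [ht]
  ext p
  constructor
  · rintro ⟨-, h⟩ n
    rw [inner_fourierBasis, inner_fourierBasis, inner_fourierBasis, hWc, h n]
    rfl
  · intro h
    refine ⟨?_, fun n => ?_⟩
    · have h1 : ∀ n, ‖(kin k n : ℂ) * inner ℂ (fourierBasis n) p.1‖ ^ 2
          = ‖inner ℂ (fourierBasis n) (p.2 - W p.1)‖ ^ 2 := fun n => by
        rw [inner_sub_right, h n, add_sub_cancel_right]
      have hs := ((hasSum_norm_sq_inner fourierBasis p.1).summable.mul_left
        (2 * (1 + ∑ i, k i ^ 2) ^ 2)).add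
        ((hasSum_norm_sq_inner fourierBasis (p.2 - W p.1)).summable.mul_left 2)
      refine Summable.of_nonneg_of_le (fun n => by positivity) (fun n => ?_) hs
      rw [← h1, norm_mul, mul_pow, ← mul_assoc, ← add_mul, ← inner_fourierBasis]
      refine mul_le_mul_of_nonneg_right ?_ (by positivity)
      rw [Complex.norm_real, Real.norm_eq_abs, sq_abs]
      have h2 := sum_sq_le_kin k n
      have h3 : 0 ≤ ∑ i, (n i : ℝ) ^ 2 := by positivity
      have h4 : 0 ≤ ∑ i, (k i) ^ 2 := by positivity
      have h5 : (1 + ∑ i, (n i : ℝ) ^ 2) ^ 2 ≤ ((1 + ∑ i, k i ^ 2) + kin k n) ^ 2 := by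
        exact pow_le_pow_left₀ (by linarith) (by linarith) 2
      nlinarith [sq_nonneg ((1 + ∑ i, k i ^ 2) - kin k n)]
    · have := h n
      rw [inner_fourierBasis, inner_fourierBasis, inner_fourierBasis, hWc] at this
      rw [this]
      rfl

theorem infinite_of_hilbertBasis {ι J : Type} [Infinite ι] {H : Type} [NormedAddCommGroup H]
    [InnerProductSpace ℂ H] (b : HilbertBasis ι ℂ H) (v : HilbertBasis J ℂ H) : Infinite J := by
  by_contra hfin
  rw [not_infinite_iff_finite] at hfin
  have := Fintype.ofFinite J
  have : FiniteDimensional ℂ H := by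
    have : FiniteDimensional ℂ (EuclideanSpace ℂ J) := inferInstance
    exact LinearEquiv.finiteDimensional (v.toOrthonormalBasis.repr.symm.toLinearEquiv)
  have := b.orthonormal.linearIndependent.finite_of_isNoetherian
  exact not_finite ι

/-! ### The fiber operators: dependence on the quasi-momentum -/

/-- The graph of the fiber operator with an arbitrary bounded perturbation `W`. -/
abbrev fib (W : TorusL2 →L[ℂ] TorusL2) (k : Space) : Set (TorusL2 × TorusL2) :=
  diagGraph fourierBasis (kin k) W

/-- The cross term of the square is controlled by Cauchy–Schwarz and `√X ≤ (X + 1) / 2`, so a change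
of quasi-momentum costs a small multiple of the kinetic energy plus a small constant. -/
theorem kin_le_kin (k k' : Space) (n : Fin 3 → ℤ) :
    kin k' n ≤ kin k n + ‖k - k'‖ * (kin k n + 1 / 2) + ‖k - k'‖ ^ 2 / 2 := by
  set δ := ‖k - k'‖ with hδ
  have hδ0 : 0 ≤ δ := norm_nonneg _
  set x : Fin 3 → ℝ := fun i => 2 * Real.pi * n i + k i with hx
  set d : Fin 3 → ℝ := fun i => k' i - k i with hd
  have hdn : ∑ i, d i ^ 2 = δ ^ 2 := by
    rw [hδ, EuclideanSpace.norm_sq_eq]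
    refine Finset.sum_congr rfl fun i _ => ?_
    simp only [hd, PiLp.sub_apply, Real.norm_eq_abs, sq_abs]
    ring
  have hX : kin k n = (1 / 2) * ∑ i, x i ^ 2 := rfl
  have hX' : kin k' n = (1 / 2) * (∑ i, x i ^ 2 + 2 * ∑ i, x i * d i + ∑ i, d i ^ 2) := by
    rw [kin, Finset.mul_sum _ _ (2 : ℝ), ← Finset.sum_add_distrib, ← Finset.sum_add_distrib]
    congr 1
    refine Finset.sum_congr rfl fun i _ => ?_
    simp only [hx, hd]
    ring
  have hcs := Finset.sum_mul_sq_le_sq_mul_sq Finset.univ x d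
  set X := ∑ i, x i ^ 2 with hXdef
  have hX0 : 0 ≤ X := by positivity
  have hb : ∑ i, x i * d i ≤ δ * ((X + 1) / 2) := by
    refine (abs_le_of_sq_le_sq' ?_ (by positivity)).2
    rw [hdn] at hcs
    nlinarith [mul_nonneg (sq_nonneg δ) (sq_nonneg (X - 1))]
  rw [hX', hX, hdn]
  nlinarith

section Fiber

variable {W : TorusL2 →L[ℂ] TorusL2}

/-- A spectral resolution of the fiber operator. -/
def fibRes (hW : IsSelfAdjoint W) (k : Space) : SpectralResolution (fib W k) :=
  Classical.choice (diagGraph_nonempty_spectralResolution fourierBasis (kin_nonneg k)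
    (finite_setOf_kin_le k) hW)

theorem infinite_fibRes (hW : IsSelfAdjoint W) (k : Space) : Infinite (fibRes hW k).J :=
  infinite_of_hilbertBasis fourierBasis (fibRes hW k).v

/-- The operator domain does not depend on `k`, so the same vector can be tested at `k'`; its
kinetic energy at `k` is recovered from the form at the cost of `‖W‖`. -/
theorem exists_mem_fib (k k' : Space) {p : TorusL2 × TorusL2} (hp : p ∈ fib W k) :
    ∃ w, (p.1, w) ∈ fib W k' ∧ (inner ℂ p.1 w).re ≤ (inner ℂ p.1 p.2).re +
      ‖k - k'‖ * ((inner ℂ p.1 p.2).re + ‖W‖ * ‖p.1‖ ^ 2) +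
      (‖k - k'‖ + ‖k - k'‖ ^ 2) / 2 * ‖p.1‖ ^ 2 := by
  set δ := ‖k - k'‖ with hδ
  have hδ0 : 0 ≤ δ := norm_nonneg _
  have hk := kin_le_kin k k'
  rw [← hδ] at hk
  have h1 : ∀ n, ‖(kin k n : ℂ) * inner ℂ (fourierBasis n) p.1‖ ^ 2
      = ‖inner ℂ (fourierBasis n) (p.2 - W p.1)‖ ^ 2 := fun n => by
    rw [inner_sub_right, hp n, add_sub_cancel_right]
  have hs : Summable fun n => ‖(kin k' n : ℂ) * inner ℂ (fourierBasis n) p.1‖ ^ 2 := by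
    have hs := ((hasSum_norm_sq_inner fourierBasis p.1).summable.mul_left
      (2 * (δ + δ ^ 2) ^ 2)).add
      ((hasSum_norm_sq_inner fourierBasis (p.2 - W p.1)).summable.mul_left (2 * (1 + δ) ^ 2))
    refine Summable.of_nonneg_of_le (fun n => by positivity) (fun n => ?_) hs
    rw [← h1, norm_mul, norm_mul, mul_pow, mul_pow, ← mul_assoc, ← add_mul]
    refine mul_le_mul_of_nonneg_right ?_ (by positivity)
    simp only [Complex.norm_real, Real.norm_eq_abs, sq_abs]
    have h3 : kin k' n ^ 2 ≤ ((δ + δ ^ 2) + (1 + δ) * kin k n) ^ 2 :=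
      pow_le_pow_left₀ (kin_nonneg _ _) (by nlinarith [hk n, kin_nonneg k n]) 2
    nlinarith [sq_nonneg ((δ + δ ^ 2) - (1 + δ) * kin k n)]
  obtain ⟨y, hy⟩ := exists_inner_eq fourierBasis _ hs
  have hmem : (p.1, y + W p.1) ∈ fib W k' := fun n => by
    simp only [inner_add_right, hy]
  refine ⟨y + W p.1, hmem, ?_⟩
  have h2 := hasSum_diagGraph_re hmem
  have h3 := hasSum_diagGraph_re hp
  have h4 := hasSum_norm_sq_inner fourierBasis p.1
  have h5 := hasSum_le (fun n => ?_) h2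
    ((h3.mul_left (1 + δ)).add (h4.mul_left ((δ + δ ^ 2) / 2)))
  · have h6 := (abs_le.1 (abs_re_inner_apply_le W p.1)).1
    simp only at h5 ⊢
    nlinarith [mul_le_mul_of_nonneg_left h6 hδ0]
  · simp only
    rw [← mul_assoc, ← add_mul]
    refine mul_le_mul_of_nonneg_right ?_ (by positivity)
    nlinarith [hk n]

/-- The energy shift that controls a change of the quasi-momentum by `δ`. -/
def shift (W : TorusL2 →L[ℂ] TorusL2) (E δ : ℝ) : ℝ := δ * (|E| + ‖W‖ + 1 + δ)

theorem exists_mem_fib_of_le (k k' : Space) {p : TorusL2 × TorusL2} (hp : p ∈ fib W k) {E : ℝ}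
    (hE : (inner ℂ p.1 p.2).re ≤ E * ‖p.1‖ ^ 2) :
    ∃ w, (p.1, w) ∈ fib W k' ∧
      (inner ℂ p.1 w).re ≤ (inner ℂ p.1 p.2).re + shift W E ‖k - k'‖ * ‖p.1‖ ^ 2 := by
  obtain ⟨w, hw, hle⟩ := exists_mem_fib k k' hp
  refine ⟨w, hw, hle.trans ?_⟩
  have hδ0 : 0 ≤ ‖k - k'‖ := norm_nonneg _
  have h1 : (inner ℂ p.1 p.2).re + ‖W‖ * ‖p.1‖ ^ 2 ≤ (|E| + ‖W‖) * ‖p.1‖ ^ 2 := by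
    have := le_abs_self E
    nlinarith [sq_nonneg ‖p.1‖]
  have h2 := mul_le_mul_of_nonneg_left h1 hδ0
  have h3 : 0 ≤ (‖k - k'‖ + ‖k - k'‖ ^ 2) / 2 * ‖p.1‖ ^ 2 := by positivity
  unfold shift
  nlinarith

theorem fib_eigenCount_le (hW : IsSelfAdjoint W) (k k' : Space) (E : ℝ) :
    eigenCount (fib W k) E ≤ eigenCount (fib W k') (E + shift W E ‖k - k'‖) := by
  have hfd : FiniteDimensional ℂ
      (Submodule.span ℂ {u | ∃ l : ℝ, l ≤ E ∧ (u, (l : ℂ) • u) ∈ fib W k}) := by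
    rw [(fibRes hW k).span_eigenvectors E]
    exact FiniteDimensional.span_of_finite ℂ (Set.finite_range _)
  refine (fibRes hW k').finrank_le_eigenCount _ fun u hu => ?_
  obtain ⟨w, hw, hle⟩ := (fibRes hW k).exists_mem_of_mem_span
    (exists_submodule_eq_diagGraph _ _ _) hu
  obtain ⟨w', hw', hle'⟩ := exists_mem_fib_of_le k k' hw hle
  exact ⟨w', hw', by simp only at hle'; nlinarith⟩

theorem fib_riesz_le (hW : IsSelfAdjoint W) (k k' : Space) (E : ℝ) :
    (fibRes hW k).riesz E ≤ (fibRes hW k').riesz (E + shift W E ‖k - k'‖) := by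
  set D := fibRes hW k
  have hex : ∀ j : D.below E, ∃ w, (D.v j, w) ∈ fib W k' ∧
      (inner ℂ (D.v j) w).re ≤ D.μ j + shift W E ‖k - k'‖ := fun j => by
    have hn : ‖D.v j‖ = 1 := D.v.orthonormal.1 j
    have hre : (inner ℂ (D.v j) ((D.μ j : ℂ) • D.v j)).re = D.μ j := by
      rw [inner_smul_right, inner_self_eq_norm_sq_to_K, hn]; simp
    obtain ⟨w, hw, hle⟩ := exists_mem_fib_of_le k k' (D.mem j) (E := E)
      (by simp only [hre, hn]; simpa using D.mem_below.1 j.2)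
    refine ⟨w, hw, ?_⟩
    simpa only [hre, hn, one_pow, mul_one] using hle
  choose w hw hle using hex
  have h := (fibRes hW k').sum_le_riesz (fun j : D.below E => (D.v j, w j)) hw (fun g => ?_)
    (E + shift W E ‖k - k'‖)
  · refine le_trans ?_ h
    rw [SpectralResolution.riesz, ← Finset.sum_coe_sort]
    refine Finset.sum_le_sum fun j _ => ?_
    have hn : ‖D.v j‖ = 1 := D.v.orthonormal.1 j
    simp only [hn]
    linarith [hle j]
  · have := D.v.orthonormal.sum_inner_products_le (x := g) (s := D.below E)
    rw [← Finset.sum_coe_sort] at this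
    exact this

/-- A bound on the number of eigenvalues that is uniform in the Brillouin zone. -/
def fibBound (W : TorusL2 →L[ℂ] TorusL2) (E : ℝ) : ℕ :=
  {n : Fin 3 → ℤ | ∑ i, (n i : ℝ) ^ 2 ≤ E + ‖W‖}.ncard

/-- In the Brillouin zone `|kᵢ| ≤ π`, so `|2π nᵢ + kᵢ| ≥ π |nᵢ|`; the bound is uniform in `k`. -/
theorem sum_sq_le_kin_of_mem {k : Space} (hk : k ∈ brillouinZone) (n : Fin 3 → ℤ) :
    ∑ i, (n i : ℝ) ^ 2 ≤ kin k n := by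
  unfold kin
  rw [Finset.mul_sum]
  refine Finset.sum_le_sum fun i _ => ?_
  obtain ⟨h1, h2⟩ := hk i
  have hpi := Real.pi_gt_three
  have key : Real.pi ^ 2 * (n i : ℝ) ^ 2 ≤ (2 * Real.pi * n i + k i) ^ 2 := by
    rcases lt_trichotomy (n i) 0 with h | h | h
    · have h3 : (n i : ℝ) ≤ -1 := by exact_mod_cast Int.le_sub_one_of_lt h
      have h4 : 2 * Real.pi * n i + k i ≤ Real.pi * n i := by nlinarith
      have h5 : Real.pi * (n i : ℝ) ≤ 0 := by nlinarith
      nlinarith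
    · simp [h]; positivity
    · have h3 : (1 : ℝ) ≤ n i := by exact_mod_cast h
      have h4 : Real.pi * n i ≤ 2 * Real.pi * n i + k i := by nlinarith
      have h5 : 0 ≤ Real.pi * (n i : ℝ) := by nlinarith
      nlinarith
  have h9 : 2 * (n i : ℝ) ^ 2 ≤ Real.pi ^ 2 * (n i : ℝ) ^ 2 :=
    mul_le_mul_of_nonneg_right (by nlinarith) (sq_nonneg _)
  linarith

theorem fib_eigenCount_le_fibBound (hW : IsSelfAdjoint W) {k : Space} (hk : k ∈ brillouinZone)
    (E : ℝ) : eigenCount (fib W k) E ≤ fibBound W E := by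
  refine (eigenCount_diagGraph_le (fibRes hW k) (finite_setOf_kin_le k) E).trans ?_
  refine Set.ncard_le_ncard (fun n hn => ?_) (finite_setOf_sum_sq_le _)
  exact (sum_sq_le_kin_of_mem hk n).trans hn

theorem fib_eigenCount_eq_zero (hW : IsSelfAdjoint W) (k : Space) {E : ℝ} (hE : E < -‖W‖) :
    eigenCount (fib W k) E = 0 := by
  have h := eigenCount_diagGraph_le (fibRes hW k) (finite_setOf_kin_le k) E
  have : {i | kin k i ≤ E + ‖W‖} = ∅ := by
    ext n
    simp only [Set.mem_ofPred_eq, Set.mem_empty_iff_false, iff_false, not_le]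
    have := kin_nonneg k n
    linarith
  rw [this, Set.ncard_empty] at h
  exact Nat.le_zero.1 h

theorem fib_nth_le_iff (hW : IsSelfAdjoint W) (k : Space) {m : ℕ} (hm : 1 ≤ m) (E : ℝ) :
    nthEigenvalue (fib W k) m ≤ E ↔ m ≤ eigenCount (fib W k) E :=
  (fibRes hW k).nthEigenvalue_le_iff (infinite_fibRes hW k) hm E

theorem fib_nth_ge (hW : IsSelfAdjoint W) (k : Space) {m : ℕ} (hm : 1 ≤ m) :
    -‖W‖ ≤ nthEigenvalue (fib W k) m := by
  by_contra h
  rw [not_le] at h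
  have h1 := (fib_nth_le_iff hW k hm _).1 le_rfl
  rw [fib_eigenCount_eq_zero hW k h] at h1
  omega

theorem fib_nth_le (hW : IsSelfAdjoint W) (k k' : Space) {m : ℕ} (hm : 1 ≤ m) :
    nthEigenvalue (fib W k') m ≤ nthEigenvalue (fib W k) m +
      shift W (nthEigenvalue (fib W k) m) ‖k - k'‖ := by
  rw [fib_nth_le_iff hW k' hm]
  exact ((fib_nth_le_iff hW k hm _).1 le_rfl).trans (fib_eigenCount_le hW k k' _)

theorem shift_mono {E F δ : ℝ} (hδ : 0 ≤ δ) (h : |E| ≤ F) : shift W E δ ≤ shift W F δ := by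
  unfold shift
  have := le_abs_self F
  exact mul_le_mul_of_nonneg_left (by linarith) hδ

theorem shift_nonneg {E δ : ℝ} (hδ : 0 ≤ δ) : 0 ≤ shift W E δ := by
  unfold shift; positivity

theorem tendsto_shift (E : ℝ) (k₀ : Space) :
    Tendsto (fun k => shift W E ‖k - k₀‖) (𝓝 k₀) (𝓝 0) := by
  have : Continuous fun k => shift W E ‖k - k₀‖ := by unfold shift; fun_prop
  have h := this.tendsto k₀
  simpa [shift] using h

theorem continuous_fib_nth (hW : IsSelfAdjoint W) {m : ℕ} (hm : 1 ≤ m) :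
    Continuous fun k => nthEigenvalue (fib W k) m := by
  rw [continuous_iff_continuousAt]
  intro k₀
  set e := fun k => nthEigenvalue (fib W k) m with he
  -- The shift in the reverse estimate depends on the still uncontrolled `e k`. The upper estimate
  -- from `k₀` and the lower bound `-‖W‖` confine `e k` to `[-B, B]` near `k₀`, so one shift serves
  -- in both directions.
  set B := |e k₀| + ‖W‖ + 1 with hB
  have hup : ∀ k, e k ≤ e k₀ + shift W B ‖k - k₀‖ := fun k => by
    have h := fib_nth_le hW k₀ k hm
    rw [norm_sub_rev] at h
    refine h.trans (add_le_add le_rfl (shift_mono (norm_nonneg _) ?_))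
    have := norm_nonneg W
    change |e k₀| ≤ B
    linarith
  have hs := tendsto_shift (W := W) B k₀
  have hev : ∀ᶠ k in 𝓝 k₀, shift W B ‖k - k₀‖ ≤ 1 :=
    hs.eventually (ge_mem_nhds zero_lt_one)
  have hlow : ∀ᶠ k in 𝓝 k₀, e k₀ - shift W B ‖k - k₀‖ ≤ e k := by
    filter_upwards [hev] with k hk
    have h := fib_nth_le hW k k₀ hm
    have h1 : |nthEigenvalue (fib W k) m| ≤ B := by
      rw [abs_le]
      have h2 := fib_nth_ge hW k hm
      have h3 := hup k
      have h4 := le_abs_self (e k₀)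
      have h5 := abs_nonneg (e k₀)
      have h6 := norm_nonneg W
      constructor
      · linarith
      · change e k ≤ B
        linarith
    have h2 := shift_mono (W := W) (norm_nonneg (k - k₀)) h1
    simp only [he]
    linarith
  refine tendsto_of_tendsto_of_tendsto_of_le_of_le' (g := fun k => e k₀ - shift W B ‖k - k₀‖)
    (h := fun k => e k₀ + shift W B ‖k - k₀‖) ?_ ?_ hlow (Eventually.of_forall hup)
  · simpa using hs.const_sub (e k₀)
  · simpa using hs.const_add (e k₀)

/-- The reason for working with Riesz means: the counting function jumps in `k`, whereas this
quantity is continuous and its Riemann sums converge. -/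
theorem continuous_fib_riesz (hW : IsSelfAdjoint W) (E : ℝ) :
    Continuous fun k => (fibRes hW k).riesz E := by
  rw [continuous_iff_continuousAt]
  intro k₀
  have hs := tendsto_shift (W := W) E k₀
  have hs' := tendsto_shift (W := W) (E + 1) k₀
  have key : ∀ k k', shift W E ‖k - k'‖ ≤ 1 → (fibRes hW k).riesz E ≤ (fibRes hW k').riesz E +
      shift W E ‖k - k'‖ * eigenCount (fib W k') (E + 1) := fun k k' h => by
    have h1 := ((fibRes hW k').riesz_add_sub E
      (shift_nonneg (W := W) (E := E) (norm_nonneg (k - k')))).2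
    have h2 := fib_riesz_le hW k k' E
    have h3 : (eigenCount (fib W k') (E + shift W E ‖k - k'‖) : ℝ) ≤
        eigenCount (fib W k') (E + 1) := by
      exact_mod_cast (fibRes hW k').eigenCount_mono (by linarith)
    have h4 := mul_le_mul_of_nonneg_left h3
      (shift_nonneg (W := W) (E := E) (norm_nonneg (k - k')))
    linarith
  set C : ℝ := ((eigenCount (fib W k₀) (E + 2) : ℕ) : ℝ) with hC
  have hc : ∀ᶠ k in 𝓝 k₀, (eigenCount (fib W k) (E + 1) : ℝ) ≤ C := by
    filter_upwards [hs'.eventually (ge_mem_nhds zero_lt_one)] with k hk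
    rw [hC]
    exact_mod_cast (fib_eigenCount_le hW k k₀ (E + 1)).trans
      ((fibRes hW k₀).eigenCount_mono (by linarith))
  have hev := hs.eventually (ge_mem_nhds zero_lt_one)
  refine tendsto_of_tendsto_of_tendsto_of_le_of_le'
    (g := fun k => (fibRes hW k₀).riesz E - shift W E ‖k - k₀‖ * C)
    (h := fun k => (fibRes hW k₀).riesz E + shift W E ‖k - k₀‖ * eigenCount (fib W k₀) (E + 1))
    ?_ ?_ ?_ ?_
  · simpa using (hs.mul_const C).const_sub ((fibRes hW k₀).riesz E)
  · simpa using (hs.mul_const (eigenCount (fib W k₀) (E + 1) : ℝ)).const_add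
      ((fibRes hW k₀).riesz E)
  · filter_upwards [hev, hc] with k h1 h2
    have h3 := key k₀ k (by rwa [norm_sub_rev])
    rw [norm_sub_rev] at h3
    have h4 := mul_le_mul_of_nonneg_left h2
      (shift_nonneg (W := W) (E := E) (norm_nonneg (k - k₀)))
    linarith
  · filter_upwards [hev] with k h1
    exact key k k₀ h1

end Fiber

/-! ### Absence of flat bands -/

/-- The quasi-momentum `2πy`. -/
def momentum (y : Fin 3 → ℝ) : Space := WithLp.toLp 2 fun i => 2 * Real.pi * y i

theorem continuous_momentum : Continuous momentum := by
  unfold momentum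
  exact (PiLp.continuous_toLp 2 _).comp (by fun_prop)

theorem tendsto_kin_cofinite (k : Space) : Tendsto (kin k) cofinite atTop := by
  refine tendsto_atTop.2 fun E => ?_
  have : {n | ¬ E ≤ kin k n}.Finite :=
    (finite_setOf_kin_le k E).subset fun n hn => (not_le.1 hn).le
  simpa [Filter.Eventually, Filter.mem_cofinite, Set.compl_def] using this

set_option maxHeartbeats 1000000 in
/-- Along every line in the first coordinate direction, `E` is an eigenvalue of the fiber operator
for at most countably many quasi-momenta. -/
theorem countable_slice (W : TorusL2 →L[ℂ] TorusL2) (E : ℝ) (y : Fin 3 → ℝ) :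
    {t : ℝ | ∃ u : TorusL2, u ≠ 0 ∧
      (u, (E : ℂ) • u) ∈ fib W (momentum (y + Pi.single 0 t))}.Countable := by
  -- Chosen so that `π τ > ‖W‖ + |E|`, which makes `1 + W' R` below invertible.
  set τ : ℝ := ‖W‖ + |E| + 1 with hτ
  have hτ1 : 1 ≤ τ := by have := norm_nonneg W; have := abs_nonneg E; linarith
  -- The base point for the first momentum component. The symbol `d n` has imaginary part `(2π n₀ +
  -- π) τ`, of modulus at least `π τ` for every integer `n₀`; this is why the real part is `π`.
  set z₀ : ℂ := (Real.pi : ℂ) + τ * Complex.I with hz₀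
  have hpi := Real.pi_gt_three
  set rest : (Fin 3 → ℤ) → ℝ := fun n =>
    (2 * Real.pi * n 1 + 2 * Real.pi * y 1) ^ 2 + (2 * Real.pi * n 2 + 2 * Real.pi * y 2) ^ 2
    with hrest
  have hrest0 : ∀ n, 0 ≤ rest n := fun n => by positivity
  set b : (Fin 3 → ℤ) → ℂ := fun n => 2 * Real.pi * n 0 + z₀ with hb
  set d : (Fin 3 → ℤ) → ℂ := fun n => (1 / 2) * (b n ^ 2 + rest n) with hd
  set x : (Fin 3 → ℤ) → ℝ := fun n => (1 / 2) * ((2 * Real.pi * n 0 + Real.pi) ^ 2 + rest n)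
    with hx
  have hxk : x = kin (WithLp.toLp 2 ![Real.pi, 2 * Real.pi * y 1, 2 * Real.pi * y 2]) := by
    ext n
    simp [hx, hrest, kin, Fin.sum_univ_three]
    ring
  have hbre : ∀ n, b n = ((2 * Real.pi * n 0 + Real.pi : ℝ) : ℂ) + (τ : ℝ) * Complex.I :=
    fun n => by simp only [hb, hz₀]; push_cast; ring
  have hdre : ∀ n, d n = ((x n - τ ^ 2 / 2 : ℝ) : ℂ) +
      (((2 * Real.pi * n 0 + Real.pi) * τ : ℝ) : ℂ) * Complex.I := fun n => by
    simp only [hd, hbre, hx]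
    push_cast
    linear_combination (1 / 2 * (τ : ℂ) ^ 2) * Complex.I_sq
  have hd1 : ∀ n, Real.pi * τ ≤ ‖d n‖ := fun n => by
    have h1 := Complex.abs_im_le_norm (d n)
    have h2 : (d n).im = (2 * Real.pi * n 0 + Real.pi) * τ := by
      rw [hdre]
      simp only [Complex.add_im, Complex.ofReal_im, Complex.mul_im, Complex.ofReal_re,
        Complex.I_re, Complex.I_im]
      ring
    rw [h2, abs_mul, abs_of_pos (by linarith : (0 : ℝ) < τ)] at h1
    refine le_trans ?_ h1
    refine mul_le_mul_of_nonneg_right ?_ (by linarith)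
    have h3 : (1 : ℝ) ≤ |2 * (n 0 : ℝ) + 1| := by
      have : (1 : ℤ) ≤ |2 * n 0 + 1| := Int.one_le_abs (by omega)
      exact_mod_cast this
    have h4 : 2 * Real.pi * n 0 + Real.pi = Real.pi * (2 * n 0 + 1) := by ring
    rw [h4, abs_mul, abs_of_pos Real.pi_pos]
    nlinarith
  have hd2 : ∀ n, x n - τ ^ 2 / 2 ≤ ‖d n‖ := fun n => by
    have h1 := (le_abs_self _).trans (Complex.abs_re_le_norm (d n))
    have h2 : (d n).re = x n - τ ^ 2 / 2 := by
      rw [hdre]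
      simp only [Complex.add_re, Complex.ofReal_im, Complex.mul_re, Complex.ofReal_re,
        Complex.I_re, Complex.I_im]
      ring
    rwa [h2] at h1
  have hdpos : ∀ n, 0 < ‖d n‖ := fun n => lt_of_lt_of_le (by positivity) (hd1 n)
  have hd0 : ∀ n, d n ≠ 0 := fun n => norm_pos_iff.1 (hdpos n)
  -- The linear symbol is of square-root order relative to `d`, so `b / d` tends to zero and `S` is
  -- compact.
  have hb2 : ∀ n, ‖b n‖ ^ 2 ≤ 2 * ‖d n‖ + 2 * τ ^ 2 := fun n => by
    have h1 : ‖b n‖ ^ 2 = (2 * Real.pi * n 0 + Real.pi) ^ 2 + τ ^ 2 := by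
      rw [hbre, ← Complex.normSq_eq_norm_sq, Complex.normSq_add_mul_I]
    rw [h1]
    have := hd2 n
    have := hrest0 n
    simp only [hx] at *
    linarith
  have hdt : Tendsto (fun n => ‖d n‖) cofinite atTop := by
    refine tendsto_atTop_mono hd2 (tendsto_atTop_add_const_right _ _ ?_)
    rw [hxk]
    exact tendsto_kin_cofinite _
  have hinv : Tendsto (fun n => ‖d n‖⁻¹) cofinite (𝓝 0) := tendsto_inv_atTop_zero.comp hdt
  have hd3 : ∀ n, ‖d n‖⁻¹ ≤ (Real.pi * τ)⁻¹ := fun n => inv_anti₀ (by positivity) (hd1 n)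
  obtain ⟨R, hR, hRn⟩ := exists_diagonal fourierBasis (fun n => (d n)⁻¹) (Real.pi * τ)⁻¹
    (by positivity) (fun n => by rw [norm_inv]; exact hd3 n)
  have hRc : IsCompactOperator R := by
    refine isCompactOperator_diagonal fourierBasis ?_ hR
    rw [tendsto_zero_iff_norm_tendsto_zero]
    simpa only [norm_inv] using hinv
  have ha2 : ∀ n, ‖b n * (d n)⁻¹‖ ^ 2 ≤ 2 * ‖d n‖⁻¹ + 2 * τ ^ 2 * (‖d n‖⁻¹) ^ 2 := fun n => by
    rw [norm_mul, norm_inv, mul_pow]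
    have h1 := mul_le_mul_of_nonneg_right (hb2 n) (sq_nonneg ‖d n‖⁻¹)
    have h2 : ‖d n‖ * ‖d n‖⁻¹ ^ 2 = ‖d n‖⁻¹ := by
      rw [sq, ← mul_assoc, mul_inv_cancel₀ (hdpos n).ne', one_mul]
    nlinarith
  obtain ⟨S, hS, -⟩ := exists_diagonal fourierBasis (fun n => b n * (d n)⁻¹) 2
    (by norm_num) (fun n => by
      refine (abs_le_of_sq_le_sq' ((ha2 n).trans ?_) (by norm_num)).2
      have h1 : (Real.pi * τ)⁻¹ ≤ τ⁻¹ := inv_anti₀ (by linarith) (by nlinarith)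
      have h2 : ‖d n‖⁻¹ ≤ τ⁻¹ := (hd3 n).trans h1
      have h3 : τ⁻¹ ≤ 1 := inv_le_one_of_one_le₀ hτ1
      have h4 : 0 ≤ ‖d n‖⁻¹ := by positivity
      have h5 : τ ^ 2 * (‖d n‖⁻¹) ^ 2 ≤ 1 := by
        rw [← mul_pow]
        refine pow_le_one₀ (by positivity) ?_
        calc τ * ‖d n‖⁻¹ ≤ τ * τ⁻¹ := by gcongr
          _ = 1 := mul_inv_cancel₀ (by linarith)
      linarith)
  have hSc : IsCompactOperator S := by
    refine isCompactOperator_diagonal fourierBasis ?_ hS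
    rw [tendsto_zero_iff_norm_tendsto_zero]
    have h1 : Tendsto (fun n => ‖b n * (d n)⁻¹‖ ^ 2) cofinite (𝓝 0) := by
      refine squeeze_zero (fun n => sq_nonneg _) ha2 ?_
      simpa using (hinv.const_mul 2).add ((hinv.pow 2).const_mul (2 * τ ^ 2))
    have h2 := h1.sqrt
    simpa only [Real.sqrt_sq (norm_nonneg _), Real.sqrt_zero] using h2
  set W' : TorusL2 →L[ℂ] TorusL2 := W - (E : ℂ) • 1 with hW'
  have hW'n : ‖W'‖ ≤ ‖W‖ + |E| := by
    refine (norm_sub_le _ _).trans ?_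
    gcongr
    rw [norm_smul, Complex.norm_real, Real.norm_eq_abs]
    exact mul_le_of_le_one_right (abs_nonneg _) ContinuousLinearMap.norm_id_le
  have hu : IsUnit (1 + W' * R) := by
    have : ‖-(W' * R)‖ < 1 := by
      rw [norm_neg]
      calc ‖W' * R‖ ≤ ‖W'‖ * ‖R‖ := norm_mul_le _ _
        _ ≤ (‖W‖ + |E|) * (Real.pi * τ)⁻¹ := by gcongr
        _ < 1 := by
          rw [← div_eq_mul_inv, div_lt_one (by positivity)]
          nlinarith
    simpa using isUnit_one_sub_of_norm_lt_one this
  obtain ⟨U, hU⟩ := hu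
  have hU2 : ∀ x, U⁻¹.val (U.val x) = x := fun x =>
    congrArg (fun A : TorusL2 →L[ℂ] TorusL2 => A x) U.inv_mul
  have hUx : ∀ z, U.val z = z + W' (R z) := fun z => by rw [hU]; simp
  have hA : IsCompactOperator (U⁻¹.val ∘L S) := hSc.clm_comp U⁻¹.val
  have hC : IsCompactOperator ((1 / 2 : ℂ) • (U⁻¹.val ∘L R)) := by
    have : IsCompactOperator (U⁻¹.val ∘L R) := hRc.clm_comp U⁻¹.val
    exact this.smul (1 / 2 : ℂ)
  have hcount := countable_singular_pencil hA hC
  refine (hcount.preimage_of_injOn (f := fun t : ℝ => ((2 * Real.pi * (y 0 + t) : ℝ) : ℂ) - z₀)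
    ?_).mono ?_
  · intro t _ t' _ h
    have h1 : ((2 * Real.pi * (y 0 + t) : ℝ) : ℂ) = ((2 * Real.pi * (y 0 + t') : ℝ) : ℂ) :=
      sub_left_injective h
    have h2 : 2 * Real.pi * (y 0 + t) = 2 * Real.pi * (y 0 + t') := by exact_mod_cast h1
    have h3 := mul_left_cancel₀ (by positivity) h2
    linarith
  rintro t ⟨u, hu0, hu⟩
  set s : ℝ := 2 * Real.pi * (y 0 + t) with hs
  set w : ℂ := (s : ℂ) - z₀ with hw
  set k := momentum (y + Pi.single 0 t) with hk
  have hkin : ∀ n, kin k n = (1 / 2) * ((2 * Real.pi * n 0 + s) ^ 2 + rest n) := fun n => by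
    simp [hk, momentum, kin, Fin.sum_univ_three, hrest, hs]
    ring
  -- With `w = s - z₀` the kinetic energy is exactly quadratic in `w`. Writing `u = R v` and
  -- applying the inverse of `1 + W' R` turns the eigenvalue equation into singularity of the
  -- compact pencil at `w`.
  have hkinc : ∀ n, (kin k n : ℂ) = d n + w * b n + w ^ 2 / 2 := fun n => by
    rw [hkin]
    simp only [hd, hw, hb]
    push_cast
    ring
  have heq : ∀ n, (d n + w * b n + w ^ 2 / 2) * inner ℂ (fourierBasis n) u
      + inner ℂ (fourierBasis n) (W' u) = 0 := fun n => by
    have h := hu n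
    simp only [inner_smul_right, hkinc] at h
    simp only [hW', sub_apply, smul_apply, one_apply_eq_self, inner_sub_right,
      inner_smul_right]
    linear_combination -h
  -- The coefficients of `v` are square summable: the eigenvalue equation expresses `kin k n` times
  -- those of `u` through `W' u`, and `‖d n‖ ≤ 2 kin k n + ‖w‖²`.
  have hsum : Summable fun n => ‖d n * inner ℂ (fourierBasis n) u‖ ^ 2 := by
    have hs := ((hasSum_norm_sq_inner fourierBasis u).summable.mul_left
      (2 * (‖w‖ ^ 2) ^ 2)).add
      ((hasSum_norm_sq_inner fourierBasis (W' u)).summable.mul_left 8)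
    refine Summable.of_nonneg_of_le (fun n => by positivity) (fun n => ?_) hs
    have h1 : ‖inner ℂ (fourierBasis n) (W' u)‖ = kin k n * ‖inner ℂ (fourierBasis n) u‖ := by
      have h2 := heq n
      rw [← hkinc] at h2
      rw [eq_neg_of_add_eq_zero_right h2, norm_neg, norm_mul, Complex.norm_real,
        Real.norm_of_nonneg (kin_nonneg _ _)]
    have h3 : ‖d n‖ ≤ 2 * kin k n + ‖w‖ ^ 2 := by
      have h4 : b n = ((2 * Real.pi * n 0 + s : ℝ) : ℂ) - w := by
        simp only [hb, hw]; push_cast; ring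
      have h5 : ‖b n‖ ≤ |2 * Real.pi * n 0 + s| + ‖w‖ := by
        rw [h4]
        refine (norm_sub_le _ _).trans ?_
        rw [Complex.norm_real, Real.norm_eq_abs]
      have h6 : ‖b n‖ ^ 2 ≤ 2 * (2 * Real.pi * n 0 + s) ^ 2 + 2 * ‖w‖ ^ 2 := by
        rw [← sq_abs (2 * Real.pi * n 0 + s)]
        have h := pow_le_pow_left₀ (norm_nonneg _) h5 2
        linarith [add_sq_le (a := |2 * Real.pi * n 0 + s|) (b := ‖w‖)]
      have h7 : ‖d n‖ ≤ 1 / 2 * (‖b n‖ ^ 2 + rest n) := by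
        simp only [hd]
        rw [norm_mul]
        have : ‖(1 / 2 : ℂ)‖ = 1 / 2 := by norm_num
        rw [this]
        gcongr
        refine (norm_add_le _ _).trans ?_
        rw [norm_pow, Complex.norm_real, Real.norm_of_nonneg (hrest0 n)]
      rw [hkin]
      have := hrest0 n
      linarith
    rw [norm_mul, mul_pow, h1, mul_pow]
    have h8 : ‖d n‖ ^ 2 ≤ 2 * (‖w‖ ^ 2) ^ 2 + 8 * kin k n ^ 2 := by
      have := pow_le_pow_left₀ (norm_nonneg _) h3 2
      nlinarith [sq_nonneg (2 * kin k n - ‖w‖ ^ 2)]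
    nlinarith [sq_nonneg ‖inner ℂ (fourierBasis n) u‖]
  obtain ⟨v, hv⟩ := exists_inner_eq fourierBasis _ hsum
  have hRv : R v = u := eq_of_inner_eq fourierBasis fun n => by
    rw [hR, hv, ← mul_assoc, inv_mul_cancel₀ (hd0 n), one_mul]
  refine ⟨v, ?_, ?_⟩
  · rintro rfl
    exact hu0 (by rw [← hRv, map_zero])
  · have h1 : U.val v + w • S v + (w ^ 2 / 2) • R v = 0 := by
      refine eq_of_inner_eq fourierBasis fun n => ?_
      rw [hUx, hRv]
      simp only [inner_add_right, inner_smul_right, hS, hv, inner_zero_right]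
      have h2 : b n * (d n)⁻¹ * (d n * inner ℂ (fourierBasis n) u)
          = b n * inner ℂ (fourierBasis n) u := by
        have := hd0 n
        field_simp
      rw [h2]
      linear_combination heq n
    have h2 := congrArg U⁻¹.val h1
    simp only [map_add, map_smul, hU2, map_zero] at h2
    rw [← h2]
    simp only [ContinuousLinearMap.comp_apply, smul_apply, smul_smul]
    congr 2
    ring

/-! ### The integrated density of states -/

theorem SpectralResolution.exists_eigenCount_eq_left {H : Type} [NormedAddCommGroup H]
    [InnerProductSpace ℂ H] [CompleteSpace H] {G : Set (H × H)} (D : SpectralResolution G) {E : ℝ}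
    (hE : ∀ j, D.μ j ≠ E) : ∃ F < E, eigenCount G F = eigenCount G E := by
  have key : ∀ F, F < E → (∀ j ∈ D.below E, D.μ j ≤ F) →
      eigenCount G F = eigenCount G E := fun F h1 h3 => by
    rw [D.eigenCount_eq, D.eigenCount_eq]
    congr 1
    refine Finset.Subset.antisymm (D.below_mono h1.le) fun j hj => ?_
    exact D.mem_below.2 (h3 j hj)
  by_cases hs : (D.below E).Nonempty
  · obtain ⟨j, hj, hmax⟩ := (D.below E).exists_max_image D.μ hs
    exact ⟨D.μ j, lt_of_le_of_ne (D.mem_below.1 hj) (hE j),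
      key _ (lt_of_le_of_ne (D.mem_below.1 hj) (hE j)) hmax⟩
  · exact ⟨E - 1, by linarith, key _ (by linarith) fun i hi => (hs ⟨i, hi⟩).elim⟩

/-- The unit cell of rescaled quasi-momenta. -/
def cell : Set (Fin 3 → ℝ) := Set.univ.pi fun _ => Set.Ico (-(1 / 2) : ℝ) (1 / 2)

theorem measurableSet_cell : MeasurableSet cell :=
  MeasurableSet.univ_pi fun _ => measurableSet_Ico

theorem volume_cell : volume cell = 1 := by
  rw [cell, volume_pi_pi]
  simp
  norm_num

theorem momentum_mem_of_mem_cell {y : Fin 3 → ℝ} (hy : y ∈ cell) :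
    momentum y ∈ brillouinZone := fun i => by
  have h := hy i trivial
  have hpi := Real.pi_pos
  constructor
  · change -Real.pi ≤ 2 * Real.pi * y i
    nlinarith [h.1]
  · change 2 * Real.pi * y i ≤ Real.pi
    nlinarith [h.2.le]

section IDS

variable {W : TorusL2 →L[ℂ] TorusL2}

/-- The number of eigenvalues up to `E` at quasi-momentum `2πy`. -/
def fibCount (W : TorusL2 →L[ℂ] TorusL2) (E : ℝ) (y : Fin 3 → ℝ) : ℕ :=
  eigenCount (fib W (momentum y)) E

/-- The integrated density of states. -/
def ids (W : TorusL2 →L[ℂ] TorusL2) (E : ℝ) : ℝ := ∫ y in cell, (fibCount W E y : ℝ)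

/-- The integrated Riesz mean. -/
def rieszDensity (hW : IsSelfAdjoint W) (E : ℝ) : ℝ :=
  ∫ y in cell, (fibRes hW (momentum y)).riesz E

theorem continuous_nth_momentum (hW : IsSelfAdjoint W) {m : ℕ} (hm : 1 ≤ m) :
    Continuous fun y => nthEigenvalue (fib W (momentum y)) m :=
  (continuous_fib_nth hW hm).comp continuous_momentum

theorem measurable_fibCount (hW : IsSelfAdjoint W) (E : ℝ) :
    Measurable (fibCount W E) := by
  refine measurable_of_Ici fun m => ?_
  rcases Nat.eq_zero_or_pos m with rfl | hm
  · simp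
  · have : fibCount W E ⁻¹' Set.Ici m = {y | nthEigenvalue (fib W (momentum y)) m ≤ E} := by
      ext y
      exact (fib_nth_le_iff hW _ hm E).symm
    rw [this]
    exact (isClosed_le (continuous_nth_momentum hW hm) continuous_const).measurableSet

theorem fibCount_mono (hW : IsSelfAdjoint W) (y : Fin 3 → ℝ) {E F : ℝ} (h : E ≤ F) :
    fibCount W E y ≤ fibCount W F y :=
  (fibRes hW (momentum y)).eigenCount_mono h

theorem fibCount_le (hW : IsSelfAdjoint W) {y : Fin 3 → ℝ} (hy : y ∈ cell) (E : ℝ) :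
    fibCount W E y ≤ fibBound W E :=
  fib_eigenCount_le_fibBound hW (momentum_mem_of_mem_cell hy) E

theorem isFiniteMeasure_cell : IsFiniteMeasure (volume.restrict cell) :=
  ⟨by rw [Measure.restrict_apply_univ, volume_cell]; simp⟩

theorem integrableOn_fibCount (hW : IsSelfAdjoint W) (E : ℝ) :
    IntegrableOn (fun y => (fibCount W E y : ℝ)) cell := by
  have := isFiniteMeasure_cell
  refine Integrable.of_bound (measurable_from_top.comp
    (measurable_fibCount hW E)).aestronglyMeasurable (fibBound W E : ℝ) ?_
  filter_upwards [ae_restrict_mem measurableSet_cell] with y hy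
  rw [Real.norm_of_nonneg (by positivity)]
  exact_mod_cast fibCount_le hW hy E

theorem ids_mono (hW : IsSelfAdjoint W) : Monotone (ids W) := fun E F h =>
  setIntegral_mono (integrableOn_fibCount hW E) (integrableOn_fibCount hW F) fun y =>
    Nat.cast_le.2 (fibCount_mono hW y h)

theorem integrableOn_riesz (hW : IsSelfAdjoint W) (E : ℝ) :
    IntegrableOn (fun y => (fibRes hW (momentum y)).riesz E) cell := by
  have hc : Continuous fun y => (fibRes hW (momentum y)).riesz E :=
    (continuous_fib_riesz hW E).comp continuous_momentum
  have hsub : cell ⊆ Set.univ.pi fun _ => Set.Icc (-(1 / 2) : ℝ) (1 / 2) :=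
    Set.pi_mono fun _ _ => Set.Ico_subset_Icc_self
  exact (hc.continuousOn.integrableOn_compact
    (isCompact_univ_pi fun _ => isCompact_Icc)).mono_set hsub

theorem rieszDensity_add_sub (hW : IsSelfAdjoint W) (E : ℝ) {δ : ℝ} (hδ : 0 ≤ δ) :
    δ * ids W E ≤ rieszDensity hW (E + δ) - rieszDensity hW E ∧
      rieszDensity hW (E + δ) - rieszDensity hW E ≤ δ * ids W (E + δ) := by
  have h := fun y => (fibRes hW (momentum y)).riesz_add_sub E hδ
  have hi := (integrableOn_riesz hW (E + δ)).sub (integrableOn_riesz hW E)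
  rw [rieszDensity, rieszDensity, ids, ids, ← integral_sub (integrableOn_riesz hW (E + δ))
    (integrableOn_riesz hW E), ← integral_const_mul, ← integral_const_mul]
  exact ⟨integral_mono ((integrableOn_fibCount hW E).const_mul δ) hi fun y => (h y).1,
    integral_mono hi ((integrableOn_fibCount hW (E + δ)).const_mul δ) fun y => (h y).2⟩

/-- No band is flat on a set of positive measure. By Fubini it suffices to consider lines in the
first coordinate direction, where `countable_slice` leaves a countable set; a band can take the
value `E` only where `E` is an eigenvalue, since the count must jump there. -/
theorem ae_nth_ne (hW : IsSelfAdjoint W) {m : ℕ} (hm : 1 ≤ m) (E : ℝ) :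
    ∀ᵐ y : Fin 3 → ℝ, nthEigenvalue (fib W (momentum y)) m ≠ E := by
  have hmeas : MeasurableSet {y : Fin 3 → ℝ | nthEigenvalue (fib W (momentum y)) m ≠ E} :=
    (isOpen_ne_fun (continuous_nth_momentum hW hm) continuous_const).measurableSet
  refine ae_mem_of_ae_add_linearMap_mem (LinearMap.single ℝ (fun _ : Fin 3 => ℝ) 0)
    (volume : Measure ℝ) volume hmeas fun y => ?_
  have hc := (countable_slice W E y).ae_notMem volume
  filter_upwards [hc] with t ht hE
  refine ht ?_
  set k := momentum (y + Pi.single 0 t) with hk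
  have hE : nthEigenvalue (fib W k) m = E := hE
  by_contra hno
  obtain ⟨F, hF, hFE⟩ := (fibRes hW k).exists_eigenCount_eq_left (E := E) fun j hj => by
    refine hno ⟨(fibRes hW k).v j, ?_, ?_⟩
    · intro h0
      have := (fibRes hW k).v.orthonormal.1 j
      rw [h0, norm_zero] at this
      exact zero_ne_one this
    · have := (fibRes hW k).mem j
      rwa [hj] at this
  have h1 := (fib_nth_le_iff hW k hm E).1 hE.le
  rw [← hFE] at h1
  have h2 := (fib_nth_le_iff hW k hm F).2 h1
  linarith

theorem ae_fibCount_locally_const (hW : IsSelfAdjoint W) (E : ℝ) :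
    ∀ᵐ y : Fin 3 → ℝ, ∀ᶠ F in 𝓝 E, fibCount W F y = fibCount W E y := by
  have h : ∀ᵐ y : Fin 3 → ℝ, ∀ m : ℕ, nthEigenvalue (fib W (momentum y)) (m + 1) ≠ E :=
    ae_all_iff.2 fun m => ae_nth_ne hW (by omega) E
  filter_upwards [h] with y hy
  obtain ⟨F₂, hF₂, h₂⟩ := (fibRes hW (momentum y)).exists_eigenCount_eq_right E
  have hleft : ∃ F₁ < E, fibCount W F₁ y = fibCount W E y := by
    rcases hN : fibCount W E y with _ | N
    · refine ⟨E - 1, by linarith, ?_⟩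
      have := fibCount_mono hW y (show E - 1 ≤ E by linarith)
      omega
    · have h1 := (fib_nth_le_iff hW (momentum y) (m := N + 1) (by omega) E).2 hN.ge
      have h2 := lt_of_le_of_ne h1 (hy N)
      refine ⟨_, h2, le_antisymm ((fibCount_mono hW y h2.le).trans hN.le) ?_⟩
      exact (fib_nth_le_iff hW (momentum y) (m := N + 1) (by omega) _).1 le_rfl
  obtain ⟨F₁, hF₁, h₁⟩ := hleft
  filter_upwards [Ioo_mem_nhds hF₁ hF₂] with F hF
  refine le_antisymm ?_ ?_
  · exact (fibCount_mono hW y hF.2.le).trans h₂.le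
  · exact h₁.ge.trans (fibCount_mono hW y hF.1.le)

/-- A flat band would produce a jump. Without one, the count at almost every `y` is locally constant
near `E`, and dominated convergence applies. -/
theorem continuous_ids (hW : IsSelfAdjoint W) : Continuous (ids W) := by
  have := isFiniteMeasure_cell
  rw [continuous_iff_continuousAt]
  intro E
  refine tendsto_integral_filter_of_dominated_convergence (fun _ => (fibBound W (E + 1) : ℝ))
    (Eventually.of_forall fun F => (integrableOn_fibCount hW F).aestronglyMeasurable) ?_
    (integrable_const _) ?_
  · filter_upwards [ge_mem_nhds (show E < E + 1 by linarith)] with F hF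
    filter_upwards [ae_restrict_mem measurableSet_cell] with y hy
    rw [Real.norm_of_nonneg (by positivity)]
    exact_mod_cast (fibCount_mono hW y hF).trans (fibCount_le hW hy _)
  · filter_upwards [ae_restrict_of_ae (ae_fibCount_locally_const hW E)] with y hy
    refine tendsto_nhds_of_eventually_eq ?_
    filter_upwards [hy] with F hF
    rw [hF]

theorem ids_eq_of_forall (N : ℕ) {E : ℝ} (h : ∀ y ∈ cell, fibCount W E y = N) :
    ids W E = N := by
  rw [ids, setIntegral_congr_fun measurableSet_cell (g := fun _ => (N : ℝ))
    (fun y hy => by simp only [h y hy])]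
  simp [Measure.real, volume_cell]

theorem ids_ge_of_forall (hW : IsSelfAdjoint W) (N : ℕ) {E : ℝ}
    (h : ∀ y ∈ cell, N ≤ fibCount W E y) : (N : ℝ) ≤ ids W E := by
  have h1 : ∫ y in cell, (N : ℝ) = N := by simp [Measure.real, volume_cell]
  have := isFiniteMeasure_cell
  rw [ids, ← h1]
  exact setIntegral_mono_on (integrable_const _) (integrableOn_fibCount hW E) measurableSet_cell
    fun y hy => by exact_mod_cast h y hy

theorem ids_eq_zero (hW : IsSelfAdjoint W) {E : ℝ} (hE : E < -‖W‖) : ids W E = 0 := by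
  have := ids_eq_of_forall (W := W) 0 (E := E) fun y _ => fib_eigenCount_eq_zero hW _ hE
  simpa using this

theorem exists_momentum_eq {k : Space} (hk : k ∈ brillouinZone) :
    ∃ y ∈ Set.univ.pi fun _ : Fin 3 => Set.Icc (-(1 / 2) : ℝ) (1 / 2), momentum y = k := by
  have hpi := Real.pi_pos
  refine ⟨fun i => k i / (2 * Real.pi), fun i _ => ?_, ?_⟩
  · obtain ⟨h1, h2⟩ := hk i
    constructor
    · rw [le_div_iff₀ (by positivity)]; linarith
    · rw [div_le_iff₀ (by positivity)]; linarith
  · ext i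
    simp only [momentum]
    field_simp

/-- If a band takes a value strictly between `a` and `b`, the integrated density of states grows
from `a` to `b`. -/
theorem ids_lt_ids (hW : IsSelfAdjoint W) {m : ℕ} (hm : 1 ≤ m) {k : Space}
    (hk : k ∈ brillouinZone) {a b : ℝ} (ha : a < nthEigenvalue (fib W k) m)
    (hb : nthEigenvalue (fib W k) m < b) : ids W a < ids W b := by
  obtain ⟨y₀, hy₀, rfl⟩ := exists_momentum_eq hk
  set O : Set (Fin 3 → ℝ) := {y | a < nthEigenvalue (fib W (momentum y)) m} ∩
    {y | nthEigenvalue (fib W (momentum y)) m < b} with hO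
  have hOo : IsOpen O := (isOpen_lt continuous_const (continuous_nth_momentum hW hm)).inter
    (isOpen_lt (continuous_nth_momentum hW hm) continuous_const)
  set I : Set (Fin 3 → ℝ) := Set.univ.pi fun _ => Set.Ioo (-(1 / 2) : ℝ) (1 / 2) with hI
  have hIo : IsOpen I := isOpen_set_pi Set.finite_univ fun _ _ => isOpen_Ioo
  -- The given quasi-momentum may lie on the boundary of the zone; the open condition is carried to
  -- an interior point, so that it holds on a set of positive measure inside the cell.
  have hcl : y₀ ∈ closure I := by
    rw [hI, closure_pi_set]
    intro i _
    rw [closure_Ioo (by norm_num)]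
    exact hy₀ i trivial
  obtain ⟨y₁, hy₁⟩ := mem_closure_iff.1 hcl O hOo ⟨ha, hb⟩
  have hpos : 0 < volume (O ∩ I) := (hOo.inter hIo).measure_pos volume ⟨y₁, hy₁⟩
  have hsub : O ∩ I ⊆ cell := fun y hy i _ => Set.Ioo_subset_Ico_self (hy.2 i trivial)
  have hmeas : MeasurableSet (O ∩ I) := (hOo.inter hIo).measurableSet
  have hlt : volume (O ∩ I) < ⊤ := by
    refine lt_of_le_of_lt (measure_mono hsub) ?_
    rw [volume_cell]; simp
  have h1 : volume.real (O ∩ I) ≤ ids W b - ids W a := by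
    rw [ids, ids, ← integral_sub (integrableOn_fibCount hW b) (integrableOn_fibCount hW a)]
    have hi : IntegrableOn (fun y => (fibCount W b y : ℝ) - fibCount W a y) cell :=
      (integrableOn_fibCount hW b).sub (integrableOn_fibCount hW a)
    have hab : a ≤ b := by linarith
    calc volume.real (O ∩ I) = ∫ y in O ∩ I, (1 : ℝ) := by simp
      _ ≤ ∫ y in O ∩ I, ((fibCount W b y : ℝ) - fibCount W a y) := by
        refine setIntegral_mono_on (integrableOn_const hlt.ne) (hi.mono_set hsub) hmeas
          fun y hy => ?_
        have h2 : m ≤ fibCount W b y := (fib_nth_le_iff hW _ hm b).1 hy.1.2.le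
        have h3 : ¬ m ≤ fibCount W a y := fun h =>
          absurd ((fib_nth_le_iff hW _ hm a).2 h) (not_le.2 hy.1.1)
        have h4 : fibCount W a y + 1 ≤ fibCount W b y := by omega
        have h5 : (fibCount W a y : ℝ) + 1 ≤ fibCount W b y := by exact_mod_cast h4
        linarith
      _ ≤ _ := by
        refine setIntegral_mono_set hi (Eventually.of_forall fun y => ?_)
          (LE.le.eventuallyLE hsub)
        have : (fibCount W a y : ℝ) ≤ fibCount W b y := by
          exact_mod_cast fibCount_mono hW y hab
        simp only [Pi.zero_apply]
        linarith
  have h2 : 0 < volume.real (O ∩ I) := ENNReal.toReal_pos hpos.ne' hlt.ne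
  linarith

end IDS

/-! ### Continuous functions on the box -/

theorem isOpen_box (L : ℝ) : IsOpen (box L) := by
  have : box L = ⋂ i : Fin 3, ({x : Space | -(L / 2) < x i} ∩ {x : Space | x i < L / 2}) := by
    ext x; simp [box]
  rw [this]
  refine isOpen_iInter_of_finite fun i => ?_
  exact (isOpen_lt continuous_const (by fun_prop)).inter (isOpen_lt (by fun_prop) continuous_const)

theorem measurableSet_box (L : ℝ) : MeasurableSet (box L) := (isOpen_box L).measurableSet

/-- The closed cube. -/
def closedBox (L : ℝ) : Set Space := {x | ∀ i, x i ∈ Set.Icc (-(L / 2)) (L / 2)}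

theorem box_subset_closedBox (L : ℝ) : box L ⊆ closedBox L := fun _ hx i =>
  ⟨(hx i).1.le, (hx i).2.le⟩

theorem isCompact_closedBox (L : ℝ) : IsCompact (closedBox L) := by
  have h : IsCompact (Set.univ.pi fun _ : Fin 3 => Set.Icc (-(L / 2)) (L / 2)) :=
    isCompact_univ_pi fun _ => isCompact_Icc
  have := h.image (PiLp.continuous_toLp 2 fun _ : Fin 3 => ℝ)
  convert this using 1
  ext x
  constructor
  · intro hx
    exact ⟨x.ofLp, fun i _ => hx i, rfl⟩
  · rintro ⟨y, hy, rfl⟩ i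
    exact hy i trivial

theorem box_eq_preimage (L : ℝ) :
    box L = WithLp.ofLp ⁻¹' (Set.univ.pi fun _ : Fin 3 => Set.Ioo (-(L / 2)) (L / 2)) := by
  ext x
  simp [box, Set.mem_pi]

theorem measurableEmbedding_ofLp :
    MeasurableEmbedding (WithLp.ofLp : Space → Fin 3 → ℝ) :=
  (MeasurableEquiv.toLp 2 (Fin 3 → ℝ)).symm.measurableEmbedding

theorem volume_box {L : ℝ} (hL : 0 ≤ L) : volume (box L) = ENNReal.ofReal (L ^ 3) := by
  rw [box_eq_preimage, (PiLp.volume_preserving_ofLp (Fin 3)).measure_preimage_emb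
    measurableEmbedding_ofLp, volume_pi_pi]
  simp [ENNReal.ofReal_pow hL]

theorem isFiniteMeasure_box (L : ℝ) : IsFiniteMeasure (volume.restrict (box L)) :=
  ⟨by
    rw [Measure.restrict_apply_univ]
    exact lt_of_le_of_lt (measure_mono (box_subset_closedBox L))
      (isCompact_closedBox L).measure_lt_top⟩

theorem setIntegral_box_prod (L : ℝ) (f : Fin 3 → ℝ → ℂ) :
    ∫ x in box L, ∏ i, f i (x i) = ∏ i, ∫ s in Set.Ioo (-(L / 2)) (L / 2), f i s := by
  rw [box_eq_preimage, (PiLp.volume_preserving_ofLp (Fin 3)).setIntegral_preimage_emb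
    measurableEmbedding_ofLp (fun y => ∏ i, f i (y i)), volume_pi, Measure.restrict_pi_pi,
    integral_fintype_prod_eq_prod]

theorem exists_bound_on_box (L : ℝ) {F : Space → ℂ} (hF : Continuous F) :
    ∃ C : ℝ, 0 ≤ C ∧ ∀ x ∈ box L, ‖F x‖ ≤ C := by
  obtain ⟨C, hC⟩ := (isCompact_closedBox L).exists_bound_of_continuousOn hF.continuousOn
  exact ⟨max C 0, le_max_right _ _, fun x hx =>
    (hC x (box_subset_closedBox L hx)).trans (le_max_left _ _)⟩

theorem memLp_box (L : ℝ) {F : Space → ℂ} (hF : Continuous F) :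
    MemLp F 2 (volume.restrict (box L)) := by
  have := isFiniteMeasure_box L
  obtain ⟨C, -, hC⟩ := exists_bound_on_box L hF
  refine MemLp.of_bound hF.aestronglyMeasurable C ?_
  filter_upwards [ae_restrict_mem (measurableSet_box L)] with x hx using hC x hx

/-- The restriction of a continuous function to the box, as an element of `L²`. -/
def toBox (L : ℝ) (F : Space → ℂ) (hF : Continuous F) : BoxL2 L := (memLp_box L hF).toLp F

theorem coeFn_toBox (L : ℝ) {F : Space → ℂ} (hF : Continuous F) :
    toBox L F hF =ᵐ[volume.restrict (box L)] F := (memLp_box L hF).coeFn_toLp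

theorem inner_toBox (L : ℝ) {F : Space → ℂ} (hF : Continuous F) (u : BoxL2 L) :
    inner ℂ (toBox L F hF) u = ∫ x in box L, (starRingEnd ℂ) (F x) * u x := by
  rw [L2.inner_def]
  refine integral_congr_ae ?_
  filter_upwards [coeFn_toBox L hF] with x hx
  rw [hx, RCLike.inner_apply, mul_comm]

theorem inner_toBox_toBox (L : ℝ) {F G : Space → ℂ} (hF : Continuous F) (hG : Continuous G) :
    inner ℂ (toBox L F hF) (toBox L G hG) = ∫ x in box L, (starRingEnd ℂ) (F x) * G x := by
  rw [inner_toBox]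
  refine integral_congr_ae ?_
  filter_upwards [coeFn_toBox L hG] with x hx
  rw [hx]

theorem integrable_mul_box (L : ℝ) {F : Space → ℂ} (hF : Continuous F) (u : BoxL2 L) :
    Integrable (fun x => F x * u x) (volume.restrict (box L)) := by
  have := (memLp_box L hF).integrable_mul (Lp.memLp u)
  exact this

theorem integrable_coe_box (L : ℝ) (u : BoxL2 L) :
    Integrable u (volume.restrict (box L)) := by
  simpa using integrable_mul_box L (F := fun _ => 1) continuous_const u

theorem norm_toBox_sq (L : ℝ) {F : Space → ℂ} (hF : Continuous F) :
    ‖toBox L F hF‖ ^ 2 = ∫ x in box L, ‖F x‖ ^ 2 := by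
  have h := inner_self_eq_norm_sq_to_K (𝕜 := ℂ) (toBox L F hF)
  rw [inner_toBox_toBox] at h
  have h2 : ∫ x in box L, (starRingEnd ℂ) (F x) * F x
      = ((∫ x in box L, ‖F x‖ ^ 2 : ℝ) : ℂ) := by
    rw [← integral_complex_ofReal]
    refine integral_congr_ae (Eventually.of_forall fun x => ?_)
    simp only
    rw [mul_comm, Complex.mul_conj, Complex.normSq_eq_norm_sq]
  rw [h2] at h
  refine Complex.ofReal_injective ?_
  rw [Complex.ofReal_pow]
  exact h.symm

/-! ### The trigonometric systems of the box -/

/-- The frequency `π (m + 1) / L`. -/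
def freq (L : ℝ) (m : ℕ) : ℝ := Real.pi * (m + 1) / L

/-- A normalized sine on the interval, shifted by `s` quarter periods. -/
def sine (L : ℝ) (s m : ℕ) (x : ℝ) : ℝ :=
  Real.sqrt (2 / L) * Real.sin (freq L m * (x + L / 2) + s * (Real.pi / 2))

/-- Products of sines and cosines: the `i`-th factor is shifted by `σ i` quarter periods. -/
def trig (L : ℝ) (σ n : Fin 3 → ℕ) (x : Space) : ℂ := ((∏ i, sine L (σ i) (n i) (x i) : ℝ) : ℂ)

/-- A quarter-period shift exchanges sine and cosine, so the family is closed under differentiation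
and all mixed products are treated at once. -/
theorem hasDerivAt_sine (L : ℝ) (s m : ℕ) (x : ℝ) :
    HasDerivAt (sine L s m) (freq L m * sine L (s + 1) m x) x := by
  unfold sine
  have h1 : HasDerivAt (fun x => freq L m * (x + L / 2) + s * (Real.pi / 2)) (freq L m) x := by
    simpa using (((hasDerivAt_id x).add_const (L / 2)).const_mul (freq L m)).add_const
      (s * (Real.pi / 2))
  refine ((h1.sin).const_mul (Real.sqrt (2 / L))).congr_deriv ?_
  have : freq L m * (x + L / 2) + ((s + 1 : ℕ) : ℝ) * (Real.pi / 2)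
      = freq L m * (x + L / 2) + s * (Real.pi / 2) + Real.pi / 2 := by push_cast; ring
  rw [this, Real.sin_add_pi_div_two]
  ring

theorem sine_add_two (L : ℝ) (s m : ℕ) (x : ℝ) : sine L (s + 2) m x = -sine L s m x := by
  unfold sine
  have : freq L m * (x + L / 2) + ((s + 2 : ℕ) : ℝ) * (Real.pi / 2)
      = freq L m * (x + L / 2) + s * (Real.pi / 2) + Real.pi := by push_cast; ring
  rw [this, Real.sin_add_pi]
  ring

theorem contDiff_sine (L : ℝ) (s m : ℕ) : ContDiff ℝ ∞ (sine L s m) := by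
  unfold sine
  exact contDiff_const.mul (Real.contDiff_sin.comp (by fun_prop))

theorem contDiff_coord (i : Fin 3) : ContDiff ℝ ∞ fun x : Space => x i :=
  (EuclideanSpace.proj (𝕜 := ℝ) i).contDiff

theorem contDiff_trig (L : ℝ) (σ n : Fin 3 → ℕ) : ContDiff ℝ ∞ (trig L σ n) := by
  unfold trig
  have h : ContDiff ℝ ∞ fun x : Space => ∏ i, sine L (σ i) (n i) (x i) :=
    contDiff_prod fun i _ => (contDiff_sine L _ _).comp (contDiff_coord i)
  exact Complex.ofRealCLM.contDiff.comp h

theorem continuous_trig (L : ℝ) (σ n : Fin 3 → ℕ) : Continuous (trig L σ n) :=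
  (contDiff_trig L σ n).continuous

theorem partialDeriv_eq_of_hasDerivAt {φ : Space → ℂ} {x : Space} {i : Fin 3}
    (hφ : DifferentiableAt ℝ φ x) {c : ℂ}
    (h : HasDerivAt (fun t : ℝ => φ (x + t • EuclideanSpace.single i 1)) c 0) :
    partialDeriv i φ x = c := by
  rw [partialDeriv, ← hφ.lineDeriv_eq_fderiv]
  exact HasLineDerivAt.lineDeriv h

theorem partialDeriv_trig (L : ℝ) (σ n : Fin 3 → ℕ) (i : Fin 3) (x : Space) :
    partialDeriv i (trig L σ n) x = freq L (n i) * trig L (σ + Pi.single i 1) n x := by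
  refine partialDeriv_eq_of_hasDerivAt ((contDiff_trig L σ n).differentiable (by simp) x) ?_
  have hline : (fun t : ℝ => trig L σ n (x + t • EuclideanSpace.single i 1)) = fun t =>
      ((sine L (σ i) (n i) (x i + t) *
        ∏ j ∈ Finset.univ.erase i, sine L (σ j) (n j) (x j) : ℝ) : ℂ) := by
    ext t
    rw [trig, ← Finset.mul_prod_erase _ _ (Finset.mem_univ i)]
    congr 2
    · simp
    · refine Finset.prod_congr rfl fun j hj => ?_
      have : j ≠ i := (Finset.mem_erase.1 hj).1
      simp [this]
  rw [hline]
  have h1 : HasDerivAt (fun t => sine L (σ i) (n i) (x i + t))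
      (freq L (n i) * sine L (σ i + 1) (n i) (x i)) 0 := by
    have := hasDerivAt_sine L (σ i) (n i) (x i + 0)
    rw [add_zero] at this
    exact HasDerivAt.comp_const_add (x i) 0 (by simpa using this)
  have h2 := (h1.mul_const (∏ j ∈ Finset.univ.erase i, sine L (σ j) (n j) (x j))).ofReal_comp
  refine h2.congr_deriv ?_
  rw [trig, ← Finset.mul_prod_erase _ _ (Finset.mem_univ i)]
  have h3 : ∏ j ∈ Finset.univ.erase i, sine L ((σ + Pi.single i 1 : Fin 3 → ℕ) j) (n j) (x j)
      = ∏ j ∈ Finset.univ.erase i, sine L (σ j) (n j) (x j) :=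
    Finset.prod_congr rfl fun j hj => by
      have : j ≠ i := (Finset.mem_erase.1 hj).1
      simp [this]
  rw [h3]
  simp only [Pi.add_apply, Pi.single_eq_same]
  push_cast
  ring

theorem trig_add_two (L : ℝ) (σ n : Fin 3 → ℕ) (i : Fin 3) (x : Space) :
    trig L (σ + Pi.single i 1 + Pi.single i 1) n x = -trig L σ n x := by
  rw [trig, trig, ← Finset.mul_prod_erase _ _ (Finset.mem_univ i),
    ← Finset.mul_prod_erase Finset.univ (fun j => sine L (σ j) (n j) (x j)) (Finset.mem_univ i)]
  have h3 : ∏ j ∈ Finset.univ.erase i,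
        sine L ((σ + Pi.single i 1 + Pi.single i 1 : Fin 3 → ℕ) j) (n j) (x j)
      = ∏ j ∈ Finset.univ.erase i, sine L (σ j) (n j) (x j) :=
    Finset.prod_congr rfl fun j hj => by
      have : j ≠ i := (Finset.mem_erase.1 hj).1
      simp [this]
  rw [h3]
  simp only [Pi.add_apply, Pi.single_eq_same, add_assoc]
  rw [show 1 + 1 = 2 from rfl, sine_add_two]
  push_cast
  ring

theorem integral_cos_eq_zero {L : ℝ} (hL : 0 < L) {p : ℤ} (hp : p ≠ 0) (q : ℕ) :
    ∫ x in (-(L / 2))..(L / 2), Real.cos (Real.pi * p / L * (x + L / 2) + q * Real.pi) = 0 := by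
  have hc : Real.pi * p / L ≠ 0 := by
    have := Real.pi_ne_zero
    have : (p : ℝ) ≠ 0 := by exact_mod_cast hp
    positivity
  have hd : ∀ x ∈ Set.uIcc (-(L / 2)) (L / 2), HasDerivAt
      (fun x => Real.sin (Real.pi * p / L * (x + L / 2) + q * Real.pi) / (Real.pi * p / L))
      (Real.cos (Real.pi * p / L * (x + L / 2) + q * Real.pi)) x := fun x _ => by
    have h1 : HasDerivAt (fun x => Real.pi * p / L * (x + L / 2) + q * Real.pi)
        (Real.pi * p / L) x := by
      simpa using (((hasDerivAt_id x).add_const (L / 2)).const_mul (Real.pi * p / L)).add_const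
        (q * Real.pi)
    have h2 := h1.sin.div_const (Real.pi * p / L)
    rwa [mul_div_cancel_right₀ _ hc] at h2
  rw [intervalIntegral.integral_eq_sub_of_hasDerivAt hd
    (Continuous.intervalIntegrable (by fun_prop) _ _)]
  have h1 : Real.pi * p / L * (L / 2 + L / 2) + q * Real.pi = ((p + q : ℤ) : ℝ) * Real.pi := by
    push_cast
    field_simp
    ring
  have h2 : Real.pi * p / L * (-(L / 2) + L / 2) + q * Real.pi = ((q : ℤ) : ℝ) * Real.pi := by
    push_cast
    ring
  rw [h1, h2, Real.sin_int_mul_pi, Real.sin_int_mul_pi]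
  simp

/-- Valid for sines and cosines alike: frequencies start at `π / L`, so `m + m' + 2` is never zero
and the constant cosine, which would need another normalization, does not occur. -/
theorem integral_sine_mul_sine {L : ℝ} (hL : 0 < L) (s m m' : ℕ) :
    ∫ x in Set.Ioo (-(L / 2)) (L / 2), sine L s m x * sine L s m' x =
      if m = m' then 1 else 0 := by
  rw [← integral_Ioc_eq_integral_Ioo, ← intervalIntegral.integral_of_le (by linarith)]
  have hprod : ∀ x, sine L s m x * sine L s m' x =
      L⁻¹ * (Real.cos (Real.pi * ((m : ℤ) - m' : ℤ) / L * (x + L / 2) + (0 : ℕ) * Real.pi)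
        - Real.cos (Real.pi * ((m : ℤ) + m' + 2 : ℤ) / L * (x + L / 2) + s * Real.pi)) := by
    intro x
    unfold sine
    have hs : Real.sqrt (2 / L) * Real.sqrt (2 / L) = 2 / L :=
      Real.mul_self_sqrt (by positivity)
    set A := freq L m * (x + L / 2) + s * (Real.pi / 2) with hA
    set B := freq L m' * (x + L / 2) + s * (Real.pi / 2) with hB
    have h1 : Real.pi * ((m : ℤ) - m' : ℤ) / L * (x + L / 2) + (0 : ℕ) * Real.pi = A - B := by
      rw [hA, hB]; unfold freq; push_cast; ring
    have h2 : Real.pi * ((m : ℤ) + m' + 2 : ℤ) / L * (x + L / 2) + s * Real.pi = A + B := by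
      rw [hA, hB]; unfold freq; push_cast; ring
    rw [h1, h2, Real.cos_sub A B, Real.cos_add A B]
    linear_combination (Real.sin A * Real.sin B) * hs
  simp only [hprod]
  rw [intervalIntegral.integral_const_mul, intervalIntegral.integral_sub
    (Continuous.intervalIntegrable (by fun_prop) _ _)
    (Continuous.intervalIntegrable (by fun_prop) _ _),
    integral_cos_eq_zero hL (p := (m : ℤ) + m' + 2) (by omega) s, sub_zero]
  split_ifs with h
  · subst h
    simp
    field_simp
  · rw [integral_cos_eq_zero hL (p := (m : ℤ) - m') (by omega) 0, mul_zero]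

/-- The trigonometric system in `L²` of the box. -/
def trigLp (L : ℝ) (σ n : Fin 3 → ℕ) : BoxL2 L := toBox L (trig L σ n) (continuous_trig L σ n)

theorem conj_trig (L : ℝ) (σ n : Fin 3 → ℕ) (x : Space) :
    (starRingEnd ℂ) (trig L σ n x) = trig L σ n x := by
  rw [trig, Complex.conj_ofReal]

theorem orthonormal_trigLp {L : ℝ} (hL : 0 < L) (σ : Fin 3 → ℕ) :
    Orthonormal ℂ (trigLp L σ) := by
  classical
  rw [orthonormal_iff_ite]
  intro n m
  rw [trigLp, trigLp, inner_toBox_toBox]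
  have h1 : ∀ x : Space, (starRingEnd ℂ) (trig L σ n x) * trig L σ m x =
      ∏ i, (((sine L (σ i) (n i) (x i) * sine L (σ i) (m i) (x i) : ℝ)) : ℂ) := fun x => by
    rw [conj_trig, trig, trig, ← Complex.ofReal_mul, ← Finset.prod_mul_distrib]
    push_cast
    rfl
  simp only [h1]
  rw [setIntegral_box_prod L fun i s => ((sine L (σ i) (n i) s * sine L (σ i) (m i) s : ℝ) : ℂ)]
  simp only [integral_complex_ofReal, integral_sine_mul_sine hL]
  split_ifs with h
  · subst h; simp
  · obtain ⟨i, hi⟩ := Function.ne_iff.1 h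
    exact Finset.prod_eq_zero (Finset.mem_univ i) (by simp [hi])

/-! ### Completeness of the sine system -/

theorem trig_update (L : ℝ) (σ n : Fin 3 → ℕ) (i : Fin 3) (m : ℕ) (x : Space) :
    trig L σ (Function.update n i m) x = (sine L (σ i) m (x i) : ℂ) *
      ((∏ j ∈ Finset.univ.erase i, sine L (σ j) (n j) (x j) : ℝ) : ℂ) := by
  rw [trig, ← Finset.mul_prod_erase _ _ (Finset.mem_univ i)]
  have h3 : ∏ j ∈ Finset.univ.erase i, sine L (σ j) (Function.update n i m j) (x j)
      = ∏ j ∈ Finset.univ.erase i, sine L (σ j) (n j) (x j) :=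
    Finset.prod_congr rfl fun j hj => by
      have : j ≠ i := (Finset.mem_erase.1 hj).1
      simp [this]
  rw [h3]
  simp

/-- With the next lemma, this shows that multiplication by `cos (π (x + L/2) / L)` preserves the
span of the sines. The lowest sine has no lower neighbour. -/
theorem sine_zero_mul_cos (L x : ℝ) :
    sine L 0 0 x * Real.cos (Real.pi / L * (x + L / 2)) = 1 / 2 * sine L 0 1 x := by
  unfold sine freq
  have h1 : Real.pi * (((1 : ℕ) : ℝ) + 1) / L * (x + L / 2) + ((0 : ℕ) : ℝ) * (Real.pi / 2)
      = 2 * (Real.pi / L * (x + L / 2)) := by push_cast; ring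
  have h2 : Real.pi * (((0 : ℕ) : ℝ) + 1) / L * (x + L / 2) + ((0 : ℕ) : ℝ) * (Real.pi / 2)
      = Real.pi / L * (x + L / 2) := by push_cast; ring
  rw [h1, h2, Real.sin_two_mul]
  ring

theorem sine_succ_mul_cos (L : ℝ) (m : ℕ) (x : ℝ) :
    sine L 0 (m + 1) x * Real.cos (Real.pi / L * (x + L / 2)) =
      1 / 2 * sine L 0 (m + 2) x + 1 / 2 * sine L 0 m x := by
  unfold sine freq
  set θ := Real.pi / L * (x + L / 2) with hθ
  set A := Real.pi * (((m + 1 : ℕ) : ℝ) + 1) / L * (x + L / 2) + ((0 : ℕ) : ℝ) * (Real.pi / 2)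
    with hA
  have h1 : Real.pi * (((m + 2 : ℕ) : ℝ) + 1) / L * (x + L / 2) + ((0 : ℕ) : ℝ) * (Real.pi / 2)
      = A + θ := by rw [hA, hθ]; push_cast; ring
  have h2 : Real.pi * ((m : ℝ) + 1) / L * (x + L / 2) + ((0 : ℕ) : ℝ) * (Real.pi / 2)
      = A - θ := by rw [hA, hθ]; push_cast; ring
  rw [h1, h2, Real.sin_add A θ, Real.sin_sub A θ]
  ring

theorem sine_zero_pos {L : ℝ} (hL : 0 < L) {x : ℝ} (h1 : -(L / 2) < x) (h2 : x < L / 2) :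
    0 < sine L 0 0 x := by
  unfold sine freq
  have hpi := Real.pi_pos
  have h3 : Real.pi * (((0 : ℕ) : ℝ) + 1) / L * (x + L / 2) + ((0 : ℕ) : ℝ) * (Real.pi / 2)
      = Real.pi * ((x + L / 2) / L) := by push_cast; ring
  rw [h3]
  have h4 : 0 < (x + L / 2) / L := div_pos (by linarith) hL
  have h5 : (x + L / 2) / L < 1 := by rw [div_lt_one hL]; linarith
  exact mul_pos (Real.sqrt_pos.2 (by positivity))
    (Real.sin_pos_of_pos_of_lt_pi (by positivity) (by nlinarith))

/-- For `u` orthogonal to all sine products, the continuous `p` such that `p u` is still orthogonal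
to them form a closed subspace containing `1` and stable under multiplication by the coordinate
cosines. These separate the points of the closed cube, so by Stone–Weierstrass every `p` occurs.
Hence the ground state times `u` vanishes, and the ground state is positive inside the box. -/
theorem orthogonal_span_trigLp {L : ℝ} (hL : 0 < L) :
    (Submodule.span ℂ (Set.range (trigLp L 0)))ᗮ = ⊥ := by
  rw [eq_bot_iff]
  intro u hu
  have hu0 : ∀ n, ∫ x in box L, trig L 0 n x * u x = 0 := fun n => by
    have h := hu (trigLp L 0 n) (Submodule.subset_span ⟨n, rfl⟩)
    rw [trigLp, inner_toBox] at h
    simpa only [conj_trig] using h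
  have hle : -(L / 2) ≤ L / 2 := by linarith
  let K := Fin 3 → Set.Icc (-(L / 2)) (L / 2)
  -- Stone–Weierstrass requires a compact space; this projection onto the closed cube is the
  -- identity on the box.
  let proj : Space → K := fun x i => Set.projIcc _ _ hle (x i)
  have hproj : Continuous proj :=
    continuous_pi fun i => continuous_projIcc.comp (contDiff_coord i).continuous
  have hprojv : ∀ x ∈ box L, ∀ i, (proj x i : ℝ) = x i := fun x hx i => by
    simp only [proj]
    rw [Set.projIcc_of_mem hle ⟨(hx i).1.le, (hx i).2.le⟩]
  let Λ : (Fin 3 → ℕ) → C(K, ℝ) → ℂ := fun n p =>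
    ∫ x in box L, ((p (proj x) : ℝ) : ℂ) * trig L 0 n x * u x
  have hcont : ∀ n (p : C(K, ℝ)), Continuous fun x => ((p (proj x) : ℝ) : ℂ) * trig L 0 n x :=
    fun n p => (Complex.continuous_ofReal.comp (p.continuous.comp hproj)).mul
      (continuous_trig L 0 n)
  have hint : ∀ n (p : C(K, ℝ)), Integrable (fun x => ((p (proj x) : ℝ) : ℂ) * trig L 0 n x * u x)
      (volume.restrict (box L)) := fun n p => integrable_mul_box L (hcont n p) u
  let B : Submodule ℝ C(K, ℝ) :=
    { carrier := {p | ∀ n, Λ n p = 0}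
      add_mem' := fun {p q} hp hq n => by
        have : Λ n (p + q) = Λ n p + Λ n q := by
          simp only [Λ]
          rw [← integral_add (hint n p) (hint n q)]
          refine integral_congr_ae (Eventually.of_forall fun x => ?_)
          simp only [ContinuousMap.add_apply]
          push_cast
          ring
        rw [this, hp n, hq n, add_zero]
      zero_mem' := fun n => by simp [Λ]
      smul_mem' := fun c p hp n => by
        have : Λ n (c • p) = c * Λ n p := by
          simp only [Λ]
          rw [← integral_const_mul]
          refine integral_congr_ae (Eventually.of_forall fun x => ?_)
          simp only [ContinuousMap.smul_apply, smul_eq_mul]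
          push_cast
          ring
        rw [this, hp n, mul_zero] }
  have hB : ∀ p, p ∈ B ↔ ∀ n, Λ n p = 0 := fun p => Iff.rfl
  have hΛc : ∀ n, Continuous (Λ n) := fun n => by
    set C := ∫ x in box L, ‖trig L 0 n x * u x‖ with hC
    have hi := (integrable_mul_box L (continuous_trig L 0 n) u).norm
    have hC0 : 0 ≤ C := integral_nonneg fun x => norm_nonneg _
    refine (LipschitzWith.of_dist_le_mul (K := C.toNNReal) fun p q => ?_).continuous
    rw [Real.coe_toNNReal _ hC0, dist_eq_norm, dist_eq_norm]
    simp only [Λ]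
    rw [← integral_sub (hint n p) (hint n q), hC, ← integral_mul_const]
    refine norm_integral_le_of_norm_le (hi.mul_const _) (Eventually.of_forall fun x => ?_)
    have : ((p (proj x) : ℝ) : ℂ) * trig L 0 n x * u x - ((q (proj x) : ℝ) : ℂ) * trig L 0 n x * u x
        = (((p - q) (proj x) : ℝ) : ℂ) * (trig L 0 n x * u x) := by
      simp only [ContinuousMap.sub_apply]; push_cast; ring
    rw [this, norm_mul, mul_comm]
    refine mul_le_mul_of_nonneg_left ?_ (norm_nonneg _)
    rw [Complex.norm_real]
    exact (p - q).norm_coe_le_norm _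
  have hBcl : IsClosed (B : Set C(K, ℝ)) := by
    have : (B : Set C(K, ℝ)) = ⋂ n, {p | Λ n p = 0} := by ext p; simp [hB]
    rw [this]
    exact isClosed_iInter fun n => isClosed_eq (hΛc n) continuous_const
  let g : Fin 3 → C(K, ℝ) := fun i =>
    ⟨fun y => Real.cos (Real.pi / L * ((y i : ℝ) + L / 2)), by fun_prop⟩
  have hgx : ∀ i, ∀ x ∈ box L, g i (proj x) = Real.cos (Real.pi / L * (x i + L / 2)) :=
    fun i x hx => by
      change Real.cos (Real.pi / L * ((proj x i : ℝ) + L / 2)) = _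
      rw [hprojv x hx i]
  have hgB : ∀ i, ∀ p ∈ B, g i * p ∈ B := by
    intro i p hp n
    rcases hn : n i with _ | m
    · have : Λ n (g i * p) = (1 / 2 : ℂ) * Λ (Function.update n i 1) p := by
        simp only [Λ]
        rw [← integral_const_mul]
        refine setIntegral_congr_fun (measurableSet_box L) fun x hx => ?_
        have h1 := sine_zero_mul_cos L (x i)
        have h2 := trig_update L 0 n i (n i) x
        rw [Function.update_eq_self] at h2
        simp only [ContinuousMap.mul_apply, hgx i x hx, trig_update, h2, hn, Pi.zero_apply]
        have h3 : (sine L 0 0 (x i) : ℂ) * (Real.cos (Real.pi / L * (x i + L / 2)) : ℝ)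
            = 1 / 2 * (sine L 0 1 (x i) : ℂ) := by
          rw [← Complex.ofReal_mul, h1]; push_cast; ring
        push_cast at h3 ⊢
        linear_combination ((p (proj x) : ℂ) * (∏ j ∈ Finset.univ.erase i,
          (sine L 0 (n j) (x j) : ℂ)) * u x) * h3
      rw [this, hp, mul_zero]
    · have : Λ n (g i * p) = (1 / 2 : ℂ) * Λ (Function.update n i (m + 2)) p
          + (1 / 2 : ℂ) * Λ (Function.update n i m) p := by
        simp only [Λ]
        rw [← integral_const_mul, ← integral_const_mul, ← integral_add
          ((hint _ p).const_mul _) ((hint _ p).const_mul _)]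
        refine setIntegral_congr_fun (measurableSet_box L) fun x hx => ?_
        have h1 := sine_succ_mul_cos L m (x i)
        have h2 := trig_update L 0 n i (n i) x
        rw [Function.update_eq_self] at h2
        simp only [ContinuousMap.mul_apply, hgx i x hx, trig_update, h2, hn, Pi.zero_apply]
        have h3 : (sine L 0 (m + 1) (x i) : ℂ) * (Real.cos (Real.pi / L * (x i + L / 2)) : ℝ)
            = 1 / 2 * (sine L 0 (m + 2) (x i) : ℂ) + 1 / 2 * (sine L 0 m (x i) : ℂ) := by
          rw [← Complex.ofReal_mul, h1]; push_cast; ring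
        push_cast at h3 ⊢
        linear_combination ((p (proj x) : ℂ) * (∏ j ∈ Finset.univ.erase i,
          (sine L 0 (n j) (x j) : ℂ)) * u x) * h3
      rw [this, hp, hp, mul_zero, add_zero]
  have h1B : (1 : C(K, ℝ)) ∈ B := fun n => by
    simp only [Λ, ContinuousMap.one_apply, Complex.ofReal_one, one_mul]
    exact hu0 n
  let A : Subalgebra ℝ C(K, ℝ) := Algebra.adjoin ℝ (Set.range g)
  have hAB : ∀ a ∈ A, ∀ p ∈ B, a * p ∈ B := fun a ha => by
    refine Algebra.adjoin_induction (p := fun a _ => ∀ p ∈ B, a * p ∈ B) ?_ ?_ ?_ ?_ ha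
    · rintro _ ⟨i, rfl⟩ p hp
      exact hgB i p hp
    · intro r p hp
      rw [← Algebra.smul_def]
      exact B.smul_mem r hp
    · intro a b _ _ ha hb p hp
      rw [add_mul]
      exact B.add_mem (ha p hp) (hb p hp)
    · intro a b _ _ ha hb p hp
      rw [mul_assoc]
      exact ha _ (hb p hp)
  have hsep : A.SeparatesPoints := by
    intro y y' hne
    obtain ⟨i, hi⟩ := Function.ne_iff.1 hne
    refine ⟨g i, ⟨g i, Algebra.subset_adjoin ⟨i, rfl⟩, rfl⟩, fun h => hi ?_⟩
    have hpi := Real.pi_pos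
    have hmem : ∀ z : Set.Icc (-(L / 2)) (L / 2),
        Real.pi / L * ((z : ℝ) + L / 2) ∈ Set.Icc 0 Real.pi := fun z => by
      have h1 := z.2.1
      have h2 := z.2.2
      constructor
      · exact mul_nonneg (by positivity) (by linarith)
      · rw [div_mul_eq_mul_div, div_le_iff₀ hL]
        nlinarith
    have h2 := Real.injOn_cos (hmem (y i)) (hmem (y' i)) h
    have h3 := mul_left_cancel₀ (by positivity) h2
    exact Subtype.ext (by linarith)
  have htop := ContinuousMap.subalgebra_topologicalClosure_eq_top_of_separatesPoints A hsep
  have hall : ∀ p : C(K, ℝ), p ∈ B := fun p => by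
    have hp : p ∈ A.topologicalClosure := by rw [htop]; trivial
    have hsub : (A : Set C(K, ℝ)) ⊆ B := fun a ha => by
      have := hAB a ha 1 h1B
      rwa [mul_one] at this
    exact closure_minimal hsub hBcl hp
  have hzero : ∀ᵐ x : Space, x ∈ box L → trig L 0 0 x * u x = 0 := by
    refine IsOpen.ae_eq_zero_of_integral_contDiff_smul_eq_zero (isOpen_box L) ?_ ?_
    · have : IntegrableOn (fun x => trig L 0 0 x * u x) (box L) :=
        integrable_mul_box L (continuous_trig L 0 0) u
      exact this.locallyIntegrableOn
    · intro φ hφ _ hsupp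
      let p : C(K, ℝ) := ⟨fun y => φ (WithLp.toLp 2 fun i => (y i : ℝ)),
        hφ.continuous.comp ((PiLp.continuous_toLp 2 _).comp (by fun_prop))⟩
      have h := hall p 0
      rw [← setIntegral_eq_integral_of_forall_compl_eq_zero (s := box L)]
      · rw [← h]
        refine setIntegral_congr_fun (measurableSet_box L) fun x hx => ?_
        have hpx : p (proj x) = φ x := by
          change φ _ = φ x
          congr 1
          ext i
          exact hprojv x hx i
        simp only [hpx, Complex.real_smul]
        ring
      · intro x hx
        have : φ x = 0 := image_eq_zero_of_notMem_tsupport fun h => hx (hsupp h)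
        rw [this, zero_smul]
  rw [Submodule.mem_bot]
  refine Lp.ext ?_
  have h0 := Lp.coeFn_zero ℂ 2 (volume.restrict (box L))
  filter_upwards [h0, ae_restrict_of_ae hzero, ae_restrict_mem (measurableSet_box L)]
    with x hx1 hx2 hx3
  rw [hx1]
  rcases mul_eq_zero.1 (hx2 hx3) with h | h
  · exfalso
    rw [trig, Complex.ofReal_eq_zero] at h
    exact (Finset.prod_pos fun i _ => sine_zero_pos hL (hx3 i).1 (hx3 i).2).ne' h
  · simpa using h

/-- The sine basis of the box. -/
def sineBasis {L : ℝ} (hL : 0 < L) : HilbertBasis (Fin 3 → ℕ) ℂ (BoxL2 L) :=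
  HilbertBasis.mkOfOrthogonalEqBot (orthonormal_trigLp hL 0) (orthogonal_span_trigLp hL)

theorem sineBasis_apply {L : ℝ} (hL : 0 < L) (n : Fin 3 → ℕ) : sineBasis hL n = trigLp L 0 n := by
  simp [sineBasis]

/-! ### The Sobolev space of the box -/

theorem exists_hasSum_of_orthonormal {H ι : Type*} [NormedAddCommGroup H] [InnerProductSpace ℂ H]
    [CompleteSpace H] {v : ι → H} (hv : Orthonormal ℂ v) {a : ι → ℂ}
    (ha : Summable fun i => ‖a i‖ ^ 2) :
    ∃ g : H, HasSum (fun i => a i • v i) g ∧ ‖g‖ ^ 2 = ∑' i, ‖a i‖ ^ 2 := by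
  have hm : Memℓp a 2 := by
    rw [memℓp_gen_iff (by norm_num)]
    simpa using ha
  let f : lp (fun _ : ι => ℂ) 2 := ⟨a, hm⟩
  refine ⟨hv.orthogonalFamily.linearIsometry f, ?_, ?_⟩
  · simpa using hv.orthogonalFamily.hasSum_linearIsometry f
  · rw [LinearIsometry.norm_map]
    have := lp.norm_rpow_eq_tsum (p := 2) (by norm_num) f
    simpa using this

theorem toBox_congr (L : ℝ) {F G : Space → ℂ} (hF : Continuous F) (hG : Continuous G)
    (h : ∀ x ∈ box L, F x = G x) : toBox L F hF = toBox L G hG := by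
  refine Lp.ext ?_
  filter_upwards [coeFn_toBox L hF, coeFn_toBox L hG, ae_restrict_mem (measurableSet_box L)]
    with x h1 h2 hx
  rw [h1, h2, h x hx]

theorem toBox_sub (L : ℝ) {F G : Space → ℂ} (hF : Continuous F) (hG : Continuous G) :
    toBox L F hF - toBox L G hG = toBox L (fun x => F x - G x) (hF.sub hG) :=
  (MemLp.toLp_sub _ _).symm

theorem toBox_const_mul (L : ℝ) (c : ℂ) {F : Space → ℂ} (hF : Continuous F) :
    toBox L (fun x => c * F x) (continuous_const.mul hF) = c • toBox L F hF :=
  MemLp.toLp_const_smul c (memLp_box L hF)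

theorem tendsto_toBox (L : ℝ) {F : ℕ → Space → ℂ} {G : Space → ℂ} (hF : ∀ m, Continuous (F m))
    (hG : Continuous G) {C : ℝ} (hb : ∀ m, ∀ x ∈ box L, ‖F m x - G x‖ ≤ C)
    (hlim : ∀ x ∈ box L, Tendsto (fun m => F m x) atTop (𝓝 (G x))) :
    Tendsto (fun m => toBox L (F m) (hF m)) atTop (𝓝 (toBox L G hG)) := by
  have := isFiniteMeasure_box L
  rw [tendsto_iff_norm_sub_tendsto_zero]
  have h1 : Tendsto (fun m => ‖toBox L (F m) (hF m) - toBox L G hG‖ ^ 2) atTop (𝓝 0) := by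
    have h2 : ∀ m, ‖toBox L (F m) (hF m) - toBox L G hG‖ ^ 2
        = ∫ x in box L, ‖F m x - G x‖ ^ 2 := fun m => by
      rw [toBox_sub, norm_toBox_sq]
    simp only [h2]
    have h3 : (0 : ℝ) = ∫ _ in box L, (0 : ℝ) := by simp
    rw [h3]
    refine tendsto_integral_of_dominated_convergence (fun _ => C ^ 2) (fun m => ?_)
      (integrable_const _) (fun m => ?_) ?_
    · exact (((hF m).sub hG).norm.pow 2).aestronglyMeasurable
    · filter_upwards [ae_restrict_mem (measurableSet_box L)] with x hx
      rw [norm_pow, norm_norm]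
      exact pow_le_pow_left₀ (norm_nonneg _) (hb m x hx) 2
    · filter_upwards [ae_restrict_mem (measurableSet_box L)] with x hx
      have := ((tendsto_iff_norm_sub_tendsto_zero.1 (hlim x hx)).pow 2)
      simpa using this
  have h4 := h1.sqrt
  simpa [Real.sqrt_sq] using h4

theorem continuous_partialDeriv {F : Space → ℂ} (hF : ContDiff ℝ ∞ F) (i : Fin 3) :
    Continuous (partialDeriv i F) := (hF.continuous_fderiv (by simp)).clm_apply continuous_const

theorem IsTest.eq_zero {L : ℝ} {φ : Space → ℂ} (hφ : IsTest L φ) {x : Space} (hx : x ∉ box L) :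
    φ x = 0 := image_eq_zero_of_notMem_tsupport fun h => hx (hφ.2.2 h)

theorem IsTest.partialDeriv_eq_zero {L : ℝ} {φ : Space → ℂ} (hφ : IsTest L φ) (i : Fin 3)
    {x : Space} (hx : x ∉ box L) : partialDeriv i φ x = 0 := by
  rw [partialDeriv, fderiv_of_notMem_tsupport ℝ fun h => hx (hφ.2.2 h)]
  rfl

theorem partialDeriv_mul {F G : Space → ℂ} (hF : ContDiff ℝ ∞ F) (hG : ContDiff ℝ ∞ G)
    (i : Fin 3) (x : Space) :
    partialDeriv i (fun y => F y * G y) x = partialDeriv i F x * G x + F x * partialDeriv i G x := by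
  have h1 := (hF.differentiable (by simp) x)
  have h2 := (hG.differentiable (by simp) x)
  rw [partialDeriv, fderiv_fun_mul h1 h2, partialDeriv, partialDeriv]
  simp
  ring

theorem partialDeriv_add {F G : Space → ℂ} (hF : ContDiff ℝ ∞ F) (hG : ContDiff ℝ ∞ G)
    (i : Fin 3) (x : Space) :
    partialDeriv i (fun y => F y + G y) x = partialDeriv i F x + partialDeriv i G x := by
  have h1 := (hF.differentiable (by simp) x)
  have h2 := (hG.differentiable (by simp) x)
  rw [partialDeriv, fderiv_fun_add h1 h2]
  rfl

theorem partialDeriv_const_mul {F : Space → ℂ} (hF : ContDiff ℝ ∞ F) (c : ℂ)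
    (i : Fin 3) (x : Space) :
    partialDeriv i (fun y => c * F y) x = c * partialDeriv i F x := by
  have h1 := (hF.differentiable (by simp) x)
  rw [partialDeriv, fderiv_const_mul h1]
  rfl

theorem IsTest.integral_partialDeriv_mul {L : ℝ} {φ F : Space → ℂ} (hφ : IsTest L φ)
    (hF : ContDiff ℝ ∞ F) (i : Fin 3) :
    ∫ x in box L, partialDeriv i φ x * F x = -∫ x in box L, φ x * partialDeriv i F x := by
  rw [setIntegral_eq_integral_of_forall_compl_eq_zero, setIntegral_eq_integral_of_forall_compl_eq_zero]
  · have hd := (continuous_partialDeriv hφ.1 i)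
    have hcs : HasCompactSupport (partialDeriv i φ) := by
      have := hφ.2.1.fderiv (𝕜 := ℝ)
      exact this.comp_left (g := fun A : Space →L[ℝ] ℂ => A (EuclideanSpace.single i 1)) rfl
    have := integral_mul_fderiv_eq_neg_fderiv_mul_of_integrable (𝕜 := ℂ) (f := φ) (g := F)
      (μ := volume) (v := (EuclideanSpace.single i 1 : Space))
      ((hd.mul hF.continuous).integrable_of_hasCompactSupport hcs.mul_right)
      ((hφ.1.continuous.mul (continuous_partialDeriv hF i)).integrable_of_hasCompactSupport
        hφ.2.1.mul_right)
      ((hφ.1.continuous.mul hF.continuous).integrable_of_hasCompactSupport hφ.2.1.mul_right)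
      (fun x _ => hφ.1.differentiable (by simp) x) (fun x _ => hF.differentiable (by simp) x)
    rw [eq_neg_iff_add_eq_zero, add_comm, ← eq_neg_iff_add_eq_zero]
    exact this
  · intro x hx
    rw [hφ.eq_zero hx, zero_mul]
  · intro x hx
    rw [hφ.partialDeriv_eq_zero i hx, zero_mul]

/-- The extension by zero is smooth because `F` already vanishes in the box off a compact set: near
any point either `F` or zero represents it. -/
theorem isTest_indicator {L : ℝ} {F : Space → ℂ} (hF : ContDiff ℝ ∞ F) {K : Set Space}
    (hK : IsCompact K) (hKL : K ⊆ box L) (h0 : ∀ x ∈ box L, x ∉ K → F x = 0) :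
    IsTest L ((box L).indicator F) := by
  have hz : ∀ x, x ∉ K → (box L).indicator F x = 0 := fun x hx => by
    by_cases h : x ∈ box L
    · rw [Set.indicator_of_mem h, h0 x h hx]
    · rw [Set.indicator_of_notMem h]
  have hsupp : tsupport ((box L).indicator F) ⊆ K :=
    closure_minimal (fun x hx => by by_contra h; exact hx (hz x h)) hK.isClosed
  refine ⟨?_, HasCompactSupport.intro hK hz, hsupp.trans hKL⟩
  rw [contDiff_iff_contDiffAt]
  intro x
  by_cases h : x ∈ box L
  · refine hF.contDiffAt.congr_of_eventuallyEq ?_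
    filter_upwards [(isOpen_box L).mem_nhds h] with y hy
    rw [Set.indicator_of_mem hy]
  · refine (contDiffAt_const (c := (0 : ℂ))).congr_of_eventuallyEq ?_
    filter_upwards [hK.isClosed.isOpen_compl.mem_nhds fun hx => h (hKL hx)] with y hy
    exact hz y hy

theorem partialDeriv_indicator {L : ℝ} (F : Space → ℂ) (i : Fin 3) {x : Space}
    (hx : x ∈ box L) : partialDeriv i ((box L).indicator F) x = partialDeriv i F x := by
  have : (box L).indicator F =ᶠ[𝓝 x] F := by
    filter_upwards [(isOpen_box L).mem_nhds hx] with y hy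
    rw [Set.indicator_of_mem hy]
  rw [partialDeriv, this.fderiv_eq, partialDeriv]

/-- Test functions together with their gradients. -/
def testPairs (L : ℝ) : Submodule ℂ (BoxL2 L × (Fin 3 → BoxL2 L)) where
  carrier := {p | ∃ φ, IsTest L φ ∧ p.1 =ᵐ[volume.restrict (box L)] φ ∧
    ∀ i, p.2 i =ᵐ[volume.restrict (box L)] partialDeriv i φ}
  add_mem' := by
    rintro ⟨u, g⟩ ⟨u', g'⟩ ⟨φ, hφ, hu, hg⟩ ⟨φ', hφ', hu', hg'⟩
    refine ⟨fun x => φ x + φ' x, ⟨hφ.1.add hφ'.1, hφ.2.1.add hφ'.2.1,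
      (tsupport_add φ φ').trans (Set.union_subset hφ.2.2 hφ'.2.2)⟩, ?_, fun i => ?_⟩
    · filter_upwards [Lp.coeFn_add u u', hu, hu'] with x h1 h2 h3
      simp only [Prod.mk_add_mk] at h2 h3 ⊢
      rw [h1, Pi.add_apply, h2, h3]
    · filter_upwards [Lp.coeFn_add (g i) (g' i), hg i, hg' i] with x h1 h2 h3
      simp only [Prod.mk_add_mk, Pi.add_apply] at h2 h3 ⊢
      rw [h1, Pi.add_apply, h2, h3, partialDeriv_add hφ.1 hφ'.1]
  zero_mem' := by
    refine ⟨fun _ => 0, ⟨contDiff_const, HasCompactSupport.zero, by simp [tsupport]⟩, ?_,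
      fun i => ?_⟩
    · exact Lp.coeFn_zero _ _ _
    · filter_upwards [Lp.coeFn_zero ℂ 2 (volume.restrict (box L))] with x hx
      simp only [Prod.snd_zero, Pi.zero_apply] at hx ⊢
      rw [hx]
      simp [partialDeriv]
  smul_mem' := by
    rintro c ⟨u, g⟩ ⟨φ, hφ, hu, hg⟩
    refine ⟨fun x => c * φ x, ⟨contDiff_const.mul hφ.1, hφ.2.1.mul_left,
      (tsupport_mul_subset_right (f := fun _ => c)).trans hφ.2.2⟩, ?_, fun i => ?_⟩
    · filter_upwards [Lp.coeFn_smul c u, hu] with x h1 h2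
      simp only [Prod.smul_mk] at h2 ⊢
      rw [h1, Pi.smul_apply, h2, smul_eq_mul]
    · filter_upwards [Lp.coeFn_smul c (g i), hg i] with x h1 h2
      simp only [Prod.smul_mk, Pi.smul_apply] at h2 ⊢
      rw [h1, Pi.smul_apply, h2, smul_eq_mul, partialDeriv_const_mul hφ.1]

/-- The pairs of functions in `H¹₀` of the box and their gradients. -/
def sobolev (L : ℝ) : Submodule ℂ (BoxL2 L × (Fin 3 → BoxL2 L)) :=
  (testPairs L).topologicalClosure

theorem mem_testPairs {L : ℝ} {φ : Space → ℂ} (hφ : IsTest L φ) :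
    ((toBox L φ hφ.1.continuous, fun i => toBox L (partialDeriv i φ)
      (continuous_partialDeriv hφ.1 i)) : BoxL2 L × (Fin 3 → BoxL2 L)) ∈ testPairs L :=
  ⟨φ, hφ, coeFn_toBox L hφ.1.continuous, fun i => coeFn_toBox L (continuous_partialDeriv hφ.1 i)⟩

/-- Convergence in the product of `L²` spaces is `H¹` convergence. In this form integration by parts
extends from test functions by closedness. -/
theorem memH10_iff {L : ℝ} (u : BoxL2 L) : MemH10 L u ↔ ∃ g, (u, g) ∈ sobolev L := by
  constructor
  · rintro ⟨φ, g, hφ, h1, h2⟩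
    refine ⟨g, ?_⟩
    rw [sobolev, ← SetLike.mem_coe, Submodule.topologicalClosure_coe, mem_closure_iff_seq_limit]
    refine ⟨fun m => (toBox L (φ m) (hφ m).1.continuous, fun i => toBox L (partialDeriv i (φ m))
      (continuous_partialDeriv (hφ m).1 i)), fun m => mem_testPairs (hφ m), ?_⟩
    refine Tendsto.prodMk_nhds ?_ (tendsto_pi_nhds.2 fun i => ?_)
    · rw [Lp.tendsto_Lp_iff_tendsto_eLpNorm']
      refine h1.congr fun m => eLpNorm_congr_ae ?_
      filter_upwards [coeFn_toBox L (hφ m).1.continuous] with x hx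
      rw [Pi.sub_apply, hx]
    · rw [Lp.tendsto_Lp_iff_tendsto_eLpNorm']
      refine (h2 i).congr fun m => eLpNorm_congr_ae ?_
      filter_upwards [coeFn_toBox L (continuous_partialDeriv (hφ m).1 i)] with x hx
      rw [Pi.sub_apply, hx]
  · rintro ⟨g, hg⟩
    rw [sobolev, ← SetLike.mem_coe, Submodule.topologicalClosure_coe,
      mem_closure_iff_seq_limit] at hg
    obtain ⟨p, hp, hlim⟩ := hg
    choose φ hφ h1 h2 using hp
    refine ⟨φ, g, hφ, ?_, fun i => ?_⟩
    · have := (Prod.tendsto_iff _ _).1 hlim |>.1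
      rw [Lp.tendsto_Lp_iff_tendsto_eLpNorm'] at this
      refine this.congr fun m => eLpNorm_congr_ae ?_
      filter_upwards [h1 m] with x hx
      rw [Pi.sub_apply, hx]
    · have := tendsto_pi_nhds.1 ((Prod.tendsto_iff _ _).1 hlim |>.2) i
      rw [Lp.tendsto_Lp_iff_tendsto_eLpNorm'] at this
      refine this.congr fun m => eLpNorm_congr_ae ?_
      filter_upwards [h2 m i] with x hx
      rw [Pi.sub_apply, hx]

theorem integral_mul_eq_inner (L : ℝ) {F : Space → ℂ} (hF : Continuous F) (u : BoxL2 L) :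
    ∫ x in box L, u x * F x =
      inner ℂ (toBox L (fun x => (starRingEnd ℂ) (F x)) (Complex.continuous_conj.comp hF)) u := by
  rw [inner_toBox]
  refine integral_congr_ae (Eventually.of_forall fun x => ?_)
  simp [mul_comm]

theorem continuous_integral_mul (L : ℝ) {F : Space → ℂ} (hF : Continuous F) :
    Continuous fun u : BoxL2 L => ∫ x in box L, u x * F x := by
  simp only [integral_mul_eq_inner L hF]
  fun_prop

/-- Functions in `H¹₀` integrate by parts against arbitrary smooth functions. -/
theorem integral_mul_of_mem_sobolev {L : ℝ} {p : BoxL2 L × (Fin 3 → BoxL2 L)}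
    (hp : p ∈ sobolev L) {F : Space → ℂ} (hF : ContDiff ℝ ∞ F) (i : Fin 3) :
    ∫ x in box L, p.2 i x * F x = -∫ x in box L, p.1 x * partialDeriv i F x := by
  have hcl : IsClosed {p : BoxL2 L × (Fin 3 → BoxL2 L) |
      ∫ x in box L, p.2 i x * F x = -∫ x in box L, p.1 x * partialDeriv i F x} := by
    refine isClosed_eq ?_ ?_
    · exact (continuous_integral_mul L hF.continuous).comp
        ((continuous_apply i).comp continuous_snd)
    · exact ((continuous_integral_mul L (continuous_partialDeriv hF i)).comp continuous_fst).neg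
  refine closure_minimal ?_ hcl hp
  rintro p ⟨φ, hφ, h1, h2⟩
  rw [Set.mem_ofPred_eq, integral_congr_ae (g := fun x => partialDeriv i φ x * F x),
    hφ.integral_partialDeriv_mul hF i]
  · congr 1
    refine integral_congr_ae ?_
    filter_upwards [h1] with x hx
    rw [hx]
  · filter_upwards [h2 i] with x hx
    rw [hx]

/-- Weak derivatives integrate by parts against functions in `H¹₀`. -/
theorem HasWeakPartial.integral_mul_of_mem_sobolev {L : ℝ} {i : Fin 3} {u g : BoxL2 L}
    (h : HasWeakPartial L i u g) {F : Space → ℂ} (hF : ContDiff ℝ ∞ F)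
    (hS : (toBox L F hF.continuous, fun i => toBox L (partialDeriv i F)
      (continuous_partialDeriv hF i)) ∈ sobolev L) :
    ∫ x in box L, u x * partialDeriv i F x = -∫ x in box L, g x * F x := by
  have key : ∀ v w : BoxL2 L, ∫ x in box L, v x * w x =
      inner ℂ (star v) w := fun v w => by
    rw [L2.inner_def]
    refine integral_congr_ae ?_
    filter_upwards [Lp.coeFn_star v] with x hx
    rw [hx, RCLike.inner_apply]
    simp [mul_comm]
  have hcont : ∀ v : BoxL2 L, Continuous fun w : BoxL2 L => ∫ x in box L, v x * w x := fun v => by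
    simp only [key]
    exact continuous_const.inner continuous_id
  have hcl : IsClosed {p : BoxL2 L × (Fin 3 → BoxL2 L) |
      ∫ x in box L, u x * p.2 i x = -∫ x in box L, g x * p.1 x} :=
    isClosed_eq ((hcont u).comp ((continuous_apply i).comp continuous_snd))
      ((hcont g).comp continuous_fst).neg
  have := closure_minimal (s := (testPairs L : Set _)) ?_ hcl hS
  · rw [Set.mem_ofPred_eq] at this
    rw [integral_congr_ae (g := fun x => u x * toBox L (partialDeriv i F)
      (continuous_partialDeriv hF i) x), this]
    · congr 1
      refine integral_congr_ae ?_
      filter_upwards [coeFn_toBox L hF.continuous] with x hx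
      rw [hx]
    · filter_upwards [coeFn_toBox L (continuous_partialDeriv hF i)] with x hx
      rw [hx]
  · rintro p ⟨φ, hφ, h1, h2⟩
    rw [Set.mem_ofPred_eq, integral_congr_ae (g := fun x => u x * partialDeriv i φ x), h φ hφ]
    · congr 1
      refine integral_congr_ae ?_
      filter_upwards [h1] with x hx
      rw [hx]
    · filter_upwards [h2 i] with x hx
      rw [hx]

theorem HasWeakPartial.unique {L : ℝ} {i : Fin 3} {u g g' : BoxL2 L}
    (h : HasWeakPartial L i u g) (h' : HasWeakPartial L i u g') : g = g' := by
  have hz : ∀ᵐ x : Space, x ∈ box L → (g - g' : BoxL2 L) x = 0 := by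
    refine IsOpen.ae_eq_zero_of_integral_contDiff_smul_eq_zero (isOpen_box L) ?_ ?_
    · have : IntegrableOn (g - g' : BoxL2 L) (box L) := integrable_coe_box L _
      exact this.locallyIntegrableOn
    · intro φ hφ hc hsupp
      have ht : IsTest L fun x => (φ x : ℂ) :=
        ⟨Complex.ofRealCLM.contDiff.comp hφ, hc.comp_left (g := fun r : ℝ => (r : ℂ)) rfl,
          (tsupport_comp_subset (g := fun r : ℝ => (r : ℂ)) rfl φ).trans hsupp⟩
      have e : ∫ x in box L, g x * φ x = ∫ x in box L, g' x * φ x := by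
        have := (h _ ht).symm.trans (h' _ ht)
        exact neg_injective this
      have hi : ∀ v : BoxL2 L, Integrable (fun x => v x * φ x) (volume.restrict (box L)) :=
        fun v => by
          have := integrable_mul_box L ht.1.continuous v
          simpa only [mul_comm] using this
      rw [← setIntegral_eq_integral_of_forall_compl_eq_zero (s := box L)]
      · rw [← sub_eq_zero, ← integral_sub (hi g) (hi g')] at e
        rw [← e]
        refine integral_congr_ae ?_
        filter_upwards [Lp.coeFn_sub g g'] with x hx
        rw [hx, Complex.real_smul, Pi.sub_apply]
        ring
      · intro x hx
        have : φ x = 0 := image_eq_zero_of_notMem_tsupport fun h => hx (hsupp h)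
        rw [this, zero_smul]
  rw [← sub_eq_zero]
  refine Lp.ext ?_
  filter_upwards [Lp.coeFn_zero ℂ 2 (volume.restrict (box L)), ae_restrict_of_ae hz,
    ae_restrict_mem (measurableSet_box L)] with x h0 h1 h2
  rw [h0, h1 h2]
  rfl

theorem hasWeakPartial_of_mem_sobolev {L : ℝ} {p : BoxL2 L × (Fin 3 → BoxL2 L)}
    (hp : p ∈ sobolev L) (i : Fin 3) : HasWeakPartial L i p.1 (p.2 i) := fun φ hφ => by
  rw [integral_mul_of_mem_sobolev hp hφ.1 i, neg_neg]

/-! ### The Dirichlet Hamiltonian in the sine basis -/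

theorem abs_sin_natCast_mul_le (n : ℕ) (t : ℝ) : |Real.sin (n * t)| ≤ n * |Real.sin t| := by
  induction n with
  | zero => simp
  | succ k ih =>
    have : ((k + 1 : ℕ) : ℝ) * t = k * t + t := by push_cast; ring
    rw [this, Real.sin_add]
    refine (abs_add_le _ _).trans ?_
    rw [abs_mul, abs_mul]
    have h1 := Real.abs_cos_le_one t
    have h2 := Real.abs_cos_le_one (k * t)
    push_cast
    nlinarith [abs_nonneg (Real.sin (k * t)), abs_nonneg (Real.sin t)]

/-- Domination by the ground state: this vanishing at the boundary compensates for the steep cutoff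
in `mem_sobolev_toBox_trig`. -/
theorem abs_sine_le (L : ℝ) (m : ℕ) (x : ℝ) : |sine L 0 m x| ≤ (m + 1) * |sine L 0 0 x| := by
  unfold sine freq
  have h1 : Real.pi * ((m : ℝ) + 1) / L * (x + L / 2) + ((0 : ℕ) : ℝ) * (Real.pi / 2)
      = ((m + 1 : ℕ) : ℝ) * (Real.pi / L * (x + L / 2)) := by push_cast; ring
  have h2 : Real.pi * (((0 : ℕ) : ℝ) + 1) / L * (x + L / 2) + ((0 : ℕ) : ℝ) * (Real.pi / 2)
      = Real.pi / L * (x + L / 2) := by push_cast; ring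
  rw [h1, h2, abs_mul, abs_mul]
  have := mul_le_mul_of_nonneg_left (abs_sin_natCast_mul_le (m + 1) (Real.pi / L * (x + L / 2)))
    (abs_nonneg (Real.sqrt (2 / L)))
  refine this.trans (le_of_eq ?_)
  push_cast
  ring

theorem norm_trig_le (L : ℝ) (n : Fin 3 → ℕ) (x : Space) :
    ‖trig L 0 n x‖ ≤ (∏ i, ((n i : ℝ) + 1)) * ‖trig L 0 0 x‖ := by
  rw [trig, trig, Complex.norm_real, Complex.norm_real, Real.norm_eq_abs, Real.norm_eq_abs,
    Finset.abs_prod, Finset.abs_prod, ← Finset.prod_mul_distrib]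
  exact Finset.prod_le_prod (fun i _ => abs_nonneg _) fun i _ => abs_sine_le L _ _

theorem sine_zero_eq_zero {L : ℝ} (hL : 0 < L) {x : ℝ} (h : x = -(L / 2) ∨ x = L / 2) :
    sine L 0 0 x = 0 := by
  unfold sine freq
  rcases h with rfl | rfl
  · simp
  · have : Real.pi * (((0 : ℕ) : ℝ) + 1) / L * (L / 2 + L / 2) + ((0 : ℕ) : ℝ) * (Real.pi / 2)
        = Real.pi := by push_cast; field_simp; ring
    rw [this, Real.sin_pi, mul_zero]

/-- A smooth step from `0` on `(-∞, 1]` to `1` on `[2, ∞)`. -/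
def step (t : ℝ) : ℝ := Real.smoothTransition (t - 1)

theorem contDiff_step : ContDiff ℝ ∞ step :=
  Real.smoothTransition.contDiff.comp (contDiff_id.sub contDiff_const)

theorem step_of_le {t : ℝ} (ht : t ≤ 1) : step t = 0 :=
  Real.smoothTransition.zero_of_nonpos (by linarith)

theorem step_of_ge {t : ℝ} (ht : 2 ≤ t) : step t = 1 :=
  Real.smoothTransition.one_of_one_le (by linarith)

theorem step_nonneg (t : ℝ) : 0 ≤ step t := Real.smoothTransition.nonneg _

theorem step_le_one (t : ℝ) : step t ≤ 1 := Real.smoothTransition.le_one _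

theorem deriv_step_of_lt {t : ℝ} (ht : t < 1) : deriv step t = 0 := by
  have : step =ᶠ[𝓝 t] fun _ => 0 := by
    filter_upwards [Iio_mem_nhds ht] with s hs using step_of_le (le_of_lt hs)
  rw [this.deriv_eq, deriv_const]

theorem deriv_step_of_gt {t : ℝ} (ht : 2 < t) : deriv step t = 0 := by
  have : step =ᶠ[𝓝 t] fun _ => 1 := by
    filter_upwards [Ioi_mem_nhds ht] with s hs using step_of_ge (le_of_lt hs)
  rw [this.deriv_eq, deriv_const]

theorem exists_bound_mul_deriv_step : ∃ C : ℝ, 0 ≤ C ∧ ∀ t, |t * deriv step t| ≤ C := by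
  have hc : Continuous fun t => t * deriv step t :=
    continuous_id.mul (contDiff_step.continuous_deriv (by simp))
  obtain ⟨C, hC⟩ := (isCompact_Icc (a := (1 : ℝ)) (b := 2)).exists_bound_of_continuousOn
    hc.continuousOn
  refine ⟨max C 0, le_max_right _ _, fun t => ?_⟩
  by_cases h1 : t < 1
  · simp [deriv_step_of_lt h1]
  · by_cases h2 : 2 < t
    · simp [deriv_step_of_gt h2]
    · exact (hC t ⟨not_lt.1 h1, not_lt.1 h2⟩).trans (le_max_left _ _)

/-- The approximants are the sine product times `step (m d)`, where `d` is the product of the lowest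
sines. The dangerous gradient term contains `m step'(m d) ∇d`; since the sine product is bounded by
`P d`, this term is at most `P |m d step'(m d)| |∇d|`, uniformly in `m`, and it vanishes pointwise
for large `m`. Dominated convergence finishes. -/
theorem mem_sobolev_toBox_trig {L : ℝ} (hL : 0 < L) (n : Fin 3 → ℕ) :
    ((toBox L (trig L 0 n) (contDiff_trig L 0 n).continuous,
      fun i => toBox L (partialDeriv i (trig L 0 n))
        (continuous_partialDeriv (contDiff_trig L 0 n) i)) : BoxL2 L × (Fin 3 → BoxL2 L))
      ∈ sobolev L := by
  let d : Space → ℝ := fun x => ∏ i, sine L 0 0 (x i)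
  have hd : ContDiff ℝ ∞ d := contDiff_prod fun i _ => (contDiff_sine L _ _).comp (contDiff_coord i)
  have htd : trig L 0 0 = fun x => (d x : ℂ) := rfl
  let H : ℕ → Space → ℂ := fun m x => (step (m * d x) : ℂ)
  have hH : ∀ m, ContDiff ℝ ∞ (H m) := fun m =>
    Complex.ofRealCLM.contDiff.comp (contDiff_step.comp (contDiff_const.mul hd))
  have hHd : ∀ m i x, partialDeriv i (H m) x =
      ((deriv step (m * d x) * m : ℝ) : ℂ) * partialDeriv i (trig L 0 0) x := fun m i x => by
    have h0 := (hd.differentiable (by simp) x).hasFDerivAt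
    have h1 : HasFDerivAt (fun y => (m : ℝ) * d y) _ x := h0.const_mul (m : ℝ)
    have h2 := ((contDiff_step.differentiable (by simp)
      (m * d x)).hasDerivAt).comp_hasFDerivAt x h1
    have h3 : HasFDerivAt (H m) _ x := Complex.ofRealCLM.hasFDerivAt.comp x h2
    have h4 : HasFDerivAt (trig L 0 0) _ x := Complex.ofRealCLM.hasFDerivAt.comp x h0
    rw [partialDeriv, h3.fderiv, partialDeriv, h4.fderiv]
    simp
    ring
  let F : ℕ → Space → ℂ := fun m x => trig L 0 n x * H m x
  have hF : ∀ m, ContDiff ℝ ∞ (F m) := fun m => (contDiff_trig L 0 n).mul (hH m)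
  let K : ℕ → Set Space := fun m => closedBox L ∩ {x | 1 ≤ m * d x}
  have hK : ∀ m, IsCompact (K m) := fun m => (isCompact_closedBox L).inter_right
    (isClosed_le continuous_const (continuous_const.mul hd.continuous))
  have hKL : ∀ m, K m ⊆ box L := by
    rintro m x ⟨hx, hx1⟩ i
    by_contra hcon
    have hb : x i = -(L / 2) ∨ x i = L / 2 := by
      by_contra h
      rw [not_or] at h
      exact hcon ⟨lt_of_le_of_ne (hx i).1 (Ne.symm h.1), lt_of_le_of_ne (hx i).2 h.2⟩
    have h0 : d x = 0 := Finset.prod_eq_zero (Finset.mem_univ i) (sine_zero_eq_zero hL hb)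
    have h1 : (1 : ℝ) ≤ m * d x := hx1
    rw [h0, mul_zero] at h1
    linarith
  have hF0 : ∀ m, ∀ x ∈ box L, x ∉ K m → F m x = 0 := fun m x hx hxK => by
    have : ¬ (1 : ℝ) ≤ m * d x := fun h => hxK ⟨box_subset_closedBox L hx, h⟩
    simp only [F, H]
    rw [step_of_le (not_le.1 this).le]
    simp
  have htest : ∀ m, IsTest L ((box L).indicator (F m)) := fun m =>
    isTest_indicator (hF m) (hK m) (hKL m) (hF0 m)
  have hdpos : ∀ x ∈ box L, 0 < d x := fun x hx =>
    Finset.prod_pos fun i _ => sine_zero_pos hL (hx i).1 (hx i).2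
  have hlarge : ∀ x ∈ box L, ∀ᶠ m : ℕ in atTop, 2 < (m : ℝ) * d x := fun x hx =>
    (tendsto_natCast_atTop_atTop.atTop_mul_const (hdpos x hx)).eventually_gt_atTop 2
  have hstep : ∀ t : ℝ, ‖(step t : ℂ) - 1‖ ≤ 1 := fun t => by
    rw [← Complex.ofReal_one, ← Complex.ofReal_sub, Complex.norm_real, Real.norm_eq_abs, abs_le]
    constructor <;> linarith [step_nonneg t, step_le_one t]
  rw [sobolev, ← SetLike.mem_coe, Submodule.topologicalClosure_coe, mem_closure_iff_seq_limit]
  refine ⟨_, fun m => mem_testPairs (htest m), ?_⟩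
  refine Tendsto.prodMk_nhds ?_ (tendsto_pi_nhds.2 fun i => ?_)
  · obtain ⟨C, hC0, hC⟩ := exists_bound_on_box L (continuous_trig L 0 n)
    have := tendsto_toBox L (F := F) (G := trig L 0 n) (fun m => (hF m).continuous)
      (contDiff_trig L 0 n).continuous (C := C) (fun m x hx => ?_) (fun x hx => ?_)
    · refine this.congr fun m => toBox_congr L _ _ fun x hx => ?_
      rw [Set.indicator_of_mem hx]
    · have : F m x - trig L 0 n x = trig L 0 n x * ((step (m * d x) : ℂ) - 1) := by
        simp only [F, H]; ring
      rw [this, norm_mul]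
      calc _ ≤ C * 1 := mul_le_mul (hC x hx) (hstep _) (norm_nonneg _) hC0
        _ = C := mul_one C
    · refine tendsto_const_nhds.congr' ?_
      filter_upwards [hlarge x hx] with m hm
      simp only [F, H]
      rw [step_of_ge hm.le]
      simp
  · obtain ⟨C1, hC10, hC1⟩ := exists_bound_on_box L
      (continuous_partialDeriv (contDiff_trig L 0 n) i)
    obtain ⟨C2, hC20, hC2⟩ := exists_bound_on_box L
      (continuous_partialDeriv (contDiff_trig L 0 0) i)
    obtain ⟨C3, hC30, hC3⟩ := exists_bound_mul_deriv_step
    have hpd : ∀ m x, partialDeriv i (F m) x = partialDeriv i (trig L 0 n) x * H m x +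
        trig L 0 n x * (((deriv step (m * d x) * m : ℝ) : ℂ) * partialDeriv i (trig L 0 0) x) :=
      fun m x => by rw [← hHd, ← partialDeriv_mul (contDiff_trig L 0 n) (hH m)]
    set P := ∏ i, ((n i : ℝ) + 1) with hP
    have hP0 : 0 ≤ P := Finset.prod_nonneg fun i _ => by positivity
    have := tendsto_toBox L (F := fun m => partialDeriv i (F m)) (G := partialDeriv i (trig L 0 n))
      (fun m => continuous_partialDeriv (hF m) i)
      (continuous_partialDeriv (contDiff_trig L 0 n) i) (C := C1 + P * C3 * C2)
      (fun m x hx => ?_) (fun x hx => ?_)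
    · refine this.congr fun m => toBox_congr L _ _ fun x hx => ?_
      rw [partialDeriv_indicator _ _ hx]
    · rw [hpd]
      have e : partialDeriv i (trig L 0 n) x * H m x +
          trig L 0 n x * (((deriv step (m * d x) * m : ℝ) : ℂ) * partialDeriv i (trig L 0 0) x) -
          partialDeriv i (trig L 0 n) x = partialDeriv i (trig L 0 n) x *
            ((step (m * d x) : ℂ) - 1) + trig L 0 n x * ((deriv step (m * d x) * m : ℝ) : ℂ) *
              partialDeriv i (trig L 0 0) x := by simp only [H]; ring
      rw [e]
      refine (norm_add_le _ _).trans (add_le_add ?_ ?_)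
      · rw [norm_mul]
        calc _ ≤ C1 * 1 := mul_le_mul (hC1 x hx) (hstep _) (norm_nonneg _) hC10
          _ = C1 := mul_one C1
      · rw [norm_mul]
        refine mul_le_mul ?_ (hC2 x hx) (norm_nonneg _) (by positivity)
        rw [norm_mul]
        have h1 := norm_trig_le L n x
        have h2 : ‖trig L 0 0 x‖ = |d x| := by rw [htd]; exact Complex.norm_real _
        rw [h2] at h1
        have h3 := hC3 (m * d x)
        rw [Complex.norm_real, Real.norm_eq_abs]
        calc ‖trig L 0 n x‖ * |deriv step (m * d x) * m|
            ≤ P * |d x| * |deriv step (m * d x) * m| :=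
              mul_le_mul_of_nonneg_right h1 (abs_nonneg _)
          _ = P * |m * d x * deriv step (m * d x)| := by
              rw [mul_assoc, ← abs_mul]; congr 2; ring
          _ ≤ P * C3 := mul_le_mul_of_nonneg_left h3 hP0
    · refine tendsto_const_nhds.congr' ?_
      filter_upwards [hlarge x hx] with m hm
      rw [hpd, deriv_step_of_gt hm]
      simp only [H]
      rw [step_of_ge hm.le]
      simp

theorem toBox_partialDeriv_trig (L : ℝ) (σ n : Fin 3 → ℕ) (i : Fin 3) :
    toBox L (partialDeriv i (trig L σ n)) (continuous_partialDeriv (contDiff_trig L σ n) i) =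
      (freq L (n i) : ℂ) • trigLp L (σ + Pi.single i 1) n := by
  rw [trigLp, ← toBox_const_mul]
  exact toBox_congr L _ _ fun x _ => partialDeriv_trig L σ n i x

theorem mem_sobolev_trigLp {L : ℝ} (hL : 0 < L) (n : Fin 3 → ℕ) :
    ((trigLp L 0 n, fun i => (freq L (n i) : ℂ) • trigLp L (Pi.single i 1) n) :
      BoxL2 L × (Fin 3 → BoxL2 L)) ∈ sobolev L := by
  have h := mem_sobolev_toBox_trig hL n
  simp only [toBox_partialDeriv_trig, zero_add] at h
  exact h

/-- The Dirichlet eigenvalues of `-Δ/2` in the box. -/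
def dirichletLevel (L : ℝ) (n : Fin 3 → ℕ) : ℝ := 1 / 2 * ∑ i, freq L (n i) ^ 2

theorem dirichletLevel_nonneg (L : ℝ) (n : Fin 3 → ℕ) : 0 ≤ dirichletLevel L n := by
  unfold dirichletLevel; positivity

theorem freq_sq_le (L : ℝ) (n : Fin 3 → ℕ) (i : Fin 3) :
    freq L (n i) ^ 2 ≤ 2 * dirichletLevel L n := by
  unfold dirichletLevel
  have := Finset.single_le_sum (f := fun i => freq L (n i) ^ 2) (fun i _ => sq_nonneg _)
    (Finset.mem_univ i)
  linarith

/-- A function in `H¹₀` produces no boundary term, so its derivative in direction `i` can be paired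
with the system that has cosines in that direction. -/
theorem inner_trigLp_single {L : ℝ} (hL : 0 < L) {p : BoxL2 L × (Fin 3 → BoxL2 L)}
    (hp : p ∈ sobolev L) (n : Fin 3 → ℕ) (i : Fin 3) :
    inner ℂ (trigLp L (Pi.single i 1) n) (p.2 i)
      = freq L (n i) * inner ℂ (sineBasis hL n) p.1 := by
  have h := integral_mul_of_mem_sobolev hp (contDiff_trig L (Pi.single i 1) n) i
  rw [sineBasis_apply, trigLp, inner_toBox, trigLp, inner_toBox]
  simp only [conj_trig]
  have e1 : ∫ x in box L, trig L (Pi.single i 1) n x * p.2 i x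
      = ∫ x in box L, p.2 i x * trig L (Pi.single i 1) n x := by simp only [mul_comm]
  rw [e1, h, ← integral_const_mul, ← integral_neg]
  refine integral_congr_ae (Eventually.of_forall fun x => ?_)
  have e2 := trig_add_two L 0 n i x
  rw [zero_add] at e2
  simp only
  rw [partialDeriv_trig, e2]
  ring

/-- The energy of a function in `H¹₀` dominates its energy in the sine basis. -/
theorem summable_dirichletLevel {L : ℝ} (hL : 0 < L) {p : BoxL2 L × (Fin 3 → BoxL2 L)}
    (hp : p ∈ sobolev L) :
    Summable (fun n => dirichletLevel L n * ‖inner ℂ (sineBasis hL n) p.1‖ ^ 2) ∧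
    ∑' n, dirichletLevel L n * ‖inner ℂ (sineBasis hL n) p.1‖ ^ 2
      ≤ 1 / 2 * ∑ i, ‖p.2 i‖ ^ 2 := by
  have he : ∀ n, dirichletLevel L n * ‖inner ℂ (sineBasis hL n) p.1‖ ^ 2
      = ∑ i, 1 / 2 * ‖inner ℂ (trigLp L (Pi.single i 1) n) (p.2 i)‖ ^ 2 := fun n => by
    simp only [inner_trigLp_single hL hp, norm_mul, mul_pow, dirichletLevel,
      Complex.norm_real, Real.norm_eq_abs, sq_abs]
    rw [Finset.mul_sum, Finset.sum_mul]
    exact Finset.sum_congr rfl fun i _ => by ring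
  simp only [he]
  have hs : ∀ i, Summable fun n => 1 / 2 * ‖inner ℂ (trigLp L (Pi.single i 1) n) (p.2 i)‖ ^ 2 :=
    fun i => ((orthonormal_trigLp hL (Pi.single i 1)).inner_products_summable (p.2 i)).mul_left _
  refine ⟨summable_sum fun i _ => hs i, ?_⟩
  rw [Summable.tsum_finsetSum fun i _ => hs i, Finset.mul_sum]
  refine Finset.sum_le_sum fun i _ => ?_
  rw [tsum_mul_left]
  -- Only Bessel is available here: without the constant mode in direction `i` the cosine system is
  -- not complete.
  exact mul_le_mul_of_nonneg_left
    ((orthonormal_trigLp hL (Pi.single i 1)).tsum_inner_products_le (x := p.2 i)) (by norm_num)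

theorem hasSum_sineBasis {L : ℝ} (hL : 0 < L) (u : BoxL2 L) :
    HasSum (fun n => inner ℂ (sineBasis hL n) u • trigLp L 0 n) u := by
  have := (sineBasis hL).hasSum_repr u
  simpa only [HilbertBasis.repr_apply_apply, sineBasis_apply] using this

/-- Functions of finite energy in the sine basis lie in `H¹₀`. -/
theorem exists_gradient {L : ℝ} (hL : 0 < L) {u : BoxL2 L}
    (hu : Summable fun n => dirichletLevel L n * ‖inner ℂ (sineBasis hL n) u‖ ^ 2) :
    ∃ g : Fin 3 → BoxL2 L, (u, g) ∈ sobolev L ∧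
      (∀ i, HasSum (fun n => (inner ℂ (sineBasis hL n) u * freq L (n i)) •
        trigLp L (Pi.single i 1) n) (g i)) ∧
      1 / 2 * ∑ i, ‖g i‖ ^ 2
        = ∑' n, dirichletLevel L n * ‖inner ℂ (sineBasis hL n) u‖ ^ 2 := by
  have hn : ∀ i n, ‖inner ℂ (sineBasis hL n) u * (freq L (n i) : ℂ)‖ ^ 2
      = freq L (n i) ^ 2 * ‖inner ℂ (sineBasis hL n) u‖ ^ 2 := fun i n => by
    rw [norm_mul, mul_pow, Complex.norm_real, Real.norm_eq_abs, sq_abs, mul_comm]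
  have hs : ∀ i, Summable fun n => ‖inner ℂ (sineBasis hL n) u * (freq L (n i) : ℂ)‖ ^ 2 :=
    fun i => by
      refine Summable.of_nonneg_of_le (fun n => by positivity) (fun n => ?_) (hu.mul_left 2)
      rw [hn, ← mul_assoc]
      exact mul_le_mul_of_nonneg_right (freq_sq_le L n i) (by positivity)
  choose g hg hgn using fun i =>
    exists_hasSum_of_orthonormal (orthonormal_trigLp hL (Pi.single i 1)) (hs i)
  refine ⟨g, ?_, hg, ?_⟩
  · have h1 : HasSum (fun n => inner ℂ (sineBasis hL n) u • ((trigLp L 0 n,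
        fun i => (freq L (n i) : ℂ) • trigLp L (Pi.single i 1) n) :
          BoxL2 L × (Fin 3 → BoxL2 L))) (u, g) := by
      refine (hasSum_sineBasis hL u).prodMk ?_
      rw [Pi.hasSum]
      intro i
      simpa only [Pi.smul_apply, smul_smul] using hg i
    have hcl : IsClosed (sobolev L : Set (BoxL2 L × (Fin 3 → BoxL2 L))) :=
      Submodule.isClosed_topologicalClosure _
    exact hcl.mem_of_tendsto h1 (Eventually.of_forall fun s =>
      Submodule.sum_mem _ fun n _ => Submodule.smul_mem _ _ (mem_sobolev_trigLp hL n))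
  · simp only [hgn]
    rw [← Summable.tsum_finsetSum fun i _ => hs i, ← tsum_mul_left]
    refine tsum_congr fun n => ?_
    simp only [hn, dirichletLevel]
    rw [← Finset.sum_mul]
    ring

theorem hasWeakPartial_trigLp (L : ℝ) (σ n : Fin 3 → ℕ) (i : Fin 3) :
    HasWeakPartial L i (trigLp L σ n) ((freq L (n i) : ℂ) • trigLp L (σ + Pi.single i 1) n) := by
  intro φ hφ
  have h := hφ.integral_partialDeriv_mul (contDiff_trig L σ n) i
  rw [← toBox_partialDeriv_trig]
  have e1 : ∫ x in box L, trigLp L σ n x * partialDeriv i φ x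
      = ∫ x in box L, partialDeriv i φ x * trig L σ n x := by
    refine integral_congr_ae ?_
    filter_upwards [coeFn_toBox L (continuous_trig L σ n)] with x hx
    rw [trigLp, hx, mul_comm]
  rw [e1, h]
  congr 1
  refine integral_congr_ae ?_
  filter_upwards [coeFn_toBox L (continuous_partialDeriv (contDiff_trig L σ n) i)] with x hx
  rw [hx, mul_comm]

theorem hasWeakPartial_of_hasSum {ι : Type*} {L : ℝ} {i : Fin 3} {a : ι → ℂ} {t t' : ι → BoxL2 L}
    {u g : BoxL2 L} (h : ∀ n, HasWeakPartial L i (t n) (t' n))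
    (hu : HasSum (fun n => a n • t n) u) (hg : HasSum (fun n => a n • t' n) g) :
    HasWeakPartial L i u g := by
  intro φ hφ
  have hc := continuous_partialDeriv hφ.1 i
  have h1 := hu.mapL (innerSL ℂ (toBox L (fun x => (starRingEnd ℂ) (partialDeriv i φ x))
    (Complex.continuous_conj.comp hc)))
  have h2 := (hg.mapL (innerSL ℂ (toBox L (fun x => (starRingEnd ℂ) (φ x))
    (Complex.continuous_conj.comp hφ.1.continuous)))).neg
  rw [integral_mul_eq_inner L hc, integral_mul_eq_inner L hφ.1.continuous]
  have h12 := fun n => h n φ hφ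
  simp only [integral_mul_eq_inner L hc, integral_mul_eq_inner L hφ.1.continuous] at h12
  simp only [innerSL_apply_apply, inner_smul_right, h12, mul_neg] at h1 h2
  exact h1.unique h2

/-- Two integrations by parts: the outer weak derivative is moved onto the sine product, which lies
in `H¹₀`, and the inner one uses that `p.1` does. -/
theorem inner_sineBasis_of_hasWeakPartial {L : ℝ} (hL : 0 < L)
    {p : BoxL2 L × (Fin 3 → BoxL2 L)} (hp : p ∈ sobolev L) {i : Fin 3} {h : BoxL2 L}
    (hh : HasWeakPartial L i (p.2 i) h) (n : Fin 3 → ℕ) :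
    inner ℂ (sineBasis hL n) h = -(freq L (n i) : ℂ) ^ 2 * inner ℂ (sineBasis hL n) p.1 := by
  have h1 := hh.integral_mul_of_mem_sobolev (contDiff_trig L 0 n) (mem_sobolev_toBox_trig hL n)
  have h2 := inner_trigLp_single hL hp n i
  have h3 : inner ℂ (sineBasis hL n) h = ∫ x in box L, h x * trig L 0 n x := by
    rw [sineBasis_apply, trigLp, inner_toBox]
    simp only [conj_trig, mul_comm]
  have h4 : ∫ x in box L, p.2 i x * partialDeriv i (trig L 0 n) x
      = freq L (n i) * inner ℂ (trigLp L (Pi.single i 1) n) (p.2 i) := by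
    rw [trigLp, inner_toBox, ← integral_const_mul]
    refine integral_congr_ae (Eventually.of_forall fun x => ?_)
    simp only [conj_trig, partialDeriv_trig, zero_add]
    ring
  rw [h3, ← neg_eq_iff_eq_neg.2 h1, h4, h2]
  ring

/-- The Dirichlet Hamiltonian is diagonal in the sine basis, up to the potential. -/
theorem dirichletGraph_eq {L : ℝ} (hL : 0 < L) {V : Space → ℝ} {W : BoxL2 L →L[ℂ] BoxL2 L}
    (hW : ∀ u : BoxL2 L, W u =ᵐ[volume.restrict (box L)] fun x => (V x : ℂ) * u x) :
    dirichletGraph V L = diagGraph (sineBasis hL) (dirichletLevel L) W := by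
  have hlp : ∀ (u w : BoxL2 L) (h : Fin 3 → Fin 3 → BoxL2 L),
      (∀ᵐ x ∂(volume.restrict (box L)), w x = -(1 / 2 : ℂ) * ∑ i, h i i x + (V x : ℂ) * u x) ↔
      w = -(1 / 2 : ℂ) • ∑ i, h i i + W u := fun u w h => by
    have hR : (-(1 / 2 : ℂ) • ∑ i, h i i + W u : BoxL2 L) =ᵐ[volume.restrict (box L)]
        fun x => -(1 / 2 : ℂ) * ∑ i, h i i x + (V x : ℂ) * u x := by
      have hsum : (∑ i, h i i : BoxL2 L) =ᵐ[volume.restrict (box L)] fun x => ∑ i, h i i x := by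
        simp only [Fin.sum_univ_three]
        filter_upwards [Lp.coeFn_add (h 0 0 + h 1 1) (h 2 2), Lp.coeFn_add (h 0 0) (h 1 1)]
          with x h1 h2
        rw [h1, Pi.add_apply, h2, Pi.add_apply]
      filter_upwards [Lp.coeFn_add (-(1 / 2 : ℂ) • ∑ i, h i i) (W u),
        Lp.coeFn_smul (-(1 / 2 : ℂ)) (∑ i, h i i), hW u, hsum] with x h1 h2 h3 h4
      rw [h1, Pi.add_apply, h2, Pi.smul_apply, h3, h4, smul_eq_mul]
    constructor
    · intro hx
      refine Lp.ext ?_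
      filter_upwards [hx, hR] with x h1 h2
      rw [h1, h2]
    · rintro rfl
      exact hR
  have hin : ∀ (u : BoxL2 L) (g : Fin 3 → BoxL2 L) (h : Fin 3 → Fin 3 → BoxL2 L),
      (u, g) ∈ sobolev L → (∀ i, HasWeakPartial L i (g i) (h i i)) → ∀ n,
      inner ℂ (sineBasis hL n) (-(1 / 2 : ℂ) • ∑ i, h i i + W u) =
        dirichletLevel L n * inner ℂ (sineBasis hL n) u + inner ℂ (sineBasis hL n) (W u) := by
    intro u g h hug hh n
    rw [inner_add_right, inner_smul_right, inner_sum]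
    congr 1
    have := fun i => inner_sineBasis_of_hasWeakPartial hL hug (hh i) n
    simp only [this, dirichletLevel]
    rw [← Finset.sum_mul]
    push_cast
    simp only [Finset.sum_neg_distrib]
    ring
  ext ⟨u, w⟩
  constructor
  · rintro ⟨hH, g, h, hg, hh, hae⟩
    obtain ⟨g', hg'⟩ := (memH10_iff u).1 hH
    have hgg : g = g' := funext fun i => (hg i).unique (hasWeakPartial_of_mem_sobolev hg' i)
    subst hgg
    intro n
    have := (hlp u w h).1 hae
    simp only
    rw [this, hin u g h hg' (fun i => hh i i) n]
  · intro hp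
    have hp' : ∀ n, dirichletLevel L n * inner ℂ (sineBasis hL n) u
        = inner ℂ (sineBasis hL n) (w - W u) := fun n => by
      have h1 := hp n
      simp only at h1
      rw [inner_sub_right, h1]
      ring
    have hs2 : Summable fun n => dirichletLevel L n ^ 2 * ‖inner ℂ (sineBasis hL n) u‖ ^ 2 := by
      refine (hasSum_norm_sq_inner (sineBasis hL) (w - W u)).summable.congr fun n => ?_
      rw [← hp', norm_mul, mul_pow, Complex.norm_real, Real.norm_eq_abs, sq_abs]
    -- From `λ ≤ λ² + 1`: membership in the diagonal domain implies finite form energy, hence a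
    -- gradient in `H¹₀`.
    have hs1 : Summable fun n => dirichletLevel L n * ‖inner ℂ (sineBasis hL n) u‖ ^ 2 := by
      refine Summable.of_nonneg_of_le
        (fun n => mul_nonneg (dirichletLevel_nonneg L n) (by positivity)) (fun n => ?_)
        (hs2.add (hasSum_norm_sq_inner (sineBasis hL) u).summable)
      nlinarith [sq_nonneg ‖inner ℂ (sineBasis hL n) u‖,
        mul_nonneg (sq_nonneg (dirichletLevel L n - 1)) (sq_nonneg ‖inner ℂ (sineBasis hL n) u‖),
        mul_nonneg (sq_nonneg (dirichletLevel L n)) (sq_nonneg ‖inner ℂ (sineBasis hL n) u‖)]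
    obtain ⟨g, hug, hg, -⟩ := exists_gradient hL hs1
    have hsij : ∀ i j : Fin 3, Summable fun n =>
        ‖inner ℂ (sineBasis hL n) u * (freq L (n i) : ℂ) * (freq L (n j) : ℂ)‖ ^ 2 := fun i j => by
      refine Summable.of_nonneg_of_le (fun n => by positivity) (fun n => ?_) (hs2.mul_left 4)
      rw [norm_mul, norm_mul, mul_pow, mul_pow, Complex.norm_real, Complex.norm_real,
        Real.norm_eq_abs, Real.norm_eq_abs, sq_abs, sq_abs]
      have h1 := mul_le_mul (freq_sq_le L n i) (freq_sq_le L n j) (sq_nonneg _)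
        (mul_nonneg zero_le_two (dirichletLevel_nonneg L n))
      nlinarith [mul_le_mul_of_nonneg_right h1 (sq_nonneg ‖inner ℂ (sineBasis hL n) u‖)]
    -- The bound of `freqᵢ² freqⱼ²` by `4 λ²` makes all mixed second derivatives square summable;
    -- this is the `H²` regularity demanded by the graph.
    choose h hh using fun i j => exists_hasSum_of_orthonormal
      (orthonormal_trigLp hL (Pi.single i 1 + Pi.single j 1)) (hsij i j)
    have hweak : ∀ i j, HasWeakPartial L j (g i) (h i j) := fun i j => by
      refine hasWeakPartial_of_hasSum
        (fun n => hasWeakPartial_trigLp L (Pi.single i 1) n j) (hg i) ?_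
      simpa only [smul_smul] using (hh i j).1
    refine ⟨(memH10_iff u).2 ⟨g, hug⟩, g, h, fun i => hasWeakPartial_of_mem_sobolev hug i,
      hweak, (hlp u w h).2 ?_⟩
    refine eq_of_inner_eq (sineBasis hL) fun n => ?_
    rw [hin u g h hug (fun i => hweak i i) n]
    exact hp n

/-! ### The Bloch–Floquet transform of functions on the box -/

/-- The Haar measure of the torus. -/
abbrev torusMeasure : Measure (UnitAddTorus (Fin 3)) :=
  Measure.pi fun _ : Fin 3 => (AddCircle.haarAddCircle : Measure UnitAddCircle)

theorem haarAddCircle_eq_volume :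
    (AddCircle.haarAddCircle : Measure UnitAddCircle) = (volume : Measure (AddCircle (1 : ℝ))) := by
  rw [AddCircle.volume_eq_smul_haarAddCircle]
  simp

/-- The section of the projection of the cube of side `M` onto the torus. -/
def unfold (M : ℕ) (t : UnitAddTorus (Fin 3)) : Space :=
  (M : ℝ) • WithLp.toLp 2 fun i => (AddCircle.equivIoc (1 : ℝ) (-(1 / 2)) (t i) : ℝ)

theorem coe_unfold_div {M : ℕ} (hM : 0 < M) (t : UnitAddTorus (Fin 3)) (i : Fin 3) :
    ((unfold M t i / M : ℝ) : UnitAddCircle) = t i := by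
  have hM' : (M : ℝ) ≠ 0 := by positivity
  have : unfold M t i / M = (AddCircle.equivIoc (1 : ℝ) (-(1 / 2)) (t i) : ℝ) := by
    simp only [unfold, PiLp.smul_apply, smul_eq_mul]
    field_simp
  rw [this]
  exact (AddCircle.equivIoc (1 : ℝ) (-(1 / 2))).symm_apply_apply (t i)

theorem box_eq_preimage_smul {M : ℕ} (hM : 0 < M) :
    (fun x : Space => (M : ℝ) • x) ⁻¹' box M = box 1 := by
  have hM' : (0 : ℝ) < M := by positivity
  ext x
  simp only [box, Set.mem_preimage, Set.mem_ofPred_eq, PiLp.smul_apply, smul_eq_mul]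
  refine forall_congr' fun i => and_congr ?_ ?_
  · constructor <;> intro h <;> nlinarith
  · constructor <;> intro h <;> nlinarith

/-- The half-open cube on which the section lives differs from the open box by a null set; the
factor `M⁻³` comes from the dilation. -/
theorem measurePreserving_unfold {M : ℕ} (hM : 0 < M) :
    MeasurePreserving (unfold M) torusMeasure
      (ENNReal.ofReal ((M : ℝ) ^ 3)⁻¹ • volume.restrict (box M)) := by
  have h1 : MeasurePreserving (fun t : UnitAddCircle =>
      (AddCircle.equivIoc (1 : ℝ) (-(1 / 2)) t : ℝ)) AddCircle.haarAddCircle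
      (volume.restrict (Set.Ioc (-(1 / 2) : ℝ) (1 / 2))) := by
    have h := (measurePreserving_subtype_coe (measurableSet_Ioc
      (a := (-(1 / 2) : ℝ)) (b := -(1 / 2) + 1))).comp
      (AddCircle.measurePreserving_equivIoc 1 (a := (-(1 / 2) : ℝ)))
    rw [haarAddCircle_eq_volume]
    norm_num at h ⊢
    exact h
  have h2 := measurePreserving_pi (fun _ : Fin 3 => (AddCircle.haarAddCircle :
    Measure UnitAddCircle)) (fun _ : Fin 3 => volume.restrict (Set.Ioc (-(1 / 2) : ℝ) (1 / 2)))
    fun _ => h1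
  have e1 : (Measure.pi fun _ : Fin 3 => volume.restrict (Set.Ioc (-(1 / 2) : ℝ) (1 / 2)))
      = volume.restrict (Set.univ.pi fun _ : Fin 3 => Set.Ioo (-(1 / 2) : ℝ) (1 / 2)) := by
    rw [← Measure.restrict_pi_pi, ← volume_pi]
    exact Measure.restrict_congr_set (Measure.univ_pi_Ioc_ae_eq_Icc.trans
      Measure.univ_pi_Ioo_ae_eq_Icc.symm)
  rw [e1] at h2
  have h3 : MeasurePreserving (WithLp.toLp 2 : (Fin 3 → ℝ) → Space)
      (volume.restrict (Set.univ.pi fun _ : Fin 3 => Set.Ioo (-(1 / 2) : ℝ) (1 / 2)))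
      (volume.restrict (box 1)) := by
    have := (PiLp.volume_preserving_toLp (Fin 3)).restrict_preimage (measurableSet_box 1)
    have e : (WithLp.toLp 2 : (Fin 3 → ℝ) → Space) ⁻¹' box 1 =
        Set.univ.pi fun _ : Fin 3 => Set.Ioo (-(1 / 2) : ℝ) (1 / 2) := by
      rw [box_eq_preimage]
      rfl
    rwa [e] at this
  have h4 : MeasurePreserving (fun x : Space => (M : ℝ) • x) (volume.restrict (box 1))
      (ENNReal.ofReal ((M : ℝ) ^ 3)⁻¹ • volume.restrict (box M)) := by
    have hM' : (M : ℝ) ≠ 0 := by positivity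
    have h5 : MeasurePreserving (fun x : Space => (M : ℝ) • x) volume
        (ENNReal.ofReal ((M : ℝ) ^ 3)⁻¹ • volume) := by
      refine ⟨measurable_const_smul _, ?_⟩
      rw [Measure.map_addHaar_smul _ hM']
      simp
    have h6 := h5.restrict_preimage (measurableSet_box M)
    rwa [box_eq_preimage_smul hM, Measure.restrict_smul] at h6
  exact h4.comp (h3.comp h2)

theorem ae_unfold {M : ℕ} (hM : 0 < M) {p : Space → Prop}
    (h : ∀ᵐ x ∂(volume.restrict (box M)), p x) : ∀ᵐ t ∂torusMeasure, p (unfold M t) := by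
  refine (measurePreserving_unfold hM).quasiMeasurePreserving.ae ?_
  exact Measure.ae_smul_measure h _

theorem integral_unfold {M : ℕ} (hM : 0 < M) {F : Space → ℂ}
    (hF : AEStronglyMeasurable F (volume.restrict (box M))) :
    ∫ t, F (unfold M t) ∂torusMeasure = ((M : ℂ) ^ 3)⁻¹ * ∫ x in box M, F x := by
  have h := measurePreserving_unfold hM
  rw [← integral_map h.aemeasurable (by rw [h.map_eq]; exact hF.smul_measure _), h.map_eq,
    integral_smul_measure, ENNReal.toReal_ofReal (by positivity), Complex.real_smul]
  push_cast
  rfl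

theorem measurePreserving_nsmul_torus {M : ℕ} (hM : 0 < M) :
    MeasurePreserving (fun t : UnitAddTorus (Fin 3) => M • t) torusMeasure torusMeasure := by
  have h1 : MeasurePreserving (fun t : UnitAddCircle => M • t) AddCircle.haarAddCircle
      AddCircle.haarAddCircle := by
    refine AddMonoidHom.measurePreserving (G := UnitAddCircle) (H := UnitAddCircle)
      (f := (nsmulAddMonoidHom M : UnitAddCircle →+ UnitAddCircle)) ?_ ?_ ?_
    · exact continuous_nsmul M
    · intro t
      obtain ⟨x, rfl⟩ := QuotientAddGroup.mk_surjective t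
      refine ⟨((x / M : ℝ) : UnitAddCircle), ?_⟩
      change M • ((x / M : ℝ) : UnitAddCircle) = (x : UnitAddCircle)
      rw [← AddCircle.coe_nsmul, nsmul_eq_mul, mul_div_cancel₀ _ (by positivity)]
    · simp
  exact measurePreserving_pi (fun _ : Fin 3 => (AddCircle.haarAddCircle :
    Measure UnitAddCircle)) (fun _ => AddCircle.haarAddCircle) fun _ => h1

/-- The zero extension of `f` to the cube of side `M`, rescaled to the torus. -/
def foldFun (L : ℝ) (M : ℕ) (f : Space → ℂ) (t : UnitAddTorus (Fin 3)) : ℂ :=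
  (Real.sqrt ((M : ℝ) ^ 3) : ℂ) * (box L).indicator f (unfold M t)

theorem box_mono {L M : ℝ} (h : L ≤ M) : box L ⊆ box M := fun x hx i =>
  ⟨by linarith [(hx i).1], by linarith [(hx i).2]⟩

theorem memLp_foldFun {L : ℝ} {M : ℕ} (hM : 0 < M) (f : BoxL2 L) :
    MemLp (foldFun L M f) 2 torusMeasure := by
  have h1 : MemLp ((box L).indicator f) 2 volume :=
    (memLp_indicator_iff_restrict (measurableSet_box L)).2 (Lp.memLp f)
  have h2 : MemLp ((box L).indicator f) 2
      (ENNReal.ofReal ((M : ℝ) ^ 3)⁻¹ • volume.restrict (box M)) :=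
    (h1.restrict _).smul_measure (by simp)
  exact (h2.comp_measurePreserving (measurePreserving_unfold hM)).const_mul _

theorem ae_indicator_unfold {L : ℝ} {M : ℕ} (hM : 0 < M) {p : Space → Prop}
    (h : ∀ᵐ x ∂(volume.restrict (box L)), p x) :
    ∀ᵐ t ∂torusMeasure, unfold M t ∈ box L → p (unfold M t) :=
  ae_unfold hM (p := fun x => x ∈ box L → p x)
    (ae_restrict_of_ae ((ae_restrict_iff' (measurableSet_box L)).1 h))

theorem foldFun_congr {L : ℝ} {M : ℕ} (hM : 0 < M) {f g : Space → ℂ}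
    (h : f =ᵐ[volume.restrict (box L)] g) : foldFun L M f =ᵐ[torusMeasure] foldFun L M g := by
  filter_upwards [ae_indicator_unfold hM h] with t ht
  unfold foldFun
  by_cases hx : unfold M t ∈ box L
  · rw [Set.indicator_of_mem hx, Set.indicator_of_mem hx, ht hx]
  · rw [Set.indicator_of_notMem hx, Set.indicator_of_notMem hx]

/-- The rescaled zero extension, on `L²`. -/
def foldLin (L : ℝ) {M : ℕ} (hM : 0 < M) : BoxL2 L →ₗ[ℂ] TorusL2 where
  toFun f := (memLp_foldFun hM f).toLp _
  map_add' f g := by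
    refine Lp.ext ?_
    filter_upwards [(memLp_foldFun hM (f + g)).coeFn_toLp, (memLp_foldFun hM f).coeFn_toLp,
      (memLp_foldFun hM g).coeFn_toLp, foldFun_congr hM (Lp.coeFn_add f g),
      Lp.coeFn_add ((memLp_foldFun hM f).toLp _) ((memLp_foldFun hM g).toLp _)]
      with t h1 h2 h3 h4 h5
    rw [h1, h5, Pi.add_apply, h2, h3, h4]
    simp only [foldFun, Set.indicator_add', Pi.add_apply]
    ring
  map_smul' c f := by
    refine Lp.ext ?_
    filter_upwards [(memLp_foldFun hM (c • f)).coeFn_toLp, (memLp_foldFun hM f).coeFn_toLp,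
      foldFun_congr hM (Lp.coeFn_smul c f), Lp.coeFn_smul c ((memLp_foldFun hM f).toLp _)]
      with t h1 h2 h3 h4
    simp only [RingHom.id_apply]
    rw [h1, h4, Pi.smul_apply, h2, h3]
    simp only [foldFun, smul_eq_mul]
    by_cases hx : unfold M t ∈ box L
    · simp only [Set.indicator_of_mem hx]
      simp only [Pi.smul_apply, smul_eq_mul]
      ring
    · simp only [Set.indicator_of_notMem hx]
      ring

theorem coeFn_foldLin (L : ℝ) {M : ℕ} (hM : 0 < M) (f : BoxL2 L) :
    foldLin L hM f =ᵐ[torusMeasure] foldFun L M f := (memLp_foldFun hM f).coeFn_toLp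

theorem sqrt_pow_mul_self (M : ℕ) :
    (Real.sqrt ((M : ℝ) ^ 3) : ℂ) * (Real.sqrt ((M : ℝ) ^ 3) : ℂ) = (M : ℂ) ^ 3 := by
  rw [← Complex.ofReal_mul, Real.mul_self_sqrt (by positivity)]
  push_cast
  rfl

/-- Pairing the rescaled zero extension with a function on the torus. -/
theorem integral_mul_foldFun {L : ℝ} {M : ℕ} (hM : 0 < M) (hLM : L ≤ M) {G : Space → ℂ}
    (f : BoxL2 L) (hG : AEStronglyMeasurable G (volume.restrict (box L))) :
    ∫ t, G (unfold M t) * foldFun L M f t ∂torusMeasure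
      = (Real.sqrt ((M : ℝ) ^ 3) : ℂ)⁻¹ * ∫ x in box L, G x * f x := by
  have hM' : (M : ℂ) ^ 3 ≠ 0 := by
    have : (M : ℂ) ≠ 0 := by exact_mod_cast hM.ne'
    positivity
  have hs := sqrt_pow_mul_self M
  set s := (Real.sqrt ((M : ℝ) ^ 3) : ℂ) with hsdef
  have hs0 : s ≠ 0 := fun h => hM' (by rw [← hs, h, zero_mul])
  have h1 : ∀ t, G (unfold M t) * foldFun L M f t
      = s * (box L).indicator (fun x => G x * f x) (unfold M t) := fun t => by
    rw [foldFun, Set.indicator_mul_right]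
    ring
  simp only [h1]
  rw [integral_const_mul, integral_unfold hM, ← integral_indicator (measurableSet_box M),
    Set.indicator_indicator, Set.inter_eq_right.2 (box_mono hLM),
    integral_indicator (measurableSet_box L), ← hs]
  · field_simp
  · refine AEStronglyMeasurable.restrict ?_
    rw [aestronglyMeasurable_indicator_iff (measurableSet_box L)]
    exact hG.mul (Lp.aestronglyMeasurable f)

/-- The factor `√(M³)` in `foldFun` compensates for the passage from the cube of volume `M³` to the
torus of mass one. -/
theorem inner_foldLin {L : ℝ} {M : ℕ} (hM : 0 < M) (hLM : L ≤ M) (f g : BoxL2 L) :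
    inner ℂ (foldLin L hM f) (foldLin L hM g) = inner ℂ f g := by
  have hM' : (M : ℂ) ^ 3 ≠ 0 := by
    have : (M : ℂ) ≠ 0 := by exact_mod_cast hM.ne'
    positivity
  have hs := sqrt_pow_mul_self M
  have hs0 : (Real.sqrt ((M : ℝ) ^ 3) : ℂ) ≠ 0 := fun h => hM' (by rw [← hs, h, zero_mul])
  have h := integral_mul_foldFun hM hLM (G := fun x => (starRingEnd ℂ) (f x)) g
    (Complex.continuous_conj.comp_aestronglyMeasurable (Lp.aestronglyMeasurable f))
  rw [L2.inner_def, L2.inner_def]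
  have e1 : ∫ x in box L, inner ℂ (f x) (g x) = ∫ x in box L, (starRingEnd ℂ) (f x) * g x := by
    simp only [RCLike.inner_apply, mul_comm]
  rw [e1, ← mul_right_inj' (inv_ne_zero hs0), ← h, ← integral_const_mul]
  refine integral_congr_ae ?_
  filter_upwards [coeFn_foldLin L hM f, coeFn_foldLin L hM g] with t h1 h2
  rw [h1, h2, RCLike.inner_apply, foldFun, foldFun]
  by_cases hx : unfold M t ∈ box L
  · rw [Set.indicator_of_mem hx, Set.indicator_of_mem hx, map_mul, Complex.conj_ofReal]
    field_simp
  · rw [Set.indicator_of_notMem hx, Set.indicator_of_notMem hx]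
    simp

/-- The rescaled zero extension as an isometry. -/
def fold {L : ℝ} {M : ℕ} (hM : 0 < M) (hLM : L ≤ M) : BoxL2 L →ₗᵢ[ℂ] TorusL2 :=
  (foldLin L hM).isometryOfInner (inner_foldLin hM hLM)

theorem coeFn_fold {L : ℝ} {M : ℕ} (hM : 0 < M) (hLM : L ≤ M) (f : BoxL2 L) :
    fold hM hLM f =ᵐ[torusMeasure] foldFun L M f := coeFn_foldLin L hM f

/-- Isometric because the character has modulus one and `t ↦ M t` preserves Haar measure. The range
consists of the modes congruent to `κ` modulo `M`, so the adjoint extracts one fiber. -/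
theorem exists_dilation {M : ℕ} (hM : 0 < M) (κ : Fin 3 → ℤ) : ∃ J : TorusL2 →ₗᵢ[ℂ] TorusL2,
    ∀ w : TorusL2, J w =ᵐ[torusMeasure] fun t => UnitAddTorus.mFourier κ t * w (M • t) := by
  have hnorm : ∀ t, ‖UnitAddTorus.mFourier κ t‖ = 1 := fun t => by
    simp only [UnitAddTorus.mFourier, fourier_apply, ContinuousMap.coe_mk, norm_prod,
      Circle.norm_coe, Finset.prod_const_one]
  obtain ⟨T, hT, -⟩ := exists_mulOperator torusMeasure (F := UnitAddTorus.mFourier κ)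
    (UnitAddTorus.mFourier κ).continuous.aestronglyMeasurable zero_le_one fun t => (hnorm t).le
  let C := Lp.compMeasurePreservingₗᵢ ℂ (E := ℂ) (p := 2) _ (measurePreserving_nsmul_torus hM)
  have hC : ∀ w : TorusL2, C w =ᵐ[torusMeasure] fun t => w (M • t) := fun w =>
    Lp.coeFn_compMeasurePreserving w (measurePreserving_nsmul_torus hM)
  have hTC : ∀ w : TorusL2, T (C w) =ᵐ[torusMeasure] fun t =>
      UnitAddTorus.mFourier κ t * w (M • t) := fun w => by
    filter_upwards [hT (C w), hC w] with t h1 h2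
    rw [h1, h2]
  refine ⟨(T.toLinearMap ∘ₗ C.toLinearMap).isometryOfInner fun w w' => ?_, hTC⟩
  change inner ℂ (T (C w)) (T (C w')) = _
  rw [← C.inner_map_map w w', L2.inner_def, L2.inner_def]
  refine integral_congr_ae ?_
  filter_upwards [hT (C w), hT (C w')] with t h1 h2
  rw [h1, h2, RCLike.inner_apply, RCLike.inner_apply, map_mul]
  have : UnitAddTorus.mFourier κ t * (starRingEnd ℂ) (UnitAddTorus.mFourier κ t) = 1 := by
    rw [Complex.mul_conj, Complex.normSq_eq_norm_sq, hnorm]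
    simp
  linear_combination (C w' t * (starRingEnd ℂ) (C w t)) * this

/-- The map `w ↦ e^{2πi κ·t} w(M t)` on the torus. -/
def dilation {M : ℕ} (hM : 0 < M) (κ : Fin 3 → ℤ) : TorusL2 →ₗᵢ[ℂ] TorusL2 :=
  (exists_dilation hM κ).choose

theorem coeFn_dilation {M : ℕ} (hM : 0 < M) (κ : Fin 3 → ℤ) (w : TorusL2) :
    dilation hM κ w =ᵐ[torusMeasure] fun t => UnitAddTorus.mFourier κ t * w (M • t) :=
  (exists_dilation hM κ).choose_spec w

theorem coeFn_fourierBasis (n : Fin 3 → ℤ) :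
    fourierBasis n =ᵐ[torusMeasure] UnitAddTorus.mFourier n := by
  have : fourierBasis n = UnitAddTorus.mFourierLp 2 n :=
    congrFun UnitAddTorus.coe_mFourierBasis n
  rw [this]
  exact UnitAddTorus.coeFn_mFourierLp 2 n

theorem dilation_fourierBasis {M : ℕ} (hM : 0 < M) (κ n : Fin 3 → ℤ) :
    dilation hM κ (fourierBasis n) = fourierBasis (κ + (M : ℤ) • n) := by
  refine Lp.ext ?_
  filter_upwards [coeFn_dilation hM κ (fourierBasis n), coeFn_fourierBasis (κ + (M : ℤ) • n),
    (measurePreserving_nsmul_torus hM).quasiMeasurePreserving.ae (coeFn_fourierBasis n)]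
    with t h1 h2 h3
  rw [h1, h2, h3, UnitAddTorus.mFourier_add]
  congr 1
  simp only [UnitAddTorus.mFourier, ContinuousMap.coe_mk, Pi.smul_apply]
  refine Finset.prod_congr rfl fun i _ => ?_
  rw [fourier_apply, fourier_apply, smul_eq_mul, mul_comm, mul_zsmul, natCast_zsmul]

/-- The Bloch–Floquet transform at quasi-momentum `2πκ/M`. -/
def floquet {L : ℝ} {M : ℕ} (hM : 0 < M) (hLM : L ≤ M) (κ : Fin 3 → ℤ) : BoxL2 L →L[ℂ] TorusL2 :=
  (ContinuousLinearMap.adjoint (dilation hM κ).toContinuousLinearMap).comp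
    (fold hM hLM).toContinuousLinearMap

theorem inner_floquet {L : ℝ} {M : ℕ} (hM : 0 < M) (hLM : L ≤ M) (κ : Fin 3 → ℤ) (w : TorusL2)
    (f : BoxL2 L) : inner ℂ w (floquet hM hLM κ f) = inner ℂ (dilation hM κ w) (fold hM hLM f) := by
  rw [floquet, ContinuousLinearMap.comp_apply, ContinuousLinearMap.adjoint_inner_right]
  rfl

/-- The plane wave `e^{iξ·x}`. -/
def planeWave (ξ : Fin 3 → ℝ) (x : Space) : ℂ := Complex.exp (Complex.I * ((∑ i, ξ i * x i : ℝ) : ℂ))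

/-- The wave vector `2π(κ/M + n)`. -/
def waveVec (M : ℕ) (κ n : Fin 3 → ℤ) (i : Fin 3) : ℝ := 2 * Real.pi * n i + 2 * Real.pi * (κ i / M)

theorem mFourier_eq_planeWave {M : ℕ} (hM : 0 < M) (κ n : Fin 3 → ℤ) (t : UnitAddTorus (Fin 3)) :
    UnitAddTorus.mFourier (κ + (M : ℤ) • n) t = planeWave (waveVec M κ n) (unfold M t) := by
  have hM' : (M : ℂ) ≠ 0 := by exact_mod_cast hM.ne'
  simp only [UnitAddTorus.mFourier, ContinuousMap.coe_mk]
  have h1 : ∀ i, fourier ((κ + (M : ℤ) • n) i) (t i) =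
      Complex.exp (Complex.I * ((waveVec M κ n i * unfold M t i : ℝ) : ℂ)) := fun i => by
    conv_lhs => rw [← coe_unfold_div hM t i]
    rw [fourier_coe_apply]
    congr 1
    simp only [waveVec, Pi.add_apply, Pi.smul_apply, smul_eq_mul]
    push_cast
    field_simp
    ring
  simp only [h1]
  rw [← Complex.exp_sum, planeWave]
  congr 1
  push_cast
  rw [Finset.mul_sum]

theorem continuous_planeWave (ξ : Fin 3 → ℝ) : Continuous (planeWave ξ) := by
  unfold planeWave
  fun_prop

theorem conj_planeWave (ξ : Fin 3 → ℝ) (x : Space) :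
    (starRingEnd ℂ) (planeWave ξ x) = planeWave (-ξ) x := by
  rw [planeWave, planeWave, ← Complex.exp_conj]
  congr 1
  simp

theorem inner_fourierBasis_floquet {L : ℝ} {M : ℕ} (hM : 0 < M) (hLM : L ≤ M) (κ n : Fin 3 → ℤ)
    (f : BoxL2 L) : inner ℂ (fourierBasis n) (floquet hM hLM κ f) =
      (Real.sqrt ((M : ℝ) ^ 3) : ℂ)⁻¹ * ∫ x in box L, planeWave (-waveVec M κ n) x * f x := by
  rw [inner_floquet, dilation_fourierBasis, ← integral_mul_foldFun hM hLM f
    (continuous_planeWave _).aestronglyMeasurable, L2.inner_def]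
  refine integral_congr_ae ?_
  filter_upwards [coeFn_fold hM hLM f, coeFn_fourierBasis (κ + (M : ℤ) • n)] with t h1 h2
  rw [h1, h2, RCLike.inner_apply, mFourier_eq_planeWave hM, conj_planeWave, mul_comm]

/-! ### The grid of quasi-momenta -/

/-- The integer points of `M` times the unit cell. -/
def grid (M : ℕ) : Finset (Fin 3 → ℤ) :=
  Fintype.piFinset fun _ => Finset.Ico (-((M / 2 : ℕ) : ℤ)) ((M : ℤ) - (M / 2 : ℕ))

theorem mem_grid {M : ℕ} {κ : Fin 3 → ℤ} :
    κ ∈ grid M ↔ ∀ i, -((M / 2 : ℕ) : ℤ) ≤ κ i ∧ κ i < (M : ℤ) - (M / 2 : ℕ) := by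
  simp [grid]

theorem card_grid (M : ℕ) : (grid M).card = M ^ 3 := by
  rw [grid, Fintype.card_piFinset]
  have : (Finset.Ico (-((M / 2 : ℕ) : ℤ)) ((M : ℤ) - (M / 2 : ℕ))).card = M := by
    rw [Int.card_Ico]; omega
  simp

/-- The grid point `κ / M` of the unit cell. -/
def gridPoint (M : ℕ) (κ : Fin 3 → ℤ) (i : Fin 3) : ℝ := κ i / M

theorem gridPoint_mem_cell_iff {M : ℕ} (hM : 0 < M) {κ : Fin 3 → ℤ} :
    gridPoint M κ ∈ cell ↔ κ ∈ grid M := by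
  have hM' : (0 : ℝ) < M := by exact_mod_cast hM
  rw [mem_grid, cell, Set.mem_univ_pi]
  refine forall_congr' fun i => ?_
  rw [Set.mem_Ico, gridPoint, le_div_iff₀ hM', div_lt_iff₀ hM']
  have h1 : -(1 / 2) * (M : ℝ) ≤ κ i ↔ -(M : ℤ) ≤ 2 * κ i := by
    rw [← @Int.cast_le ℝ]
    push_cast
    constructor <;> intro h <;> linarith
  have h2 : (κ i : ℝ) < 1 / 2 * M ↔ 2 * κ i < (M : ℤ) := by
    rw [← @Int.cast_lt ℝ]
    push_cast
    constructor <;> intro h <;> linarith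
  rw [h1, h2]
  omega

/-- Euclidean division by `M` in each coordinate, with remainders centred so that `κ / M` falls in
the cell. -/
theorem bijective_grid {M : ℕ} (hM : 0 < M) :
    Function.Bijective fun p : grid M × (Fin 3 → ℤ) => (p.1 : Fin 3 → ℤ) + (M : ℤ) • p.2 := by
  have hM' : (0 : ℤ) < M := by exact_mod_cast hM
  constructor
  · rintro ⟨⟨κ, hκ⟩, n⟩ ⟨⟨κ', hκ'⟩, n'⟩ h
    rw [mem_grid] at hκ hκ'
    have h1 : ∀ i, κ i + M * n i = κ' i + M * n' i := fun i => by
      have := congrFun h i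
      simpa using this
    have h2 : ∀ i, n i = n' i := fun i => by
      have a1 := hκ i
      have a2 := hκ' i
      have a3 := h1 i
      have b1 : (M : ℤ) * (n i - n' i) < M * 1 := by linarith
      have b2 : (M : ℤ) * (-1) < M * (n i - n' i) := by linarith
      have c1 := lt_of_mul_lt_mul_left b1 hM'.le
      have c2 := lt_of_mul_lt_mul_left b2 hM'.le
      omega
    have h3 : n = n' := funext h2
    subst h3
    have h4 : κ = κ' := funext fun i => by have := h1 i; linarith
    subst h4
    rfl
  · intro p
    refine ⟨⟨⟨fun i => (p i + (M / 2 : ℕ)) % M - (M / 2 : ℕ), ?_⟩,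
      fun i => (p i + (M / 2 : ℕ)) / M⟩, ?_⟩
    · rw [mem_grid]
      intro i
      have h1 := Int.emod_nonneg (p i + (M / 2 : ℕ)) hM'.ne'
      have h2 := Int.emod_lt_of_pos (p i + (M / 2 : ℕ)) hM'
      constructor <;> linarith
    · ext i
      have := Int.emod_add_mul_ediv (p i + (M / 2 : ℕ)) M
      simp only [Pi.add_apply, Pi.smul_apply, smul_eq_mul]
      linarith

theorem momentum_gridPoint (M : ℕ) (κ n : Fin 3 → ℤ) :
    kin (momentum (gridPoint M κ)) n = 1 / 2 * ∑ i, waveVec M κ n i ^ 2 := rfl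

theorem onTorus_nsmul {M : ℕ} (hM : 0 < M) {V : Space → ℝ} (hV : Continuous V)
    (hper : ∀ (m : Fin 3 → ℤ) (x : Space), V (x + WithLp.toLp 2 (fun i => (m i : ℝ))) = V x)
    (t : UnitAddTorus (Fin 3)) : onTorus V (M • t) = V (unfold M t) := by
  rw [← onTorus_toTorus hV hper]
  congr 1
  ext i
  rw [toTorus, Pi.smul_apply, ← coe_unfold_div hM t i, ← AddCircle.coe_nsmul, nsmul_eq_mul,
    mul_div_cancel₀ _ (by exact_mod_cast hM.ne')]

/-! ### Parseval identity and intertwining relations of the Bloch–Floquet transform -/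

section Floquet

variable {L : ℝ} {M : ℕ} (hM : 0 < M) (hLM : L ≤ M)

/-- Parseval on the large torus, with the modes regrouped by residue class modulo `M`; each class is
one fiber. -/
theorem sum_inner_floquet (f g : BoxL2 L) :
    ∑ κ ∈ grid M, inner ℂ (floquet hM hLM κ f) (floquet hM hLM κ g) = inner ℂ f g := by
  have h1 := fourierBasis.hasSum_inner_mul_inner (fold hM hLM f) (fold hM hLM g)
  rw [LinearIsometry.inner_map_map] at h1
  have h2 := (Equiv.ofBijective _ (bijective_grid hM)).hasSum_iff.2 h1
  have h3 : ∀ κ : grid M, HasSum (fun n => ((fun p => inner ℂ (fold hM hLM f) (fourierBasis p) *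
      inner ℂ (fourierBasis p) (fold hM hLM g)) ∘ (Equiv.ofBijective _ (bijective_grid hM)))
        (κ, n)) (inner ℂ (floquet hM hLM κ f) (floquet hM hLM κ g)) := fun κ => by
    refine (fourierBasis.hasSum_inner_mul_inner (floquet hM hLM κ f)
      (floquet hM hLM κ g)).congr_fun fun n => ?_
    rw [← inner_conj_symm (floquet hM hLM κ f), inner_floquet, inner_floquet,
      dilation_fourierBasis, inner_conj_symm]
    rfl
  have h4 := h2.prod_fiberwise h3
  rw [← (hasSum_fintype _).unique h4, ← Finset.sum_coe_sort (grid M)]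

theorem sum_norm_floquet (f : BoxL2 L) :
    ∑ κ ∈ grid M, ‖floquet hM hLM κ f‖ ^ 2 = ‖f‖ ^ 2 := by
  have h := congrArg Complex.re (sum_inner_floquet hM hLM f f)
  rw [Complex.re_sum] at h
  have h1 : ∀ u : TorusL2, (inner ℂ u u).re = ‖u‖ ^ 2 := inner_self_eq_norm_sq (𝕜 := ℂ)
  have h2 : (inner ℂ f f).re = ‖f‖ ^ 2 := inner_self_eq_norm_sq (𝕜 := ℂ) f
  simpa only [h1, h2] using h

/-- A `ℤ³`-periodic potential on the cube of side `M` is a function of `M t`, so multiplication by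
it commutes with the dilation; self-adjointness of `W` carries this to the adjoint. -/
theorem floquet_mul {V : Space → ℝ} (hV : Continuous V)
    (hper : ∀ (m : Fin 3 → ℤ) (x : Space), V (x + WithLp.toLp 2 (fun i => (m i : ℝ))) = V x)
    {W : TorusL2 →L[ℂ] TorusL2} (hWs : IsSelfAdjoint W)
    (hW : ∀ u : TorusL2, W u =ᵐ[torusMeasure] fun t => (onTorus V t : ℂ) * u t)
    {f g : BoxL2 L} (hg : g =ᵐ[volume.restrict (box L)] fun x => (V x : ℂ) * f x) (κ : Fin 3 → ℤ) :
    floquet hM hLM κ g = W (floquet hM hLM κ f) := by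
  refine ext_inner_left ℂ fun w => ?_
  have hs : inner ℂ w (W (floquet hM hLM κ f)) = inner ℂ (W w) (floquet hM hLM κ f) :=
    ((ContinuousLinearMap.isSelfAdjoint_iff_isSymmetric.1 hWs) w _).symm
  rw [hs, inner_floquet, inner_floquet, L2.inner_def, L2.inner_def]
  refine integral_congr_ae ?_
  filter_upwards [coeFn_fold hM hLM f, coeFn_fold hM hLM g, foldFun_congr hM hg,
    coeFn_dilation hM κ w, coeFn_dilation hM κ (W w),
    (measurePreserving_nsmul_torus hM).quasiMeasurePreserving.ae (hW w)] with t h1 h2 h3 h4 h5 h6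
  rw [h1, h2, h3, h4, h5, h6, RCLike.inner_apply, RCLike.inner_apply]
  rw [onTorus_nsmul hM hV hper, foldFun, foldFun]
  by_cases hx : unfold M t ∈ box L
  · simp only [Set.indicator_of_mem hx, map_mul, Complex.conj_ofReal]
    ring
  · simp only [Set.indicator_of_notMem hx]
    simp

theorem contDiff_planeWave (ξ : Fin 3 → ℝ) : ContDiff ℝ ∞ (planeWave ξ) := by
  unfold planeWave
  have h : ContDiff ℝ ∞ fun x : Space => ∑ i, ξ i * x i :=
    ContDiff.sum fun i _ => contDiff_const.mul (contDiff_coord i)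
  exact Complex.contDiff_exp.comp (contDiff_const.mul (Complex.ofRealCLM.contDiff.comp h))

theorem partialDeriv_planeWave (ξ : Fin 3 → ℝ) (i : Fin 3) (x : Space) :
    partialDeriv i (planeWave ξ) x = Complex.I * ξ i * planeWave ξ x := by
  refine partialDeriv_eq_of_hasDerivAt ((contDiff_planeWave ξ).differentiable (by simp) x) ?_
  have hline : (fun t : ℝ => planeWave ξ (x + t • EuclideanSpace.single i 1)) = fun t : ℝ =>
      Complex.exp (Complex.I * ((∑ j, ξ j * x j : ℝ) + ((t * ξ i : ℝ) : ℂ))) := by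
    ext t
    rw [planeWave]
    congr 2
    rw [← Complex.ofReal_add]
    congr 1
    simp only [PiLp.add_apply, PiLp.smul_apply, smul_eq_mul, mul_add, Finset.sum_add_distrib]
    congr 1
    simp
    ring
  rw [hline]
  have h1 : HasDerivAt (fun t : ℝ => ((t * ξ i : ℝ) : ℂ)) ((ξ i : ℝ) : ℂ) 0 := by
    simpa using ((hasDerivAt_id (0 : ℝ)).mul_const (ξ i)).ofReal_comp
  have h2 := ((h1.const_add ((∑ j, ξ j * x j : ℝ) : ℂ)).const_mul Complex.I).cexp
  refine h2.congr_deriv ?_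
  rw [planeWave]
  simp
  ring

/-- Against plane waves, which do not vanish at the boundary, a function in `H¹₀` still integrates
by parts without boundary term; extension by zero therefore costs no energy. -/
theorem waveVec_mul_inner_floquet {p : BoxL2 L × (Fin 3 → BoxL2 L)} (hp : p ∈ sobolev L)
    (κ n : Fin 3 → ℤ) (i : Fin 3) :
    inner ℂ (fourierBasis n) (floquet hM hLM κ (p.2 i)) =
      Complex.I * waveVec M κ n i * inner ℂ (fourierBasis n) (floquet hM hLM κ p.1) := by
  have h := integral_mul_of_mem_sobolev hp (contDiff_planeWave (-waveVec M κ n)) i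
  rw [inner_fourierBasis_floquet, inner_fourierBasis_floquet]
  have e1 : ∫ x in box L, planeWave (-waveVec M κ n) x * p.2 i x
      = ∫ x in box L, p.2 i x * planeWave (-waveVec M κ n) x := by simp only [mul_comm]
  have e2 : ∫ x in box L, p.1 x * partialDeriv i (planeWave (-waveVec M κ n)) x
      = -(Complex.I * waveVec M κ n i) * ∫ x in box L, planeWave (-waveVec M κ n) x * p.1 x := by
    rw [← integral_const_mul]
    refine integral_congr_ae (Eventually.of_forall fun x => ?_)
    simp only [partialDeriv_planeWave, Pi.neg_apply]
    push_cast
    ring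
  rw [e1, h, e2]
  ring

theorem hasSum_kin_floquet {p : BoxL2 L × (Fin 3 → BoxL2 L)} (hp : p ∈ sobolev L)
    (κ : Fin 3 → ℤ) :
    HasSum (fun n => kin (momentum (gridPoint M κ)) n *
      ‖inner ℂ (fourierBasis n) (floquet hM hLM κ p.1)‖ ^ 2)
      (1 / 2 * ∑ i, ‖floquet hM hLM κ (p.2 i)‖ ^ 2) := by
  have h := (hasSum_sum fun i (_ : i ∈ Finset.univ) =>
    hasSum_norm_sq_inner fourierBasis (floquet hM hLM κ (p.2 i))).mul_left (1 / 2 : ℝ)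
  refine h.congr_fun fun n => ?_
  simp only [waveVec_mul_inner_floquet hM hLM hp, momentum_gridPoint, norm_mul, Complex.norm_I,
    one_mul, mul_pow, Complex.norm_real, Real.norm_eq_abs, sq_abs]
  rw [← Finset.sum_mul]
  ring

theorem norm_floquet_le (κ : Fin 3 → ℤ) (f : BoxL2 L) : ‖floquet hM hLM κ f‖ ≤ ‖f‖ := by
  have h1 : ‖ContinuousLinearMap.adjoint (dilation hM κ).toContinuousLinearMap‖ ≤ 1 := by
    rw [LinearIsometryEquiv.norm_map]
    exact (dilation hM κ).norm_toContinuousLinearMap_le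
  rw [floquet, ContinuousLinearMap.comp_apply]
  refine (ContinuousLinearMap.le_opNorm _ _).trans ?_
  have h2 : ‖(fold hM hLM).toContinuousLinearMap f‖ = ‖f‖ := (fold hM hLM).norm_map f
  rw [h2]
  nlinarith [norm_nonneg f]

end Floquet

/-! ### Upper bound for the Riesz means of the box -/

theorem sum_norm_inner_apply_le {H H' : Type*} [NormedAddCommGroup H] [InnerProductSpace ℂ H]
    [CompleteSpace H] [NormedAddCommGroup H'] [InnerProductSpace ℂ H'] [CompleteSpace H']
    {α : Type*} [Fintype α] {v : α → H} (hv : Orthonormal ℂ v) {T : H →L[ℂ] H'} (hT : ‖T‖ ≤ 1)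
    (x : H') : ∑ a, ‖inner ℂ (T (v a)) x‖ ^ 2 ≤ ‖x‖ ^ 2 := by
  have h1 : ∀ a, inner ℂ (T (v a)) x = inner ℂ (v a) (ContinuousLinearMap.adjoint T x) :=
    fun a => (ContinuousLinearMap.adjoint_inner_right T (v a) x).symm
  simp only [h1]
  refine (hv.sum_inner_products_le (s := Finset.univ)
    (x := ContinuousLinearMap.adjoint T x)).trans ?_
  refine pow_le_pow_left₀ (norm_nonneg _) ?_ 2
  refine (ContinuousLinearMap.le_opNorm _ _).trans ?_
  rw [LinearIsometryEquiv.norm_map]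
  nlinarith [norm_nonneg x]

section Box

variable {V : Space → ℝ} (hV : Continuous V)
    (hper : ∀ (m : Fin 3 → ℤ) (x : Space), V (x + WithLp.toLp 2 (fun i => (m i : ℝ))) = V x)
    {W : TorusL2 →L[ℂ] TorusL2} (hWs : IsSelfAdjoint W)
    (hW : ∀ u : TorusL2, W u =ᵐ[torusMeasure] fun t => (onTorus V t : ℂ) * u t)
include hV hper hW

-- Dirichlet eigenfunctions extended by zero are trial functions for the periodic problem. Their
-- Floquet components form a Bessel family in each fiber, and masses and energies add up over the
-- fibers to those in the box, so the fiberwise variational bounds sum without error.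
set_option maxHeartbeats 1000000 in
theorem riesz_box_le {L : ℝ} (hL : 0 < L) {M : ℕ} (hM : 0 < M) (hLM : L ≤ M)
    {Wb : BoxL2 L →L[ℂ] BoxL2 L}
    (hWb : ∀ u : BoxL2 L, Wb u =ᵐ[volume.restrict (box L)] fun x => (V x : ℂ) * u x)
    (D : SpectralResolution (diagGraph (sineBasis hL) (dirichletLevel L) Wb)) (E : ℝ) :
    D.riesz E ≤ ∑ κ ∈ grid M, (fibRes hWs (momentum (gridPoint M κ))).riesz E := by
  have hform : ∀ a, HasSum (fun n => dirichletLevel L n * ‖inner ℂ (sineBasis hL n) (D.v a)‖ ^ 2)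
      (D.μ a - (inner ℂ (D.v a) (Wb (D.v a))).re) := fun a => by
    have h := hasSum_diagGraph_re (D.mem a)
    simp only [inner_smul_right] at h
    rw [inner_self_eq_norm_sq_to_K, D.v.orthonormal.1 a] at h
    simpa using h
  choose g hg _ hgn using fun a => exists_gradient hL (hform a).summable
  have hκ : ∀ κ ∈ grid M, ∑ a : D.below E, (E * ‖floquet hM hLM κ (D.v a)‖ ^ 2
      - 1 / 2 * ∑ i, ‖floquet hM hLM κ (g a i)‖ ^ 2
      - (inner ℂ (floquet hM hLM κ (D.v a)) (floquet hM hLM κ (Wb (D.v a)))).re)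
      ≤ (fibRes hWs (momentum (gridPoint M κ))).riesz E := fun κ _ => by
    simp only [floquet_mul hM hLM hV hper hWs hW (hWb _) κ]
    refine (fibRes hWs (momentum (gridPoint M κ))).sum_form_le_riesz
      (fun a : D.below E => floquet hM hLM κ (D.v a)) _ (fun a => ?_) ?_ E
    · exact hasSum_kin_floquet hM hLM (hg a) κ
    · exact sum_norm_inner_apply_le (D.v.orthonormal.comp _ Subtype.val_injective)
        (ContinuousLinearMap.opNorm_le_bound _ zero_le_one fun f => by
          rw [one_mul]; exact norm_floquet_le hM hLM κ f)
  refine le_trans (le_of_eq ?_) (Finset.sum_le_sum hκ)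
  rw [Finset.sum_comm, SpectralResolution.riesz, ← Finset.sum_coe_sort]
  refine Finset.sum_congr rfl fun a _ => ?_
  rw [Finset.sum_sub_distrib, Finset.sum_sub_distrib, ← Finset.mul_sum, ← Finset.mul_sum,
    Finset.sum_comm, sum_norm_floquet, ← Complex.re_sum, sum_inner_floquet]
  simp only [sum_norm_floquet]
  rw [hgn, (hform a).tsum_eq, D.v.orthonormal.1]
  ring

end Box

/-! ### Cutoff functions -/

theorem exists_cutoff {θ : ℝ} (hθ : 0 < θ) (hθ1 : θ < 1) :
    ∃ χ : Space → ℂ, IsTest 1 χ ∧ (∀ x, ∃ r : ℝ, 0 ≤ r ∧ r ≤ 1 ∧ χ x = r) ∧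
      (∀ x ∈ box (1 - θ), χ x = 1) ∧ ∃ C : ℝ, 0 ≤ C ∧ ∀ i x, ‖partialDeriv i χ x‖ ≤ C := by
  -- The step acts on `1/4 - xᵢ²` and runs from `η` to `2η`. That quantity is at least `θ/4 ≥ 2η`
  -- for `|xᵢ| < (1 - θ)/2`, and at most `η` for some `i` outside `closedBox (1 - 2η)`.
  set η := θ / 16 with hη
  have hη0 : 0 < η := by positivity
  let p : Space → ℝ := fun x => ∏ i, step ((1 / 4 - x i ^ 2) / η)
  have hp : ContDiff ℝ ∞ p := contDiff_prod fun i _ => contDiff_step.comp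
    ((contDiff_const.sub ((contDiff_coord i).pow 2)).div_const η)
  have hp0 : ∀ x, 0 ≤ p x := fun x => Finset.prod_nonneg fun i _ => step_nonneg _
  have hp1 : ∀ x, p x ≤ 1 := fun x => Finset.prod_le_one (fun i _ => step_nonneg _)
    fun i _ => step_le_one _
  let K : Set Space := closedBox (1 - 2 * η)
  have hKb : K ⊆ box 1 := fun x hx i => by
    obtain ⟨h1, h2⟩ := hx i
    constructor <;> linarith
  have hz : ∀ x, x ∉ K → p x = 0 := fun x hx => by
    have : ∃ i, x i ∉ Set.Icc (-((1 - 2 * η) / 2)) ((1 - 2 * η) / 2) := by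
      by_contra h
      push Not at h
      exact hx h
    obtain ⟨i, hi⟩ := this
    refine Finset.prod_eq_zero (Finset.mem_univ i) (step_of_le ?_)
    rw [div_le_one hη0]
    have h3 : ((1 - 2 * η) / 2) ^ 2 ≤ x i ^ 2 := by
      rw [sq_le_sq]
      have h4 : 0 ≤ (1 - 2 * η) / 2 := by linarith
      rw [abs_of_nonneg h4]
      by_contra h
      rw [not_le, abs_lt] at h
      exact hi ⟨h.1.le, h.2.le⟩
    nlinarith
  have hc : HasCompactSupport fun x => (p x : ℂ) :=
    HasCompactSupport.intro (isCompact_closedBox _) fun x hx => by rw [hz x hx]; simp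
  have hpC : ContDiff ℝ ∞ fun x => (p x : ℂ) := Complex.ofRealCLM.contDiff.comp hp
  refine ⟨fun x => (p x : ℂ), ⟨hpC, hc, ?_⟩, fun x => ⟨p x, hp0 x, hp1 x, rfl⟩, fun x hx => ?_, ?_⟩
  · refine (closure_minimal (fun x hx => ?_) (isCompact_closedBox (1 - 2 * η)).isClosed).trans hKb
    by_contra h
    exact hx (by simp only; rw [hz x h]; simp)
  · have : p x = 1 := Finset.prod_eq_one fun i _ => by
      refine step_of_ge ?_
      rw [le_div_iff₀ hη0]
      obtain ⟨h1, h2⟩ := hx i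
      have h3 : x i ^ 2 ≤ ((1 - θ) / 2) ^ 2 := by
        rw [sq_le_sq, abs_of_nonneg (by linarith : 0 ≤ (1 - θ) / 2), abs_le]
        exact ⟨h1.le, h2.le⟩
      nlinarith
    simp only [this, Complex.ofReal_one]
  · have hb : ∀ i, ∃ C, ∀ x, ‖partialDeriv i (fun x => (p x : ℂ)) x‖ ≤ C := fun i => by
      have hcs : HasCompactSupport (partialDeriv i fun x => (p x : ℂ)) := by
        have := hc.fderiv (𝕜 := ℝ)
        exact this.comp_left (g := fun A : Space →L[ℝ] ℂ => A (EuclideanSpace.single i 1)) rfl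
      exact hcs.exists_bound_of_continuous (continuous_partialDeriv hpC i)
    choose C hC using hb
    refine ⟨∑ i, |C i|, by positivity, fun i x => (hC i x).trans ((le_abs_self _).trans
      (Finset.single_le_sum (f := fun i => |C i|) (fun i _ => abs_nonneg _) (Finset.mem_univ i)))⟩

theorem partialDeriv_comp_smul {F : Space → ℂ} (hF : ContDiff ℝ ∞ F) (c : ℝ) (i : Fin 3)
    (x : Space) : partialDeriv i (fun y => F (c • y)) x = c * partialDeriv i F (c • x) := by
  have h0 : HasFDerivAt (fun y : Space => c • y) (c • ContinuousLinearMap.id ℝ Space) x :=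
    (hasFDerivAt_id x).const_smul c
  have h1 := ((hF.differentiable (by simp) (c • x)).hasFDerivAt).comp x h0
  rw [partialDeriv]
  have h2 : fderiv ℝ (fun y => F (c • y)) x = _ := h1.fderiv
  rw [h2, partialDeriv]
  simp

theorem IsTest.comp_inv_smul {φ : Space → ℂ} (hφ : IsTest 1 φ) {L : ℝ} (hL : 0 < L) :
    IsTest L fun x => φ (L⁻¹ • x) := by
  have hmem : ∀ x : Space, L⁻¹ • x ∈ box 1 ↔ x ∈ box L := fun x => by
    simp only [box, Set.mem_ofPred_eq, PiLp.smul_apply, smul_eq_mul]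
    refine forall_congr' fun i => and_congr ?_ ?_
    · rw [← div_eq_inv_mul, lt_div_iff₀ hL]
      constructor <;> intro h <;> linarith
    · rw [← div_eq_inv_mul, div_lt_iff₀ hL]
      constructor <;> intro h <;> linarith
  let e : Space ≃ₜ Space := Homeomorph.smulOfNeZero L⁻¹ (inv_ne_zero hL.ne')
  have hts : tsupport (fun x => φ (L⁻¹ • x)) = e ⁻¹' tsupport φ :=
    tsupport_comp_eq_preimage φ e
  refine ⟨hφ.1.comp (contDiff_const_smul _), hφ.2.1.comp_homeomorph e, ?_⟩
  rw [hts]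
  intro x hx
  exact (hmem x).1 (hφ.2.2 hx)

/-! ### Bloch waves -/

/-- The Bloch wave with quasi-momentum `2πκ/M` and Fourier coefficients `c`. -/
def blochWave (M : ℕ) (κ : Fin 3 → ℤ) (K : Finset (Fin 3 → ℤ)) (c : (Fin 3 → ℤ) → ℂ) (x : Space) :
    ℂ := (Real.sqrt ((M : ℝ) ^ 3) : ℂ)⁻¹ * ∑ n ∈ K, c n * planeWave (waveVec M κ n) x

/-- The trigonometric polynomial with Fourier coefficients `c`. -/
def trigPoly (K : Finset (Fin 3 → ℤ)) (c : (Fin 3 → ℤ) → ℂ) : TorusL2 :=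
  ∑ n ∈ K, c n • fourierBasis n

theorem norm_trigPoly (K : Finset (Fin 3 → ℤ)) (c : (Fin 3 → ℤ) → ℂ) :
    ‖trigPoly K c‖ ^ 2 = ∑ n ∈ K, ‖c n‖ ^ 2 := by
  have h := fourierBasis.orthonormal.inner_sum c c K
  have h2 := inner_self_eq_norm_sq_to_K (𝕜 := ℂ) (trigPoly K c)
  rw [trigPoly, h] at h2
  have h3 : ∑ n ∈ K, (starRingEnd ℂ) (c n) * c n = ((∑ n ∈ K, ‖c n‖ ^ 2 : ℝ) : ℂ) := by
    push_cast
    refine Finset.sum_congr rfl fun n _ => ?_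
    rw [mul_comm, Complex.mul_conj, Complex.normSq_eq_norm_sq]
    push_cast
    rfl
  rw [h3] at h2
  refine Complex.ofReal_injective ?_
  rw [Complex.ofReal_pow]
  exact h2.symm

theorem contDiff_blochWave (M : ℕ) (κ : Fin 3 → ℤ) (K : Finset (Fin 3 → ℤ))
    (c : (Fin 3 → ℤ) → ℂ) : ContDiff ℝ ∞ (blochWave M κ K c) :=
  contDiff_const.mul (ContDiff.sum fun _ _ => contDiff_const.mul (contDiff_planeWave _))

theorem partialDeriv_sum {ι : Type*} (K : Finset ι) {F : ι → Space → ℂ}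
    (hF : ∀ n, ContDiff ℝ ∞ (F n)) (i : Fin 3) (x : Space) :
    partialDeriv i (fun y => ∑ n ∈ K, F n y) x = ∑ n ∈ K, partialDeriv i (F n) x := by
  rw [partialDeriv, fderiv_fun_sum fun n _ => (hF n).differentiable (by simp) x]
  simp [partialDeriv]

theorem partialDeriv_blochWave (M : ℕ) (κ : Fin 3 → ℤ) (K : Finset (Fin 3 → ℤ))
    (c : (Fin 3 → ℤ) → ℂ) (i : Fin 3) (x : Space) :
    partialDeriv i (blochWave M κ K c) x =
      blochWave M κ K (fun n => c n * (Complex.I * waveVec M κ n i)) x := by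
  have h1 : ∀ n, ContDiff ℝ ∞ fun x => c n * planeWave (waveVec M κ n) x := fun n =>
    contDiff_const.mul (contDiff_planeWave _)
  have h2 : ContDiff ℝ ∞ fun x => ∑ n ∈ K, c n * planeWave (waveVec M κ n) x :=
    ContDiff.sum fun n _ => h1 n
  unfold blochWave
  rw [partialDeriv_const_mul h2, partialDeriv_sum K h1]
  congr 1
  refine Finset.sum_congr rfl fun n _ => ?_
  rw [partialDeriv_const_mul (contDiff_planeWave _), partialDeriv_planeWave]
  ring

theorem norm_planeWave (ξ : Fin 3 → ℝ) (x : Space) : ‖planeWave ξ x‖ = 1 := by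
  rw [planeWave, mul_comm, Complex.norm_exp_ofReal_mul_I]

/-- With finitely many modes the density is bounded pointwise by a multiple of `M⁻³`, so what is
lost near the boundary is proportional to the volume removed. -/
theorem norm_blochWave_sq_le {M : ℕ} (hM : 0 < M) (κ : Fin 3 → ℤ) (K : Finset (Fin 3 → ℤ))
    (c : (Fin 3 → ℤ) → ℂ) (x : Space) :
    ‖blochWave M κ K c x‖ ^ 2 ≤ ((M : ℝ) ^ 3)⁻¹ * (K.card * ∑ n ∈ K, ‖c n‖ ^ 2) := by
  rw [blochWave, norm_mul, mul_pow, norm_inv, Complex.norm_real, Real.norm_eq_abs,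
    abs_of_nonneg (Real.sqrt_nonneg _), inv_pow, Real.sq_sqrt (by positivity)]
  refine mul_le_mul_of_nonneg_left ?_ (by positivity)
  have h1 : ‖∑ n ∈ K, c n * planeWave (waveVec M κ n) x‖ ≤ ∑ n ∈ K, ‖c n‖ := by
    refine (norm_sum_le _ _).trans (le_of_eq (Finset.sum_congr rfl fun n _ => ?_))
    rw [norm_mul, norm_planeWave, mul_one]
  exact (pow_le_pow_left₀ (norm_nonneg _) h1 2).trans sq_sum_le_card_mul_sum_sq

section Waves

variable {M : ℕ} (hM : 0 < M) (κ : Fin 3 → ℤ) (K : Finset (Fin 3 → ℤ)) (c : (Fin 3 → ℤ) → ℂ)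

theorem coeFn_trigPoly_sum (b : (Fin 3 → ℤ) → (Fin 3 → ℤ)) :
    (∑ n ∈ K, c n • fourierBasis (b n) : TorusL2) =ᵐ[torusMeasure]
      fun t => ∑ n ∈ K, c n * UnitAddTorus.mFourier (b n) t := by
  classical
  induction K using Finset.induction_on with
  | empty =>
    simp only [Finset.sum_empty]
    exact Lp.coeFn_zero _ _ _
  | insert a s ha ih =>
    rw [Finset.sum_insert ha]
    filter_upwards [Lp.coeFn_add (c a • fourierBasis (b a)) (∑ n ∈ s, c n • fourierBasis (b n)),
      Lp.coeFn_smul (c a) (fourierBasis (b a)), coeFn_fourierBasis (b a), ih] with t h1 h2 h3 h4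
    rw [h1, Pi.add_apply, h2, Pi.smul_apply, h3, h4, Finset.sum_insert ha, smul_eq_mul]

theorem blochWave_unfold :
    (fun t => (Real.sqrt ((M : ℝ) ^ 3) : ℂ) * blochWave M κ K c (unfold M t))
      =ᵐ[torusMeasure] dilation hM κ (trigPoly K c) := by
  have h1 : dilation hM κ (trigPoly K c) = ∑ n ∈ K, c n • fourierBasis (κ + (M : ℤ) • n) := by
    rw [trigPoly, map_sum]
    exact Finset.sum_congr rfl fun n _ => by rw [map_smul, dilation_fourierBasis]
  have hM' : (M : ℂ) ^ 3 ≠ 0 := by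
    have : (M : ℂ) ≠ 0 := by exact_mod_cast hM.ne'
    positivity
  have hs0 : (Real.sqrt ((M : ℝ) ^ 3) : ℂ) ≠ 0 := fun h => hM' (by
    rw [← sqrt_pow_mul_self M, h, zero_mul])
  rw [h1]
  filter_upwards [coeFn_trigPoly_sum K c fun n => κ + (M : ℤ) • n] with t ht
  rw [ht, blochWave, mul_inv_cancel_left₀ hs0]
  exact Finset.sum_congr rfl fun n _ => by rw [mFourier_eq_planeWave hM]

/-- On a cube of integer side `M` a Bloch wave is a rescaled dilation of a trigonometric polynomial
on the torus, so its mass and potential energy are computed exactly. -/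
theorem integral_unfold_mul_norm_dilation {F : Space → ℝ} (hF : Continuous F) :
    ((∫ x in box M, F x * ‖blochWave M κ K c x‖ ^ 2 : ℝ) : ℂ) =
      ∫ t, (F (unfold M t) : ℂ) * (dilation hM κ (trigPoly K c) t *
        (starRingEnd ℂ) (dilation hM κ (trigPoly K c) t)) ∂torusMeasure := by
  have hM' : (M : ℂ) ≠ 0 := by exact_mod_cast hM.ne'
  have hw := (contDiff_blochWave M κ K c).continuous
  have h1 : ∫ t, (F (unfold M t) : ℂ) * (dilation hM κ (trigPoly K c) t *
        (starRingEnd ℂ) (dilation hM κ (trigPoly K c) t)) ∂torusMeasure =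
      ∫ t, (fun x => (M : ℂ) ^ 3 * ((F x * ‖blochWave M κ K c x‖ ^ 2 : ℝ) : ℂ)) (unfold M t)
        ∂torusMeasure := by
    refine integral_congr_ae ?_
    filter_upwards [blochWave_unfold hM κ K c] with t ht
    rw [← ht, map_mul, Complex.conj_ofReal, ← sqrt_pow_mul_self M]
    have := Complex.mul_conj (blochWave M κ K c (unfold M t))
    rw [Complex.normSq_eq_norm_sq] at this
    push_cast at this ⊢
    linear_combination ((F (unfold M t) : ℂ) * (Real.sqrt ((M : ℝ) ^ 3) : ℂ) *
      (Real.sqrt ((M : ℝ) ^ 3) : ℂ)) * this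
  rw [h1, integral_unfold hM (F := fun x => (M : ℂ) ^ 3 *
    ((F x * ‖blochWave M κ K c x‖ ^ 2 : ℝ) : ℂ)), integral_const_mul, integral_complex_ofReal]
  · field_simp
  · exact (continuous_const.mul (Complex.continuous_ofReal.comp
      (hF.mul (hw.norm.pow 2)))).aestronglyMeasurable

include hM

theorem integral_norm_blochWave_sq :
    ∫ x in box M, ‖blochWave M κ K c x‖ ^ 2 = ∑ n ∈ K, ‖c n‖ ^ 2 := by
  have h := integral_unfold_mul_norm_dilation hM κ K c (F := fun _ => 1) continuous_const
  simp only [one_mul, Complex.ofReal_one] at h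
  have h2 := inner_self_eq_norm_sq_to_K (𝕜 := ℂ) (dilation hM κ (trigPoly K c))
  rw [L2.inner_def] at h2
  simp only [RCLike.inner_apply] at h2
  rw [h2, LinearIsometry.norm_map] at h
  refine Complex.ofReal_injective ?_
  rw [h, ← norm_trigPoly, Complex.ofReal_pow]
  rfl

theorem integral_mul_norm_blochWave_sq {V : Space → ℝ} (hV : Continuous V)
    (hper : ∀ (m : Fin 3 → ℤ) (x : Space), V (x + WithLp.toLp 2 (fun i => (m i : ℝ))) = V x)
    {W : TorusL2 →L[ℂ] TorusL2}
    (hW : ∀ u : TorusL2, W u =ᵐ[torusMeasure] fun t => (onTorus V t : ℂ) * u t) :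
    ∫ x in box M, V x * ‖blochWave M κ K c x‖ ^ 2 =
      (inner ℂ (trigPoly K c) (W (trigPoly K c))).re := by
  have h := integral_unfold_mul_norm_dilation hM κ K c hV
  rw [← LinearIsometry.inner_map_map (dilation hM κ), L2.inner_def]
  have h2 : ∫ t, inner ℂ (dilation hM κ (trigPoly K c) t) (dilation hM κ (W (trigPoly K c)) t)
      ∂torusMeasure = ∫ t, (V (unfold M t) : ℂ) * (dilation hM κ (trigPoly K c) t *
        (starRingEnd ℂ) (dilation hM κ (trigPoly K c) t)) ∂torusMeasure := by
    refine integral_congr_ae ?_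
    filter_upwards [coeFn_dilation hM κ (W (trigPoly K c)), coeFn_dilation hM κ (trigPoly K c),
      (measurePreserving_nsmul_torus hM).quasiMeasurePreserving.ae (hW (trigPoly K c))]
      with t h1 h2 h3
    rw [RCLike.inner_apply, h1, h3, h2, onTorus_nsmul hM hV hper]
    ring
  rw [h2, ← h, Complex.ofReal_re]

end Waves

/-! ### Localized Bloch waves as trial functions -/

theorem norm_add_sq_le_of_pos (a b : ℂ) {δ : ℝ} (hδ : 0 < δ) :
    ‖a + b‖ ^ 2 ≤ (1 + δ) * ‖b‖ ^ 2 + (1 + δ⁻¹) * ‖a‖ ^ 2 := by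
  have h1 := pow_le_pow_left₀ (norm_nonneg _) (norm_add_le a b) 2
  have h2 : 2 * (‖a‖ * ‖b‖) ≤ δ * ‖b‖ ^ 2 + δ⁻¹ * ‖a‖ ^ 2 := by
    have h3 : 0 ≤ δ⁻¹ * (‖a‖ - δ * ‖b‖) ^ 2 := by positivity
    have h4 : δ⁻¹ * (‖a‖ - δ * ‖b‖) ^ 2 = δ * ‖b‖ ^ 2 + δ⁻¹ * ‖a‖ ^ 2 - 2 * (‖a‖ * ‖b‖) := by
      field_simp
      ring
    linarith
  nlinarith

theorem IsTest.mul {L : ℝ} {χ w : Space → ℂ} (hχ : IsTest L χ) (hw : ContDiff ℝ ∞ w) :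
    IsTest L fun x => χ x * w x :=
  ⟨hχ.1.mul hw, hχ.2.1.mul_right, (tsupport_mul_subset_left (f := χ) (g := w)).trans hχ.2.2⟩

theorem continuous_integrable_box (L : ℝ) {F : Space → ℝ} (hF : Continuous F) :
    Integrable F (volume.restrict (box L)) :=
  (hF.continuousOn.integrableOn_compact (isCompact_closedBox L)).mono_set (box_subset_closedBox L)

section Trial

variable {L : ℝ} {M : ℕ} (hM : 0 < M) (hLM : L ≤ M) (κ : Fin 3 → ℤ)
  (K : Finset (Fin 3 → ℤ)) (c : (Fin 3 → ℤ) → ℂ) {χ : Space → ℂ} (hχ : IsTest L χ)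
  (hχr : ∀ x, ∃ r : ℝ, 0 ≤ r ∧ r ≤ 1 ∧ χ x = r)
include hM hLM hχ hχr

/-- The gradient splits into `χ ∂w` and `(∂χ) w`. The weight `δ` keeps the first coefficient near
one; the price `δ⁻¹` falls on the second, where `A` will be of order `1 / L`. -/
theorem norm_partialDeriv_trial_le {A : ℝ} (hA : ∀ i x, ‖partialDeriv i χ x‖ ≤ A) {δ : ℝ}
    (hδ : 0 < δ) (i : Fin 3) :
    ‖toBox L (partialDeriv i fun x => χ x * blochWave M κ K c x) (continuous_partialDeriv
      (hχ.mul (contDiff_blochWave M κ K c)).1 i)‖ ^ 2 ≤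
    (1 + δ) * ∑ n ∈ K, waveVec M κ n i ^ 2 * ‖c n‖ ^ 2
      + (1 + δ⁻¹) * A ^ 2 * ∑ n ∈ K, ‖c n‖ ^ 2 := by
  set w := blochWave M κ K c with hw
  set w' := blochWave M κ K (fun n => c n * (Complex.I * waveVec M κ n i)) with hw'
  have hwc := (contDiff_blochWave M κ K c).continuous
  have hwc' := (contDiff_blochWave M κ K
    (fun n => c n * (Complex.I * waveVec M κ n i))).continuous
  have hA0 : 0 ≤ A := (norm_nonneg _).trans (hA 0 0)
  have h1 := integral_norm_blochWave_sq hM κ K c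
  have h2 := integral_norm_blochWave_sq hM κ K (fun n => c n * (Complex.I * waveVec M κ n i))
  have h3 : ∀ n, ‖c n * (Complex.I * waveVec M κ n i)‖ ^ 2 = waveVec M κ n i ^ 2 * ‖c n‖ ^ 2 :=
    fun n => by
      rw [norm_mul, norm_mul, Complex.norm_I, one_mul, mul_pow, Complex.norm_real,
        Real.norm_eq_abs, sq_abs, mul_comm]
  simp only [h3] at h2
  have hcont : Continuous fun x => (1 + δ) * ‖w' x‖ ^ 2 + (1 + δ⁻¹) * A ^ 2 * ‖w x‖ ^ 2 :=
    (continuous_const.mul (hwc'.norm.pow 2)).add (continuous_const.mul (hwc.norm.pow 2))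
  have hi1 : Integrable (fun x => (1 + δ) * ‖w' x‖ ^ 2) (volume.restrict (box M)) :=
    continuous_integrable_box _ (continuous_const.mul (hwc'.norm.pow 2))
  have hi2 : Integrable (fun x => (1 + δ⁻¹) * A ^ 2 * ‖w x‖ ^ 2) (volume.restrict (box M)) :=
    continuous_integrable_box _ (continuous_const.mul (hwc.norm.pow 2))
  rw [norm_toBox_sq, ← h1, ← h2, ← integral_const_mul, ← integral_const_mul,
    ← integral_add hi1 hi2]
  calc ∫ x in box L, ‖partialDeriv i (fun x => χ x * w x) x‖ ^ 2
      ≤ ∫ x in box L, ((1 + δ) * ‖w' x‖ ^ 2 + (1 + δ⁻¹) * A ^ 2 * ‖w x‖ ^ 2) := by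
        refine integral_mono (continuous_integrable_box _
          ((continuous_partialDeriv (hχ.mul (contDiff_blochWave M κ K c)).1 i).norm.pow 2))
          (continuous_integrable_box _ hcont) fun x => ?_
        simp only
        rw [partialDeriv_mul hχ.1 (contDiff_blochWave M κ K c), partialDeriv_blochWave]
        refine (norm_add_sq_le_of_pos _ _ hδ).trans (add_le_add ?_ ?_)
        · refine mul_le_mul_of_nonneg_left ?_ (by positivity)
          refine pow_le_pow_left₀ (norm_nonneg _) ?_ 2
          obtain ⟨r, hr0, hr1, hr⟩ := hχr x
          rw [norm_mul, hr, Complex.norm_real, Real.norm_eq_abs, abs_of_nonneg hr0]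
          exact mul_le_of_le_one_left (norm_nonneg _) hr1
        · rw [norm_mul, mul_pow, mul_assoc]
          refine mul_le_mul_of_nonneg_left ?_ (by positivity)
          exact mul_le_mul_of_nonneg_right (pow_le_pow_left₀ (norm_nonneg _) (hA i x) 2)
            (by positivity)
    _ ≤ ∫ x in box M, ((1 + δ) * ‖w' x‖ ^ 2 + (1 + δ⁻¹) * A ^ 2 * ‖w x‖ ^ 2) :=
        setIntegral_mono_set (continuous_integrable_box _ hcont)
          (Eventually.of_forall fun x => by positivity) (box_mono hLM).eventuallyLE

theorem integral_trial_ge {U : Space → ℝ} (hU : Continuous U) {B : ℝ} (hB : ∀ x, |U x| ≤ B)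
    {L' : ℝ} (hL' : 0 ≤ L') (hLL' : L' ≤ L) (hχ1 : ∀ x ∈ box L', χ x = 1)
    (hc : ∑ n ∈ K, ‖c n‖ ^ 2 ≤ 1) :
    (∫ x in box M, U x * ‖blochWave M κ K c x‖ ^ 2)
      - B * (((M : ℝ) ^ 3)⁻¹ * K.card) * ((M : ℝ) ^ 3 - L' ^ 3)
      ≤ ∫ x in box L, U x * ‖χ x * blochWave M κ K c x‖ ^ 2 := by
  set w := blochWave M κ K c with hw
  have hwc := (contDiff_blochWave M κ K c).continuous
  have hB0 : 0 ≤ B := (abs_nonneg _).trans (hB 0)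
  have hsub : box L' ⊆ box (M : ℝ) := box_mono (hLL'.trans hLM)
  have := isFiniteMeasure_box M
  set q := B * (((M : ℝ) ^ 3)⁻¹ * K.card) with hq
  have hq0 : 0 ≤ q := by positivity
  have hext : ∫ x in box L, U x * ‖χ x * w x‖ ^ 2 = ∫ x in box M, U x * ‖χ x * w x‖ ^ 2 := by
    refine (setIntegral_eq_of_subset_of_forall_sdiff_eq_zero (measurableSet_box M)
      (box_mono hLM) fun x hx => ?_).symm
    rw [hχ.eq_zero hx.2]
    simp
  have hind : ∫ x in box M, (box L')ᶜ.indicator (fun _ => q) x = q * ((M : ℝ) ^ 3 - L' ^ 3) := by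
    rw [integral_indicator (measurableSet_box L').compl,
      Measure.restrict_restrict (measurableSet_box L').compl, setIntegral_const, smul_eq_mul,
      mul_comm]
    congr 1
    have h1 : (box L')ᶜ ∩ box (M : ℝ) = box (M : ℝ) \ box L' := by
      rw [Set.inter_comm]; rfl
    have hf : volume (box (M : ℝ)) ≠ ⊤ := by rw [volume_box (by positivity)]; simp
    rw [h1, measureReal_sdiff hsub (measurableSet_box L') hf, Measure.real, Measure.real,
      volume_box hL', volume_box (by positivity), ENNReal.toReal_ofReal (by positivity),
      ENNReal.toReal_ofReal (by positivity)]
  have hi1 : Integrable (fun x => U x * ‖w x‖ ^ 2) (volume.restrict (box M)) :=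
    continuous_integrable_box _ (hU.mul (hwc.norm.pow 2))
  have hi2 : Integrable ((box L')ᶜ.indicator fun _ => q) (volume.restrict (box M)) :=
    (integrable_const q).indicator (measurableSet_box L').compl
  rw [hext, ← hind, ← integral_sub hi1 hi2]
  refine integral_mono (hi1.sub hi2) (continuous_integrable_box _
    (hU.mul ((hχ.1.continuous.mul hwc).norm.pow 2))) fun x => ?_
  simp only
  by_cases hx : x ∈ box L'
  · rw [hχ1 x hx, Set.indicator_of_notMem (by simpa using hx)]
    simp
  · rw [Set.indicator_of_mem (by simpa using hx)]
    obtain ⟨r, hr0, hr1, hr⟩ := hχr x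
    rw [norm_mul, hr, Complex.norm_real, Real.norm_eq_abs, abs_of_nonneg hr0, mul_pow]
    have h1 := norm_blochWave_sq_le hM κ K c x
    have h2 : ((M : ℝ) ^ 3)⁻¹ * (K.card * ∑ n ∈ K, ‖c n‖ ^ 2) ≤ ((M : ℝ) ^ 3)⁻¹ * K.card := by
      refine mul_le_mul_of_nonneg_left ?_ (by positivity)
      exact mul_le_of_le_one_right (by positivity) hc
    have h3 : U x * (1 - r ^ 2) * ‖w x‖ ^ 2 ≤ q := by
      have h4 : U x * (1 - r ^ 2) ≤ B := by
        have h5 : 0 ≤ 1 - r ^ 2 := by nlinarith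
        have h6 : 1 - r ^ 2 ≤ 1 := by nlinarith
        have h7 := le_abs_self (U x)
        have h8 := hB x
        nlinarith [mul_le_mul_of_nonneg_right (h7.trans h8) h5]
      calc U x * (1 - r ^ 2) * ‖w x‖ ^ 2 ≤ B * ‖w x‖ ^ 2 :=
            mul_le_mul_of_nonneg_right h4 (by positivity)
        _ ≤ q := by rw [hq]; exact mul_le_mul_of_nonneg_left (h1.trans h2) hB0
    nlinarith

omit hχr

/-- The cutoff is moved onto `f`, which reduces the Bessel bound for the trial functions to the one
in the fibers together with `|χ| ≤ 1`. -/
theorem inner_trial {f g : BoxL2 L} (hg : g =ᵐ[volume.restrict (box L)] fun x => χ x * f x)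
    (hχ' : ∀ x, (starRingEnd ℂ) (χ x) = χ x) :
    inner ℂ (toBox L (fun x => χ x * blochWave M κ K c x)
      (hχ.mul (contDiff_blochWave M κ K c)).1.continuous) f =
    inner ℂ (trigPoly K c) (floquet hM hLM κ g) := by
  rw [inner_toBox, trigPoly, sum_inner]
  simp only [inner_smul_left, inner_fourierBasis_floquet]
  have hi : ∀ n, Integrable (fun x => (starRingEnd ℂ) (c n) * ((Real.sqrt ((M : ℝ) ^ 3) : ℂ)⁻¹ *
      (planeWave (-waveVec M κ n) x * g x))) (volume.restrict (box L)) := fun n =>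
    ((integrable_mul_box L (continuous_planeWave _) g).const_mul _).const_mul _
  simp only [← integral_const_mul]
  rw [← integral_finsetSum _ fun n _ => hi n]
  refine integral_congr_ae ?_
  filter_upwards [hg] with x hx
  rw [map_mul, hχ', blochWave, map_mul, map_inv₀, Complex.conj_ofReal, map_sum, hx]
  simp only [map_mul, conj_planeWave]
  rw [Finset.mul_sum, Finset.mul_sum, Finset.sum_mul]
  exact Finset.sum_congr rfl fun n _ => by ring

end Trial

/-! ### Lower bound for the Riesz means of the box -/

/-- The truncation of Fourier series to the modes in `K`. -/
def truncation (K : Finset (Fin 3 → ℤ)) : TorusL2 →L[ℂ] TorusL2 :=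
  ∑ n ∈ K, (innerSL ℂ (fourierBasis n)).smulRight (fourierBasis n)

theorem truncation_apply (K : Finset (Fin 3 → ℤ)) (u : TorusL2) :
    truncation K u = trigPoly K fun n => inner ℂ (fourierBasis n) u := by
  simp [truncation, trigPoly]

theorem sum_norm_inner_le (K : Finset (Fin 3 → ℤ)) (u : TorusL2) :
    ∑ n ∈ K, ‖inner ℂ (fourierBasis n) u‖ ^ 2 ≤ ‖u‖ ^ 2 :=
  fourierBasis.orthonormal.sum_inner_products_le u

theorem norm_truncation_le (K : Finset (Fin 3 → ℤ)) : ‖truncation K‖ ≤ 1 := by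
  refine ContinuousLinearMap.opNorm_le_bound _ zero_le_one fun u => ?_
  rw [one_mul]
  refine (pow_le_pow_iff_left₀ (norm_nonneg _) (norm_nonneg _) two_ne_zero).1 ?_
  rw [truncation_apply, norm_trigPoly]
  exact sum_norm_inner_le K u

section Box

variable {V : Space → ℝ} (hV : Continuous V)
    (hper : ∀ (m : Fin 3 → ℤ) (x : Space), V (x + WithLp.toLp 2 (fun i => (m i : ℝ))) = V x)
    {W : TorusL2 →L[ℂ] TorusL2} (hWs : IsSelfAdjoint W)
    (hW : ∀ u : TorusL2, W u =ᵐ[torusMeasure] fun t => (onTorus V t : ℂ) * u t)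

/-- The energy of a truncated eigenfunction. -/
theorem form_truncation_ge {k : Space} (hk : k ∈ brillouinZone) {E : ℝ}
    (D : SpectralResolution (fib W k)) {j : D.J} (hj : D.μ j ≤ E) {δ ε R : ℝ} (hδ : 0 < δ) (hε : 0 < ε)
    (hε1 : ε ≤ 1) (hR : 0 < R) (hRε : |E| + ‖W‖ ≤ R * ε ^ 2) {K : Finset (Fin 3 → ℤ)}
    (hK : ∀ n : Fin 3 → ℤ, ∑ i, (n i : ℝ) ^ 2 ≤ R → n ∈ K) :
    E - D.μ j - ((|E| + 2 * ‖W‖) * ε + δ * (|E| + ‖W‖)) ≤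
      E * ∑ n ∈ K, ‖inner ℂ (fourierBasis n) (D.v j)‖ ^ 2
      - (1 + δ) * ∑ n ∈ K, kin k n * ‖inner ℂ (fourierBasis n) (D.v j)‖ ^ 2
      - (inner ℂ (truncation K (D.v j)) (W (truncation K (D.v j)))).re := by
  classical
  set u := D.v j with hu
  set P := truncation K u with hP
  have hu1 : ‖u‖ = 1 := D.v.orthonormal.1 j
  set T := D.μ j - (inner ℂ u (W u)).re with hT
  have hform : HasSum (fun n => kin k n * ‖inner ℂ (fourierBasis n) u‖ ^ 2) T := by
    have h := hasSum_diagGraph_re (D.mem j)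
    simp only [inner_smul_right] at h
    rw [inner_self_eq_norm_sq_to_K, ← hu, hu1] at h
    simpa using h
  have hTB : T ≤ |E| + ‖W‖ := by
    have h1 := (abs_le.1 (abs_re_inner_apply_le W u)).1
    rw [hu1] at h1
    linarith [le_abs_self E]
  have hKT : ∑ n ∈ K, kin k n * ‖inner ℂ (fourierBasis n) u‖ ^ 2 ≤ T :=
    sum_le_hasSum K (fun n _ => mul_nonneg (kin_nonneg k n) (by positivity)) hform
  have hcoef : ∀ n, inner ℂ (fourierBasis n) (u - P)
      = if n ∈ K then 0 else inner ℂ (fourierBasis n) u := fun n => by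
    rw [inner_sub_right, hP, truncation_apply, trigPoly]
    split_ifs with h
    · rw [fourierBasis.orthonormal.inner_right_sum _ h, sub_self]
    · have : inner ℂ (fourierBasis n) (∑ m ∈ K, inner ℂ (fourierBasis m) u • fourierBasis m)
          = 0 := by
        rw [inner_sum]
        refine Finset.sum_eq_zero fun m hm => ?_
        rw [inner_smul_right, fourierBasis.orthonormal.2 (i := n) (j := m)
          (fun hnm => h (hnm ▸ hm)), mul_zero]
      rw [this, sub_zero]
  have htail := hasSum_norm_sq_inner fourierBasis (u - P)
  -- Chebyshev: modes outside `K` have kinetic energy at least `R`, so the kinetic energy of the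
  -- eigenfunction bounds the discarded tail.
  have hRd : R * ‖u - P‖ ^ 2 ≤ T := by
    refine hasSum_le (fun n => ?_) (htail.mul_left R) hform
    rw [hcoef]
    split_ifs with h
    · have := mul_nonneg (kin_nonneg k n) (sq_nonneg ‖inner ℂ (fourierBasis n) u‖)
      simpa using this
    · refine mul_le_mul_of_nonneg_right ?_ (by positivity)
      have h1 : ¬ ∑ i, (n i : ℝ) ^ 2 ≤ R := fun h' => h (hK n h')
      exact (not_le.1 h1).le.trans (sum_sq_le_kin_of_mem hk n)
  have hd : ‖u - P‖ ≤ ε := by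
    refine (pow_le_pow_iff_left₀ (norm_nonneg _) hε.le two_ne_zero).1 ?_
    have := hRd.trans (hTB.trans hRε)
    exact le_of_mul_le_mul_left this hR
  have hPn : ∑ n ∈ K, ‖inner ℂ (fourierBasis n) u‖ ^ 2 = 1 - ‖u - P‖ ^ 2 := by
    have h1 := (hasSum_norm_sq_inner fourierBasis u).sub htail
    rw [hu1, one_pow] at h1
    have h2 : HasSum (fun n => ‖inner ℂ (fourierBasis n) u‖ ^ 2 -
        ‖inner ℂ (fourierBasis n) (u - P)‖ ^ 2) (∑ n ∈ K, (‖inner ℂ (fourierBasis n) u‖ ^ 2 -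
        ‖inner ℂ (fourierBasis n) (u - P)‖ ^ 2)) :=
      hasSum_sum_of_ne_finset_zero fun n hn => by rw [hcoef, if_neg hn, sub_self]
    rw [h1.unique h2]
    refine Finset.sum_congr rfl fun n hn => ?_
    rw [hcoef, if_pos hn]
    simp
  have hP1 : ‖P‖ ≤ 1 := by
    have := (truncation K).le_opNorm u
    rw [hu1, mul_one] at this
    exact this.trans (norm_truncation_le K)
  have hWd : (inner ℂ P (W P)).re ≤ (inner ℂ u (W u)).re + 2 * ‖W‖ * ‖u - P‖ := by
    have e : inner ℂ P (W P) = inner ℂ u (W u) - inner ℂ (u - P) (W P) - inner ℂ u (W (u - P)) := by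
      rw [map_sub, inner_sub_left, inner_sub_right]
      ring
    have h1 : ‖inner ℂ (u - P) (W P)‖ ≤ ‖W‖ * ‖u - P‖ := by
      refine (norm_inner_le_norm _ _).trans ?_
      have := (W.le_opNorm P).trans (mul_le_of_le_one_right (norm_nonneg _) hP1)
      nlinarith [norm_nonneg (u - P)]
    have h2 : ‖inner ℂ u (W (u - P))‖ ≤ ‖W‖ * ‖u - P‖ := by
      refine (norm_inner_le_norm _ _).trans ?_
      rw [hu1, one_mul]
      exact W.le_opNorm _
    have h3 := (abs_le.1 (Complex.abs_re_le_norm (inner ℂ (u - P) (W P)))).1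
    have h4 := (abs_le.1 (Complex.abs_re_le_norm (inner ℂ u (W (u - P))))).1
    rw [e, Complex.sub_re, Complex.sub_re]
    linarith
  rw [hPn]
  have hd0 := norm_nonneg (u - P)
  have h1 : E * ‖u - P‖ ^ 2 ≤ |E| * ε := by
    have h2 : ‖u - P‖ ^ 2 ≤ ε := by nlinarith
    calc E * ‖u - P‖ ^ 2 ≤ |E| * ‖u - P‖ ^ 2 :=
          mul_le_mul_of_nonneg_right (le_abs_self E) (by positivity)
      _ ≤ |E| * ε := mul_le_mul_of_nonneg_left h2 (abs_nonneg E)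
  have h2 : 2 * ‖W‖ * ‖u - P‖ ≤ 2 * ‖W‖ * ε := mul_le_mul_of_nonneg_left hd (by positivity)
  have h3 : δ * T ≤ δ * (|E| + ‖W‖) := mul_le_mul_of_nonneg_left hTB hδ.le
  have h4 : (1 + δ) * ∑ n ∈ K, kin k n * ‖inner ℂ (fourierBasis n) u‖ ^ 2 ≤ (1 + δ) * T :=
    mul_le_mul_of_nonneg_left hKT (by positivity)
  have h5 : T = D.μ j - (inner ℂ u (W u)).re := hT
  nlinarith

include hV hper hW

/-- The energy of a localized Bloch wave. -/
theorem form_trial_ge {L : ℝ} {M : ℕ} (hM : 0 < M) (hLM : L ≤ M)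
    {Wb : BoxL2 L →L[ℂ] BoxL2 L}
    (hWb : ∀ u : BoxL2 L, Wb u =ᵐ[volume.restrict (box L)] fun x => (V x : ℂ) * u x)
    (κ : Fin 3 → ℤ) (K : Finset (Fin 3 → ℤ)) {c : (Fin 3 → ℤ) → ℂ} (hc : ∑ n ∈ K, ‖c n‖ ^ 2 ≤ 1)
    {χ : Space → ℂ} (hχ : IsTest L χ) (hχr : ∀ x, ∃ r : ℝ, 0 ≤ r ∧ r ≤ 1 ∧ χ x = r)
    {A : ℝ} (hA : ∀ i x, ‖partialDeriv i χ x‖ ≤ A) {δ : ℝ} (hδ : 0 < δ)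
    {L' : ℝ} (hL' : 0 ≤ L') (hLL' : L' ≤ L) (hχ1 : ∀ x ∈ box L', χ x = 1)
    {E B : ℝ} (hB : ∀ x, |E - V x| ≤ B) :
    E * ∑ n ∈ K, ‖c n‖ ^ 2
      - (1 + δ) * ∑ n ∈ K, kin (momentum (gridPoint M κ)) n * ‖c n‖ ^ 2
      - (inner ℂ (trigPoly K c) (W (trigPoly K c))).re
      - (3 / 2 * ((1 + δ⁻¹) * A ^ 2) + B * (((M : ℝ) ^ 3)⁻¹ * K.card) * ((M : ℝ) ^ 3 - L' ^ 3))
    ≤ E * ‖toBox L (fun x => χ x * blochWave M κ K c x)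
        (hχ.mul (contDiff_blochWave M κ K c)).1.continuous‖ ^ 2
      - 1 / 2 * ∑ i, ‖toBox L (partialDeriv i fun x => χ x * blochWave M κ K c x)
        (continuous_partialDeriv (hχ.mul (contDiff_blochWave M κ K c)).1 i)‖ ^ 2
      - (inner ℂ (toBox L (fun x => χ x * blochWave M κ K c x)
          (hχ.mul (contDiff_blochWave M κ K c)).1.continuous)
        (Wb (toBox L (fun x => χ x * blochWave M κ K c x)
          (hχ.mul (contDiff_blochWave M κ K c)).1.continuous))).re := by
  set w := blochWave M κ K c with hw
  have hwc : Continuous w := (contDiff_blochWave M κ K c).continuous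
  have hFc : Continuous fun x => χ x * w x := (hχ.mul (contDiff_blochWave M κ K c)).1.continuous
  have hA0 : 0 ≤ A := (norm_nonneg _).trans (hA 0 0)
  have hS0 : 0 ≤ ∑ n ∈ K, ‖c n‖ ^ 2 := by positivity
  have hgrad : 1 / 2 * ∑ i, ‖toBox L (partialDeriv i fun x => χ x * w x)
        (continuous_partialDeriv (hχ.mul (contDiff_blochWave M κ K c)).1 i)‖ ^ 2
      ≤ (1 + δ) * ∑ n ∈ K, kin (momentum (gridPoint M κ)) n * ‖c n‖ ^ 2
        + 3 / 2 * ((1 + δ⁻¹) * A ^ 2) := by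
    have h1 := Finset.sum_le_sum fun i (_ : i ∈ Finset.univ) =>
      norm_partialDeriv_trial_le hM hLM κ K c hχ hχr hA hδ i
    rw [Finset.sum_add_distrib, ← Finset.mul_sum, Finset.sum_comm] at h1
    have h2 : ∑ n ∈ K, ∑ i, waveVec M κ n i ^ 2 * ‖c n‖ ^ 2
        = 2 * ∑ n ∈ K, kin (momentum (gridPoint M κ)) n * ‖c n‖ ^ 2 := by
      rw [Finset.mul_sum]
      refine Finset.sum_congr rfl fun n _ => ?_
      rw [momentum_gridPoint, ← Finset.sum_mul]
      ring
    have h3 : (1 + δ⁻¹) * A ^ 2 * ∑ n ∈ K, ‖c n‖ ^ 2 ≤ (1 + δ⁻¹) * A ^ 2 :=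
      mul_le_of_le_one_right (by positivity) hc
    rw [h2] at h1
    simp only [Finset.sum_const, Finset.card_univ, Fintype.card_fin, nsmul_eq_mul] at h1
    push_cast at h1
    linarith
  have hpot : E * ‖toBox L (fun x => χ x * w x) hFc‖ ^ 2
      - (inner ℂ (toBox L (fun x => χ x * w x) hFc) (Wb (toBox L (fun x => χ x * w x) hFc))).re
      = ∫ x in box L, (E - V x) * ‖χ x * w x‖ ^ 2 := by
    have h1 : inner ℂ (toBox L (fun x => χ x * w x) hFc) (Wb (toBox L (fun x => χ x * w x) hFc))
        = ((∫ x in box L, V x * ‖χ x * w x‖ ^ 2 : ℝ) : ℂ) := by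
      rw [inner_toBox, ← integral_complex_ofReal]
      refine integral_congr_ae ?_
      filter_upwards [hWb (toBox L (fun x => χ x * w x) hFc), coeFn_toBox L hFc] with x h1 h2
      rw [h1, h2]
      have := Complex.mul_conj (χ x * w x)
      rw [Complex.normSq_eq_norm_sq] at this
      push_cast at this ⊢
      linear_combination (V x : ℂ) * this
    rw [h1, Complex.ofReal_re, norm_toBox_sq, ← integral_const_mul, ← integral_sub
      (continuous_integrable_box L (F := fun x => E * ‖χ x * w x‖ ^ 2)
        (continuous_const.mul (hFc.norm.pow 2)))
      (continuous_integrable_box L (F := fun x => V x * ‖χ x * w x‖ ^ 2)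
        (hV.mul (hFc.norm.pow 2)))]
    refine integral_congr_ae (Eventually.of_forall fun x => ?_)
    simp only
    ring
  have hM1 : ∫ x in box M, (E - V x) * ‖w x‖ ^ 2
      = E * ∑ n ∈ K, ‖c n‖ ^ 2 - (inner ℂ (trigPoly K c) (W (trigPoly K c))).re := by
    rw [← integral_norm_blochWave_sq hM κ K c,
      ← integral_mul_norm_blochWave_sq hM κ K c hV hper hW, ← integral_const_mul, ← integral_sub
      (continuous_integrable_box M (F := fun x => E * ‖w x‖ ^ 2)
        (continuous_const.mul (hwc.norm.pow 2)))
      (continuous_integrable_box M (F := fun x => V x * ‖w x‖ ^ 2)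
        (hV.mul (hwc.norm.pow 2)))]
    refine integral_congr_ae (Eventually.of_forall fun x => ?_)
    simp only
    ring
  have h4 := integral_trial_ge hM hLM κ K c hχ hχr (U := fun x => E - V x)
    (continuous_const.sub hV) hB hL' hLL' hχ1 hc
  rw [hM1] at h4
  linarith

end Box

/-- The condition `θ L ≥ 1` absorbs rounding `L` up to an integer: `(1 - θ) L ≥ (1 - 2θ) m`, and `(1
- 2θ)³ ≥ 1 - 6θ`. -/
theorem cube_sub_cube_le {θ L m : ℝ} (hθ : 0 < θ) (hθ1 : θ ≤ 1 / 2) (hL : 1 / θ ≤ L) (hLm : L ≤ m)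
    (hm : m ≤ L + 1) : m ^ 3 - ((1 - θ) * L) ^ 3 ≤ 6 * θ * m ^ 3 := by
  have hL0 : 0 < L := lt_of_lt_of_le (by positivity) hL
  have h1 : 1 ≤ θ * L := by rw [div_le_iff₀ hθ] at hL; linarith
  have h2 : (1 - 2 * θ) * m ≤ (1 - θ) * L := by nlinarith
  have h3 : ((1 - 2 * θ) * m) ^ 3 ≤ ((1 - θ) * L) ^ 3 :=
    pow_le_pow_left₀ (mul_nonneg (by linarith) (by linarith)) h2 3
  have h4 : (1 - 6 * θ) * m ^ 3 ≤ ((1 - 2 * θ) * m) ^ 3 := by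
    rw [mul_pow]
    have hm0 : 0 ≤ m := by linarith
    refine mul_le_mul_of_nonneg_right ?_ (by positivity)
    nlinarith [mul_pos hθ hθ]
  linarith

section Box

variable {V : Space → ℝ} (hV : Continuous V)
    (hper : ∀ (m : Fin 3 → ℤ) (x : Space), V (x + WithLp.toLp 2 (fun i => (m i : ℝ))) = V x)
    {W : TorusL2 →L[ℂ] TorusL2} (hWs : IsSelfAdjoint W)
    (hW : ∀ u : TorusL2, W u =ᵐ[torusMeasure] fun t => (onTorus V t : ℂ) * u t)

include hV hper hW

/-- The Riesz means of the box are bounded below by localized Bloch waves. -/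
theorem riesz_box_ge_of_cutoff {L : ℝ} (hL : 0 < L) {M : ℕ} (hM : 0 < M) (hLM : L ≤ M)
    {Wb : BoxL2 L →L[ℂ] BoxL2 L}
    (hWb : ∀ u : BoxL2 L, Wb u =ᵐ[volume.restrict (box L)] fun x => (V x : ℂ) * u x)
    (D : SpectralResolution (diagGraph (sineBasis hL) (dirichletLevel L) Wb))
    {χ : Space → ℂ} (hχ : IsTest L χ) (hχr : ∀ x, ∃ r : ℝ, 0 ≤ r ∧ r ≤ 1 ∧ χ x = r)
    {A : ℝ} (hA : ∀ i x, ‖partialDeriv i χ x‖ ≤ A) {δ ε R : ℝ} (hδ : 0 < δ)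
    {L' : ℝ} (hL' : 0 ≤ L') (hLL' : L' ≤ L) (hχ1 : ∀ x ∈ box L', χ x = 1)
    {E B : ℝ} (hB : ∀ x, |E - V x| ≤ B) (hε : 0 < ε)
    (hε1 : ε ≤ 1) (hR : 0 < R) (hRε : |E| + ‖W‖ ≤ R * ε ^ 2) {K : Finset (Fin 3 → ℤ)}
    (hK : ∀ n : Fin 3 → ℤ, ∑ i, (n i : ℝ) ^ 2 ≤ R → n ∈ K) {η : ℝ}
    (hη : (|E| + 2 * ‖W‖) * ε + δ * (|E| + ‖W‖) + (3 / 2 * ((1 + δ⁻¹) * A ^ 2) +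
      B * (((M : ℝ) ^ 3)⁻¹ * K.card) * ((M : ℝ) ^ 3 - L' ^ 3)) ≤ η) :
    ∑ κ ∈ grid M, ((fibRes hWs (momentum (gridPoint M κ))).riesz E - η *
      ((fibRes hWs (momentum (gridPoint M κ))).below E).card) ≤ D.riesz E := by
  classical
  let S : grid M → Type := fun κ => (fibRes hWs (momentum (gridPoint M κ))).below E
  let u : (Σ κ : grid M, (fibRes hWs (momentum (gridPoint M κ))).below E) → TorusL2 :=
    fun a => (fibRes hWs (momentum (gridPoint M a.1))).v a.2
  let c : (Σ κ : grid M, (fibRes hWs (momentum (gridPoint M κ))).below E) → (Fin 3 → ℤ) → ℂ :=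
    fun a n => inner ℂ (fourierBasis n) (u a)
  have hu : ∀ a, ‖u a‖ = 1 := fun a => (fibRes hWs (momentum (gridPoint M a.1))).v.orthonormal.1 _
  have hc : ∀ a, ∑ n ∈ K, ‖c a n‖ ^ 2 ≤ 1 := fun a => by
    have := sum_norm_inner_le K (u a)
    rwa [hu, one_pow] at this
  have htest : ∀ a, IsTest L fun x => χ x * blochWave M a.1 K (c a) x :=
    fun a => hχ.mul (contDiff_blochWave _ _ _ _)
  have hsob := fun a => (testPairs L).le_topologicalClosure (mem_testPairs (htest a))
  obtain ⟨T, hT, hTn⟩ := exists_mulOperator (volume.restrict (box L)) (F := χ)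
    hχ.1.continuous.aestronglyMeasurable zero_le_one fun x => by
      obtain ⟨r, hr0, hr1, hr⟩ := hχr x
      rw [hr, Complex.norm_real, Real.norm_eq_abs, abs_of_nonneg hr0]
      exact hr1
  have hconj : ∀ x, (starRingEnd ℂ) (χ x) = χ x := fun x => by
    obtain ⟨r, -, -, hr⟩ := hχr x
    rw [hr, Complex.conj_ofReal]
  -- The variational bound uses the kinetic energy in the sine basis; `summable_dirichletLevel`
  -- bounds it by the gradient energy estimated for the trial functions.
  have hmain := D.sum_form_le_riesz
    (fun a => toBox L (fun x => χ x * blochWave M a.1 K (c a) x) (htest a).1.continuous)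
    (fun a => ∑' n, dirichletLevel L n * ‖inner ℂ (sineBasis hL n)
      (toBox L (fun x => χ x * blochWave M a.1 K (c a) x) (htest a).1.continuous)‖ ^ 2)
    (fun a => (summable_dirichletLevel hL (hsob a)).1.hasSum) (fun g => ?_) E
  · refine le_trans ?_ hmain
    rw [← Finset.sum_coe_sort, Fintype.sum_sigma]
    refine Finset.sum_le_sum fun κ _ => ?_
    rw [SpectralResolution.riesz, ← Finset.sum_coe_sort, mul_comm, ← Fintype.card_coe,
      ← nsmul_eq_mul, ← Finset.card_univ, ← Finset.sum_const, ← Finset.sum_sub_distrib]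
    refine Finset.sum_le_sum fun j _ => ?_
    have hk : momentum (gridPoint M κ) ∈ brillouinZone :=
      momentum_mem_of_mem_cell ((gridPoint_mem_cell_iff hM).2 κ.2)
    have h1 := form_truncation_ge hk (fibRes hWs (momentum (gridPoint M κ)))
      ((fibRes hWs (momentum (gridPoint M κ))).mem_below.1 j.2) hδ hε hε1 hR hRε hK
    have h2 := form_trial_ge hV hper hW hM hLM hWb κ K (hc ⟨κ, j⟩) hχ hχr hA hδ hL' hLL' hχ1 hB
    have h3 := (summable_dirichletLevel hL (hsob ⟨κ, j⟩)).2
    rw [truncation_apply] at h1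
    simp only [c, u] at h2 h3 ⊢
    linarith
  · have h1 : ∀ a, inner ℂ (toBox L (fun x => χ x * blochWave M a.1 K (c a) x)
        (htest a).1.continuous) g = inner ℂ (truncation K (u a)) (floquet hM hLM a.1 (T g)) :=
      fun a => by
        rw [truncation_apply]
        exact inner_trial hM hLM a.1 K (c a) hχ (hT g) hconj
    simp only [h1]
    rw [Fintype.sum_sigma]
    have h2 : ∀ κ : grid M, ∑ j : (fibRes hWs (momentum (gridPoint M κ))).below E,
        ‖inner ℂ (truncation K (u ⟨κ, j⟩)) (floquet hM hLM κ (T g))‖ ^ 2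
          ≤ ‖floquet hM hLM κ (T g)‖ ^ 2 := fun κ =>
      sum_norm_inner_apply_le ((fibRes hWs (momentum (gridPoint M κ))).v.orthonormal.comp _
        Subtype.val_injective) (norm_truncation_le K) _
    refine (Finset.sum_le_sum fun κ _ => h2 κ).trans ?_
    rw [Finset.sum_coe_sort (grid M) fun κ => ‖floquet hM hLM κ (T g)‖ ^ 2, sum_norm_floquet]
    refine pow_le_pow_left₀ (norm_nonneg _) ?_ 2
    refine (T.le_opNorm g).trans ?_
    exact mul_le_of_le_one_left (norm_nonneg _) hTn

-- The parameters are fixed in order: `δ` and the mode radius `R`, hence `K`; then the boundary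
-- layer `θ`, which depends on the size of `K`; then `L`, large enough to make the gradient of the
-- rescaled cutoff negligible. Each of four errors takes a quarter of `η` per eigenvector, and a
-- fiber contributes at most `fibBound W E` eigenvectors.
set_option maxHeartbeats 1000000 in
theorem riesz_box_ge (E : ℝ) {ε : ℝ} (hε : 0 < ε) : ∀ᶠ L : ℝ in atTop, ∀ (hL : 0 < L)
    {Wb : BoxL2 L →L[ℂ] BoxL2 L}
    (_ : ∀ u : BoxL2 L, Wb u =ᵐ[volume.restrict (box L)] fun x => (V x : ℂ) * u x)
    (D : SpectralResolution (diagGraph (sineBasis hL) (dirichletLevel L) Wb)),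
    ∑ κ ∈ grid ⌈L⌉₊, (fibRes hWs (momentum (gridPoint ⌈L⌉₊ κ))).riesz E - ε * (⌈L⌉₊ : ℝ) ^ 3
      ≤ D.riesz E := by
  obtain ⟨C0, hC0, hVC, -⟩ := exists_potential_bound hV hper
  set η := ε / (fibBound W E + 1) with hη
  have hη0 : 0 < η := by positivity
  set b := |E| + ‖W‖ with hb
  have hb0 : 0 ≤ b := by positivity
  set δ := η / (4 * (b + 1)) with hδ
  have hδ0 : 0 < δ := by positivity
  set b2 := |E| + 2 * ‖W‖ with hb2
  have hb20 : 0 ≤ b2 := by positivity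
  set ε1 := min 1 (η / (4 * (b2 + 1))) with hε1
  have hε10 : 0 < ε1 := lt_min one_pos (by positivity)
  set R := (b + 1) / ε1 ^ 2 with hR
  have hR0 : 0 < R := by positivity
  have hRb : b ≤ R * ε1 ^ 2 := by
    rw [hR, div_mul_cancel₀ _ (by positivity)]; linarith
  obtain ⟨K, hKR⟩ : ∃ K : Finset (Fin 3 → ℤ), ∀ n : Fin 3 → ℤ,
      ∑ i, (n i : ℝ) ^ 2 ≤ R → n ∈ K :=
    ⟨(finite_setOf_sum_sq_le R).toFinset, fun n hn => by
      rw [Set.Finite.mem_toFinset]; exact hn⟩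
  set B := |E| + C0 with hB
  have hB0 : 0 ≤ B := by positivity
  have hBV : ∀ x, |E - V x| ≤ B := fun x =>
    (abs_sub _ _).trans (add_le_add le_rfl (hVC x))
  set θ := min (1 / 2) (η / (24 * (B * K.card + 1))) with hθ
  have hθ0 : 0 < θ := lt_min (by norm_num) (by positivity)
  have hθ1 : θ ≤ 1 / 2 := min_le_left _ _
  obtain ⟨χ, hχ, hχr, hχ1, C, hC0', hC⟩ := exists_cutoff hθ0 (by linarith)
  have hlim : Tendsto (fun L : ℝ => 3 / 2 * ((1 + δ⁻¹) * (L⁻¹ * C) ^ 2)) atTop (𝓝 0) := by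
    have h1 := ((tendsto_inv_atTop_zero (𝕜 := ℝ)).mul_const C).pow 2
    have h2 := (h1.const_mul (1 + δ⁻¹)).const_mul (3 / 2)
    simpa using h2
  filter_upwards [hlim.eventually (gt_mem_nhds (by positivity : (0 : ℝ) < η / 4)),
    eventually_ge_atTop (1 / θ)] with L hLs hLθ hL Wb hWb D
  set M := ⌈L⌉₊ with hMdef
  have hM : 0 < M := Nat.ceil_pos.2 hL
  have hLM : L ≤ M := Nat.le_ceil L
  have hML : (M : ℝ) ≤ L + 1 := (Nat.ceil_lt_add_one hL.le).le
  have hM3 : (0 : ℝ) < (M : ℝ) ^ 3 := by positivity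
  have hA : ∀ i x, ‖partialDeriv i (fun x => χ (L⁻¹ • x)) x‖ ≤ L⁻¹ * C := fun i x => by
    rw [partialDeriv_comp_smul hχ.1, norm_mul, Complex.norm_real, Real.norm_eq_abs,
      abs_of_nonneg (by positivity)]
    exact mul_le_mul_of_nonneg_left (hC i _) (by positivity)
  have hχ1' : ∀ x ∈ box ((1 - θ) * L), χ (L⁻¹ • x) = 1 := fun x hx => by
    refine hχ1 _ fun i => ?_
    obtain ⟨h1, h2⟩ := hx i
    simp only [PiLp.smul_apply, smul_eq_mul]
    rw [← div_eq_inv_mul, lt_div_iff₀ hL, div_lt_iff₀ hL]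
    constructor <;> linarith
  have hvol := cube_sub_cube_le hθ0 hθ1 hLθ hLM hML
  have e1 : b2 * ε1 ≤ η / 4 := by
    have h1 : ε1 ≤ η / (4 * (b2 + 1)) := min_le_right _ _
    rw [le_div_iff₀ (by positivity)] at h1
    linarith
  have e2 : δ * b ≤ η / 4 := by
    have h1 : δ * (4 * (b + 1)) = η := by rw [hδ]; field_simp
    linarith
  have e3 : B * (((M : ℝ) ^ 3)⁻¹ * K.card) * ((M : ℝ) ^ 3 - ((1 - θ) * L) ^ 3) ≤ η / 4 := by
    have h1 : B * (((M : ℝ) ^ 3)⁻¹ * K.card) * ((M : ℝ) ^ 3 - ((1 - θ) * L) ^ 3)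
        ≤ B * (((M : ℝ) ^ 3)⁻¹ * K.card) * (6 * θ * (M : ℝ) ^ 3) :=
      mul_le_mul_of_nonneg_left hvol (by positivity)
    have h2 : B * (((M : ℝ) ^ 3)⁻¹ * K.card) * (6 * θ * (M : ℝ) ^ 3)
        = 6 * (B * K.card) * θ := by field_simp
    have h3 : θ ≤ η / (24 * (B * K.card + 1)) := min_le_right _ _
    rw [le_div_iff₀ (by positivity)] at h3
    linarith
  have key := riesz_box_ge_of_cutoff hV hper hWs hW hL hM hLM hWb D (hχ.comp_inv_smul hL)
    (fun x => hχr _) hA hδ0 (mul_nonneg (by linarith) hL.le) (L' := (1 - θ) * L)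
    (by nlinarith) hχ1' hBV hε10 (min_le_left _ _) hR0 hRb hKR (η := η) (by linarith)
  refine le_trans ?_ key
  rw [Finset.sum_sub_distrib, ← Finset.mul_sum]
  refine sub_le_sub_left ?_ _
  have hcard : ∑ κ ∈ grid M, (((fibRes hWs (momentum (gridPoint M κ))).below E).card : ℝ)
      ≤ (M : ℝ) ^ 3 * (fibBound W E + 1) := by
    have h1 : ∀ κ ∈ grid M, (((fibRes hWs (momentum (gridPoint M κ))).below E).card : ℝ)
        ≤ fibBound W E + 1 := fun κ hκ => by
      rw [← SpectralResolution.eigenCount_eq]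
      have := fib_eigenCount_le_fibBound hWs
        (momentum_mem_of_mem_cell ((gridPoint_mem_cell_iff hM).2 hκ)) E
      have h2 : (eigenCount (fib W (momentum (gridPoint M κ))) E : ℝ) ≤ fibBound W E := by
        exact_mod_cast this
      linarith
    refine (Finset.sum_le_sum h1).trans (le_of_eq ?_)
    rw [Finset.sum_const, card_grid, nsmul_eq_mul]
    push_cast
    ring
  calc η * ∑ κ ∈ grid M, (((fibRes hWs (momentum (gridPoint M κ))).below E).card : ℝ)
      ≤ η * ((M : ℝ) ^ 3 * (fibBound W E + 1)) := mul_le_mul_of_nonneg_left hcard hη0.le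
    _ = ε * (M : ℝ) ^ 3 := by rw [hη]; field_simp

end Box

/-! ### The thermodynamic limit of the integrated density of states -/

-- The grid points are the points of the lattice `M⁻¹ ℤ³` in the cell, whose boundary is null
-- because the cell is convex; the sums are Riemann sums.
open scoped Pointwise in
theorem tendsto_sum_grid {F : (Fin 3 → ℝ) → ℝ} (hF : Continuous F) :
    Tendsto (fun M : ℕ => (∑ κ ∈ grid M, F (gridPoint M κ)) / (M : ℝ) ^ 3) atTop
      (𝓝 (∫ y in cell, F y)) := by
  have hb : Bornology.IsBounded cell := by
    have : cell ⊆ Set.univ.pi fun _ : Fin 3 => Set.Icc (-(1 / 2) : ℝ) (1 / 2) :=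
      Set.pi_mono fun _ _ => Set.Ico_subset_Icc_self
    exact (isCompact_univ_pi fun _ => isCompact_Icc).isBounded.subset this
  have hfr : volume (frontier cell) = 0 := by
    have hc : Convex ℝ cell := convex_pi fun _ _ => convex_Ico _ _
    exact hc.addHaar_frontier _
  have h := tendsto_tsum_div_pow_atTop_integral cell F hF hb measurableSet_cell hfr
  refine h.congr' ?_
  filter_upwards [eventually_gt_atTop 0] with M hM
  have hM' : (M : ℝ) ≠ 0 := by positivity
  have : NeZero M := ⟨hM.ne'⟩
  rw [Fintype.card_fin]
  congr 1
  have hinj : Set.InjOn (gridPoint M) (grid M) := fun κ _ κ' _ h => by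
    ext i
    have := congrFun h i
    simp only [gridPoint] at this
    rw [div_left_inj' hM'] at this
    exact_mod_cast this
  have hset : cell ∩ (M : ℝ)⁻¹ • (Submodule.span ℤ (Set.range (Pi.basisFun ℝ (Fin 3))) :
      Set (Fin 3 → ℝ)) = ((grid M).image (gridPoint M) : Finset (Fin 3 → ℝ)) := by
    ext y
    rw [Finset.coe_image, Set.mem_inter_iff, Set.mem_image]
    constructor
    · rintro ⟨hy, hyL⟩
      rw [← Submodule.coe_pointwise_smul, SetLike.mem_coe,
        BoxIntegral.unitPartition.mem_smul_span_iff] at hyL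
      choose κ hκ using hyL
      have e : gridPoint M κ = y := by
        ext i
        rw [gridPoint, div_eq_iff hM']
        have := hκ i
        simp at this
        linarith
      exact ⟨κ, (gridPoint_mem_cell_iff hM).1 (e ▸ hy), e⟩
    · rintro ⟨κ, hκ, rfl⟩
      refine ⟨(gridPoint_mem_cell_iff hM).2 hκ, ?_⟩
      rw [← Submodule.coe_pointwise_smul, SetLike.mem_coe,
        BoxIntegral.unitPartition.mem_smul_span_iff]
      intro i
      refine ⟨κ i, ?_⟩
      simp [gridPoint]
      field_simp
  have h2 := Finset.tsum_subtype ((grid M).image (gridPoint M)) F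
  rw [Finset.sum_image hinj] at h2
  rw [← h2]
  exact tsum_congr_set_coe F hset

theorem freq_mul_le {L T : ℝ} (hL : 0 < L) (hT : 0 ≤ T) {n : Fin 3 → ℕ}
    (h : dirichletLevel L n ≤ T) (i : Fin 3) : (n i : ℝ) + 1 ≤ L * (1 + T) := by
  have h1 := (freq_sq_le L n i).trans (mul_le_mul_of_nonneg_left h zero_le_two)
  have hpi := Real.pi_gt_three
  have h2 : freq L (n i) ≤ 3 * (1 + T) := by
    by_contra hcon
    rw [not_le] at hcon
    nlinarith
  unfold freq at h2
  rw [div_le_iff₀ hL] at h2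
  nlinarith

theorem ncard_dirichletLevel_le {L T : ℝ} (hL : 0 < L) (hT : 0 ≤ T) :
    {n | dirichletLevel L n ≤ T}.Finite ∧
      ({n | dirichletLevel L n ≤ T}.ncard : ℝ) ≤ (L * (1 + T)) ^ 3 := by
  have hsub : {n | dirichletLevel L n ≤ T} ⊆
      (Fintype.piFinset fun _ : Fin 3 => Finset.range ⌊L * (1 + T)⌋₊ : Finset (Fin 3 → ℕ)) := by
    intro n hn
    rw [Finset.mem_coe, Fintype.mem_piFinset]
    intro i
    rw [Finset.mem_range]
    have := freq_mul_le hL hT hn i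
    exact Nat.lt_of_succ_le (Nat.le_floor (by push_cast; exact this))
  refine ⟨(Finset.finite_toSet _).subset hsub, ?_⟩
  have h1 := Set.ncard_le_ncard hsub (Finset.finite_toSet _)
  rw [Set.ncard_coe_finset, Fintype.card_piFinset] at h1
  simp only [Finset.card_range, Finset.prod_const, Finset.card_univ, Fintype.card_fin] at h1
  calc ({n | dirichletLevel L n ≤ T}.ncard : ℝ) ≤ ((⌊L * (1 + T)⌋₊ ^ 3 : ℕ) : ℝ) := by
        exact_mod_cast h1
    _ = (⌊L * (1 + T)⌋₊ : ℝ) ^ 3 := by push_cast; rfl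
    _ ≤ (L * (1 + T)) ^ 3 := pow_le_pow_left₀ (by positivity)
        (Nat.floor_le (by positivity)) 3

theorem finite_dirichletLevel_le {L : ℝ} (hL : 0 < L) (E : ℝ) :
    {n | dirichletLevel L n ≤ E}.Finite :=
  (ncard_dirichletLevel_le hL (abs_nonneg E)).1.subset fun _ hn => le_trans hn (le_abs_self E)

section Limit

variable {V : Space → ℝ} (hV : Continuous V)
    (hper : ∀ (m : Fin 3 → ℤ) (x : Space), V (x + WithLp.toLp 2 (fun i => (m i : ℝ))) = V x)

/-- The Dirichlet Hamiltonian has a spectral resolution. -/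
theorem exists_boxResolution (hV : Continuous V) {C : ℝ} (hC : ∀ x, |V x| ≤ C) {L : ℝ}
    (hL : 0 < L) :
    ∃ Wb : BoxL2 L →L[ℂ] BoxL2 L,
      (∀ u : BoxL2 L, Wb u =ᵐ[volume.restrict (box L)] fun x => (V x : ℂ) * u x) ∧ ‖Wb‖ ≤ C ∧
      dirichletGraph V L = diagGraph (sineBasis hL) (dirichletLevel L) Wb ∧
      Nonempty (SpectralResolution (diagGraph (sineBasis hL) (dirichletLevel L) Wb)) := by
  obtain ⟨Wb, hWb, hn⟩ := exists_mulOperator (volume.restrict (box L)) (F := fun x => (V x : ℂ))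
    (Complex.continuous_ofReal.comp hV).aestronglyMeasurable ((abs_nonneg _).trans (hC 0))
    (fun x => by simpa using hC x)
  exact ⟨Wb, hWb, hn, dirichletGraph_eq hL hWb,
    diagGraph_nonempty_spectralResolution _ (dirichletLevel_nonneg L)
      (finite_dirichletLevel_le hL) (isSelfAdjoint_of_coeFn_mul hWb)⟩

/-- Comparison with the free Dirichlet count, itself bounded by counting lattice points in a cube.
The bound does not depend on `L` and is polynomial in `E`, as domination against the thermal kernel
requires. -/
theorem boxIDS_le (hV : Continuous V) {C : ℝ} (hC : ∀ x, |V x| ≤ C) {L : ℝ} (hL : 0 < L) (E : ℝ) :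
    boxIDS V L E ≤ (1 + |E| + C) ^ 3 := by
  obtain ⟨Wb, hWb, hn, hG, ⟨D⟩⟩ := exists_boxResolution hV hC hL
  have hC0 : 0 ≤ C := (abs_nonneg _).trans (hC 0)
  have h1 := eigenCount_diagGraph_le D (finite_dirichletLevel_le hL) E
  obtain ⟨hfin, h2⟩ := ncard_dirichletLevel_le hL (T := |E| + C) (by positivity)
  have h3 : {n | dirichletLevel L n ≤ E + ‖Wb‖}.ncard ≤ {n | dirichletLevel L n ≤ |E| + C}.ncard :=
    Set.ncard_le_ncard (fun n hm => le_trans hm (add_le_add (le_abs_self E) hn)) hfin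
  rw [boxIDS, hG, div_le_iff₀ (by positivity)]
  calc (eigenCount (diagGraph (sineBasis hL) (dirichletLevel L) Wb) E : ℝ)
      ≤ ({n | dirichletLevel L n ≤ |E| + C}.ncard : ℝ) := by exact_mod_cast h1.trans h3
    _ ≤ (L * (1 + (|E| + C))) ^ 3 := h2
    _ = (1 + |E| + C) ^ 3 * L ^ 3 := by ring

variable {W : TorusL2 →L[ℂ] TorusL2} (hWs : IsSelfAdjoint W)
    (hW : ∀ u : TorusL2, W u =ᵐ[torusMeasure] fun t => (onTorus V t : ℂ) * u t)
include hV hper hWs hW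

/-- Difference quotients of the box Riesz mean between `E` and a nearby `F` bound the count at `E`
from one side. They converge to those of `rieszDensity`, which `ids W F` controls, and continuity of
`ids W` lets `F` approach `E`. -/
theorem tendsto_boxIDS (E : ℝ) : Tendsto (fun L => boxIDS V L E) atTop (𝓝 (ids W E)) := by
  obtain ⟨C, hC0, hC, -⟩ := exists_potential_bound hV hper
  let S : ℝ → ℕ → ℝ := fun F M =>
    (∑ κ ∈ grid M, (fibRes hWs (momentum (gridPoint M κ))).riesz F) / (M : ℝ) ^ 3
  have hS : ∀ F, Tendsto (S F) atTop (𝓝 (rieszDensity hWs F)) := fun F =>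
    tendsto_sum_grid (F := fun y => (fibRes hWs (momentum y)).riesz F)
      ((continuous_fib_riesz hWs F).comp continuous_momentum)
  have hceil : Tendsto (fun L : ℝ => ⌈L⌉₊) atTop atTop := tendsto_nat_ceil_atTop
  have hratio : Tendsto (fun L : ℝ => ((⌈L⌉₊ : ℝ) / L) ^ 3) atTop (𝓝 1) := by
    simpa using (tendsto_nat_ceil_div_atTop (R := ℝ)).pow 3
  -- The upper estimate is used at `G` and the lower one at `F`, with no order assumed between them;
  -- exchanging the two gives the opposite bound.
  have hbase : ∀ F G : ℝ, ∀ ε > 0, ∀ᶠ L : ℝ in atTop, ∀ (hL : 0 < L)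
      {Wb : BoxL2 L →L[ℂ] BoxL2 L}
      (_ : ∀ u : BoxL2 L, Wb u =ᵐ[volume.restrict (box L)] fun x => (V x : ℂ) * u x)
      (D : SpectralResolution (diagGraph (sineBasis hL) (dirichletLevel L) Wb)),
      (D.riesz G - D.riesz F) / L ^ 3 < rieszDensity hWs G - rieszDensity hWs F + ε := by
    intro F G ε hε
    have hlim : Tendsto (fun L : ℝ => ((⌈L⌉₊ : ℝ) / L) ^ 3 * (S G ⌈L⌉₊ - S F ⌈L⌉₊ + ε / 2)) atTop
        (𝓝 (1 * (rieszDensity hWs G - rieszDensity hWs F + ε / 2))) :=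
      hratio.mul ((((hS G).comp hceil).sub ((hS F).comp hceil)).add_const _)
    have hev : ∀ᶠ L : ℝ in atTop, ((⌈L⌉₊ : ℝ) / L) ^ 3 * (S G ⌈L⌉₊ - S F ⌈L⌉₊ + ε / 2) <
        rieszDensity hWs G - rieszDensity hWs F + ε :=
      hlim.eventually_lt_const (by linarith)
    have hge := riesz_box_ge hV hper hWs hW F (half_pos hε)
    refine (hge.and hev).mono fun L h12 hL Wb hWb D => ?_
    obtain ⟨h1, h2⟩ := h12
    have hM : 0 < ⌈L⌉₊ := Nat.ceil_pos.2 hL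
    have h3 := h1 hL hWb D
    have h4 := riesz_box_le hV hper hWs hW hL hM (Nat.le_ceil L) hWb D G
    have hM3 : (0 : ℝ) < (⌈L⌉₊ : ℝ) ^ 3 := by positivity
    have e : ((⌈L⌉₊ : ℝ) / L) ^ 3 * (S G ⌈L⌉₊ - S F ⌈L⌉₊ + ε / 2) =
        (∑ κ ∈ grid ⌈L⌉₊, (fibRes hWs (momentum (gridPoint ⌈L⌉₊ κ))).riesz G -
          ∑ κ ∈ grid ⌈L⌉₊, (fibRes hWs (momentum (gridPoint ⌈L⌉₊ κ))).riesz F +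
            ε / 2 * (⌈L⌉₊ : ℝ) ^ 3) / L ^ 3 := by
      simp only [S]
      field_simp
    rw [e] at h2
    have hL3 : 0 < L ^ 3 := by positivity
    exact ((div_le_div_iff_of_pos_right hL3).2 (by linarith)).trans_lt h2
  have hcont := (continuous_ids hWs).tendsto E
  rw [tendsto_order]
  constructor
  · intro a ha
    have hev : ∀ᶠ F in 𝓝[<] E, a < ids W F :=
      (hcont.mono_left nhdsWithin_le_nhds).eventually (lt_mem_nhds ha)
    obtain ⟨F, hF, hFE⟩ := (hev.and self_mem_nhdsWithin).exists
    have hFE : F < E := hFE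
    set δ := E - F with hδ
    have hδ0 : 0 < δ := by linarith
    set ε := δ * (ids W F - a) / 2 with hε
    have hε0 : 0 < ε := by have := sub_pos.2 hF; positivity
    filter_upwards [hbase E F ε hε0, eventually_gt_atTop 0] with L h1 hL
    obtain ⟨Wb, hWb, hn, hG, ⟨D⟩⟩ := exists_boxResolution hV hC hL
    have h2 := h1 hL hWb D
    have h3 := (D.riesz_add_sub F hδ0.le).2
    have h4 := (rieszDensity_add_sub hWs F hδ0.le).1
    rw [show F + δ = E by rw [hδ]; ring] at h3 h4
    rw [boxIDS, hG, lt_div_iff₀ (by positivity)]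
    rw [div_lt_iff₀ (by positivity)] at h2
    have hL3 : 0 < L ^ 3 := by positivity
    have h5 : δ * (a * L ^ 3) <
        δ * (eigenCount (diagGraph (sineBasis hL) (dirichletLevel L) Wb) E : ℝ) := by
      have h6 : rieszDensity hWs F - rieszDensity hWs E + ε ≤ -(δ * a) - ε := by
        have : ε + ε = δ * (ids W F - a) := by rw [hε]; ring
        linarith
      have h7 := mul_le_mul_of_nonneg_right h6 hL3.le
      have h8 : 0 < ε * L ^ 3 := by positivity
      linarith
    exact lt_of_mul_lt_mul_left h5 hδ0.le
  · intro a ha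
    have hev : ∀ᶠ F in 𝓝[>] E, ids W F < a :=
      (hcont.mono_left nhdsWithin_le_nhds).eventually (gt_mem_nhds ha)
    obtain ⟨F, hF, hFE⟩ := (hev.and self_mem_nhdsWithin).exists
    have hFE : E < F := hFE
    set δ := F - E with hδ
    have hδ0 : 0 < δ := by linarith
    set ε := δ * (a - ids W F) / 2 with hε
    have hε0 : 0 < ε := by have := sub_pos.2 hF; positivity
    filter_upwards [hbase E F ε hε0, eventually_gt_atTop 0] with L h1 hL
    obtain ⟨Wb, hWb, hn, hG, ⟨D⟩⟩ := exists_boxResolution hV hC hL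
    have h2 := h1 hL hWb D
    have h3 := (D.riesz_add_sub E hδ0.le).1
    have h4 := (rieszDensity_add_sub hWs E hδ0.le).2
    rw [show E + δ = F by rw [hδ]; ring] at h3 h4
    rw [boxIDS, hG, div_lt_iff₀ (by positivity)]
    rw [div_lt_iff₀ (by positivity)] at h2
    have hL3 : 0 < L ^ 3 := by positivity
    have h5 : δ * (eigenCount (diagGraph (sineBasis hL) (dirichletLevel L) Wb) E : ℝ)
        < δ * (a * L ^ 3) := by
      have h6 : rieszDensity hWs F - rieszDensity hWs E + ε ≤ δ * a - ε := by
        have : ε + ε = δ * (a - ids W F) := by rw [hε]; ring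
        linarith
      have h7 := mul_le_mul_of_nonneg_right h6 hL3.le
      have h8 : 0 < ε * L ^ 3 := by positivity
      linarith
    exact lt_of_mul_lt_mul_left h5 hδ0.le

end Limit

/-! ### Thermal smearing of an integrated density of states -/

/-- Minus the derivative of the Fermi function `1 / (1 + e^{βx})`. -/
def thermal (β x : ℝ) : ℝ := β * Real.exp (β * x) / (1 + Real.exp (β * x)) ^ 2

theorem thermal_pos {β : ℝ} (hβ : 0 < β) (x : ℝ) : 0 < thermal β x := by
  unfold thermal; positivity

theorem continuous_thermal (β : ℝ) : Continuous (thermal β) := by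
  unfold thermal
  exact Continuous.div (by fun_prop) (by fun_prop) fun x => by positivity

theorem thermal_neg (β x : ℝ) : thermal β (-x) = thermal β x := by
  unfold thermal
  rw [mul_neg, Real.exp_neg]
  have := (Real.exp_pos (β * x)).ne'
  have h2 : (1 + Real.exp (β * x)) ≠ 0 := by positivity
  have h3 : (1 + (Real.exp (β * x))⁻¹) ≠ 0 := by positivity
  field_simp
  ring

theorem thermal_le_exp_neg {β : ℝ} (hβ : 0 < β) (x : ℝ) :
    thermal β x ≤ β * Real.exp (-(β * x)) := by
  unfold thermal
  rw [div_le_iff₀ (by positivity), mul_assoc]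
  refine mul_le_mul_of_nonneg_left ?_ hβ.le
  have h := Real.exp_pos (β * x)
  rw [Real.exp_neg]
  have e : (Real.exp (β * x))⁻¹ * (1 + Real.exp (β * x)) ^ 2
      = (Real.exp (β * x))⁻¹ + 2 + Real.exp (β * x) := by
    field_simp
    ring
  rw [e]
  have := inv_pos.2 h
  linarith

theorem thermal_le {β : ℝ} (hβ : 0 < β) (x : ℝ) :
    thermal β x ≤ β * Real.exp (-(β * |x|)) := by
  rcases abs_cases x with ⟨h, -⟩ | ⟨h, -⟩
  · rw [h]; exact thermal_le_exp_neg hβ x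
  · rw [h, ← thermal_neg]; exact thermal_le_exp_neg hβ (-x)

theorem integrable_exp_neg_mul_abs {b : ℝ} (hb : 0 < b) :
    Integrable fun x : ℝ => Real.exp (-(b * |x|)) := by
  rw [← integrableOn_univ, ← Set.Iic_union_Ioi (a := (0 : ℝ))]
  refine IntegrableOn.union ?_ ?_
  · refine (integrableOn_exp_mul_Iic hb 0).congr_fun (fun x hx => ?_) measurableSet_Iic
    simp only [abs_of_nonpos (Set.mem_Iic.1 hx)]
    ring_nf
  · refine (integrableOn_exp_mul_Ioi (neg_lt_zero.2 hb) 0).congr_fun (fun x hx => ?_)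
      measurableSet_Ioi
    simp only [abs_of_pos (Set.mem_Ioi.1 hx)]
    ring_nf

/-- From `t³ / 6 ≤ exp t`. Part of the exponential decay of the thermal kernel pays for cubic
growth. -/
theorem add_abs_pow_le {b R : ℝ} (hb : 0 < b) (hR : 0 ≤ R) (x : ℝ) :
    (R + |x|) ^ 3 ≤ 6 / b ^ 3 * Real.exp (b * R) * Real.exp (b * |x|) := by
  have h := Real.pow_div_factorial_le_exp (x := b * (R + |x|)) (by positivity) 3
  rw [mul_assoc, ← Real.exp_add, ← mul_add, div_mul_eq_mul_div, le_div_iff₀ (by positivity)]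
  rw [div_le_iff₀ (by positivity)] at h
  norm_num [Nat.factorial] at h
  linarith [mul_pow b (R + |x|) 3]

theorem integrable_pow_mul_thermal {β R : ℝ} (hβ : 0 < β) (hR : 0 ≤ R) :
    Integrable fun x : ℝ => (R + |x|) ^ 3 * thermal β x := by
  have hb : 0 < β / 2 := half_pos hβ
  refine Integrable.mono' ((integrable_exp_neg_mul_abs hb).const_mul
    (6 / (β / 2) ^ 3 * Real.exp (β / 2 * R) * β))
    ((Continuous.mul (by fun_prop) (continuous_thermal β)).aestronglyMeasurable)
    (ae_of_all _ fun x => ?_)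
  have ht := (thermal_pos hβ x).le
  rw [Real.norm_of_nonneg (by positivity)]
  calc (R + |x|) ^ 3 * thermal β x
      ≤ (6 / (β / 2) ^ 3 * Real.exp (β / 2 * R) * Real.exp (β / 2 * |x|))
          * (β * Real.exp (-(β * |x|))) :=
        mul_le_mul (add_abs_pow_le hb hR x) (thermal_le hβ x) ht (by positivity)
    _ = 6 / (β / 2) ^ 3 * Real.exp (β / 2 * R) * β *
          (Real.exp (β / 2 * |x|) * Real.exp (-(β * |x|))) := by ring
    _ = 6 / (β / 2) ^ 3 * Real.exp (β / 2 * R) * β * Real.exp (-(β / 2 * |x|)) := by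
        rw [← Real.exp_add]; ring_nf

theorem integrable_thermal {β : ℝ} (hβ : 0 < β) : Integrable (thermal β) := by
  refine Integrable.mono' (integrable_pow_mul_thermal hβ (zero_le_one' ℝ))
    (continuous_thermal β).aestronglyMeasurable (ae_of_all _ fun x => ?_)
  rw [Real.norm_of_nonneg (thermal_pos hβ x).le]
  exact le_mul_of_one_le_left (thermal_pos hβ x).le
    (one_le_pow₀ (by linarith [abs_nonneg x]))

theorem hasDerivAt_fermi (β x : ℝ) :
    HasDerivAt (fun x => -(1 + Real.exp (β * x))⁻¹) (thermal β x) x := by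
  have h1 : HasDerivAt (fun x => Real.exp (β * x)) (Real.exp (β * x) * (β * 1)) x :=
    ((hasDerivAt_id x).const_mul β).exp
  have h2 := ((h1.const_add 1).inv (by positivity)).neg
  refine h2.congr_deriv ?_
  unfold thermal
  ring

theorem tendsto_fermi {β : ℝ} (hβ : 0 < β) :
    Tendsto (fun x => -(1 + Real.exp (β * x))⁻¹) atTop (𝓝 0) := by
  have h : Tendsto (fun x : ℝ => 1 + Real.exp (β * x)) atTop atTop :=
    tendsto_atTop_add_const_left _ _ (Real.tendsto_exp_atTop.comp (tendsto_id.const_mul_atTop hβ))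
  simpa using h.inv_tendsto_atTop.neg

theorem integral_Ioi_thermal {β : ℝ} (hβ : 0 < β) (a : ℝ) :
    ∫ x in Set.Ioi a, thermal β x = (1 + Real.exp (β * a))⁻¹ := by
  rw [integral_Ioi_of_hasDerivAt_of_tendsto' (fun x _ => hasDerivAt_fermi β x)
    (integrable_thermal hβ).integrableOn (tendsto_fermi hβ)]
  ring

theorem integral_Iic_thermal {β : ℝ} (hβ : 0 < β) (a : ℝ) :
    ∫ x in Set.Iic (-a), thermal β x = (1 + Real.exp (β * a))⁻¹ := by
  rw [← integral_Ioi_thermal hβ, ← neg_neg a, ← integral_comp_neg_Iic]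
  simp only [neg_neg, thermal_neg]

theorem integral_thermal {β : ℝ} (hβ : 0 < β) : ∫ x, thermal β x = 1 := by
  rw [← intervalIntegral.integral_Iic_add_Ioi (b := -0) (integrable_thermal hβ).integrableOn
    (integrable_thermal hβ).integrableOn, integral_Iic_thermal hβ, integral_Ioi_thermal hβ]
  norm_num

/-- The convolution of `N` with the derivative of the Fermi function, at chemical potential `μ`. -/
def smeared (N : ℝ → ℝ) (β μ : ℝ) : ℝ := ∫ x, N (μ + x) * thermal β x

theorem integrable_mul_thermal {N : ℝ → ℝ} (hN : Measurable N) {R : ℝ} (hR : 0 ≤ R)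
    (hb : ∀ E, |N E| ≤ (R + |E|) ^ 3) {β : ℝ} (hβ : 0 < β) (μ : ℝ) :
    Integrable fun x => N (μ + x) * thermal β x := by
  refine Integrable.mono' (integrable_pow_mul_thermal hβ (R := R + |μ|) (by positivity))
    ((hN.comp (measurable_const_add μ)).mul (continuous_thermal β).measurable).aestronglyMeasurable
    (ae_of_all _ fun x => ?_)
  rw [norm_mul, Real.norm_of_nonneg (thermal_pos hβ x).le, Real.norm_eq_abs]
  refine mul_le_mul_of_nonneg_right ((hb _).trans ?_) (thermal_pos hβ x).le
  refine pow_le_pow_left₀ (by positivity) ?_ 3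
  linarith [abs_add_le μ x]

/-! ### The finite volume density -/

section Density

variable {V : Space → ℝ} {C : ℝ}

theorem occupation_exp (L β μ : ℝ) (j : ℕ) :
    occupation V L β (Real.exp (β * μ)) j
      = (1 + Real.exp (β * (boxEigenvalue V L j - μ)))⁻¹ := by
  unfold occupation
  rw [← Real.exp_add, show β * μ + -β * boxEigenvalue V L j
    = -(β * (boxEigenvalue V L j - μ)) by ring, Real.exp_neg]
  have := (Real.exp_pos (β * (boxEigenvalue V L j - μ))).ne'
  field_simp
  exact add_comm _ _

theorem boxEigenvalue_le_iff (hV : Continuous V) (hC : ∀ x, |V x| ≤ C) {L : ℝ} (hL : 0 < L)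
    {m : ℕ} (hm : 1 ≤ m) (E : ℝ) :
    boxEigenvalue V L m ≤ E ↔ m ≤ eigenCount (dirichletGraph V L) E := by
  obtain ⟨Wb, hWb, hn, hG, ⟨D⟩⟩ := exists_boxResolution hV hC hL
  rw [boxEigenvalue, hG]
  exact D.nthEigenvalue_le_iff (infinite_of_hilbertBasis (sineBasis hL) D.v) hm E

theorem eigenCount_box_mono (hV : Continuous V) (hC : ∀ x, |V x| ≤ C) {L : ℝ} (hL : 0 < L) :
    Monotone fun E => eigenCount (dirichletGraph V L) E := by
  obtain ⟨Wb, hWb, hn, hG, ⟨D⟩⟩ := exists_boxResolution hV hC hL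
  rw [hG]
  exact fun E F h => D.eigenCount_mono h

theorem boxIDS_nonneg {L : ℝ} (hL : 0 < L) (E : ℝ) : 0 ≤ boxIDS V L E := by
  unfold boxIDS; positivity

theorem measurable_boxIDS (hV : Continuous V) (hC : ∀ x, |V x| ≤ C) {L : ℝ} (hL : 0 < L) :
    Measurable (boxIDS V L) := by
  have h : Monotone (boxIDS V L) := fun E F h =>
    div_le_div_of_nonneg_right (Nat.cast_le.2 (eigenCount_box_mono hV hC hL h)) (by positivity)
  exact h.measurable

theorem abs_boxIDS_le (hV : Continuous V) (hC : ∀ x, |V x| ≤ C) {L : ℝ} (hL : 0 < L) (E : ℝ) :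
    |boxIDS V L E| ≤ (1 + C + |E|) ^ 3 := by
  rw [abs_of_nonneg (boxIDS_nonneg hL E), add_right_comm]
  exact boxIDS_le hV hC hL E

/-- Each Fermi factor is the integral of the thermal kernel over `[e_j - μ, ∞)`. Summing over `j`
under the integral counts the eigenvalues up to `μ + x`. -/
theorem hasSum_occupation (hV : Continuous V) (hC : ∀ x, |V x| ≤ C) {L : ℝ} (hL : 0 < L) {β : ℝ}
    (hβ : 0 < β) (μ : ℝ) :
    HasSum (fun j : ℕ => occupation V L β (Real.exp (β * μ)) (j + 1))
      (L ^ 3 * smeared (boxIDS V L) β μ) := by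
  have hC0 : 0 ≤ C := (abs_nonneg _).trans (hC 0)
  have hL3 : L ^ 3 ≠ 0 := by positivity
  let F : ℕ → ℝ → ℝ := fun j =>
    Set.indicator (Set.Ici (boxEigenvalue V L (j + 1) - μ)) (thermal β)
  have hFsum : ∀ x, HasSum (fun j => F j x) (L ^ 3 * (boxIDS V L (μ + x) * thermal β x)) := by
    intro x
    have hF : ∀ j, F j x
        = if j < eigenCount (dirichletGraph V L) (μ + x) then thermal β x else 0 := by
      intro j
      simp only [F, Set.indicator_apply, Set.mem_Ici, sub_le_iff_le_add',
        boxEigenvalue_le_iff hV hC hL (Nat.le_add_left 1 j), Nat.succ_le_iff]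
    have h := hasSum_sum_of_ne_finset_zero (L := .unconditional ℕ) (f := fun j => F j x)
      (s := Finset.range (eigenCount (dirichletGraph V L) (μ + x))) (fun j hj => by
        rw [hF, if_neg (by simpa using hj)])
    convert h using 1
    rw [Finset.sum_congr rfl fun j hj => (hF j).trans (if_pos (Finset.mem_range.1 hj)),
      Finset.sum_const, Finset.card_range, nsmul_eq_mul, boxIDS]
    field_simp
  have hint : Integrable fun x => L ^ 3 * (boxIDS V L (μ + x) * thermal β x) :=
    (integrable_mul_thermal (measurable_boxIDS hV hC hL) (R := 1 + C) (by positivity)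
      (abs_boxIDS_le hV hC hL) hβ μ).const_mul _
  have hFn : ∀ j x, 0 ≤ F j x := fun j x =>
    Set.indicator_nonneg (fun x _ => (thermal_pos hβ x).le) x
  have key := hasSum_integral_of_dominated_convergence (μ := volume) (F := F)
    (f := fun x => L ^ 3 * (boxIDS V L (μ + x) * thermal β x)) F
    (fun j => ((continuous_thermal β).measurable.indicator measurableSet_Ici).aestronglyMeasurable)
    (fun j => ae_of_all _ fun x => (Real.norm_of_nonneg (hFn j x)).le)
    (ae_of_all _ fun x => (hFsum x).summable)
    (by simpa only [fun x => (hFsum x).tsum_eq] using hint)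
    (ae_of_all _ hFsum)
  rw [integral_const_mul] at key
  refine key.congr_fun fun j => ?_
  rw [integral_indicator measurableSet_Ici, integral_Ici_eq_integral_Ioi,
    integral_Ioi_thermal hβ, occupation_exp]

theorem density_eq_smeared (hV : Continuous V) (hC : ∀ x, |V x| ≤ C) {L : ℝ} (hL : 0 < L) {β : ℝ}
    (hβ : 0 < β) (μ : ℝ) :
    density V L β (Real.exp (β * μ)) = smeared (boxIDS V L) β μ := by
  rw [density, (hasSum_occupation hV hC hL hβ μ).tsum_eq]
  have : L ^ 3 ≠ 0 := by positivity
  field_simp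

theorem tendsto_density (hV : Continuous V) (hC : ∀ x, |V x| ≤ C) {n : ℝ → ℝ}
    (hn : ∀ E, Tendsto (fun L => boxIDS V L E) atTop (𝓝 (n E))) {β : ℝ} (hβ : 0 < β) (μ : ℝ) :
    Tendsto (fun L => density V L β (Real.exp (β * μ))) atTop (𝓝 (smeared n β μ)) := by
  have hC0 : 0 ≤ C := (abs_nonneg _).trans (hC 0)
  have h : Tendsto (fun L => smeared (boxIDS V L) β μ) atTop (𝓝 (smeared n β μ)) := by
    refine tendsto_integral_filter_of_dominated_convergence
      (fun x => (1 + C + |μ| + |x|) ^ 3 * thermal β x) ?_ ?_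
      (integrable_pow_mul_thermal hβ (by positivity)) (ae_of_all _ fun x => (hn _).mul_const _)
    · filter_upwards [eventually_gt_atTop 0] with L hL
      exact (integrable_mul_thermal (measurable_boxIDS hV hC hL) (R := 1 + C) (by positivity)
        (abs_boxIDS_le hV hC hL) hβ μ).aestronglyMeasurable
    · filter_upwards [eventually_gt_atTop 0] with L hL
      refine ae_of_all _ fun x => ?_
      rw [norm_mul, Real.norm_of_nonneg (thermal_pos hβ x).le, Real.norm_eq_abs]
      refine mul_le_mul_of_nonneg_right ((abs_boxIDS_le hV hC hL _).trans ?_)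
        (thermal_pos hβ x).le
      refine pow_le_pow_left₀ (by positivity) ?_ 3
      linarith [abs_add_le μ x]
  refine h.congr' ?_
  filter_upwards [eventually_gt_atTop 0] with L hL
  exact (density_eq_smeared hV hC hL hβ μ).symm

end Density

/-! ### Chemical potential and Fermi energy of a continuous density of states -/

section Fermi

variable {n : ℝ → ℝ} {R c : ℝ}

theorem smeared_mono (hmono : Monotone n) (hR : 0 ≤ R) (hb : ∀ E, |n E| ≤ (R + |E|) ^ 3)
    {β : ℝ} (hβ : 0 < β) : Monotone (smeared n β) := fun μ ν h =>
  integral_mono (integrable_mul_thermal hmono.measurable hR hb hβ μ)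
    (integrable_mul_thermal hmono.measurable hR hb hβ ν) fun x =>
      mul_le_mul_of_nonneg_right (hmono (by linarith)) (thermal_pos hβ x).le

/-- The kernel is positive and `n` is continuous and monotone, so equality at `μ < ν` would make `n`
periodic with period `ν - μ`; this is impossible for a function that vanishes far to the left and is
unbounded. -/
theorem smeared_strictMono (hcont : Continuous n) (hmono : Monotone n) (hR : 0 ≤ R)
    (hb : ∀ E, |n E| ≤ (R + |E|) ^ 3) (hzero : ∀ E < -c, n E = 0)
    (htop : Tendsto n atTop atTop) {β : ℝ} (hβ : 0 < β) : StrictMono (smeared n β) := by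
  intro μ ν h
  refine lt_of_le_of_ne (smeared_mono hmono hR hb hβ h.le) fun heq => ?_
  have hi := fun μ => integrable_mul_thermal hmono.measurable hR hb hβ μ
  have h0 : ∫ x, (n (ν + x) * thermal β x - n (μ + x) * thermal β x) = 0 := by
    rw [integral_sub (hi ν) (hi μ)]
    exact sub_eq_zero.2 heq.symm
  have hnn : ∀ x, 0 ≤ n (ν + x) * thermal β x - n (μ + x) * thermal β x := fun x =>
    sub_nonneg.2 (mul_le_mul_of_nonneg_right (hmono (by linarith)) (thermal_pos hβ x).le)
  have hct := continuous_thermal β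
  have hae := (integral_eq_zero_iff_of_nonneg hnn ((hi ν).sub (hi μ))).1 h0
  have hall := (Continuous.ae_eq_iff_eq volume (by fun_prop) continuous_zero).1 hae
  have hper : ∀ E, n (E + (ν - μ)) = n E := by
    intro E
    have h1 := congrFun hall (E - μ)
    simp only [Pi.zero_apply, ← sub_mul] at h1
    have h2 := (mul_eq_zero.1 h1).resolve_right (thermal_pos hβ _).ne'
    rw [show ν + (E - μ) = E + (ν - μ) by ring, show μ + (E - μ) = E by ring] at h2
    linarith
  have hper' : ∀ k : ℕ, n (-c - 1 + k * (ν - μ)) = 0 := by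
    intro k
    induction k with
    | zero => simpa using hzero (-c - 1) (by linarith)
    | succ k ih =>
      rw [← ih, ← hper (-c - 1 + k * (ν - μ))]
      congr 1
      push_cast
      ring
  have hlim : Tendsto (fun k : ℕ => n (-c - 1 + k * (ν - μ))) atTop atTop :=
    htop.comp (tendsto_atTop_add_const_left _ _
      ((tendsto_natCast_atTop_atTop (R := ℝ)).atTop_mul_const (sub_pos.2 h)))
  obtain ⟨k, hk⟩ := (hlim.eventually_gt_atTop 0).exists
  exact hk.ne' (hper' k)

theorem continuous_smeared (hcont : Continuous n) (hR : 0 ≤ R) (hb : ∀ E, |n E| ≤ (R + |E|) ^ 3)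
    {β : ℝ} (hβ : 0 < β) : Continuous (smeared n β) := by
  rw [continuous_iff_continuousAt]
  intro μ₀
  refine tendsto_integral_filter_of_dominated_convergence
      (fun x => (R + (|μ₀| + 1) + |x|) ^ 3 * thermal β x) ?_ ?_
      (integrable_pow_mul_thermal hβ (by positivity)) (ae_of_all _ fun x => ?_)
  · exact Eventually.of_forall fun μ =>
      (integrable_mul_thermal hcont.measurable hR hb hβ μ).aestronglyMeasurable
  · filter_upwards [Metric.ball_mem_nhds μ₀ one_pos] with μ hμ
    refine ae_of_all _ fun x => ?_
    rw [Metric.mem_ball, Real.dist_eq] at hμ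
    rw [norm_mul, Real.norm_of_nonneg (thermal_pos hβ x).le, Real.norm_eq_abs]
    refine mul_le_mul_of_nonneg_right ((hb _).trans ?_) (thermal_pos hβ x).le
    refine pow_le_pow_left₀ (by positivity) ?_ 3
    have h1 := abs_add_le μ x
    have h2 := abs_sub_abs_le_abs_sub μ μ₀
    linarith
  · have : Continuous fun μ => n (μ + x) * thermal β x := by fun_prop
    exact this.tendsto μ₀

theorem tendsto_smeared_atBot (hmono : Monotone n) (hn : ∀ E, 0 ≤ n E) (hR : 0 ≤ R)
    (hb : ∀ E, |n E| ≤ (R + |E|) ^ 3) (hzero : ∀ E < -c, n E = 0) {β : ℝ} (hβ : 0 < β) :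
    Tendsto (smeared n β) atBot (𝓝 0) := by
  rw [← integral_zero ℝ ℝ]
  refine tendsto_integral_filter_of_dominated_convergence
      (fun x => n (0 + x) * thermal β x) ?_ ?_
      (integrable_mul_thermal hmono.measurable hR hb hβ 0) (ae_of_all _ fun x => ?_)
  · exact Eventually.of_forall fun μ =>
      (integrable_mul_thermal hmono.measurable hR hb hβ μ).aestronglyMeasurable
  · filter_upwards [eventually_le_atBot 0] with μ hμ
    refine ae_of_all _ fun x => ?_
    rw [Real.norm_of_nonneg (mul_nonneg (hn _) (thermal_pos hβ x).le)]
    exact mul_le_mul_of_nonneg_right (hmono (by linarith)) (thermal_pos hβ x).le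
  · refine tendsto_const_nhds.congr' ?_
    filter_upwards [eventually_lt_atBot (-c - x)] with μ hμ
    rw [hzero _ (by linarith), zero_mul]

/-- Half the mass of the kernel lies at positive `x`. Since `n` will be unbounded, so is its
smearing. -/
theorem half_le_smeared (hmono : Monotone n) (hn : ∀ E, 0 ≤ n E) (hR : 0 ≤ R)
    (hb : ∀ E, |n E| ≤ (R + |E|) ^ 3) {β : ℝ} (hβ : 0 < β) (μ : ℝ) :
    n μ / 2 ≤ smeared n β μ := by
  have hi := integrable_mul_thermal hmono.measurable hR hb hβ μ
  calc n μ / 2 = ∫ x in Set.Ioi 0, n μ * thermal β x := by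
        rw [integral_const_mul, integral_Ioi_thermal hβ]; norm_num; ring
    _ ≤ ∫ x in Set.Ioi 0, n (μ + x) * thermal β x :=
        setIntegral_mono_on ((integrable_thermal hβ).const_mul _).integrableOn hi.integrableOn
          measurableSet_Ioi fun x hx => mul_le_mul_of_nonneg_right
            (hmono (by linarith [Set.mem_Ioi.1 hx])) (thermal_pos hβ x).le
    _ ≤ smeared n β μ := setIntegral_le_integral hi
        (ae_of_all _ fun x => mul_nonneg (hn _) (thermal_pos hβ x).le)

theorem exists_smeared_eq (hcont : Continuous n) (hmono : Monotone n) (hn : ∀ E, 0 ≤ n E)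
    (hR : 0 ≤ R) (hb : ∀ E, |n E| ≤ (R + |E|) ^ 3) (hzero : ∀ E < -c, n E = 0)
    (htop : Tendsto n atTop atTop) {β : ℝ} (hβ : 0 < β) {ρ : ℝ} (hρ : 0 < ρ) :
    ∃ μ, smeared n β μ = ρ := by
  obtain ⟨a, ha⟩ := ((tendsto_smeared_atBot hmono hn hR hb hzero hβ).eventually
    (gt_mem_nhds hρ)).exists
  obtain ⟨b, hb'⟩ := (htop.eventually_ge_atTop (2 * ρ)).exists
  have h := half_le_smeared hmono hn hR hb hβ b
  exact mem_range_of_exists_le_of_exists_ge (continuous_smeared hcont hR hb hβ)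
    ⟨a, ha.le⟩ ⟨b, by linarith⟩

variable {ρ a b : ℝ}

theorem integral_indicator_thermal {β : ℝ} (hβ : 0 < β) (r d s : ℝ) (e : ℝ) :
    ∫ x, ((Set.Ioi d).indicator (fun x => r * thermal β x) x
      - (Set.Iic (-s)).indicator (fun x => e * thermal β x) x)
      = r * (1 + Real.exp (β * d))⁻¹ - e * (1 + Real.exp (β * s))⁻¹ := by
  rw [integral_sub (((integrable_thermal hβ).const_mul r).indicator measurableSet_Ioi)
    (((integrable_thermal hβ).const_mul e).indicator measurableSet_Iic),
    integral_indicator measurableSet_Ioi, integral_indicator measurableSet_Iic,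
    integral_const_mul, integral_const_mul, integral_Ioi_thermal hβ, integral_Iic_thermal hβ]

/-- Above the midpoint of the level set, the smeared density eventually exceeds the level. -/
theorem eventually_lt_smeared (hmono : Monotone n) (hn : ∀ E, 0 ≤ n E)
    (hR : 0 ≤ R) (hb : ∀ E, |n E| ≤ (R + |E|) ^ 3) (hab : a ≤ b)
    (hlev : ∀ E, n E = ρ ↔ E ∈ Set.Icc a b) {δ : ℝ} (hδ : 0 < δ) :
    ∀ᶠ β in atTop, ρ < smeared n β ((a + b) / 2 + δ) := by
  have hna : n a = ρ := (hlev a).2 ⟨le_rfl, hab⟩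
  have hnb : n b = ρ := (hlev b).2 ⟨hab, le_rfl⟩
  have hρ : 0 ≤ ρ := hna ▸ hn a
  -- Seen from `(a + b)/2 + δ`, the gain beyond distance `d` on the right is at least `r > 0`, with
  -- weight of order `exp (-β d)`. A loss, at most `ρ`, occurs only beyond distance `d + δ` on the
  -- left, with a weight smaller by a factor `exp (-β δ)`.
  set d := (b - a) / 2 with hd
  have hd0 : 0 ≤ d := by rw [hd]; linarith
  set r := n (b + δ) - ρ with hr
  have hr0 : 0 < r := by
    refine sub_pos.2 (lt_of_le_of_ne (hnb ▸ hmono (by linarith)) fun h => ?_)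
    have := ((hlev (b + δ)).1 h.symm).2
    linarith
  have hlim : Tendsto (fun β : ℝ => Real.exp (β * δ)) atTop atTop :=
    Real.tendsto_exp_atTop.comp (tendsto_id.atTop_mul_const hδ)
  filter_upwards [eventually_gt_atTop 0, hlim.eventually_gt_atTop (2 * ρ / r)] with β hβ hexp
  have hi := integrable_mul_thermal hmono.measurable hR hb hβ ((a + b) / 2 + δ)
  have hk := integrable_thermal hβ
  have hle := integral_mono
    (f := fun x => (Set.Ioi d).indicator (fun x => r * thermal β x) x
      - (Set.Iic (-(d + δ))).indicator (fun x => ρ * thermal β x) x)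
    (g := fun x => n ((a + b) / 2 + δ + x) * thermal β x - ρ * thermal β x)
    (((hk.const_mul r).indicator measurableSet_Ioi).sub
      ((hk.const_mul ρ).indicator measurableSet_Iic)) (hi.sub (hk.const_mul ρ)) (fun x => by
      have ht := (thermal_pos hβ x).le
      simp only [Set.indicator_apply, Set.mem_Ioi, Set.mem_Iic]
      rw [← sub_mul]
      by_cases h1 : d < x
      · rw [if_pos h1, if_neg (by linarith), sub_zero]
        refine mul_le_mul_of_nonneg_right ?_ ht
        have : n (b + δ) ≤ n ((a + b) / 2 + δ + x) := hmono (by rw [hd] at h1; linarith)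
        linarith
      · rw [if_neg h1]
        by_cases h2 : x ≤ -(d + δ)
        · rw [if_pos h2, zero_sub, ← neg_mul]
          exact mul_le_mul_of_nonneg_right (by linarith [hn ((a + b) / 2 + δ + x)]) ht
        · rw [if_neg h2, sub_zero]
          refine mul_nonneg ?_ ht
          have : n a ≤ n ((a + b) / 2 + δ + x) := hmono (by rw [hd] at h2; linarith)
          linarith)
  rw [integral_indicator_thermal hβ, integral_sub hi (hk.const_mul ρ), integral_const_mul,
    integral_thermal hβ, mul_one] at hle
  refine sub_pos.1 (lt_of_lt_of_le ?_ hle)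
  rw [sub_pos, ← div_eq_mul_inv, ← div_eq_mul_inv, div_lt_div_iff₀ (by positivity) (by positivity),
    mul_add β, Real.exp_add]
  have h1 : 1 ≤ Real.exp (β * d) := Real.one_le_exp (by positivity)
  rw [div_lt_iff₀ hr0] at hexp
  have h2 := mul_lt_mul_of_pos_right hexp (Real.exp_pos (β * d))
  nlinarith [mul_le_mul_of_nonneg_left h1 hρ]

/-- The factor `exp x` will absorb the growth of `n`; for `β ≥ 2` the integral keeps the order `exp
(-β s)` because `β / (β - 1) ≤ 2`. -/
theorem integral_Ioi_exp_mul_thermal_le {β : ℝ} (hβ : 2 ≤ β) (s : ℝ) :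
    IntegrableOn (fun x => Real.exp x * thermal β x) (Set.Ioi s) ∧
    ∫ x in Set.Ioi s, Real.exp x * thermal β x ≤ 2 * Real.exp s * Real.exp (-(β * s)) := by
  have hβ0 : 0 < β := by linarith
  have hdom : ∀ x, Real.exp x * thermal β x ≤ β * Real.exp ((1 - β) * x) := by
    intro x
    calc Real.exp x * thermal β x ≤ Real.exp x * (β * Real.exp (-(β * x))) :=
          mul_le_mul_of_nonneg_left (thermal_le_exp_neg hβ0 x) (Real.exp_pos x).le
      _ = β * (Real.exp x * Real.exp (-(β * x))) := by ring
      _ = β * Real.exp ((1 - β) * x) := by rw [← Real.exp_add]; ring_nf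
  have hint := (integrableOn_exp_mul_Ioi (show 1 - β < 0 by linarith) s).const_mul β
  have hi : IntegrableOn (fun x => Real.exp x * thermal β x) (Set.Ioi s) := by
    refine Integrable.mono' hint
      (Real.continuous_exp.mul (continuous_thermal β)).aestronglyMeasurable
      (ae_of_all _ fun x => ?_)
    rw [Real.norm_of_nonneg (mul_nonneg (Real.exp_pos x).le (thermal_pos hβ0 x).le)]
    exact hdom x
  refine ⟨hi, (integral_mono hi hint hdom).trans ?_⟩
  rw [integral_const_mul, integral_exp_mul_Ioi (by linarith), mul_assoc 2, ← Real.exp_add,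
    show s + -(β * s) = (1 - β) * s by ring, neg_div, ← div_neg, neg_sub, mul_div_assoc',
    div_le_iff₀ (by linarith)]
  nlinarith [Real.exp_pos ((1 - β) * s)]

/-- Below the midpoint of the level set, the smeared density eventually is less than the level. -/
theorem eventually_smeared_lt (hmono : Monotone n) (hn : ∀ E, 0 ≤ n E)
    (hR : 0 ≤ R) (hb : ∀ E, |n E| ≤ (R + |E|) ^ 3) (hab : a ≤ b)
    (hlev : ∀ E, n E = ρ ↔ E ∈ Set.Icc a b) {δ : ℝ} (hδ : 0 < δ) :
    ∀ᶠ β in atTop, smeared n β ((a + b) / 2 - δ) < ρ := by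
  have hna : n a = ρ := (hlev a).2 ⟨le_rfl, hab⟩
  have hnb : n b = ρ := (hlev b).2 ⟨hab, le_rfl⟩
  have hρ : 0 ≤ ρ := hna ▸ hn a
  set d := (b - a) / 2 with hd
  have hd0 : 0 ≤ d := by rw [hd]; linarith
  set r := ρ - n (a - δ) with hr
  have hr0 : 0 < r := by
    refine sub_pos.2 (lt_of_le_of_ne (hna ▸ hmono (by linarith)) fun h => ?_)
    have := ((hlev (a - δ)).1 h).1
    linarith
  -- The mirror image of the preceding estimate, except that the excess above `b` is not bounded by
  -- a constant: it is dominated by `A exp x`. Its weight beyond `s` is still of order `exp (-β s)`,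
  -- so the deficit `r` beyond distance `d` wins.
  set s := d + δ with hs
  set A := 6 / (1 : ℝ) ^ 3 * Real.exp (1 * (R + |(a + b) / 2 - δ|)) with hA
  have hA0 : 0 < A := by positivity
  have hlim : Tendsto (fun β : ℝ => Real.exp (β * δ)) atTop atTop :=
    Real.tendsto_exp_atTop.comp (tendsto_id.atTop_mul_const hδ)
  filter_upwards [eventually_ge_atTop 2, hlim.eventually_gt_atTop (4 * A * Real.exp s / r)]
    with β hβ2 hexp
  have hβ : 0 < β := by linarith
  have hi := integrable_mul_thermal hmono.measurable hR hb hβ ((a + b) / 2 - δ)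
  have hk := integrable_thermal hβ
  obtain ⟨he, hle2⟩ := integral_Ioi_exp_mul_thermal_le hβ2 s
  have hle := integral_mono
    (f := fun x => n ((a + b) / 2 - δ + x) * thermal β x - ρ * thermal β x)
    (g := fun x => (Set.Ioi s).indicator (fun x => A * (Real.exp x * thermal β x)) x
      - (Set.Iic (-d)).indicator (fun x => r * thermal β x) x)
    (hi.sub (hk.const_mul ρ)) (((integrable_indicator_iff measurableSet_Ioi).2 (he.const_mul A)).sub
      ((hk.const_mul r).indicator measurableSet_Iic)) (fun x => by
      have ht := (thermal_pos hβ x).le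
      simp only [Set.indicator_apply, Set.mem_Ioi, Set.mem_Iic]
      rw [← sub_mul]
      by_cases h1 : s < x
      · rw [if_pos h1, if_neg (by linarith), sub_zero, ← mul_assoc]
        refine mul_le_mul_of_nonneg_right ?_ ht
        have hx : 0 < x := by linarith
        have h3 := add_abs_pow_le one_pos (R := R + |(a + b) / 2 - δ|) (by positivity) x
        rw [abs_of_pos hx, one_mul x] at h3
        have h4 : (R + |(a + b) / 2 - δ + x|) ^ 3 ≤ (R + |(a + b) / 2 - δ| + x) ^ 3 := by
          refine pow_le_pow_left₀ (by positivity) ?_ 3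
          have := abs_add_le ((a + b) / 2 - δ) x
          rw [abs_of_pos hx] at this
          linarith
        have h5 : n ((a + b) / 2 - δ + x) ≤ A * Real.exp x :=
          (le_abs_self _).trans ((hb _).trans (h4.trans h3))
        linarith
      · rw [if_neg h1]
        by_cases h2 : x ≤ -d
        · rw [if_pos h2, zero_sub, ← neg_mul]
          refine mul_le_mul_of_nonneg_right ?_ ht
          have : n ((a + b) / 2 - δ + x) ≤ n (a - δ) := hmono (by rw [hd] at h2; linarith)
          linarith
        · rw [if_neg h2, sub_zero]
          refine mul_nonpos_of_nonpos_of_nonneg ?_ ht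
          have : n ((a + b) / 2 - δ + x) ≤ n b := hmono (by rw [hs, hd] at h1; linarith)
          linarith)
  rw [integral_sub ((integrable_indicator_iff measurableSet_Ioi).2 (he.const_mul A))
      ((hk.const_mul r).indicator measurableSet_Iic), integral_indicator measurableSet_Ioi,
    integral_indicator measurableSet_Iic, integral_const_mul, integral_const_mul,
    integral_Iic_thermal hβ, integral_sub hi (hk.const_mul ρ), integral_const_mul,
    integral_thermal hβ, mul_one] at hle
  refine sub_neg.1 (lt_of_le_of_lt hle ?_)
  have h1 : 1 ≤ Real.exp (β * d) := Real.one_le_exp (by positivity)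
  have h3 : Real.exp (-(β * d)) / 2 ≤ (1 + Real.exp (β * d))⁻¹ := by
    rw [Real.exp_neg, div_eq_mul_inv, ← mul_inv]
    exact inv_anti₀ (by positivity) (by linarith)
  rw [div_lt_iff₀ hr0] at hexp
  have h4 : Real.exp (-(β * d)) = Real.exp (β * δ) * Real.exp (-(β * s)) := by
    rw [← Real.exp_add, hs]; ring_nf
  have h5 := mul_lt_mul_of_pos_right hexp (Real.exp_pos (-(β * s)))
  have h6 := mul_le_mul_of_nonneg_left h3 hr0.le
  have h7 := mul_le_mul_of_nonneg_left hle2 hA0.le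
  rw [h4] at h6
  nlinarith

/-- The zero temperature limit of the chemical potential is the midpoint of the level set. -/
theorem tendsto_chemicalPotential (hmono : Monotone n) (hn : ∀ E, 0 ≤ n E)
    (hR : 0 ≤ R) (hb : ∀ E, |n E| ≤ (R + |E|) ^ 3) (hab : a ≤ b)
    (hlev : ∀ E, n E = ρ ↔ E ∈ Set.Icc a b) {mu : ℝ → ℝ}
    (hmu : ∀ β, 0 < β → smeared n β (mu β) = ρ) :
    Tendsto mu atTop (𝓝 ((a + b) / 2)) := by
  rw [Metric.tendsto_nhds]
  intro δ hδ
  filter_upwards [eventually_gt_atTop 0, eventually_lt_smeared hmono hn hR hb hab hlev hδ,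
    eventually_smeared_lt hmono hn hR hb hab hlev hδ] with β hβ h1 h2
  rw [← hmu β hβ] at h1 h2
  have hm := smeared_mono hmono hR hb hβ
  have h3 := hm.reflect_lt h1
  have h4 := hm.reflect_lt h2
  rw [Real.dist_eq, abs_lt]
  constructor <;> linarith

end Fermi

/-! ### Bloch bands and level sets of the integrated density of states -/

theorem isCompact_brillouinZone : IsCompact brillouinZone := by
  have h : brillouinZone = (WithLp.toLp 2 : (Fin 3 → ℝ) → Space) ''
      (Set.univ.pi fun _ => Set.Icc (-Real.pi) Real.pi) := by
    ext k
    constructor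
    · exact fun hk => ⟨WithLp.ofLp k, fun i _ => hk i, rfl⟩
    · rintro ⟨y, hy, rfl⟩ i
      exact hy i trivial
  rw [h]
  exact (isCompact_univ_pi fun _ => isCompact_Icc).image (PiLp.continuous_toLp 2 _)

theorem nonempty_brillouinZone : brillouinZone.Nonempty :=
  ⟨0, fun _ => ⟨neg_nonpos.2 Real.pi_pos.le, Real.pi_pos.le⟩⟩

theorem isPreconnected_brillouinZone : IsPreconnected brillouinZone := by
  have h : Convex ℝ brillouinZone := by
    intro k hk l hl s t hs ht hst i
    exact convex_Icc (-Real.pi) Real.pi (hk i) (hl i) hs ht hst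
  exact h.isPreconnected

section Bands

variable {V : Space → ℝ} {W : TorusL2 →L[ℂ] TorusL2} (hWs : IsSelfAdjoint W)
    (hW : ∀ u : TorusL2, W u =ᵐ[torusMeasure] fun t => (onTorus V t : ℂ) * u t)
include hWs hW

omit hWs in
theorem blochEnergy_eq (m : ℕ) (k : Space) : blochEnergy V m k = nthEigenvalue (fib W k) m := by
  rw [blochEnergy, fiberGraph_eq hW k]

theorem continuous_blochEnergy {m : ℕ} (hm : 1 ≤ m) : Continuous (blochEnergy V m) := by
  rw [funext (blochEnergy_eq hW m)]
  exact continuous_fib_nth hWs hm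

theorem isLeast_bandMin {m : ℕ} (hm : 1 ≤ m) :
    IsLeast (blochEnergy V m '' brillouinZone) (bandMin V m) :=
  (isCompact_brillouinZone.image (continuous_blochEnergy hWs hW hm)).isLeast_sInf
    (nonempty_brillouinZone.image _)

theorem isGreatest_bandMax {m : ℕ} (hm : 1 ≤ m) :
    IsGreatest (blochEnergy V m '' brillouinZone) (bandMax V m) :=
  (isCompact_brillouinZone.image (continuous_blochEnergy hWs hW hm)).isGreatest_sSup
    (nonempty_brillouinZone.image _)

theorem exists_blochEnergy_eq {m : ℕ} (hm : 1 ≤ m) {E : ℝ} (h1 : bandMin V m ≤ E)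
    (h2 : E ≤ bandMax V m) : ∃ k ∈ brillouinZone, blochEnergy V m k = E := by
  obtain ⟨k, hk, hke⟩ := (isLeast_bandMin hWs hW hm).1
  obtain ⟨l, hl, hle⟩ := (isGreatest_bandMax hWs hW hm).1
  exact isPreconnected_brillouinZone.intermediate_value hk hl
    (continuous_blochEnergy hWs hW hm).continuousOn ⟨hke.le.trans h1, h2.trans hle.ge⟩

theorem le_ids_of_bandMax_le {m : ℕ} (hm : 1 ≤ m) {E : ℝ} (h : bandMax V m ≤ E) :
    (m : ℝ) ≤ ids W E := by
  refine ids_ge_of_forall hWs m fun y hy => (fib_nth_le_iff hWs _ hm E).1 ?_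
  rw [← blochEnergy_eq hW]
  exact ((isGreatest_bandMax hWs hW hm).2 ⟨_, momentum_mem_of_mem_cell hy, rfl⟩).trans h

theorem ids_le_of_lt_bandMin {m : ℕ} {E : ℝ} (h : E < bandMin V (m + 1)) :
    ids W E ≤ m := by
  have h1 : ∫ y in cell, (m : ℝ) = m := by simp [Measure.real, volume_cell]
  have := isFiniteMeasure_cell
  rw [ids, ← h1]
  refine setIntegral_mono_on (integrableOn_fibCount hWs E) (integrable_const _) measurableSet_cell
    fun y hy => ?_
  have hlt : ¬ m + 1 ≤ fibCount W E y := by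
    rw [fibCount, ← fib_nth_le_iff hWs _ (Nat.le_add_left 1 m) E, not_le,
      ← blochEnergy_eq hW]
    exact h.trans_le ((isLeast_bandMin hWs hW (Nat.le_add_left 1 m)).2
      ⟨_, momentum_mem_of_mem_cell hy, rfl⟩)
  exact_mod_cast (by omega : fibCount W E y ≤ m)

/-- At the band edge itself the count may exceed `m`; continuity of `ids W` carries the bound over
from lower energies. -/
theorem ids_le_of_le_bandMin {m : ℕ} {E : ℝ} (h : E ≤ bandMin V (m + 1)) : ids W E ≤ m := by
  have hc : Tendsto (ids W) (𝓝[<] E) (𝓝 (ids W E)) :=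
    ((continuous_ids hWs).tendsto E).mono_left nhdsWithin_le_nhds
  refine le_of_tendsto hc ?_
  filter_upwards [self_mem_nhdsWithin] with F hF
  exact ids_le_of_lt_bandMin hWs hW (lt_of_lt_of_le hF h)

/-- A degenerate band would be constant on the whole cell, which has measure one, against
`ae_nth_ne`. -/
theorem bandMin_lt_bandMax {m : ℕ} (hm : 1 ≤ m) : bandMin V m < bandMax V m := by
  by_contra hcon
  rw [not_lt] at hcon
  have hae := ae_nth_ne hWs hm (bandMin V m)
  have hcell : volume cell = 0 := by
    refine measure_mono_null (fun y hy => ?_) (ae_iff.1 hae)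
    have hk := momentum_mem_of_mem_cell hy
    have h1 := (isLeast_bandMin hWs hW hm).2 ⟨_, hk, rfl⟩
    have h2 := (isGreatest_bandMax hWs hW hm).2 ⟨_, hk, rfl⟩
    rw [blochEnergy_eq hW] at h1 h2
    exact fun h => h (le_antisymm (h2.trans hcon) h1)
  rw [volume_cell] at hcell
  exact one_ne_zero hcell

/-- The integrated density of states grows strictly across any interval that meets a band in more
than a point. -/
theorem ids_lt_ids_of_band {m : ℕ} (hm : 1 ≤ m) {x y : ℝ} (hxy : x < y) (h1 : x < bandMax V m)
    (h2 : bandMin V m < y) : ids W x < ids W y := by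
  obtain ⟨t, ht1, ht2⟩ := exists_between (a₁ := max x (bandMin V m)) (a₂ := min y (bandMax V m))
    (max_lt (lt_min hxy h1) (lt_min h2 (bandMin_lt_bandMax hWs hW hm)))
  obtain ⟨k, hk, hke⟩ := exists_blochEnergy_eq hWs hW hm
    ((le_max_right _ _).trans ht1.le) (ht2.le.trans (min_le_right _ _))
  rw [blochEnergy_eq hW] at hke
  refine ids_lt_ids hWs hm hk ?_ ?_ <;> rw [hke]
  · exact (le_max_left _ _).trans_lt ht1
  · exact ht2.trans_le (min_le_left _ _)

theorem tendsto_ids_atTop : Tendsto (ids W) atTop atTop := by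
  refine tendsto_atTop_atTop_of_monotone (ids_mono hWs) fun b => ?_
  obtain ⟨N, hN⟩ := exists_nat_ge b
  refine ⟨bandMax V (N + 1), ?_⟩
  have := le_ids_of_bandMax_le hWs hW (Nat.le_add_left 1 N) le_rfl
  push_cast at this
  linarith

theorem exists_levelSet_eq_Icc {ρ : ℝ} (hρ : 0 < ρ) :
    ∃ a b : ℝ, a ≤ b ∧ ∀ E, ids W E = ρ ↔ E ∈ Set.Icc a b := by
  have hcont := continuous_ids hWs
  have hmono := ids_mono hWs
  set S : Set ℝ := ids W ⁻¹' {ρ} with hS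
  obtain ⟨M, hM⟩ := ((tendsto_ids_atTop hWs hW).eventually_gt_atTop ρ).exists
  have hz : ids W (-‖W‖ - 1) = 0 := ids_eq_zero hWs (by linarith)
  have hcl : IsClosed S := isClosed_singleton.preimage hcont
  have hne : S.Nonempty := mem_range_of_exists_le_of_exists_ge hcont
    ⟨-‖W‖ - 1, by rw [hz]; exact hρ.le⟩ ⟨M, hM.le⟩
  have hbb : BddBelow S := ⟨-‖W‖ - 1, fun E hE => (hmono.reflect_lt (by
    rw [hz, show ids W E = ρ from hE]; exact hρ)).le⟩
  have hba : BddAbove S := ⟨M, fun E hE => (hmono.reflect_lt (by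
    rw [show ids W E = ρ from hE]; exact hM)).le⟩
  have ha : ids W (sInf S) = ρ := hcl.csInf_mem hne hbb
  have hb : ids W (sSup S) = ρ := hcl.csSup_mem hne hba
  refine ⟨sInf S, sSup S, csInf_le_csSup hne hbb hba, fun E => ⟨fun h => ?_, fun h => ?_⟩⟩
  · exact ⟨csInf_le hbb h, le_csSup hba h⟩
  · exact le_antisymm (hb ▸ hmono h.2) (ha ▸ hmono h.1)

/-- The left end `a` of the level set decides. Inside a band, `ids W` increases strictly to the
right of `a`, so the level set is a single point. Otherwise `a` separates two consecutive bands, and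
`ids W` equals an integer between them. -/
theorem isSemiconductor_or_isMetal {ρ : ℝ} (hρ : 0 < ρ) :
    (∃ N, IsSemiconductor V (ids W) ρ N) ∨ ∃ EM, IsMetal V (ids W) ρ EM := by
  obtain ⟨a, b, hab, hlev⟩ := exists_levelSet_eq_Icc hWs hW hρ
  have ha : ids W a = ρ := (hlev a).2 ⟨le_rfl, hab⟩
  have hb : ids W b = ρ := (hlev b).2 ⟨hab, le_rfl⟩
  by_cases hM : ∃ m, 1 ≤ m ∧ bandMin V m < a ∧ a < bandMax V m
  · obtain ⟨m, hm, h1, h2⟩ := hM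
    have hba : b = a := by
      refine le_antisymm (not_lt.1 fun hlt => ?_) hab
      have := ids_lt_ids_of_band hWs hW hm hlt h2 (h1.trans hlt)
      rw [ha, hb] at this
      exact lt_irrefl _ this
    refine Or.inr ⟨a, fun E => ?_, m, hm, h1, h2⟩
    rw [hlev, hba, Set.Icc_self, Set.mem_singleton_iff]
  · push Not at hM
    have hex : ∃ m, a < bandMax V (m + 1) := by
      by_contra hcon
      push Not at hcon
      obtain ⟨N, hN⟩ := exists_nat_ge ρ
      have := le_ids_of_bandMax_le hWs hW (Nat.le_add_left 1 N) (hcon N)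
      rw [ha] at this
      push_cast at this
      linarith
    classical
    -- Bands are numbered from one, so band `N + 1` is the first whose top exceeds `a` and band `N`
    -- ends by `a`; the case `N = 0` is excluded by `ρ > 0`.
    set N := Nat.find hex with hNdef
    have hup : a ≤ bandMin V (N + 1) := not_lt.1 fun h =>
      absurd (Nat.find_spec hex) (not_lt.2 (hM (N + 1) (Nat.le_add_left 1 N) h))
    have hN : 1 ≤ N := by
      by_contra h0
      have h0 : N = 0 := by omega
      rw [h0] at hup
      have := ids_le_of_le_bandMin hWs hW hup
      rw [ha] at this
      norm_num at this
      linarith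
    have hlow : bandMax V N ≤ a := by
      have := Nat.find_min hex (m := N - 1) (by omega)
      rw [Nat.sub_add_cancel hN] at this
      exact not_lt.1 this
    have hval : ∀ E ∈ Set.Icc (bandMax V N) (bandMin V (N + 1)), ids W E = N := fun E hE =>
      le_antisymm (ids_le_of_le_bandMin hWs hW hE.2) (le_ids_of_bandMax_le hWs hW hN hE.1)
    refine Or.inl ⟨N, hN, hlow.trans hup, fun E hE => ?_⟩
    rw [hval E hE, ← hval a ⟨hlow, hup⟩, ha]

/-- In the semiconductor case the level set is the whole interval between the two bands. -/
theorem IsSemiconductor.levelSet_eq {ρ a b : ℝ} (hab : a ≤ b)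
    (hlev : ∀ E, ids W E = ρ ↔ E ∈ Set.Icc a b) {N : ℕ} (h : IsSemiconductor V (ids W) ρ N) :
    bandMax V N = a ∧ bandMin V (N + 1) = b := by
  obtain ⟨hN, hle, hval⟩ := h
  have ha : ids W a = ρ := (hlev a).2 ⟨le_rfl, hab⟩
  have hb : ids W b = ρ := (hlev b).2 ⟨hab, le_rfl⟩
  have h1 := hval _ ⟨le_rfl, hle⟩
  have h2 := hval _ ⟨hle, le_rfl⟩
  constructor
  · refine le_antisymm (not_lt.1 fun hlt => ?_) ((hlev _).1 h1).1
    have := ids_lt_ids_of_band hWs hW hN hlt hlt (bandMin_lt_bandMax hWs hW hN)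
    rw [ha, h1] at this
    exact lt_irrefl _ this
  · have hN' : 1 ≤ N + 1 := Nat.le_add_left 1 N
    refine le_antisymm ((hlev _).1 h2).2 (not_lt.1 fun hlt => ?_)
    have := ids_lt_ids_of_band hWs hW hN' hlt (bandMin_lt_bandMax hWs hW hN') hlt
    rw [hb, h2] at this
    exact lt_irrefl _ this

end Bands

end BlochElectrons

end

/-- `n` is the integrated density of states, `rho β z` the bulk density at fugacity `z`, `mu β ρ₀`
the chemical potential at fixed density and `EF` the Fermi energy; all are determined by the limits
and equations below. -/
theorem theorem1p1 (V : BlochElectrons.Space → ℝ) (hV : ContDiff ℝ ∞ V)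
    (hper : ∀ (m : Fin 3 → ℤ) (x : BlochElectrons.Space),
      V (x + WithLp.toLp 2 (fun i => (m i : ℝ))) = V x) :
    -- the band edges are attained, and the finite volume density series converge
    (∀ j : ℕ, 1 ≤ j →
      IsLeast (BlochElectrons.blochEnergy V j '' BlochElectrons.brillouinZone)
        (BlochElectrons.bandMin V j) ∧
      IsGreatest (BlochElectrons.blochEnergy V j '' BlochElectrons.brillouinZone)
        (BlochElectrons.bandMax V j)) ∧
    (∀ L β z : ℝ, 1 ≤ L → 0 < β → 0 < z →
      Summable (fun j : ℕ => BlochElectrons.occupation V L β z (j + 1))) ∧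
    ∃ (n : ℝ → ℝ) (rho mu : ℝ → ℝ → ℝ) (EF : ℝ → ℝ),
      -- thermodynamic limits
      (∀ E : ℝ, Tendsto (fun L : ℝ => BlochElectrons.boxIDS V L E) atTop (𝓝 (n E))) ∧
      (∀ β z : ℝ, 0 < β → 0 < z →
        Tendsto (fun L : ℝ => BlochElectrons.density V L β z) atTop (𝓝 (rho β z))) ∧
      -- the chemical potential is the unique solution of the density equation
      (∀ β ρ₀ : ℝ, 0 < β → 0 < ρ₀ →
        ∀ μ : ℝ, rho β (Real.exp (β * μ)) = ρ₀ ↔ μ = mu β ρ₀) ∧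
      -- the Fermi energy exists and is increasing
      (∀ ρ₀ : ℝ, 0 < ρ₀ → Tendsto (fun β : ℝ => mu β ρ₀) atTop (𝓝 (EF ρ₀))) ∧
      StrictMonoOn EF (Set.Ioi 0) ∧
      -- only two cases can occur
      (∀ ρ₀ : ℝ, 0 < ρ₀ →
        (∃ N : ℕ, BlochElectrons.IsSemiconductor V n ρ₀ N) ∨
          ∃ EM : ℝ, BlochElectrons.IsMetal V n ρ₀ EM) ∧
      (∀ ρ₀ : ℝ, 0 < ρ₀ → ∀ N : ℕ, BlochElectrons.IsSemiconductor V n ρ₀ N →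
        EF ρ₀ = (BlochElectrons.bandMax V N + BlochElectrons.bandMin V (N + 1)) / 2) ∧
      (∀ ρ₀ : ℝ, 0 < ρ₀ → ∀ EM : ℝ, BlochElectrons.IsMetal V n ρ₀ EM → EF ρ₀ = EM) := by
  have hVc := hV.continuous
  obtain ⟨C, hC0, hC, -⟩ := BlochElectrons.exists_potential_bound hVc hper
  obtain ⟨W, hWs, hW⟩ := BlochElectrons.exists_torusPotential hVc hper
  set n := BlochElectrons.ids W with hn
  have hlim : ∀ E, Tendsto (fun L : ℝ => BlochElectrons.boxIDS V L E) atTop (𝓝 (n E)) :=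
    BlochElectrons.tendsto_boxIDS hVc hper hWs hW
  have hcont : Continuous n := BlochElectrons.continuous_ids hWs
  have hmono : Monotone n := BlochElectrons.ids_mono hWs
  have hzero : ∀ E < -‖W‖, n E = 0 := fun E hE => BlochElectrons.ids_eq_zero hWs hE
  have hnn : ∀ E, 0 ≤ n E := fun E => ge_of_tendsto (hlim E)
    ((eventually_gt_atTop 0).mono fun L hL => BlochElectrons.boxIDS_nonneg hL E)
  have hb : ∀ E, |n E| ≤ (1 + C + |E|) ^ 3 := fun E => le_of_tendsto (hlim E).abs
    ((eventually_gt_atTop 0).mono fun L hL => BlochElectrons.abs_boxIDS_le hVc hC hL E)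
  have hR : 0 ≤ 1 + C := by positivity
  have htop : Tendsto n atTop atTop := BlochElectrons.tendsto_ids_atTop hWs hW
  -- Every positive fugacity comes from the chemical potential `log z / β`, in terms of which the
  -- density was analysed.
  have hz : ∀ {β z : ℝ}, 0 < β → 0 < z → z = Real.exp (β * (Real.log z / β)) := by
    intro β z hβ hz
    rw [mul_div_cancel₀ _ hβ.ne', Real.exp_log hz]
  -- The Fermi energy will be the midpoint of this interval; the values of `a` and `b` at `ρ ≤ 0`
  -- are arbitrary.
  choose! a b hab hlev using fun (ρ : ℝ) (hρ : 0 < ρ) =>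
    BlochElectrons.exists_levelSet_eq_Icc hWs hW hρ
  have hmu : ∀ β ρ : ℝ, 0 < β → 0 < ρ →
      BlochElectrons.smeared n β (Function.invFun (BlochElectrons.smeared n β) ρ) = ρ :=
    fun β ρ hβ hρ => Function.invFun_eq
      (BlochElectrons.exists_smeared_eq hcont hmono hnn hR hb hzero htop hβ hρ)
  have hEF : ∀ ρ, 0 < ρ → n ((a ρ + b ρ) / 2) = ρ := fun ρ hρ =>
    (hlev ρ hρ _).2 ⟨by linarith [hab ρ hρ], by linarith [hab ρ hρ]⟩
  refine ⟨fun j hj => ⟨BlochElectrons.isLeast_bandMin hWs hW hj,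
    BlochElectrons.isGreatest_bandMax hWs hW hj⟩, fun L β z hL hβ hz0 => ?_,
    n, fun β z => BlochElectrons.smeared n β (Real.log z / β),
    fun β ρ => Function.invFun (BlochElectrons.smeared n β) ρ, fun ρ => (a ρ + b ρ) / 2,
    hlim, fun β z hβ hz0 => ?_, fun β ρ hβ hρ μ => ?_, fun ρ hρ => ?_, fun ρ hρ ρ' hρ' hlt => ?_,
    fun ρ hρ => BlochElectrons.isSemiconductor_or_isMetal hWs hW hρ, fun ρ hρ N hN => ?_,
    fun ρ hρ EM hEM => ?_⟩
  · rw [hz hβ hz0]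
    exact (BlochElectrons.hasSum_occupation hVc hC (zero_lt_one.trans_le hL) hβ _).summable
  · have h := BlochElectrons.tendsto_density hVc hC hlim hβ (Real.log z / β)
    rwa [← hz hβ hz0] at h
  · simp only [Real.log_exp, mul_div_cancel_left₀ μ hβ.ne']
    have hstrict := BlochElectrons.smeared_strictMono hcont hmono hR hb hzero htop hβ
    exact ⟨fun h => hstrict.injective (h.trans (hmu β ρ hβ hρ).symm),
      fun h => h ▸ hmu β ρ hβ hρ⟩
  · exact BlochElectrons.tendsto_chemicalPotential hmono hnn hR hb (hab ρ hρ) (hlev ρ hρ)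
      fun β hβ => hmu β ρ hβ hρ
  -- The midpoint still lies in the level set, so `n` takes the value `ρ` there, and monotonicity of
  -- `n` forces the order of the Fermi energies.
  · refine hmono.reflect_lt ?_
    rwa [hEF ρ hρ, hEF ρ' hρ']
  · obtain ⟨h1, h2⟩ := hN.levelSet_eq hWs hW (hab ρ hρ) (hlev ρ hρ)
    rw [h1, h2]
  · exact (hEM.1 _).1 (hEF ρ hρ)
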